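/- Let $N,d\ge 1$, $a\in\mathbb R^d$, $p\ge 2$, $Q=(-\tfrac12,\tfrac12)^N$, and write $x=(x',x_N)\in\mathbb R^{N-1}\times\mathbb R$. All moduli $|\cdot|$ of matrices and third order tensors are Euclidean. Let $A=a\otimes e_N$, $B=-A$, and let $W:\mathbb R^{d\times N}\to[0,\infty)$ satisfy (H1) $W$ is continuous, and $W(\xi)=0$ if and only if $\xi\in\{A,B\}$; (H2) $\frac1C|\xi|^p-C\le W(\xi)\le C(|\xi|^p+1)$ for all $\xi$, for some $C>1$; (H3) for some $c,C',\rho>0$: $c|\xi-A|^p\le W(\xi)\le C'|\xi-A|^p$ whenever $|\xi-A|\le\rho$, and $c|\xi-B|^p\le W(\xi)\le C'|\xi-B|^p$ whenever $|\xi-B|\le\rho$; (H4) $W(\xi_1,\dots,-\xi_i,\dots,\xi_N)=W(\xi_1,\dots,\xi_i,\dots,\xi_N)$ for all $\xi$ and $i=1,\dots,N$, where $\xi_1,\dots,\xi_N\in\mathbb R^d$ are the columns of $\xi$. For $\varepsilon>0$, $u\in W^{2,2}(Q,\mathbb R^d)$, $\lambda\le 0$ set $$F_\varepsilon(u,\lambda)=\int_Q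 \frac1\varepsilon W(\nabla u)+\varepsilon|\nabla^2u|^2+\varepsilon\min\{\lambda^2,|\nabla^2u|^2\}\,dx\in[0,\infty],$$ and for $\gamma\ge0$ let $$\mathcal A(\gamma)=\Big\{(u,\lambda)\in W^{2,2}(Q,\mathbb R^d)\times(-\infty,0]:\ \int_Q\max\{\lambda+|\nabla^2u|,0\}\,dx\le\gamma\Big\}.$$ Let $$\tilde\Phi(\gamma)=\inf\Big\{\liminf_{h\to\infty}F_{\varepsilon_h}(u_h,\lambda_h):\ \varepsilon_h\to0^+,\ (u_h,\lambda_h)\in\mathcal A(\gamma),\ u_h\to|x_N|a\text{ in }L^1(Q,\mathbb R^d)\Big\},\qquad \Phi(\gamma)=\lim_{\delta\to0^+}\tilde\Phi(\gamma+\delta),$$ and let $\tilde\Phi_p(\gamma)$ be the infimum of $F_{1/L}(u,\lambda)$ over all $L>0$ and all $(u,\lambda)\in\mathcal A(\gamma)$ such that $u$ is periodic of period one in each of the variables $x'$ and, as a periodic function, belongs to $W^{2,\infty}(\mathbb R^{N-1}\times(-\tfrac12,\tfrac12),\mathbb R^d)$, and $\nabla u=\pm a\otimes e_N$ near $x_N=\pm\tfrac12$;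 put $\Phi_p(\gamma)=\lim_{\delta\to0^+}\tilde\Phi_p(\gamma+\delta)$. (The limits exist since $\tilde\Phi$ and $\tilde\Phi_p$ are nonincreasing.) Here the index $p$ in $\Phi_p$ stands for "periodic". Then $\Phi_p(\gamma)=\Phi(\gamma)$ for every $\gamma\ge0$. -/

import Mathlib

open Filter Topology MeasureTheory
open scoped ENNReal NNReal ContDiff

noncomputable section

namespace Surfactant

/- Throughout `N = n + 1`, points are `x : Fin (n + 1) → ℝ` with `x' = (x 0, …, x (n - 1))` and
`x_N = x (Fin.last n)`. Only the topology and the Lebesgue measure of `Fin (n + 1) → ℝ` are used,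
all moduli of gradients and second gradients are the Euclidean ones defined below. -/

variable {d n : ℕ}

/-- The Euclidean (Frobenius) modulus of a `d × N` matrix. -/
def matNorm (ξ : Matrix (Fin d) (Fin (n + 1)) ℝ) : ℝ :=
  Real.sqrt (∑ i, ∑ j, ξ i j ^ 2)

/-- The Euclidean modulus of a third order tensor, used for second gradients. -/
def hessNorm (H : Fin d → Fin (n + 1) → Fin (n + 1) → ℝ) : ℝ :=
  Real.sqrt (∑ i, ∑ j, ∑ k, H i j k ^ 2)

/-- The matrix `a ⊗ e_N`. -/
def well (n : ℕ) (a : Fin d → ℝ) : Matrix (Fin d) (Fin (n + 1)) ℝ :=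
  Matrix.vecMulVec a (Pi.single (Fin.last n) 1)

/-- (H1), normalised to the wells `A = a ⊗ e_N` and `B = -A`. -/
def H1 (W : Matrix (Fin d) (Fin (n + 1)) ℝ → ℝ≥0) (a : Fin d → ℝ) : Prop :=
  Continuous W ∧ ∀ ξ, W ξ = 0 ↔ ξ = well n a ∨ ξ = -well n a

/-- (H2): growth of order `p` at infinity. -/
def H2 (W : Matrix (Fin d) (Fin (n + 1)) ℝ → ℝ≥0) (p : ℝ) : Prop :=
  ∃ C : ℝ, 1 < C ∧ ∀ ξ, (1 / C) * matNorm ξ ^ p - C ≤ (W ξ : ℝ) ∧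
    (W ξ : ℝ) ≤ C * (matNorm ξ ^ p + 1)

/-- (H3): behaviour of order `p` near each of the two wells. -/
def H3 (W : Matrix (Fin d) (Fin (n + 1)) ℝ → ℝ≥0) (a : Fin d → ℝ) (p : ℝ) : Prop :=
  ∃ c C r : ℝ, 0 < c ∧ 0 < C ∧ 0 < r ∧
    (∀ ξ, matNorm (ξ - well n a) ≤ r →
      c * matNorm (ξ - well n a) ^ p ≤ (W ξ : ℝ) ∧
        (W ξ : ℝ) ≤ C * matNorm (ξ - well n a) ^ p) ∧
    (∀ ξ, matNorm (ξ - -well n a) ≤ r →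
      c * matNorm (ξ - -well n a) ^ p ≤ (W ξ : ℝ) ∧
        (W ξ : ℝ) ≤ C * matNorm (ξ - -well n a) ^ p)

/-- (H4): `W` is even in every column. -/
def H4 (W : Matrix (Fin d) (Fin (n + 1)) ℝ → ℝ≥0) : Prop :=
  ∀ (i : Fin (n + 1)) (ξ : Matrix (Fin d) (Fin (n + 1)) ℝ),
    W (ξ.updateCol i fun k => -ξ k i) = W ξ

/-- The open unit cube `Q = (-1/2, 1/2)^N`. -/
def cube (n : ℕ) : Set (Fin (n + 1) → ℝ) :=
  {x | ∀ j, x j ∈ Set.Ioo (-(1 / 2) : ℝ) (1 / 2)}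

/-- The strip `ℝ^{N-1} × (-1/2, 1/2)`, on which functions periodic in `x'` live. -/
def strip (n : ℕ) : Set (Fin (n + 1) → ℝ) :=
  {x | x (Fin.last n) ∈ Set.Ioo (-(1 / 2) : ℝ) (1 / 2)}

/-- `φ ∈ C_c^∞(U)`. -/
def IsTest (U : Set (Fin (n + 1) → ℝ)) (φ : (Fin (n + 1) → ℝ) → ℝ) : Prop :=
  ContDiff ℝ ∞ φ ∧ HasCompactSupport φ ∧ tsupport φ ⊆ U

/-- `u ∈ W^{2,q}(U, ℝ^d)` with weak gradient `G` and weak second gradient `H` (for an open set `U`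
and `q ≥ 1`); `G` and `H` are determined by `u` up to null subsets of `U`. -/
structure IsSobolevTwo (q : ℝ≥0∞) (U : Set (Fin (n + 1) → ℝ))
    (u : (Fin (n + 1) → ℝ) → Fin d → ℝ)
    (G : (Fin (n + 1) → ℝ) → Matrix (Fin d) (Fin (n + 1)) ℝ)
    (H : (Fin (n + 1) → ℝ) → Fin d → Fin (n + 1) → Fin (n + 1) → ℝ) : Prop where
  memLp_fun : ∀ i, MemLp (fun x => u x i) q (volume.restrict U)
  memLp_grad : ∀ i j, MemLp (fun x => G x i j) q (volume.restrict U)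
  memLp_hess : ∀ i j k, MemLp (fun x => H x i j k) q (volume.restrict U)
  weak_grad : ∀ i j φ, IsTest U φ →
    ∫ x in U, u x i * fderiv ℝ φ x (Pi.single j 1) = -∫ x in U, G x i j * φ x
  weak_hess : ∀ i j k φ, IsTest U φ →
    ∫ x in U, G x i j * fderiv ℝ φ x (Pi.single k 1) = -∫ x in U, H x i j k * φ x

/-- The energy `F_ε(u, lam) = ∫_Q W(∇u)/ε + ε |∇²u|² + ε min {lam², |∇²u|²} dx`, possibly `+∞`. -/
def energy (W : Matrix (Fin d) (Fin (n + 1)) ℝ → ℝ≥0) (ε : ℝ)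
    (G : (Fin (n + 1) → ℝ) → Matrix (Fin d) (Fin (n + 1)) ℝ)
    (H : (Fin (n + 1) → ℝ) → Fin d → Fin (n + 1) → Fin (n + 1) → ℝ) (lam : ℝ) : ℝ≥0∞ :=
  ∫⁻ x in cube n, ENNReal.ofReal
    ((1 / ε) * (W (G x) : ℝ) + ε * hessNorm (H x) ^ 2 + ε * min (lam ^ 2) (hessNorm (H x) ^ 2))

/-- `(u, lam) ∈ 𝒜(γ)`. The factor `ℋ^{N-1}(Q')` in the bound is `1`. -/
def Admissible (γ : ℝ) (u : (Fin (n + 1) → ℝ) → Fin d → ℝ)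
    (G : (Fin (n + 1) → ℝ) → Matrix (Fin d) (Fin (n + 1)) ℝ)
    (H : (Fin (n + 1) → ℝ) → Fin d → Fin (n + 1) → Fin (n + 1) → ℝ) (lam : ℝ) : Prop :=
  IsSobolevTwo 2 (cube n) u G H ∧ lam ≤ 0 ∧
    ∫⁻ x in cube n, ENNReal.ofReal (max (lam + hessNorm (H x)) 0) ≤ ENNReal.ofReal γ

/-- `Φ̃(γ) = F(γ, Q)`: the infimum of `liminf F_{ε_h}(u_h, lam_h)` over all `ε_h → 0⁺` and all
admissible `(u_h, lam_h)` with `u_h → |x_N| a` in `L¹(Q, ℝ^d)`. -/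
def PhiTilde (W : Matrix (Fin d) (Fin (n + 1)) ℝ → ℝ≥0) (a : Fin d → ℝ) (γ : ℝ) : ℝ≥0∞ :=
  sInf {E | ∃ (ε : ℕ → ℝ) (u : ℕ → (Fin (n + 1) → ℝ) → Fin d → ℝ)
      (G : ℕ → (Fin (n + 1) → ℝ) → Matrix (Fin d) (Fin (n + 1)) ℝ)
      (H : ℕ → (Fin (n + 1) → ℝ) → Fin d → Fin (n + 1) → Fin (n + 1) → ℝ) (lam : ℕ → ℝ),
    (∀ h, 0 < ε h) ∧ Tendsto ε atTop (𝓝 0) ∧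
    (∀ h, Admissible γ (u h) (G h) (H h) (lam h)) ∧
    Tendsto (fun h => eLpNorm (fun x => u h x - |x (Fin.last n)| • a) 1
      (volume.restrict (cube n))) atTop (𝓝 0) ∧
    E = liminf (fun h => energy W (ε h) (G h) (H h) (lam h)) atTop}

/-- The surface tension `Φ(γ) = lim_{δ → 0⁺} Φ̃(γ + δ)`; the limit exists, see `tendsto_Phi`. -/
def Phi (W : Matrix (Fin d) (Fin (n + 1)) ℝ → ℝ≥0) (a : Fin d → ℝ) (γ : ℝ) : ℝ≥0∞ :=
  limUnder (𝓝[>] (0 : ℝ)) fun δ => PhiTilde W a (γ + δ)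

/-- `Φ̃_p(γ)`: the infimum of `F_{1/L}(u, lam)` over `L > 0` and `(u, lam) ∈ 𝒜(γ)` such that `u`
is one-periodic in `x'` and of class `W^{2,∞}` (as a periodic function, i.e. on the whole strip)
and `∇u = ± a ⊗ e_N` near `x_N = ± 1/2`. -/
def PhiPTilde (W : Matrix (Fin d) (Fin (n + 1)) ℝ → ℝ≥0) (a : Fin d → ℝ) (γ : ℝ) : ℝ≥0∞ :=
  sInf {E | ∃ (L : ℝ) (u : (Fin (n + 1) → ℝ) → Fin d → ℝ)
      (G : (Fin (n + 1) → ℝ) → Matrix (Fin d) (Fin (n + 1)) ℝ)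
      (H : (Fin (n + 1) → ℝ) → Fin d → Fin (n + 1) → Fin (n + 1) → ℝ) (lam : ℝ),
    0 < L ∧ IsSobolevTwo ∞ (strip n) u G H ∧
    (∀ (j : Fin n) (x : Fin (n + 1) → ℝ), u (x + Pi.single j.castSucc 1) = u x) ∧
    (∃ η : ℝ, 0 < η ∧ ∀ᵐ x ∂(volume.restrict (strip n)),
      (1 / 2 - η < x (Fin.last n) → G x = well n a) ∧
      (x (Fin.last n) < -(1 / 2) + η → G x = -well n a)) ∧
    Admissible γ u G H lam ∧
    E = energy W (1 / L) G H lam}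

/-- `Φ_p(γ) = lim_{δ → 0⁺} Φ̃_p(γ + δ)`; the limit exists, see `tendsto_PhiP`. -/
def PhiP (W : Matrix (Fin d) (Fin (n + 1)) ℝ → ℝ≥0) (a : Fin d → ℝ) (γ : ℝ) : ℝ≥0∞ :=
  limUnder (𝓝[>] (0 : ℝ)) fun δ => PhiPTilde W a (γ + δ)

theorem Admissible.mono {γ γ' : ℝ} (h : γ ≤ γ') {u : (Fin (n + 1) → ℝ) → Fin d → ℝ}
    {G : (Fin (n + 1) → ℝ) → Matrix (Fin d) (Fin (n + 1)) ℝ}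
    {H : (Fin (n + 1) → ℝ) → Fin d → Fin (n + 1) → Fin (n + 1) → ℝ} {lam : ℝ}
    (hA : Admissible γ u G H lam) : Admissible γ' u G H lam :=
  ⟨hA.1, hA.2.1, hA.2.2.trans (ENNReal.ofReal_le_ofReal h)⟩

theorem PhiTilde_antitone (W : Matrix (Fin d) (Fin (n + 1)) ℝ → ℝ≥0) (a : Fin d → ℝ) :
    Antitone (PhiTilde W a) := by
  intro γ γ' h
  refine sInf_le_sInf ?_
  rintro E ⟨ε, u, G, H, lam, h1, h2, h3, h4⟩
  exact ⟨ε, u, G, H, lam, h1, h2, fun k => (h3 k).mono h, h4⟩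

theorem PhiPTilde_antitone (W : Matrix (Fin d) (Fin (n + 1)) ℝ → ℝ≥0) (a : Fin d → ℝ) :
    Antitone (PhiPTilde W a) := by
  intro γ γ' h
  refine sInf_le_sInf ?_
  rintro E ⟨L, u, G, H, lam, h1, h2, h3, h4, h5, h6⟩
  exact ⟨L, u, G, H, lam, h1, h2, h3, h4, h5.mono h, h6⟩

theorem tendsto_Phi (W : Matrix (Fin d) (Fin (n + 1)) ℝ → ℝ≥0) (a : Fin d → ℝ) (γ : ℝ) :
    Tendsto (fun δ => PhiTilde W a (γ + δ)) (𝓝[>] (0 : ℝ)) (𝓝 (Phi W a γ)) := by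
  have hm : Antitone fun δ => PhiTilde W a (γ + δ) :=
    fun s t h => PhiTilde_antitone W a (by gcongr)
  exact tendsto_nhds_limUnder ⟨_, hm.tendsto_nhdsGT 0⟩

theorem tendsto_PhiP (W : Matrix (Fin d) (Fin (n + 1)) ℝ → ℝ≥0) (a : Fin d → ℝ) (γ : ℝ) :
    Tendsto (fun δ => PhiPTilde W a (γ + δ)) (𝓝[>] (0 : ℝ)) (𝓝 (PhiP W a γ)) := by
  have hm : Antitone fun δ => PhiPTilde W a (γ + δ) :=
    fun s t h => PhiPTilde_antitone W a (by gcongr)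
  exact tendsto_nhds_limUnder ⟨_, hm.tendsto_nhdsGT 0⟩

end Surfactant

end

/-!
Both inequalities between `Phi` and `PhiP` pass through smooth maps which are periodic in the
horizontal variables and, outside a horizontal layer, equal to `|x_N| a` up to one constant on
either side (`Profile`). Blowing down such a map preserves its energy and its constraint integral
per unit of horizontal area. A single blow-down is a competitor for `PhiPTilde`, and the sequence
of all of them is one for `PhiTilde` (`Profile.phiPTilde_le`, `Profile.phiTilde_le`). It remains to
produce profiles, at the price of an arbitrarily small increase of `γ`, which disappears in the
limit defining `Phi` and `PhiP`.

For `Phi ≤ PhiP` a periodic competitor is mollified and continued affinely above and below the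
strip (`exists_profile_of_competitor`).

For `PhiP ≤ Phi` let `u` be a member of a sequence admissible for `PhiTilde`, far out in it. Its
gradient is close in `L ^ p` to the well `± a ⊗ e_N` on either side of the interface, because the
energy forces it to be close to one of the wells and the convergence of `u` to `|x_N| a` decides
which one (`exists_side_bound`). After mollification (`exists_smooth_approximation`) `u` is smooth.
It is made periodic by composition with a fold map `x ↦ (y + ρ(x_N) ψ(x'), θ(x_N))`, where `ψ` is
a rounded triangle wave in each horizontal variable. Between the kinks of `ψ` this is a translated
reflection in the horizontal variables, which leaves the densities unchanged by (H4). At a height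
`s` the variable `x_N` is frozen over a length of order `ε`, and only above that the horizontal
variables are faded out, so that the map becomes affine (`folded`). The differential of the fold is
a contraction, so the distance to the wells does not increase; new second derivatives arise only at
the kinks and in the layers.

The errors at the kinks and in the layers are small on average over the offset `y` and the height
`s`. A choice of `y` has to be good for the energy and for the constraint at the same time, and
the two averages by themselves do not give such a `y`. However, the set of pairs of energy and
constraint realised by profiles (`attain`) is closed and convex: profiles can alternate on wide
vertical strips, the transitions between them being negligible (`convex_attain`). So the pair of
the averages is itself realised (`average_mem_attain`, `attain_of_smooth`). The choice of the
parameters is made in `exists_phiPTilde_le_of_smooth`.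
-/

namespace Surfactant

noncomputable section

/-! ### Frobenius norms -/

section Norms

variable {d n : ℕ}

theorem matNorm_eq_norm (ξ : Matrix (Fin d) (Fin (n + 1)) ℝ) :
    matNorm ξ = ‖WithLp.toLp 2 (fun q : Fin d × Fin (n + 1) => ξ q.1 q.2)‖ := by
  rw [EuclideanSpace.norm_eq, matNorm, Fintype.sum_prod_type]
  simp

theorem hessNorm_eq_norm (H : Fin d → Fin (n + 1) → Fin (n + 1) → ℝ) :
    hessNorm H = ‖WithLp.toLp 2
      (fun q : Fin d × Fin (n + 1) × Fin (n + 1) => H q.1 q.2.1 q.2.2)‖ := by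
  rw [EuclideanSpace.norm_eq, hessNorm, Fintype.sum_prod_type]
  simp [Fintype.sum_prod_type]

theorem matNorm_nonneg (ξ : Matrix (Fin d) (Fin (n + 1)) ℝ) : 0 ≤ matNorm ξ := Real.sqrt_nonneg _

theorem hessNorm_nonneg (H : Fin d → Fin (n + 1) → Fin (n + 1) → ℝ) : 0 ≤ hessNorm H :=
  Real.sqrt_nonneg _

theorem matNorm_sq (ξ : Matrix (Fin d) (Fin (n + 1)) ℝ) :
    matNorm ξ ^ 2 = ∑ i, ∑ j, ξ i j ^ 2 :=
  Real.sq_sqrt (by positivity)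

theorem hessNorm_sq (H : Fin d → Fin (n + 1) → Fin (n + 1) → ℝ) :
    hessNorm H ^ 2 = ∑ i, ∑ j, ∑ k, H i j k ^ 2 :=
  Real.sq_sqrt (by positivity)

theorem matNorm_add_le (ξ η : Matrix (Fin d) (Fin (n + 1)) ℝ) :
    matNorm (ξ + η) ≤ matNorm ξ + matNorm η := by
  simp only [matNorm_eq_norm]
  exact norm_add_le (WithLp.toLp 2 (fun q : Fin d × Fin (n + 1) => ξ q.1 q.2))
    (WithLp.toLp 2 (fun q : Fin d × Fin (n + 1) => η q.1 q.2))

theorem hessNorm_add_le (H K : Fin d → Fin (n + 1) → Fin (n + 1) → ℝ) :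
    hessNorm (fun i j k => H i j k + K i j k) ≤ hessNorm H + hessNorm K := by
  simp only [hessNorm_eq_norm]
  exact norm_add_le
    (WithLp.toLp 2 (fun q : Fin d × Fin (n + 1) × Fin (n + 1) => H q.1 q.2.1 q.2.2))
    (WithLp.toLp 2 (fun q : Fin d × Fin (n + 1) × Fin (n + 1) => K q.1 q.2.1 q.2.2))

theorem matNorm_neg (ξ : Matrix (Fin d) (Fin (n + 1)) ℝ) : matNorm (-ξ) = matNorm ξ := by
  simp [matNorm]

@[simp] theorem matNorm_zero : matNorm (0 : Matrix (Fin d) (Fin (n + 1)) ℝ) = 0 := by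
  simp [matNorm]

@[simp] theorem hessNorm_zero : hessNorm (fun (_ : Fin d) (_ _ : Fin (n + 1)) => (0 : ℝ)) = 0 := by
  simp [hessNorm]

theorem abs_entry_le_matNorm (ξ : Matrix (Fin d) (Fin (n + 1)) ℝ) (i : Fin d) (j : Fin (n + 1)) :
    |ξ i j| ≤ matNorm ξ := by
  rw [matNorm_eq_norm]
  exact PiLp.norm_apply_le (p := 2)
    (WithLp.toLp 2 (fun q : Fin d × Fin (n + 1) => ξ q.1 q.2)) (i, j)

theorem abs_entry_le_hessNorm (H : Fin d → Fin (n + 1) → Fin (n + 1) → ℝ)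
    (i : Fin d) (j k : Fin (n + 1)) : |H i j k| ≤ hessNorm H := by
  rw [hessNorm_eq_norm]
  exact PiLp.norm_apply_le (p := 2)
    (WithLp.toLp 2 (fun q : Fin d × Fin (n + 1) × Fin (n + 1) => H q.1 q.2.1 q.2.2)) (i, j, k)

theorem matNorm_le_sum (ξ : Matrix (Fin d) (Fin (n + 1)) ℝ) :
    matNorm ξ ≤ ∑ i, ∑ j, |ξ i j| := by
  refine Real.sqrt_le_iff.2 ⟨by positivity, ?_⟩
  have := Finset.sum_sq_le_sq_sum_of_nonneg (s := Finset.univ)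
    (f := fun q : Fin d × Fin (n + 1) => |ξ q.1 q.2|) (fun i _ => abs_nonneg _)
  simpa [Fintype.sum_prod_type] using this

theorem hessNorm_le_sum (H : Fin d → Fin (n + 1) → Fin (n + 1) → ℝ) :
    hessNorm H ≤ ∑ i, ∑ j, ∑ k, |H i j k| := by
  refine Real.sqrt_le_iff.2 ⟨by positivity, ?_⟩
  have := Finset.sum_sq_le_sq_sum_of_nonneg (s := Finset.univ)
    (f := fun q : Fin d × Fin (n + 1) × Fin (n + 1) => |H q.1 q.2.1 q.2.2|) (fun i _ => abs_nonneg _)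
  simpa [Fintype.sum_prod_type] using this

theorem continuous_matNorm :
    Continuous (matNorm : Matrix (Fin d) (Fin (n + 1)) ℝ → ℝ) := by
  unfold matNorm
  fun_prop

theorem continuous_hessNorm :
    Continuous (hessNorm : (Fin d → Fin (n + 1) → Fin (n + 1) → ℝ) → ℝ) := by
  unfold hessNorm
  fun_prop

/-- The transpose of the square matrix `A` does not increase Euclidean length. -/
def Contr (A : Fin (n + 1) → Fin (n + 1) → ℝ) : Prop :=
  ∀ h : Fin (n + 1) → ℝ, ∑ k, (∑ m, h m * A m k) ^ 2 ≤ ∑ m, h m ^ 2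

theorem Contr.matNorm_le {A : Fin (n + 1) → Fin (n + 1) → ℝ} (hA : Contr A)
    (G : Matrix (Fin d) (Fin (n + 1)) ℝ) :
    matNorm (fun i j => ∑ l, G i l * A l j) ≤ matNorm G :=
  Real.sqrt_le_sqrt (Finset.sum_le_sum fun i _ => hA (G i))

theorem Contr.hessNorm_le {A : Fin (n + 1) → Fin (n + 1) → ℝ} (hA : Contr A)
    (H : Fin d → Fin (n + 1) → Fin (n + 1) → ℝ) :
    hessNorm (fun i j k => ∑ l, (∑ m, H i l m * A m k) * A l j) ≤ hessNorm H := by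
  refine Real.sqrt_le_sqrt (Finset.sum_le_sum fun i _ => ?_)
  rw [Finset.sum_comm]
  calc _ ≤ ∑ k, ∑ l, (∑ m, H i l m * A m k) ^ 2 :=
        Finset.sum_le_sum fun k _ => hA (fun l => ∑ m, H i l m * A m k)
    _ = ∑ l, ∑ k, (∑ m, H i l m * A m k) ^ 2 := Finset.sum_comm
    _ ≤ _ := Finset.sum_le_sum fun l _ => hA (H i l)

theorem hessNorm_contract_le {b : ℝ} (hb : 0 ≤ b)
    {B : Fin (n + 1) → Fin (n + 1) → Fin (n + 1) → ℝ} (hB : ∀ l j k, |B l j k| ≤ b)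
    (G : Matrix (Fin d) (Fin (n + 1)) ℝ) :
    hessNorm (fun i j k => ∑ l, G i l * B l j k) ≤ (n + 1) ^ 2 * b * matNorm G := by
  have hG := matNorm_nonneg G
  refine Real.sqrt_le_iff.2 ⟨by positivity, ?_⟩
  have h1 : ∀ i j k, (∑ l, G i l * B l j k) ^ 2 ≤ (n + 1) * b ^ 2 * ∑ l, G i l ^ 2 := by
    intro i j k
    refine (Finset.sum_mul_sq_le_sq_mul_sq _ _ _).trans ?_
    rw [mul_comm]
    refine mul_le_mul_of_nonneg_right ?_ (by positivity)
    calc ∑ l, B l j k ^ 2 ≤ ∑ _l : Fin (n + 1), b ^ 2 :=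
          Finset.sum_le_sum fun l _ => sq_le_sq.2 (by rw [abs_of_nonneg hb]; exact hB l j k)
      _ = _ := by simp
  calc _ ≤ ∑ i, ∑ _j : Fin (n + 1), ∑ _k : Fin (n + 1), (n + 1) * b ^ 2 * ∑ l, G i l ^ 2 :=
        Finset.sum_le_sum fun i _ => Finset.sum_le_sum fun j _ => Finset.sum_le_sum fun k _ =>
          h1 i j k
    _ = (n + 1) ^ 3 * b ^ 2 * matNorm G ^ 2 := by
        rw [matNorm_sq, Finset.mul_sum]
        refine Finset.sum_congr rfl fun i _ => ?_
        simp
        ring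
    _ ≤ (n + 1) ^ 4 * b ^ 2 * matNorm G ^ 2 := by
        gcongr
        · exact le_add_of_nonneg_left (by positivity)
        · norm_num
    _ = _ := by ring

end Norms

/-! ### Two-sided bounds for the double-well potential -/

section Wells

variable {d n : ℕ}

/-- The distance of `ξ` from the set of wells `{a ⊗ e_N, -a ⊗ e_N}`. -/
def wellDist (a : Fin d → ℝ) (ξ : Matrix (Fin d) (Fin (n + 1)) ℝ) : ℝ :=
  min (matNorm (ξ - well n a)) (matNorm (ξ - -well n a))

theorem wellDist_nonneg (a : Fin d → ℝ) (ξ : Matrix (Fin d) (Fin (n + 1)) ℝ) :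
    0 ≤ wellDist a ξ := le_min (matNorm_nonneg _) (matNorm_nonneg _)

theorem continuous_wellDist (a : Fin d → ℝ) :
    Continuous (wellDist a : Matrix (Fin d) (Fin (n + 1)) ℝ → ℝ) :=
  (continuous_matNorm.comp (by fun_prop)).min (continuous_matNorm.comp (by fun_prop))

/-- `W` is comparable, with constant `C`, to the `p`-th power of the distance from the wells. -/
structure Comparable (W : Matrix (Fin d) (Fin (n + 1)) ℝ → ℝ≥0) (a : Fin d → ℝ) (p C : ℝ) :
    Prop where
  one_le : 1 ≤ C
  lower : ∀ ξ, wellDist a ξ ^ p ≤ C * W ξ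
  upper : ∀ ξ, (W ξ : ℝ) ≤ C * wellDist a ξ ^ p

theorem matNorm_sub_le (ξ η : Matrix (Fin d) (Fin (n + 1)) ℝ) :
    matNorm (ξ - η) ≤ matNorm ξ + matNorm η := by
  rw [sub_eq_add_neg]
  exact (matNorm_add_le _ _).trans_eq (by rw [matNorm_neg])

theorem wellDist_le (a : Fin d → ℝ) (ξ : Matrix (Fin d) (Fin (n + 1)) ℝ) :
    wellDist a ξ ≤ matNorm ξ + matNorm (well n a) :=
  (min_le_left _ _).trans (matNorm_sub_le _ _)

theorem matNorm_le_wellDist (a : Fin d → ℝ) (ξ : Matrix (Fin d) (Fin (n + 1)) ℝ) :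
    matNorm ξ ≤ wellDist a ξ + matNorm (well n a) := by
  rw [← sub_le_iff_le_add]
  refine le_min ?_ ?_ <;> rw [sub_le_iff_le_add]
  · simpa using matNorm_add_le (ξ - well n a) (well n a)
  · simpa [matNorm_neg] using matNorm_add_le (ξ - -well n a) (-well n a)

/-- By (H3) near the wells; at distance at least `r` from them the bound of (H2) is dominated by the
`p`-th power of the distance. -/
theorem exists_upper {W : Matrix (Fin d) (Fin (n + 1)) ℝ → ℝ≥0} {a : Fin d → ℝ} {p : ℝ}
    (hp : 2 ≤ p) (h2 : H2 W p) (h3 : H3 W a p) :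
    ∃ C : ℝ, 0 < C ∧ ∀ ξ, (W ξ : ℝ) ≤ C * wellDist a ξ ^ p := by
  obtain ⟨C, hC, hW⟩ := h2
  obtain ⟨c, C', r, hc, hC', hr, hA, hB⟩ := h3
  set m := matNorm (well n a) with hm
  have hm0 : 0 ≤ m := matNorm_nonneg _
  refine ⟨C' + C * ((1 + m / r) ^ p + (1 / r) ^ p), by positivity, fun ξ => ?_⟩
  have hD := wellDist_nonneg a ξ
  rcases le_or_gt (wellDist a ξ) r with h | h
  · have key : (W ξ : ℝ) ≤ C' * wellDist a ξ ^ p := by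
      rcases le_total (matNorm (ξ - well n a)) (matNorm (ξ - -well n a)) with h' | h'
      · rw [wellDist, min_eq_left h'] at h ⊢
        exact (hA ξ h).2
      · rw [wellDist, min_eq_right h'] at h ⊢
        exact (hB ξ h).2
    refine key.trans (mul_le_mul_of_nonneg_right ?_ (by positivity))
    exact le_add_of_nonneg_right (by positivity)
  · have h1 : matNorm ξ ≤ (1 + m / r) * wellDist a ξ := by
      refine (matNorm_le_wellDist a ξ).trans ?_
      rw [add_mul, one_mul]
      gcongr
      rw [div_mul_eq_mul_div, le_div_iff₀ hr]
      exact mul_le_mul_of_nonneg_left h.le hm0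
    have h2 : (1 : ℝ) ≤ 1 / r * wellDist a ξ := by
      rw [div_mul_eq_mul_div, one_mul, le_div_iff₀ hr, one_mul]; exact h.le
    calc (W ξ : ℝ) ≤ C * (matNorm ξ ^ p + 1) := (hW ξ).2
      _ ≤ C * (((1 + m / r) * wellDist a ξ) ^ p + (1 / r * wellDist a ξ) ^ p) := by
          gcongr
          · exact matNorm_nonneg _
          · exact Real.one_le_rpow h2 (by linarith)
      _ = C * ((1 + m / r) ^ p + (1 / r) ^ p) * wellDist a ξ ^ p := by
          rw [Real.mul_rpow (by positivity) hD, Real.mul_rpow (by positivity) hD]; ring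
      _ ≤ _ := mul_le_mul_of_nonneg_right (le_add_of_nonneg_left hC'.le) (by positivity)

/-- By (H3) near the wells, by (H2) for large `ξ`, and by compactness and positivity of `W` for the
remaining `ξ`. -/
theorem exists_lower {W : Matrix (Fin d) (Fin (n + 1)) ℝ → ℝ≥0} {a : Fin d → ℝ} {p : ℝ}
    (hp : 2 ≤ p) (h1 : H1 W a) (h2 : H2 W p) (h3 : H3 W a p) :
    ∃ C : ℝ, 0 < C ∧ ∀ ξ, wellDist a ξ ^ p ≤ C * W ξ := by
  obtain ⟨C, hC, hW⟩ := h2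
  obtain ⟨c, C', r, hc, hC', hr, hA, hB⟩ := h3
  set m := matNorm (well n a) with hm
  have hm0 : 0 ≤ m := matNorm_nonneg _
  -- for `matNorm ξ ≥ R` the lower bound in (H2) is at least half of its leading term
  set R := 2 * C ^ 2 + 1 with hR
  have hR1 : 1 ≤ R := by nlinarith
  -- the bounded set of matrices away from the wells
  let K : Set (Fin d → Fin (n + 1) → ℝ) :=
    {ξ | matNorm (Matrix.of ξ) ≤ R ∧ r ≤ wellDist a (Matrix.of ξ)}
  have hof : Continuous fun ξ : Fin d → Fin (n + 1) → ℝ => Matrix.of ξ := by fun_prop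
  have hKc : IsCompact K := by
    refine Metric.isCompact_of_isClosed_isBounded ?_ ?_
    · exact (isClosed_le (continuous_matNorm.comp hof) continuous_const).inter
        (isClosed_le continuous_const ((continuous_wellDist a).comp hof))
    · refine (Metric.isBounded_closedBall (x := (0 : Fin d → Fin (n + 1) → ℝ)) (r := R)).subset ?_
      intro ξ hξ
      rw [mem_closedBall_zero_iff, pi_norm_le_iff_of_nonneg (by linarith)]
      intro i
      rw [pi_norm_le_iff_of_nonneg (by linarith)]
      intro j
      exact (abs_entry_le_matNorm (Matrix.of ξ) i j).trans hξ.1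
  have hpos : ∀ ξ ∈ K, 0 < (W (Matrix.of ξ) : ℝ) := by
    intro ξ hξ
    rw [NNReal.coe_pos, pos_iff_ne_zero]
    intro h0
    have hlt : 0 < wellDist a (Matrix.of ξ) := hr.trans_le hξ.2
    rcases (h1.2 _).1 h0 with h | h
    · have hle : wellDist a (Matrix.of ξ) ≤ matNorm (Matrix.of ξ - well n a) := min_le_left _ _
      rw [h, sub_self, matNorm_zero, ← h] at hle
      exact absurd hle (not_le.2 hlt)
    · have hle : wellDist a (Matrix.of ξ) ≤ matNorm (Matrix.of ξ - -well n a) := min_le_right _ _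
      rw [h, sub_self, matNorm_zero, ← h] at hle
      exact absurd hle (not_le.2 hlt)
  obtain ⟨w, hw0, hw⟩ : ∃ w : ℝ, 0 < w ∧ ∀ ξ ∈ K, w ≤ W (Matrix.of ξ) := by
    rcases K.eq_empty_or_nonempty with h | h
    · exact ⟨1, one_pos, by simp [h]⟩
    · obtain ⟨ξ, hξ, hmin⟩ := hKc.exists_isMinOn h
        (f := fun ξ => (W (Matrix.of ξ) : ℝ))
        (NNReal.continuous_coe.comp (h1.1.comp hof)).continuousOn
      exact ⟨_, hpos ξ hξ, fun η hη => hmin hη⟩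
  refine ⟨1 / c + (R + m) ^ p / w + 2 * C * (1 + m) ^ p, by positivity, fun ξ => ?_⟩
  have hD := wellDist_nonneg a ξ
  have hWξ : 0 ≤ (W ξ : ℝ) := NNReal.coe_nonneg _
  rcases le_or_gt (wellDist a ξ) r with h | h
  · have key : c * wellDist a ξ ^ p ≤ (W ξ : ℝ) := by
      rcases le_total (matNorm (ξ - well n a)) (matNorm (ξ - -well n a)) with h' | h'
      · rw [wellDist, min_eq_left h'] at h ⊢
        exact (hA ξ h).1
      · rw [wellDist, min_eq_right h'] at h ⊢
        exact (hB ξ h).1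
    have : wellDist a ξ ^ p ≤ 1 / c * W ξ := by
      rw [div_mul_eq_mul_div, one_mul, le_div_iff₀ hc]; linarith
    refine this.trans (mul_le_mul_of_nonneg_right ?_ hWξ)
    rw [add_assoc]
    exact le_add_of_nonneg_right (by positivity)
  rcases le_or_gt (matNorm ξ) R with h' | h'
  · have hw' := hw ξ ⟨h', h.le⟩
    change w ≤ W ξ at hw'
    calc wellDist a ξ ^ p ≤ (R + m) ^ p := by
          refine Real.rpow_le_rpow hD ?_ (by linarith)
          exact (wellDist_le a ξ).trans (by gcongr)
      _ = (R + m) ^ p / w * w := by field_simp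
      _ ≤ (R + m) ^ p / w * W ξ := by gcongr
      _ ≤ _ := by
          refine mul_le_mul_of_nonneg_right ?_ hWξ
          have h1 : 0 ≤ 1 / c := by positivity
          have h2 : 0 ≤ 2 * C * (1 + m) ^ p := by positivity
          linarith
  · have hx : 1 ≤ matNorm ξ := hR1.trans h'.le
    have e1 : matNorm ξ ≤ matNorm ξ ^ p := by
      conv_lhs => rw [← Real.rpow_one (matNorm ξ)]
      exact Real.rpow_le_rpow_of_exponent_le hx (by linarith)
    have e2 : matNorm ξ ^ p ≤ 2 * C * W ξ := by
      have h3 := (hW ξ).1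
      have h4 : matNorm ξ ^ p - C ^ 2 ≤ C * W ξ := by
        have := mul_le_mul_of_nonneg_left h3 (by linarith : 0 ≤ C)
        have h5 : C * (1 / C * matNorm ξ ^ p - C) = matNorm ξ ^ p - C ^ 2 := by field_simp
        linarith
      nlinarith
    calc wellDist a ξ ^ p ≤ ((1 + m) * matNorm ξ) ^ p := by
          refine Real.rpow_le_rpow hD ?_ (by linarith)
          refine (wellDist_le a ξ).trans ?_
          nlinarith
      _ = (1 + m) ^ p * matNorm ξ ^ p := Real.mul_rpow (by positivity) (matNorm_nonneg _)
      _ ≤ (1 + m) ^ p * (2 * C * W ξ) := by gcongr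
      _ = 2 * C * (1 + m) ^ p * W ξ := by ring
      _ ≤ _ := by
          refine mul_le_mul_of_nonneg_right ?_ hWξ
          exact le_add_of_nonneg_left (by positivity)

/-- The growth conditions at the wells and at infinity, together with positivity and continuity in
between, give the comparison on the whole space of matrices. -/
theorem exists_comparable {W : Matrix (Fin d) (Fin (n + 1)) ℝ → ℝ≥0} {a : Fin d → ℝ} {p : ℝ}
    (hp : 2 ≤ p) (h1 : H1 W a) (h2 : H2 W p) (h3 : H3 W a p) : ∃ C, Comparable W a p C := by
  obtain ⟨C, hC, hu⟩ := exists_upper hp h2 h3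
  obtain ⟨c, hc, hl⟩ := exists_lower hp h1 h2 h3
  refine ⟨1 + C + c, by linarith, fun ξ => (hl ξ).trans ?_, fun ξ => (hu ξ).trans ?_⟩
  · exact mul_le_mul_of_nonneg_right (by linarith) (NNReal.coe_nonneg _)
  · exact mul_le_mul_of_nonneg_right (by linarith) (Real.rpow_nonneg (wellDist_nonneg a ξ) _)

/-- Symmetry in each column gives symmetry under any change of signs of the columns. -/
theorem H4.mul_sign {W : Matrix (Fin d) (Fin (n + 1)) ℝ → ℝ≥0} (h : H4 W)
    (s : Fin (n + 1) → ℝ) (hs : ∀ j, s j = 1 ∨ s j = -1)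
    (ξ : Matrix (Fin d) (Fin (n + 1)) ℝ) : W (fun i j => ξ i j * s j) = W ξ := by
  classical
  have key : ∀ t : Finset (Fin (n + 1)),
      W (fun i j => if j ∈ t then ξ i j * s j else ξ i j) = W ξ := by
    intro t
    induction t using Finset.induction_on with
    | empty => simp
    | insert j0 t hj ih =>
      rw [← ih]
      rcases hs j0 with h1 | h1
      · congr 1
        funext i j
        by_cases hjj : j = j0
        · subst hjj; simp [hj, h1]
        · simp [hjj]
      · rw [← h j0 (fun i j => if j ∈ t then ξ i j * s j else ξ i j)]
        congr 1
        funext i j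
        change _ = Function.update (fun j => if j ∈ t then ξ i j * s j else ξ i j) j0
          (-(if j0 ∈ t then ξ i j0 * s j0 else ξ i j0)) j
        rw [Function.update_apply]
        by_cases hjj : j = j0
        · subst hjj; simp [hj, h1]
        · simp [hjj]
  simpa using key Finset.univ

end Wells

/-! ### Partial derivatives, gradients and second gradients of smooth maps -/

section Calculus

variable {d n : ℕ}

/-- The partial derivative `∂_j f`. -/
def pd (j : Fin (n + 1)) (f : (Fin (n + 1) → ℝ) → ℝ) (x : Fin (n + 1) → ℝ) : ℝ :=
  fderiv ℝ f x (Pi.single j 1)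

/-- A vector-valued map with `C^∞` components. -/
def Smooth (v : (Fin (n + 1) → ℝ) → Fin d → ℝ) : Prop :=
  ∀ i, ContDiff ℝ ∞ fun x => v x i

/-- The gradient of a smooth map. -/
def grad (v : (Fin (n + 1) → ℝ) → Fin d → ℝ) (x : Fin (n + 1) → ℝ) :
    Matrix (Fin d) (Fin (n + 1)) ℝ :=
  fun i j => pd j (fun y => v y i) x

/-- The second gradient of a smooth map. -/
def hess (v : (Fin (n + 1) → ℝ) → Fin d → ℝ) (x : Fin (n + 1) → ℝ) :
    Fin d → Fin (n + 1) → Fin (n + 1) → ℝ :=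
  fun i j k => pd k (pd j fun y => v y i) x

theorem contDiff_pd {f : (Fin (n + 1) → ℝ) → ℝ} (hf : ContDiff ℝ ∞ f) (j : Fin (n + 1)) :
    ContDiff ℝ ∞ (pd j f) :=
  (hf.fderiv_right (m := ∞) (by simp)).clm_apply contDiff_const

theorem diffAt_of_contDiff {f : (Fin (n + 1) → ℝ) → ℝ} (hf : ContDiff ℝ ∞ f)
    (x : Fin (n + 1) → ℝ) : DifferentiableAt ℝ f x :=
  (hf.differentiable (by simp)) x

theorem pd_congr {f g : (Fin (n + 1) → ℝ) → ℝ} {x : Fin (n + 1) → ℝ} (h : f =ᶠ[𝓝 x] g)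
    (j : Fin (n + 1)) : pd j f x = pd j g x := by
  rw [pd, pd, h.fderiv_eq]

theorem pd_congr_nhds {f g : (Fin (n + 1) → ℝ) → ℝ} {x : Fin (n + 1) → ℝ} (h : f =ᶠ[𝓝 x] g)
    (j : Fin (n + 1)) : pd j f =ᶠ[𝓝 x] pd j g := by
  filter_upwards [h.eventually_nhds] with y hy using pd_congr hy j

theorem grad_congr {v w : (Fin (n + 1) → ℝ) → Fin d → ℝ} {x : Fin (n + 1) → ℝ}
    (h : v =ᶠ[𝓝 x] w) : grad v x = grad w x := by
  funext i j
  exact pd_congr (h.fun_comp fun y => y i) j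

theorem hess_congr {v w : (Fin (n + 1) → ℝ) → Fin d → ℝ} {x : Fin (n + 1) → ℝ}
    (h : v =ᶠ[𝓝 x] w) : hess v x = hess w x := by
  funext i j k
  exact pd_congr (pd_congr_nhds (h.fun_comp fun y => y i) j) k

theorem pd_add {f g : (Fin (n + 1) → ℝ) → ℝ} {x : Fin (n + 1) → ℝ}
    (hf : DifferentiableAt ℝ f x) (hg : DifferentiableAt ℝ g x) (j : Fin (n + 1)) :
    pd j (fun y => f y + g y) x = pd j f x + pd j g x := by
  simp [pd, fderiv_fun_add hf hg]

theorem pd_sub {f g : (Fin (n + 1) → ℝ) → ℝ} {x : Fin (n + 1) → ℝ}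
    (hf : DifferentiableAt ℝ f x) (hg : DifferentiableAt ℝ g x) (j : Fin (n + 1)) :
    pd j (fun y => f y - g y) x = pd j f x - pd j g x := by
  simp [pd, fderiv_fun_sub hf hg]

theorem pd_mul {f g : (Fin (n + 1) → ℝ) → ℝ} {x : Fin (n + 1) → ℝ}
    (hf : DifferentiableAt ℝ f x) (hg : DifferentiableAt ℝ g x) (j : Fin (n + 1)) :
    pd j (fun y => f y * g y) x = f x * pd j g x + pd j f x * g x := by
  simp only [pd, fderiv_fun_mul hf hg, add_apply, smul_apply,
    smul_eq_mul]
  ring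

theorem pd_const_mul {f : (Fin (n + 1) → ℝ) → ℝ} {x : Fin (n + 1) → ℝ}
    (hf : DifferentiableAt ℝ f x) (c : ℝ) (j : Fin (n + 1)) :
    pd j (fun y => c * f y) x = c * pd j f x := by
  simp [pd, fderiv_const_mul hf c]

@[simp] theorem pd_const (c : ℝ) (j : Fin (n + 1)) (x : Fin (n + 1) → ℝ) :
    pd j (fun _ => c) x = 0 := by
  simp [pd]

theorem pd_sum {ι : Type*} {s : Finset ι} {f : ι → (Fin (n + 1) → ℝ) → ℝ} {x : Fin (n + 1) → ℝ}
    (hf : ∀ l ∈ s, DifferentiableAt ℝ (f l) x) (j : Fin (n + 1)) :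
    pd j (fun y => ∑ l ∈ s, f l y) x = ∑ l ∈ s, pd j (f l) x := by
  simp [pd, fderiv_fun_sum hf]

theorem pd_comp {f : (Fin (n + 1) → ℝ) → ℝ} {Φ : (Fin (n + 1) → ℝ) → Fin (n + 1) → ℝ}
    {x : Fin (n + 1) → ℝ} (hf : DifferentiableAt ℝ f (Φ x))
    (hΦ : ∀ l, DifferentiableAt ℝ (fun y => Φ y l) x) (j : Fin (n + 1)) :
    pd j (fun y => f (Φ y)) x = ∑ l, pd l f (Φ x) * pd j (fun y => Φ y l) x := by
  have hΦ' : DifferentiableAt ℝ Φ x := differentiableAt_pi.2 hΦ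
  have h1 : fderiv ℝ (fun y => f (Φ y)) x = (fderiv ℝ f (Φ x)).comp (fderiv ℝ Φ x) :=
    fderiv_comp x hf hΦ'
  have h2 : ∀ l, (fderiv ℝ Φ x (Pi.single j 1)) l = pd j (fun y => Φ y l) x := by
    intro l
    rw [pd, fderiv_apply hΦ']
    rfl
  rw [pd, h1, ContinuousLinearMap.comp_apply]
  have h3 := LinearMap.pi_apply_eq_sum_univ (fderiv ℝ f (Φ x)).toLinearMap
    (fderiv ℝ Φ x (Pi.single j 1))
  rw [ContinuousLinearMap.coe_coe] at h3
  rw [h3]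
  refine Finset.sum_congr rfl fun l _ => ?_
  have h4 : (fun j => if l = j then (1 : ℝ) else 0) = Pi.single l 1 := by
    funext j
    simp [Pi.single_apply, eq_comm]
  rw [h2, smul_eq_mul, mul_comm, h4]
  rfl

theorem pd_coord {g : ℝ → ℝ} {x : Fin (n + 1) → ℝ} {i : Fin (n + 1)}
    (hg : DifferentiableAt ℝ g (x i)) (j : Fin (n + 1)) :
    pd j (fun y => g (y i)) x = if j = i then deriv g (x i) else 0 := by
  have h := (hg.hasDerivAt.hasFDerivAt.comp x (hasFDerivAt_apply (𝕜 := ℝ) i x)).fderiv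
  have h' : fderiv ℝ (fun y : Fin (n + 1) → ℝ => g (y i)) x = _ := h
  rw [pd, h']
  simp [Pi.single_apply, eq_comm]

theorem pd_comp_add_right (f : (Fin (n + 1) → ℝ) → ℝ) (j : Fin (n + 1))
    (b x : Fin (n + 1) → ℝ) : pd j (fun y => f (y + b)) x = pd j f (x + b) := by
  rw [pd, fderiv_comp_add_right, pd]

theorem pd_comp_smul (f : (Fin (n + 1) → ℝ) → ℝ) (j : Fin (n + 1)) (c : ℝ)
    (x : Fin (n + 1) → ℝ) : pd j (fun y => f (c • y)) x = c * pd j f (c • x) := by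
  rw [pd, fderiv_comp_smul, pd]
  simp

theorem pd_pd_comp {f : (Fin (n + 1) → ℝ) → ℝ} {Φ : (Fin (n + 1) → ℝ) → Fin (n + 1) → ℝ}
    (hf : ContDiff ℝ ∞ f) (hΦ : Smooth Φ) (x : Fin (n + 1) → ℝ) (j k : Fin (n + 1)) :
    pd k (pd j fun y => f (Φ y)) x =
      ∑ l, (∑ m, pd m (pd l f) (Φ x) * pd k (fun y => Φ y m) x) * pd j (fun y => Φ y l) x +
        ∑ l, pd l f (Φ x) * pd k (pd j fun y => Φ y l) x := by
  have hc : ∀ l, ContDiff ℝ ∞ fun y => pd l f (Φ y) := fun l =>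
    (contDiff_pd hf l).comp (contDiff_pi.2 hΦ)
  have h1 : (pd j fun y => f (Φ y)) = fun y => ∑ l, pd l f (Φ y) * pd j (fun z => Φ z l) y :=
    funext fun y => pd_comp (diffAt_of_contDiff hf _) (fun l => diffAt_of_contDiff (hΦ l) _) j
  rw [h1, pd_sum (f := fun l y => pd l f (Φ y) * pd j (fun z => Φ z l) y) fun l _ =>
    (diffAt_of_contDiff (hc l) x).mul (diffAt_of_contDiff (contDiff_pd (hΦ l) j) x),
    ← Finset.sum_add_distrib]
  refine Finset.sum_congr rfl fun l _ => ?_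
  rw [pd_mul (diffAt_of_contDiff (hc l) x) (diffAt_of_contDiff (contDiff_pd (hΦ l) j) x),
    pd_comp (diffAt_of_contDiff (contDiff_pd hf l) _) fun m => diffAt_of_contDiff (hΦ m) _]
  exact add_comm _ _

theorem Smooth.continuous {v : (Fin (n + 1) → ℝ) → Fin d → ℝ} (hv : Smooth v) : Continuous v :=
  continuous_pi fun i => (hv i).continuous

theorem Smooth.continuous_grad {v : (Fin (n + 1) → ℝ) → Fin d → ℝ} (hv : Smooth v) :
    Continuous (grad v) :=
  continuous_pi fun i => continuous_pi fun j => (contDiff_pd (hv i) j).continuous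

theorem Smooth.continuous_hess {v : (Fin (n + 1) → ℝ) → Fin d → ℝ} (hv : Smooth v) :
    Continuous (hess v) :=
  continuous_pi fun i => continuous_pi fun j => continuous_pi fun k =>
    (contDiff_pd (contDiff_pd (hv i) j) k).continuous

theorem grad_comp {u : (Fin (n + 1) → ℝ) → Fin d → ℝ} {Φ : (Fin (n + 1) → ℝ) → Fin (n + 1) → ℝ}
    (hu : Smooth u) (hΦ : Smooth Φ) (x : Fin (n + 1) → ℝ) :
    grad (fun y => u (Φ y)) x = fun i j => ∑ l, grad u (Φ x) i l * grad Φ x l j := by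
  funext i j
  exact pd_comp (diffAt_of_contDiff (hu i) _) (fun l => diffAt_of_contDiff (hΦ l) _) j

theorem hess_comp {u : (Fin (n + 1) → ℝ) → Fin d → ℝ} {Φ : (Fin (n + 1) → ℝ) → Fin (n + 1) → ℝ}
    (hu : Smooth u) (hΦ : Smooth Φ) (x : Fin (n + 1) → ℝ) :
    hess (fun y => u (Φ y)) x = fun i j k =>
      (∑ l, (∑ m, hess u (Φ x) i l m * grad Φ x m k) * grad Φ x l j) +
        ∑ l, grad u (Φ x) i l * hess Φ x l j k := by
  funext i j k
  exact pd_pd_comp (hu i) hΦ x j k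

theorem Smooth.comp {u : (Fin (n + 1) → ℝ) → Fin d → ℝ} {Φ : (Fin (n + 1) → ℝ) → Fin (n + 1) → ℝ}
    (hu : Smooth u) (hΦ : Smooth Φ) : Smooth fun x => u (Φ x) :=
  fun i => (hu i).comp (contDiff_pi.2 hΦ)

theorem Smooth.add {u v : (Fin (n + 1) → ℝ) → Fin d → ℝ} (hu : Smooth u) (hv : Smooth v) :
    Smooth fun x => u x + v x := fun i => (hu i).add (hv i)

theorem grad_add {u v : (Fin (n + 1) → ℝ) → Fin d → ℝ} (hu : Smooth u) (hv : Smooth v)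
    (x : Fin (n + 1) → ℝ) : grad (fun y => u y + v y) x = grad u x + grad v x := by
  funext i j
  exact pd_add (diffAt_of_contDiff (hu i) x) (diffAt_of_contDiff (hv i) x) j

theorem hess_add {u v : (Fin (n + 1) → ℝ) → Fin d → ℝ} (hu : Smooth u) (hv : Smooth v)
    (x : Fin (n + 1) → ℝ) :
    hess (fun y => u y + v y) x = fun i j k => hess u x i j k + hess v x i j k := by
  funext i j k
  have : (pd j fun y => (u y + v y) i) = fun y => pd j (fun z => u z i) y + pd j (fun z => v z i) y :=
    funext fun y => pd_add (diffAt_of_contDiff (hu i) y) (diffAt_of_contDiff (hv i) y) j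
  change pd k (pd j fun y => (u y + v y) i) x = _
  rw [this, pd_add (diffAt_of_contDiff (contDiff_pd (hu i) j) x)
    (diffAt_of_contDiff (contDiff_pd (hv i) j) x)]
  rfl

theorem contDiff_coord {g : ℝ → ℝ} (hg : ContDiff ℝ ∞ g) (l : Fin (n + 1)) :
    ContDiff ℝ ∞ fun x : Fin (n + 1) → ℝ => g (x l) :=
  hg.comp (contDiff_apply ℝ ℝ l)

theorem contDiff_deriv {g : ℝ → ℝ} (hg : ContDiff ℝ ∞ g) : ContDiff ℝ ∞ (deriv g) :=
  ((contDiff_infty_iff_deriv (𝕜 := ℝ)).1 hg).2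

/-- The map `x ↦ g (x_l) b`. -/
def coordMap (l : Fin (n + 1)) (g : ℝ → ℝ) (b : Fin d → ℝ) (x : Fin (n + 1) → ℝ) : Fin d → ℝ :=
  g (x l) • b

theorem smooth_coordMap {g : ℝ → ℝ} (hg : ContDiff ℝ ∞ g) (l : Fin (n + 1)) (b : Fin d → ℝ) :
    Smooth (coordMap l g b) := fun _ => (contDiff_coord hg l).mul contDiff_const

theorem pd_coordMap {g : ℝ → ℝ} (hg : ContDiff ℝ ∞ g) (l j : Fin (n + 1)) (b : Fin d → ℝ)
    (i : Fin d) : (pd j fun y => coordMap l g b y i) =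
      fun x => if j = l then deriv g (x l) * b i else 0 := by
  funext x
  have : (fun y => coordMap l g b y i) = fun y => (fun t => g t * b i) (y l) := rfl
  have hg' : DifferentiableAt ℝ g (x l) := (hg.differentiable (by simp)) _
  rw [this, pd_coord (g := fun t => g t * b i) (hg'.mul_const _), deriv_mul_const hg']

theorem grad_coordMap {g : ℝ → ℝ} (hg : ContDiff ℝ ∞ g) (l : Fin (n + 1)) (b : Fin d → ℝ)
    (x : Fin (n + 1) → ℝ) :
    grad (coordMap l g b) x = fun i j => if j = l then deriv g (x l) * b i else 0 := by
  funext i j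
  exact congrFun (pd_coordMap hg l j b i) x

theorem hess_coordMap {g : ℝ → ℝ} (hg : ContDiff ℝ ∞ g) (l : Fin (n + 1)) (b : Fin d → ℝ)
    (x : Fin (n + 1) → ℝ) :
    hess (coordMap l g b) x =
      fun i j k => if j = l ∧ k = l then deriv (deriv g) (x l) * b i else 0 := by
  funext i j k
  change pd k (pd j fun y => coordMap l g b y i) x = _
  rw [pd_coordMap hg]
  by_cases hj : j = l
  · simp only [hj, if_true, true_and]
    exact congrFun (pd_coordMap (contDiff_deriv hg) l k b i) x
  · simp [hj]

end Calculus

/-! ### Periodicity in the horizontal variables -/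

section Periodicity

variable {d n : ℕ}

/-- The horizontal vector `(y, 0)`. -/
def hvec (y : Fin n → ℝ) : Fin (n + 1) → ℝ := Fin.snoc (α := fun _ => ℝ) y 0

@[simp] theorem hvec_castSucc (y : Fin n → ℝ) (j : Fin n) : hvec y j.castSucc = y j := by
  simp [hvec]

@[simp] theorem hvec_last (y : Fin n → ℝ) : hvec y (Fin.last n) = 0 := by
  simp [hvec]

/-- `f` is `P`-periodic in each of the horizontal variables. -/
def Per {β : Type*} (P : ℝ) (f : (Fin (n + 1) → ℝ) → β) : Prop :=
  ∀ (k : Fin n → ℤ) (x : Fin (n + 1) → ℝ), f (x + hvec fun j => k j * P) = f x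

/-- The vertical cylinder over the half-open period cell `(0, P]^{N-1}`. -/
def slab (n : ℕ) (P : ℝ) : Set (Fin (n + 1) → ℝ) :=
  {x | ∀ j : Fin n, x j.castSucc ∈ Set.Ioc 0 P}

theorem Per.mul_nat {β : Type*} {P : ℝ} {f : (Fin (n + 1) → ℝ) → β} (hf : Per P f) (m : ℕ) :
    Per (m * P) f := by
  intro k x
  rw [← hf (fun j => k j * m) x]
  congr 3
  funext j
  push_cast
  ring

theorem Per.pd {P : ℝ} {f : (Fin (n + 1) → ℝ) → ℝ} (hf : Per P f) (j : Fin (n + 1)) :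
    Per P (pd j f) := by
  intro k x
  rw [← pd_comp_add_right]
  congr 1
  funext y
  exact hf k y

theorem Per.grad {P : ℝ} {v : (Fin (n + 1) → ℝ) → Fin d → ℝ} (hv : Per P v) :
    Per P (grad v) := by
  intro k x
  funext i j
  exact Per.pd (f := fun y => v y i) (fun k x => congrFun (hv k x) i) j k x

theorem Per.hess {P : ℝ} {v : (Fin (n + 1) → ℝ) → Fin d → ℝ} (hv : Per P v) :
    Per P (hess v) := by
  intro k x
  funext i j l
  exact (Per.pd (f := fun y => v y i) (fun k x => congrFun (hv k x) i) j).pd l k x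

theorem Per.comp {β δ : Type*} {P : ℝ} {f : (Fin (n + 1) → ℝ) → β} (hf : Per P f) (g : β → δ) :
    Per P fun x => g (f x) := fun k x => congrArg g (hf k x)

/-- Periodicity in the horizontal variables reduces boundedness on a layer to a compact set. -/
theorem Per.exists_bound {E : Type*} [NormedAddCommGroup E] {P : ℝ} (hP : 0 < P)
    {f : (Fin (n + 1) → ℝ) → E} (hf : Per P f) (hc : Continuous f) (h : ℝ) :
    ∃ K : ℝ, 0 ≤ K ∧ ∀ x, |x (Fin.last n)| ≤ h → ‖f x‖ ≤ K := by
  have hK : IsCompact (Set.Icc (hvec 0 + Pi.single (Fin.last n) (-h))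
      (hvec (fun _ : Fin n => P) + Pi.single (Fin.last n) h)) := isCompact_Icc
  obtain ⟨K, hK⟩ := hK.exists_bound_of_continuousOn hc.continuousOn
  refine ⟨max K 0, le_max_right _ _, fun x hx => ?_⟩
  rw [← hf (fun j => -⌊x j.castSucc / P⌋) x]
  refine (hK _ ⟨?_, ?_⟩).trans (le_max_left _ _) <;> intro l <;>
    refine Fin.lastCases ?_ (fun j => ?_) l
  · simpa using (abs_le.1 hx).1
  · have := Int.floor_le (x j.castSucc / P)
    rw [le_div_iff₀ hP] at this
    simp [Fin.castSucc_ne_last]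
    linarith
  · simpa using (abs_le.1 hx).2
  · have := (Int.lt_floor_add_one (x j.castSucc / P)).le
    rw [div_le_iff₀ hP] at this
    simp [Fin.castSucc_ne_last]
    linarith

theorem measurableSet_slab (P : ℝ) : MeasurableSet (slab n P) := by
  have : slab n P = ⋂ j : Fin n, (fun x : Fin (n + 1) → ℝ => x j.castSucc) ⁻¹' Set.Ioc 0 P := by
    ext x; simp [slab]
  rw [this]
  exact MeasurableSet.iInter fun j => measurable_pi_apply _ measurableSet_Ioc

theorem setLIntegral_translate (f : (Fin (n + 1) → ℝ) → ℝ≥0∞) (S : Set (Fin (n + 1) → ℝ))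
    (g : Fin (n + 1) → ℝ) :
    ∫⁻ x in {x | x - g ∈ S}, f x = ∫⁻ x in S, f (x + g) := by
  have h := (measurePreserving_add_right (volume : Measure (Fin (n + 1) → ℝ)) g)
  rw [← h.setLIntegral_comp_preimage_emb (measurableEmbedding_addRight g)]
  congr 2
  ext x
  simp

/-- Integrals of periodic functions over translates of a period cell by a period. -/
theorem Per.setLIntegral_translate {P : ℝ} {f : (Fin (n + 1) → ℝ) → ℝ≥0∞} (hf : Per P f)
    (S : Set (Fin (n + 1) → ℝ)) (k : Fin n → ℤ) :
    ∫⁻ x in {x | x - hvec (fun j => k j * P) ∈ S}, f x = ∫⁻ x in S, f x := by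
  rw [Surfactant.setLIntegral_translate]
  congr 1
  funext x
  exact hf k x

/-- A slab over the box of side `m P` consists of `m ^ n` translates of the slab of side `P`. -/
theorem Per.setLIntegral_slab {P : ℝ} (hP : 0 < P) {f : (Fin (n + 1) → ℝ) → ℝ≥0∞}
    (hf : Per P f) (m : ℕ) :
    ∫⁻ x in slab n (m * P), f x = (m : ℝ≥0∞) ^ n * ∫⁻ x in slab n P, f x := by
  let T : (Fin n → Fin m) → Set (Fin (n + 1) → ℝ) := fun k =>
    {x | x - hvec (fun j => ((k j : ℕ) : ℤ) * P) ∈ slab n P}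
  have hU : slab n (m * P) = ⋃ k, T k := by
    ext x
    simp only [Set.mem_iUnion]
    constructor
    · intro hx
      have h1 : ∀ j : Fin n, 0 < x j.castSucc / P := fun j => div_pos (hx j).1 hP
      have h2 : ∀ j : Fin n, 0 < ⌈x j.castSucc / P⌉₊ := fun j => Nat.ceil_pos.2 (h1 j)
      refine ⟨fun j => ⟨⌈x j.castSucc / P⌉₊ - 1, ?_⟩, fun j => ?_⟩
      · have h3 : ⌈x j.castSucc / P⌉₊ ≤ m := by
          rw [Nat.ceil_le, div_le_iff₀ hP]; exact (hx j).2
        have := h2 j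
        omega
      · have h4 := Nat.ceil_lt_add_one (h1 j).le
        have h5 := Nat.le_ceil (x j.castSucc / P)
        have h6 : ((⌈x j.castSucc / P⌉₊ - 1 : ℕ) : ℝ) = ⌈x j.castSucc / P⌉₊ - 1 := by
          rw [Nat.cast_sub (h2 j)]; simp
        have h7 : x j.castSucc = x j.castSucc / P * P := by field_simp
        simp only [Pi.sub_apply, hvec_castSucc, Int.cast_natCast, h6, Set.mem_Ioc]
        constructor
        · nlinarith
        · nlinarith
    · rintro ⟨k, hk⟩ j
      have := hk j
      simp only [Pi.sub_apply, hvec_castSucc, Int.cast_natCast, Set.mem_Ioc] at this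
      have h0 : (0 : ℝ) ≤ (k j : ℕ) := Nat.cast_nonneg _
      have h1 : ((k j : ℕ) : ℝ) + 1 ≤ m := by exact_mod_cast (k j).2
      constructor
      · nlinarith
      · nlinarith
  have hdis : Pairwise (Function.onFun Disjoint T) := by
    intro k k' hkk
    rw [Function.onFun, Set.disjoint_left]
    intro x hx hx'
    apply hkk
    funext j
    have h1 := hx j
    have h2 := hx' j
    simp only [Pi.sub_apply, hvec_castSucc, Int.cast_natCast, Set.mem_Ioc] at h1 h2
    have h3 : ((k j : ℕ) : ℝ) < (k' j : ℕ) + 1 := by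
      by_contra hcon
      push Not at hcon
      nlinarith
    have h4 : ((k' j : ℕ) : ℝ) < (k j : ℕ) + 1 := by
      by_contra hcon
      push Not at hcon
      nlinarith
    have h5 : (k j : ℕ) < k' j + 1 := by exact_mod_cast h3
    have h6 : (k' j : ℕ) < k j + 1 := by exact_mod_cast h4
    exact Fin.ext (by omega)
  have hT : ∀ k, MeasurableSet (T k) := fun k => (measurableSet_slab P).preimage (by fun_prop)
  rw [hU, lintegral_iUnion hT hdis, tsum_fintype]
  rw [Finset.sum_congr rfl fun k _ => Per.setLIntegral_translate hf (slab n P) _]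
  simp

/-- The two halves of a cell of side `2 m P` carry the same integral of a `P`-periodic function. -/
theorem Per.setLIntegral_half {P : ℝ} (hP : 0 < P) {f : (Fin (n + 1) → ℝ) → ℝ≥0∞}
    (hf : Per P f) (m : ℕ) (j₀ : Fin n) :
    2 * ∫⁻ x in slab n (2 * m * P) ∩ {x | x j₀.castSucc ≤ m * P}, f x =
        (2 * m : ℝ≥0∞) ^ n * ∫⁻ x in slab n P, f x ∧
      2 * ∫⁻ x in slab n (2 * m * P) ∩ {x | m * P < x j₀.castSucc}, f x =
        (2 * m : ℝ≥0∞) ^ n * ∫⁻ x in slab n P, f x := by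
  have hmP : 0 ≤ m * P := by positivity
  have hfull := Per.setLIntegral_slab hP hf (2 * m)
  push_cast at hfull
  have hms : MeasurableSet {x : Fin (n + 1) → ℝ | x j₀.castSucc ≤ m * P} :=
    measurableSet_le (measurable_pi_apply _) measurable_const
  have hsplit := lintegral_inter_add_sdiff (μ := volume) f (slab n (2 * m * P)) hms
  have hdiff : slab n (2 * m * P) \ {x | x j₀.castSucc ≤ m * P} =
      slab n (2 * m * P) ∩ {x | m * P < x j₀.castSucc} := by
    ext x; simp
  rw [hdiff, hfull] at hsplit
  classical
  have hshift := Per.setLIntegral_translate hf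
    (slab n (2 * m * P) ∩ {x | x j₀.castSucc ≤ m * P}) (Pi.single j₀ (m : ℤ))
  have hset : {x : Fin (n + 1) → ℝ | x - hvec (fun j => ((Pi.single j₀ (m : ℤ) : Fin n → ℤ) j : ℝ)
      * P) ∈ slab n (2 * m * P) ∩ {x | x j₀.castSucc ≤ m * P}} =
      slab n (2 * m * P) ∩ {x | m * P < x j₀.castSucc} := by
    ext x
    simp only [slab, Set.mem_inter_iff, Set.mem_ofPred_eq, Pi.sub_apply, hvec_castSucc,
      Pi.single_eq_same, Int.cast_natCast, Set.mem_Ioc]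
    constructor
    · rintro ⟨h1, h2⟩
      have h0 := h1 j₀
      simp only [Pi.single_eq_same, Int.cast_natCast] at h0
      refine ⟨fun j => ?_, by linarith [h0.1]⟩
      by_cases hj : j = j₀
      · subst hj
        have := h1 j
        simp only [Pi.single_eq_same, Int.cast_natCast] at this
        constructor <;> linarith
      · simpa [Pi.single_apply, hj] using h1 j
    · rintro ⟨h1, h2⟩
      refine ⟨fun j => ?_, by linarith [(h1 j₀).2]⟩
      by_cases hj : j = j₀
      · subst hj
        simp only [Pi.single_eq_same, Int.cast_natCast]
        have := h1 j
        constructor <;> linarith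
      · simpa [Pi.single_apply, hj] using h1 j
  rw [hset] at hshift
  rw [hshift] at hsplit
  rw [hshift, two_mul, hsplit]
  exact ⟨rfl, rfl⟩

theorem setLIntegral_comp_smul {k : ℝ} (hk : 0 < k) {f : (Fin (n + 1) → ℝ) → ℝ≥0∞}
    (hf : Measurable f) {S : Set (Fin (n + 1) → ℝ)} (hS : MeasurableSet S) :
    ∫⁻ x in {x | k • x ∈ S}, f (k • x) =
      ENNReal.ofReal ((k ^ (n + 1))⁻¹) * ∫⁻ x in S, f x := by
  have h := Measure.map_addHaar_smul (volume : Measure (Fin (n + 1) → ℝ)) hk.ne'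
  have hm : Measurable fun x : Fin (n + 1) → ℝ => k • x := measurable_const_smul k
  have h2 : ∫⁻ x in S, f x ∂(Measure.map (fun x : Fin (n + 1) → ℝ => k • x) volume) =
      ∫⁻ x in {x | k • x ∈ S}, f (k • x) := by
    rw [Measure.restrict_map hm hS, lintegral_map hf hm]
    rfl
  rw [← h2]
  change ∫⁻ x in S, f x ∂(Measure.map (k • ·) volume) = _
  rw [h, Measure.restrict_smul, lintegral_smul_measure, smul_eq_mul,
    abs_of_pos (by positivity)]
  simp

end Periodicity

/-! ### Smooth periodic profiles as competitors -/

section Profiles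

variable {d n : ℕ}

theorem measurableSet_cube : MeasurableSet (cube n) := by
  have : cube n = ⋂ j, (fun x : Fin (n + 1) → ℝ => x j) ⁻¹' Set.Ioo (-(1 / 2) : ℝ) (1 / 2) := by
    ext x; simp [cube]
  rw [this]
  exact MeasurableSet.iInter fun j => measurable_pi_apply _ measurableSet_Ioo

theorem measurableSet_strip : MeasurableSet (strip n) :=
  measurable_pi_apply (Fin.last n) measurableSet_Ioo

theorem volume_cube : volume (cube n) = 1 := by
  have : cube n = Set.pi Set.univ fun _ => Set.Ioo (-(1 / 2) : ℝ) (1 / 2) := by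
    ext x; simp [cube]
  rw [this, volume_pi_pi]
  simp
  norm_num

/-- The energy density of a smooth map. -/
def eden (W : Matrix (Fin d) (Fin (n + 1)) ℝ → ℝ≥0) (ε lam : ℝ)
    (v : (Fin (n + 1) → ℝ) → Fin d → ℝ) (x : Fin (n + 1) → ℝ) : ℝ≥0∞ :=
  ENNReal.ofReal ((1 / ε) * (W (grad v x) : ℝ) + ε * hessNorm (hess v x) ^ 2 +
    ε * min (lam ^ 2) (hessNorm (hess v x) ^ 2))

/-- The density of the constraint `∫ max {lam + |∇²v|, 0}` for a smooth map. -/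
def gden (lam : ℝ) (v : (Fin (n + 1) → ℝ) → Fin d → ℝ) (x : Fin (n + 1) → ℝ) : ℝ≥0∞ :=
  ENNReal.ofReal (max (lam + hessNorm (hess v x)) 0)

theorem measurable_eden {W : Matrix (Fin d) (Fin (n + 1)) ℝ → ℝ≥0} (hW : Continuous W)
    (ε lam : ℝ) {v : (Fin (n + 1) → ℝ) → Fin d → ℝ} (hv : Smooth v) :
    Measurable (eden W ε lam v) := by
  have h1 : Continuous fun x => (W (grad v x) : ℝ) :=
    NNReal.continuous_coe.comp (hW.comp hv.continuous_grad)
  have h2 : Continuous fun x => hessNorm (hess v x) := continuous_hessNorm.comp hv.continuous_hess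
  exact (ENNReal.continuous_ofReal.comp (by fun_prop)).measurable

theorem measurable_gden (lam : ℝ) {v : (Fin (n + 1) → ℝ) → Fin d → ℝ} (hv : Smooth v) :
    Measurable (gden lam v) := by
  have h2 : Continuous fun x => hessNorm (hess v x) := continuous_hessNorm.comp hv.continuous_hess
  exact (ENNReal.continuous_ofReal.comp (by fun_prop)).measurable

theorem Per.eden (W : Matrix (Fin d) (Fin (n + 1)) ℝ → ℝ≥0) (ε lam : ℝ) {P : ℝ}
    {v : (Fin (n + 1) → ℝ) → Fin d → ℝ} (hv : Per P v) : Per P (eden W ε lam v) := by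
  intro k x
  rw [Surfactant.eden, hv.grad k x, hv.hess k x]
  rfl

theorem Per.gden (lam : ℝ) {P : ℝ}
    {v : (Fin (n + 1) → ℝ) → Fin d → ℝ} (hv : Per P v) : Per P (gden lam v) := by
  intro k x
  rw [Surfactant.gden, hv.hess k x]
  rfl

/-- A smooth map, `P`-periodic in the horizontal variables and equal to `|x_N| a`, up to one
additive constant on either side, away from a horizontal layer; `E` and `Γ` bound its energy and
the value of its constraint integral per unit of horizontal area. -/
structure Profile (W : Matrix (Fin d) (Fin (n + 1)) ℝ → ℝ≥0) (a : Fin d → ℝ) (ε lam P : ℝ)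
    (E Γ : ℝ≥0∞) (v : (Fin (n + 1) → ℝ) → Fin d → ℝ) : Prop where
  smooth : Smooth v
  per : Per P v
  far : ∃ (h : ℝ) (cp cm : Fin d → ℝ), 0 < h ∧ ∀ x : Fin (n + 1) → ℝ,
    (h ≤ x (Fin.last n) → v x = x (Fin.last n) • a + cp) ∧
    (x (Fin.last n) ≤ -h → v x = -x (Fin.last n) • a + cm)
  energy_le : ∫⁻ x in slab n P, eden W ε lam v x ≤ ENNReal.ofReal (P ^ n) * E
  constraint_le : ∫⁻ x in slab n P, gden lam v x ≤ ENNReal.ofReal (P ^ n) * Γ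

theorem setIntegral_mul_fderiv_test {U : Set (Fin (n + 1) → ℝ)} {f φ : (Fin (n + 1) → ℝ) → ℝ}
    (hf : ContDiff ℝ ∞ f) (hφ : IsTest U φ) (j : Fin (n + 1)) :
    ∫ x in U, f x * fderiv ℝ φ x (Pi.single j 1) = -∫ x in U, pd j f x * φ x := by
  obtain ⟨h1, h2, h3⟩ := hφ
  have hφ0 : ∀ x, x ∉ U → φ x = 0 := fun x hx => image_eq_zero_of_notMem_tsupport fun h => hx (h3 h)
  have hφ1 : ∀ x, x ∉ U → fderiv ℝ φ x (Pi.single j 1) = 0 := fun x hx => by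
    rw [fderiv_of_notMem_tsupport ℝ fun h => hx (h3 h)]; rfl
  rw [setIntegral_eq_integral_of_forall_compl_eq_zero fun x hx => by rw [hφ1 x hx, mul_zero],
    setIntegral_eq_integral_of_forall_compl_eq_zero fun x hx => by rw [hφ0 x hx, mul_zero]]
  have hc : Continuous fun x => fderiv ℝ φ x (Pi.single j 1) := (contDiff_pd h1 j).continuous
  have hcs : HasCompactSupport fun x => fderiv ℝ φ x (Pi.single j 1) :=
    (h2.fderiv (𝕜 := ℝ)).comp_left (g := fun L : (Fin (n + 1) → ℝ) →L[ℝ] ℝ => L (Pi.single j 1)) rfl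
  refine integral_mul_fderiv_eq_neg_fderiv_mul_of_integrable ?_ ?_ ?_
    (fun x _ => diffAt_of_contDiff hf x) (fun x _ => diffAt_of_contDiff h1 x)
  · exact ((contDiff_pd hf j).continuous.mul h1.continuous).integrable_of_hasCompactSupport
      h2.mul_left
  · exact (hf.continuous.mul hc).integrable_of_hasCompactSupport hcs.mul_left
  · exact (hf.continuous.mul h1.continuous).integrable_of_hasCompactSupport h2.mul_left

theorem Smooth.isSobolevTwo_top {U : Set (Fin (n + 1) → ℝ)} (hU : MeasurableSet U)
    {v : (Fin (n + 1) → ℝ) → Fin d → ℝ} (hv : Smooth v) {K : ℝ}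
    (h0 : ∀ x ∈ U, ∀ i, |v x i| ≤ K) (h1 : ∀ x ∈ U, ∀ i j, |grad v x i j| ≤ K)
    (h2 : ∀ x ∈ U, ∀ i j k, |hess v x i j k| ≤ K) :
    IsSobolevTwo ∞ U v (grad v) (hess v) where
  memLp_fun i := memLp_top_of_bound (hv i).continuous.aestronglyMeasurable K
    ((ae_restrict_iff' hU).2 (ae_of_all _ fun x hx => h0 x hx i))
  memLp_grad i j := memLp_top_of_bound (contDiff_pd (hv i) j).continuous.aestronglyMeasurable K
    ((ae_restrict_iff' hU).2 (ae_of_all _ fun x hx => h1 x hx i j))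
  memLp_hess i j k := memLp_top_of_bound
    (contDiff_pd (contDiff_pd (hv i) j) k).continuous.aestronglyMeasurable K
    ((ae_restrict_iff' hU).2 (ae_of_all _ fun x hx => h2 x hx i j k))
  weak_grad i j _ hφ := setIntegral_mul_fderiv_test (hv i) hφ j
  weak_hess i j k _ hφ := setIntegral_mul_fderiv_test (contDiff_pd (hv i) j) hφ k

theorem IsSobolevTwo.two_of_top {U : Set (Fin (n + 1) → ℝ)} (hU : volume U ≠ ⊤)
    {u : (Fin (n + 1) → ℝ) → Fin d → ℝ}
    {G : (Fin (n + 1) → ℝ) → Matrix (Fin d) (Fin (n + 1)) ℝ}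
    {H : (Fin (n + 1) → ℝ) → Fin d → Fin (n + 1) → Fin (n + 1) → ℝ}
    (h : IsSobolevTwo ∞ U u G H) : IsSobolevTwo 2 U u G H := by
  have : IsFiniteMeasure (volume.restrict U) := isFiniteMeasure_restrict.2 hU
  exact ⟨fun i => (h.1 i).mono_exponent le_top, fun i j => (h.2 i j).mono_exponent le_top,
    fun i j k => (h.3 i j k).mono_exponent le_top, h.4, h.5⟩

/-- The blow-down `x ↦ v (k x) / k`. -/
def scaled (k : ℝ) (v : (Fin (n + 1) → ℝ) → Fin d → ℝ) (x : Fin (n + 1) → ℝ) : Fin d → ℝ :=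
  k⁻¹ • v (k • x)

theorem Smooth.scaled (k : ℝ) {v : (Fin (n + 1) → ℝ) → Fin d → ℝ} (hv : Smooth v) :
    Smooth (scaled k v) := fun i =>
  contDiff_const.mul ((hv i).comp (contDiff_const_smul k))

theorem pd_scaled {k : ℝ} (hk : k ≠ 0) {v : (Fin (n + 1) → ℝ) → Fin d → ℝ} (hv : Smooth v)
    (i : Fin d) (j : Fin (n + 1)) :
    (pd j fun y => scaled k v y i) = fun x => pd j (fun y => v y i) (k • x) := by
  funext x
  have h : ContDiff ℝ ∞ fun y => v (k • y) i := (hv i).comp (contDiff_const_smul k)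
  change pd j (fun y => k⁻¹ * v (k • y) i) x = _
  rw [pd_const_mul (diffAt_of_contDiff h x), pd_comp_smul (fun y => v y i)]
  field_simp

theorem grad_scaled {k : ℝ} (hk : k ≠ 0) {v : (Fin (n + 1) → ℝ) → Fin d → ℝ} (hv : Smooth v)
    (x : Fin (n + 1) → ℝ) : grad (scaled k v) x = grad v (k • x) := by
  funext i j
  exact congrFun (pd_scaled hk hv i j) x

theorem hess_scaled {k : ℝ} (hk : k ≠ 0) {v : (Fin (n + 1) → ℝ) → Fin d → ℝ} (hv : Smooth v)
    (x : Fin (n + 1) → ℝ) : hess (scaled k v) x = fun i j l => k * hess v (k • x) i j l := by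
  funext i j l
  change pd l (pd j fun y => scaled k v y i) x = _
  rw [pd_scaled hk hv, pd_comp_smul]
  rfl

theorem hessNorm_mul {k : ℝ} (hk : 0 ≤ k) (H : Fin d → Fin (n + 1) → Fin (n + 1) → ℝ) :
    hessNorm (fun i j l => k * H i j l) = k * hessNorm H := by
  simp only [hessNorm, mul_pow, ← Finset.mul_sum]
  rw [Real.sqrt_mul (sq_nonneg k), Real.sqrt_sq hk]

theorem eden_scaled (W : Matrix (Fin d) (Fin (n + 1)) ℝ → ℝ≥0) (ε lam : ℝ) {k : ℝ} (hk : 0 < k)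
    {v : (Fin (n + 1) → ℝ) → Fin d → ℝ} (hv : Smooth v) (x : Fin (n + 1) → ℝ) :
    eden W (ε / k) (k * lam) (scaled k v) x = ENNReal.ofReal k * eden W ε lam v (k • x) := by
  rw [eden, grad_scaled hk.ne' hv, hess_scaled hk.ne' hv, hessNorm_mul hk.le, eden,
    ← ENNReal.ofReal_mul hk.le]
  congr 1
  rw [mul_pow, mul_pow, ← mul_min_of_nonneg _ _ (sq_nonneg k)]
  rcases eq_or_ne ε 0 with h | h
  · simp [h]
  · field_simp

theorem gden_scaled (lam : ℝ) {k : ℝ} (hk : 0 < k)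
    {v : (Fin (n + 1) → ℝ) → Fin d → ℝ} (hv : Smooth v) (x : Fin (n + 1) → ℝ) :
    gden (k * lam) (scaled k v) x = ENNReal.ofReal k * gden lam v (k • x) := by
  rw [gden, hess_scaled hk.ne' hv, hessNorm_mul hk.le, gden, ← ENNReal.ofReal_mul hk.le,
    mul_max_of_nonneg _ _ hk.le, mul_zero, mul_add]

/-- The substitution `x ↦ k x` maps the unit cube into a translate of a slab of side `k = 2 m P`; of
the Jacobian `k ^ (n + 1)`, a factor `k ^ n` is accounted for by the area of its base. -/
theorem Per.setLIntegral_cube_le {P : ℝ} (hP : 0 < P) {f : (Fin (n + 1) → ℝ) → ℝ≥0∞}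
    (hf : Per P f) (hm : Measurable f) {m : ℕ} (hm0 : 0 < m) {k : ℝ} (hk : k = 2 * m * P)
    {E : ℝ≥0∞} (hE : ∫⁻ x in slab n P, f x ≤ ENNReal.ofReal (P ^ n) * E) :
    ∫⁻ x in cube n, ENNReal.ofReal k * f (k • x) ≤ E := by
  have hk0 : 0 < k := by rw [hk]; positivity
  let S : Set (Fin (n + 1) → ℝ) :=
    {x | x - hvec (fun _ => ((-(m : ℤ) : ℤ) : ℝ) * P) ∈ slab n (2 * m * P)}
  have hS : MeasurableSet S := (measurableSet_slab _).preimage (by fun_prop)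
  have hsub : cube n ⊆ {x | k • x ∈ S} := by
    intro x hx j
    have h1 := (hx j.castSucc).1
    have h2 := (hx j.castSucc).2
    simp only [Pi.sub_apply, Pi.smul_apply, hvec_castSucc, smul_eq_mul]
    push_cast
    rw [← hk]
    constructor <;> nlinarith
  have hmeas : Measurable fun x : Fin (n + 1) → ℝ => f (k • x) :=
    hm.comp (measurable_const_smul k)
  have h1 : ∫⁻ x in S, f x = (2 * m : ℝ≥0∞) ^ n * ∫⁻ x in slab n P, f x := by
    rw [Per.setLIntegral_translate hf (slab n (2 * m * P)) fun _ => -(m : ℤ)]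
    have := Per.setLIntegral_slab hP hf (2 * m)
    push_cast at this
    exact this
  calc ∫⁻ x in cube n, ENNReal.ofReal k * f (k • x)
      ≤ ∫⁻ x in {x | k • x ∈ S}, ENNReal.ofReal k * f (k • x) :=
        lintegral_mono_set hsub
    _ = ENNReal.ofReal k * ∫⁻ x in {x | k • x ∈ S}, f (k • x) := lintegral_const_mul _ hmeas
    _ = ENNReal.ofReal k * (ENNReal.ofReal ((k ^ (n + 1))⁻¹) *
          ((2 * m : ℝ≥0∞) ^ n * ∫⁻ x in slab n P, f x)) := by
        rw [setLIntegral_comp_smul hk0 hm hS, h1]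
    _ ≤ ENNReal.ofReal k * (ENNReal.ofReal ((k ^ (n + 1))⁻¹) *
          ((2 * m : ℝ≥0∞) ^ n * (ENNReal.ofReal (P ^ n) * E))) := by gcongr
    _ = ENNReal.ofReal (k * (k ^ (n + 1))⁻¹ * (2 * m) ^ n * P ^ n) * E := by
        have : (2 * m : ℝ≥0∞) ^ n = ENNReal.ofReal ((2 * m) ^ n) := by
          rw [ENNReal.ofReal_pow (by positivity), ENNReal.ofReal_mul (by norm_num)]
          simp
        rw [this, ENNReal.ofReal_mul (by positivity), ENNReal.ofReal_mul (by positivity),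
          ENNReal.ofReal_mul (by positivity)]
        ring
    _ = E := by
        have : k * (k ^ (n + 1))⁻¹ * (2 * m) ^ n * P ^ n = 1 := by
          rw [mul_assoc, ← mul_pow, ← hk, pow_succ]
          field_simp
        rw [this]; simp

/-- The blow-down `k⁻¹ v (k x)` of a profile, with `k` an even multiple of the period, has on the
unit cube at most the energy and constraint per unit area of the profile. -/
theorem Profile.energy_scaled_le {W : Matrix (Fin d) (Fin (n + 1)) ℝ → ℝ≥0} (hW : Continuous W)
    {a : Fin d → ℝ} {ε lam P : ℝ} (hP : 0 < P) {E Γ : ℝ≥0∞}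
    {v : (Fin (n + 1) → ℝ) → Fin d → ℝ} (hv : Profile W a ε lam P E Γ v) {m : ℕ} (hm : 0 < m)
    {k : ℝ} (hk : k = 2 * m * P) :
    energy W (ε / k) (grad (scaled k v)) (hess (scaled k v)) (k * lam) ≤ E ∧
      ∫⁻ x in cube n, gden (k * lam) (scaled k v) x ≤ Γ := by
  have hk0 : 0 < k := by rw [hk]; positivity
  constructor
  · change ∫⁻ x in cube n, eden W (ε / k) (k * lam) (scaled k v) x ≤ E
    rw [lintegral_congr (eden_scaled W ε lam hk0 hv.smooth)]
    exact Per.setLIntegral_cube_le hP (hv.per.eden W ε lam) (measurable_eden hW ε lam hv.smooth)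
      hm hk hv.energy_le
  · rw [lintegral_congr (gden_scaled lam hk0 hv.smooth)]
    exact Per.setLIntegral_cube_le hP (hv.per.gden lam) (measurable_gden lam hv.smooth)
      hm hk hv.constraint_le

/-- Blow-downs of a profile are bounded together with their derivatives on the strip. -/
theorem Profile.isSobolevTwo_scaled {W : Matrix (Fin d) (Fin (n + 1)) ℝ → ℝ≥0}
    {a : Fin d → ℝ} {ε lam P : ℝ} (hP : 0 < P) {E Γ : ℝ≥0∞}
    {v : (Fin (n + 1) → ℝ) → Fin d → ℝ} (hv : Profile W a ε lam P E Γ v) {k : ℝ} (hk : 0 < k)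
    {U : Set (Fin (n + 1) → ℝ)} (hU : MeasurableSet U) (hUs : U ⊆ strip n) :
    IsSobolevTwo ∞ U (scaled k v) (grad (scaled k v)) (hess (scaled k v)) := by
  obtain ⟨K0, hK0, h0⟩ := hv.per.exists_bound hP hv.smooth.continuous (k / 2)
  obtain ⟨K1, hK1, h1⟩ := (Per.grad hv.per).comp matNorm |>.exists_bound hP
    (continuous_matNorm.comp hv.smooth.continuous_grad) (k / 2)
  obtain ⟨K2, hK2, h2⟩ := (Per.hess hv.per).comp hessNorm |>.exists_bound hP
    (continuous_hessNorm.comp hv.smooth.continuous_hess) (k / 2)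
  have hN : ∀ x ∈ U, |(k • x) (Fin.last n)| ≤ k / 2 := by
    intro x hx
    have h := hUs hx
    have h3 := h.1
    have h4 := h.2
    rw [Pi.smul_apply, smul_eq_mul, abs_le]
    constructor <;> nlinarith
  refine (hv.smooth.scaled k).isSobolevTwo_top (K := k⁻¹ * K0 + K1 + k * K2) hU ?_ ?_ ?_
  · intro x hx i
    have := (norm_le_pi_norm (v (k • x)) i).trans (h0 _ (hN x hx))
    rw [scaled, Pi.smul_apply, smul_eq_mul, abs_mul, abs_of_pos (inv_pos.2 hk), add_assoc]
    refine le_add_of_le_of_nonneg (mul_le_mul_of_nonneg_left this (inv_pos.2 hk).le) (by positivity)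
  · intro x hx i j
    have h3 := h1 _ (hN x hx)
    rw [Real.norm_of_nonneg (matNorm_nonneg _)] at h3
    rw [grad_scaled hk.ne' hv.smooth]
    have h4 := (abs_entry_le_matNorm _ i j).trans h3
    have : 0 ≤ k⁻¹ * K0 := by positivity
    have : 0 ≤ k * K2 := by positivity
    linarith
  · intro x hx i j l
    have h3 := h2 _ (hN x hx)
    rw [Real.norm_of_nonneg (hessNorm_nonneg _)] at h3
    rw [hess_scaled hk.ne' hv.smooth, abs_mul, abs_of_pos hk]
    have h4 := mul_le_mul_of_nonneg_left ((abs_entry_le_hessNorm _ i j l).trans h3) hk.le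
    have : 0 ≤ k⁻¹ * K0 := by positivity
    linarith

theorem cube_subset_strip : cube n ⊆ strip n := fun _ hx => hx (Fin.last n)

theorem grad_of_eventually_affine {v : (Fin (n + 1) → ℝ) → Fin d → ℝ} {x : Fin (n + 1) → ℝ}
    {a c : Fin d → ℝ} {s : ℝ} (h : v =ᶠ[𝓝 x] fun y => (s * y (Fin.last n)) • a + c) :
    grad v x = s • well n a ∧ hess v x = fun _ _ _ => 0 := by
  have hs : ContDiff ℝ ∞ fun t : ℝ => s * t := by fun_prop
  have h1 : v =ᶠ[𝓝 x] fun y => coordMap (Fin.last n) (fun t => s * t) a y +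
    coordMap (Fin.last n) (fun _ => 1) c y := by
    filter_upwards [h] with y hy
    rw [hy]; simp [coordMap]
  have hd : deriv (fun t : ℝ => s * t) = fun _ => s := by
    funext t; simp
  have hsm := smooth_coordMap (n := n) hs (Fin.last n) a
  have hsm' := smooth_coordMap (n := n) (g := fun _ => 1) contDiff_const (Fin.last n) c
  constructor
  · rw [grad_congr h1, grad_add hsm hsm', grad_coordMap hs, grad_coordMap contDiff_const, hd]
    funext i j
    change (if j = Fin.last n then s * a i else 0) +
      (if j = Fin.last n then deriv (fun _ => (1 : ℝ)) (x (Fin.last n)) * c i else 0) = _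
    simp [well, Matrix.vecMulVec_apply, Pi.single_apply]
  · rw [hess_congr h1, hess_add hsm hsm', hess_coordMap hs, hess_coordMap contDiff_const, hd]
    funext i j k
    simp

theorem eventually_lt_last {x : Fin (n + 1) → ℝ} {h : ℝ} (hx : h < x (Fin.last n)) :
    ∀ᶠ y in 𝓝 x, h < y (Fin.last n) :=
  (continuous_apply (Fin.last n)).continuousAt.eventually (lt_mem_nhds hx)

theorem eventually_last_lt {x : Fin (n + 1) → ℝ} {h : ℝ} (hx : x (Fin.last n) < h) :
    ∀ᶠ y in 𝓝 x, y (Fin.last n) < h :=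
  (continuous_apply (Fin.last n)).continuousAt.eventually (gt_mem_nhds hx)

/-- A blow-down of a profile, by a factor large enough for the layer to fit into the strip, is
admissible in the definition of `PhiPTilde`. -/
theorem Profile.phiPTilde_le {W : Matrix (Fin d) (Fin (n + 1)) ℝ → ℝ≥0} (hW : Continuous W)
    {a : Fin d → ℝ} {ε lam P Γ : ℝ} (hε : 0 < ε) (hlam : lam ≤ 0) (hP : 0 < P) {E : ℝ≥0∞}
    {v : (Fin (n + 1) → ℝ) → Fin d → ℝ} (hv : Profile W a ε lam P E (ENNReal.ofReal Γ) v) :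
    PhiPTilde W a Γ ≤ E := by
  obtain ⟨h, cp, cm, hh, hfar⟩ := hv.far
  obtain ⟨m, hm⟩ := exists_nat_gt ((2 * h + 1) / P)
  rw [div_lt_iff₀ hP] at hm
  have hmP : 0 < m * P := by linarith
  have hm0 : 0 < m := by
    rcases Nat.eq_zero_or_pos m with h0 | h0
    · rw [h0] at hmP; simp at hmP
    · exact h0
  set k : ℝ := 2 * m * P with hk
  have hk0 : 0 < k := by rw [hk]; linarith
  have hE := hv.energy_scaled_le hW hP hm0 hk
  refine le_trans (b := energy W (1 / (k / ε)) (grad (scaled k v)) (hess (scaled k v)) (k * lam))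
    ?_ (by simpa using hE.1)
  unfold PhiPTilde
  refine sInf_le ⟨k / ε, scaled k v, grad (scaled k v), hess (scaled k v), k * lam,
    by positivity, hv.isSobolevTwo_scaled hP hk0 measurableSet_strip subset_rfl, ?_, ?_, ?_, rfl⟩
  · intro j x
    have := hv.per (Pi.single j ((2 * m : ℕ) : ℤ)) (k • x)
    rw [scaled, scaled, ← this, smul_add]
    congr 3
    funext l
    refine Fin.lastCases ?_ (fun i => ?_) l
    · simp [Pi.single_apply, (Fin.castSucc_ne_last j).symm]
    · by_cases hij : i = j
      · subst hij; simp [hk]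
      · simp [hij]
  · refine ⟨1 / 4, by norm_num, ae_of_all _ fun x => ⟨fun hx => ?_, fun hx => ?_⟩⟩
    · rw [grad_scaled hk0.ne' hv.smooth]
      have hx' : h < (k • x) (Fin.last n) := by
        rw [Pi.smul_apply, smul_eq_mul]; nlinarith
      have := (grad_of_eventually_affine (v := v) (x := k • x) (a := a) (c := cp) (s := 1) (by
        filter_upwards [eventually_lt_last hx'] with y hy
        rw [(hfar y).1 hy.le, one_mul])).1
      rw [this, one_smul]
    · rw [grad_scaled hk0.ne' hv.smooth]
      have hx' : (k • x) (Fin.last n) < -h := by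
        rw [Pi.smul_apply, smul_eq_mul]; nlinarith
      have := (grad_of_eventually_affine (v := v) (x := k • x) (a := a) (c := cm) (s := -1) (by
        filter_upwards [eventually_last_lt hx'] with y hy
        rw [(hfar y).2 hy.le]
        simp)).1
      rw [this, neg_one_smul]
  · exact ⟨(hv.isSobolevTwo_scaled hP hk0 measurableSet_cube cube_subset_strip).two_of_top
      (by rw [volume_cube]; simp), mul_nonpos_of_nonneg_of_nonpos hk0.le hlam, hE.2⟩

/-- A profile stays at bounded distance from `|x_N| a`, so its blow-downs converge to `|x_N| a`
uniformly. -/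
theorem Profile.exists_bound_sub {W : Matrix (Fin d) (Fin (n + 1)) ℝ → ℝ≥0}
    {a : Fin d → ℝ} {ε lam P : ℝ} (hP : 0 < P) {E Γ : ℝ≥0∞}
    {v : (Fin (n + 1) → ℝ) → Fin d → ℝ} (hv : Profile W a ε lam P E Γ v) :
    ∃ K, ∀ x, ‖v x - |x (Fin.last n)| • a‖ ≤ K := by
  obtain ⟨h, cp, cm, hh, hfar⟩ := hv.far
  have hper : Per P fun x => v x - |x (Fin.last n)| • a := by
    intro k x
    simp [hv.per k x]
  obtain ⟨K, hK, hb⟩ := hper.exists_bound hP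
    (hv.smooth.continuous.sub (by fun_prop)) h
  refine ⟨max K (max ‖cp‖ ‖cm‖), fun x => ?_⟩
  rcases le_or_gt |x (Fin.last n)| h with hx | hx
  · exact (hb x hx).trans (le_max_left _ _)
  · rcases lt_abs.1 hx with h1 | h1
    · rw [(hfar x).1 h1.le, abs_of_pos (hh.trans h1), add_sub_cancel_left]
      exact (le_max_left _ _).trans (le_max_right _ _)
    · rw [(hfar x).2 (by linarith), abs_of_neg (by linarith), add_sub_cancel_left]
      exact (le_max_right _ _).trans (le_max_right _ _)

/-- The sequence of all blow-downs of a profile is admissible in the definition of `PhiTilde`. -/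
theorem Profile.phiTilde_le {W : Matrix (Fin d) (Fin (n + 1)) ℝ → ℝ≥0} (hW : Continuous W)
    {a : Fin d → ℝ} {ε lam P Γ : ℝ} (hε : 0 < ε) (hlam : lam ≤ 0) (hP : 0 < P) {E : ℝ≥0∞}
    {v : (Fin (n + 1) → ℝ) → Fin d → ℝ} (hv : Profile W a ε lam P E (ENNReal.ofReal Γ) v) :
    PhiTilde W a Γ ≤ E := by
  obtain ⟨K, hK⟩ := hv.exists_bound_sub hP
  let k : ℕ → ℝ := fun h => 2 * ((h + 1 : ℕ) : ℝ) * P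
  have hk0 : ∀ h, 0 < k h := fun h => by simp only [k]; positivity
  have hE : ∀ h, _ := fun h => hv.energy_scaled_le hW hP (m := h + 1) h.succ_pos (k := k h) rfl
  have hkt : Tendsto k atTop atTop := by
    have h1 : Tendsto (fun h : ℕ => ((h + 1 : ℕ) : ℝ)) atTop atTop :=
      tendsto_natCast_atTop_atTop.comp (tendsto_add_atTop_nat 1)
    exact (h1.const_mul_atTop two_pos).atTop_mul_const hP
  refine le_trans (b := liminf (fun h => energy W (ε / k h) (grad (scaled (k h) v))
    (hess (scaled (k h) v)) (k h * lam)) atTop) ?_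
    ((liminf_le_liminf (Eventually.of_forall fun h => (hE h).1)).trans (by simp))
  unfold PhiTilde
  refine sInf_le ⟨fun h => ε / k h, fun h => scaled (k h) v, fun h => grad (scaled (k h) v),
    fun h => hess (scaled (k h) v), fun h => k h * lam, fun h => div_pos hε (hk0 h),
    hkt.const_div_atTop ε, fun h => ⟨?_, mul_nonpos_of_nonneg_of_nonpos (hk0 h).le hlam,
      (hE h).2⟩, ?_, rfl⟩
  · exact (hv.isSobolevTwo_scaled hP (hk0 h) measurableSet_cube cube_subset_strip).two_of_top
      (by rw [volume_cube]; simp)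
  · have hb : ∀ h x, ‖scaled (k h) v x - |x (Fin.last n)| • a‖ ≤ K / k h := by
      intro h x
      have h1 : scaled (k h) v x - |x (Fin.last n)| • a =
          (k h)⁻¹ • (v (k h • x) - |(k h • x) (Fin.last n)| • a) := by
        rw [Pi.smul_apply, smul_eq_mul, abs_mul, abs_of_pos (hk0 h), smul_sub, smul_smul,
          ← mul_assoc, inv_mul_cancel₀ (hk0 h).ne', one_mul]
        rfl
      rw [h1, norm_smul, norm_inv, Real.norm_of_nonneg (hk0 h).le, div_eq_inv_mul]
      exact mul_le_mul_of_nonneg_left (hK _) (inv_nonneg.2 (hk0 h).le)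
    have hle : ∀ h, eLpNorm (fun x => scaled (k h) v x - |x (Fin.last n)| • a) 1
        (volume.restrict (cube n)) ≤ ENNReal.ofReal (K / k h) := by
      intro h
      refine (eLpNorm_le_of_ae_bound (ae_of_all _ (hb h))).trans ?_
      simp [volume_cube]
    refine tendsto_of_tendsto_of_tendsto_of_le_of_le tendsto_const_nhds ?_ (fun _ => zero_le) hle
    have := ENNReal.tendsto_ofReal (hkt.const_div_atTop K)
    simpa using this

end Profiles

/-! ### One-dimensional cutoffs -/

section Cutoffs

theorem exists_bound_deriv_smoothTransition :
    ∃ K : ℝ, 1 ≤ K ∧ ∀ t, |deriv Real.smoothTransition t| ≤ K ∧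
      |deriv (deriv Real.smoothTransition) t| ≤ K := by
  have h0 : ContDiff ℝ ∞ Real.smoothTransition := Real.smoothTransition.contDiff
  have h1 := contDiff_deriv h0
  have h2 := contDiff_deriv h1
  have hlo : ∀ t < 0, Real.smoothTransition =ᶠ[𝓝 t] fun _ => 0 := fun t ht => by
    filter_upwards [gt_mem_nhds ht] with s hs using Real.smoothTransition.zero_of_nonpos hs.le
  have hhi : ∀ t > 1, Real.smoothTransition =ᶠ[𝓝 t] fun _ => 1 := fun t ht => by
    filter_upwards [lt_mem_nhds ht] with s hs using Real.smoothTransition.one_of_one_le hs.le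
  obtain ⟨K1, hK1⟩ := (isCompact_Icc (a := (0 : ℝ)) (b := 1)).exists_bound_of_continuousOn
    h1.continuous.continuousOn
  obtain ⟨K2, hK2⟩ := (isCompact_Icc (a := (0 : ℝ)) (b := 1)).exists_bound_of_continuousOn
    h2.continuous.continuousOn
  refine ⟨max 1 (max K1 K2), le_max_left _ _, fun t => ?_⟩
  by_cases ht : t ∈ Set.Icc (0 : ℝ) 1
  · exact ⟨(hK1 t ht).trans ((le_max_left _ _).trans (le_max_right _ _)),
      (hK2 t ht).trans ((le_max_right _ _).trans (le_max_right _ _))⟩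
  · have hd : deriv Real.smoothTransition =ᶠ[𝓝 t] fun _ => 0 := by
      rw [Set.mem_Icc, not_and_or, not_le, not_le] at ht
      rcases ht with ht | ht
      · exact (hlo t ht).deriv.trans (by simp)
      · exact (hhi t ht).deriv.trans (by simp)
    rw [hd.deriv_eq, hd.eq_of_nhds]
    simp

/-- An odd smooth approximation of the sign function, exact outside `(-η, η)`. -/
def smoothSign (η t : ℝ) : ℝ := 2 * Real.smoothTransition ((t / η + 1) / 2) - 1

theorem contDiff_smoothSign (η : ℝ) : ContDiff ℝ ∞ (smoothSign η) :=
  (contDiff_const.mul (Real.smoothTransition.contDiff.comp (by fun_prop))).sub contDiff_const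

theorem abs_smoothSign_le (η t : ℝ) : |smoothSign η t| ≤ 1 := by
  have h1 := Real.smoothTransition.nonneg ((t / η + 1) / 2)
  have h2 := Real.smoothTransition.le_one ((t / η + 1) / 2)
  rw [smoothSign, abs_le]
  constructor <;> linarith

theorem smoothSign_of_ge {η t : ℝ} (hη : 0 < η) (h : η ≤ t) : smoothSign η t = 1 := by
  have : 1 ≤ t / η := by rwa [le_div_iff₀ hη, one_mul]
  rw [smoothSign, Real.smoothTransition.one_of_one_le (by linarith)]
  norm_num

theorem smoothSign_of_le {η t : ℝ} (hη : 0 < η) (h : t ≤ -η) : smoothSign η t = -1 := by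
  have : t / η ≤ -1 := by rw [div_le_iff₀ hη]; linarith
  rw [smoothSign, Real.smoothTransition.zero_of_nonpos (by linarith)]
  norm_num

theorem smoothTransition_one_sub (t : ℝ) :
    Real.smoothTransition (1 - t) = 1 - Real.smoothTransition t := by
  have h1 := (Real.smoothTransition.pos_denom t).ne'
  have h2 := (Real.smoothTransition.pos_denom (1 - t)).ne'
  rw [Real.smoothTransition, Real.smoothTransition]
  rw [sub_sub_cancel] at h2 ⊢
  field_simp
  ring

theorem smoothSign_neg (η t : ℝ) : smoothSign η (-t) = -smoothSign η t := by
  have : (-t / η + 1) / 2 = 1 - (t / η + 1) / 2 := by ring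
  rw [smoothSign, this, smoothTransition_one_sub, smoothSign]
  ring

/-- A smoothed square wave of period `2 r`, equal to `±1` off `kink η r`. -/
def wave (η r t : ℝ) : ℝ := smoothSign η (Real.sin (Real.pi * (r⁻¹ * t)))

theorem contDiff_wave (η r : ℝ) : ContDiff ℝ ∞ (wave η r) :=
  (contDiff_smoothSign η).comp (Real.contDiff_sin.comp (by fun_prop))

theorem abs_wave_le (η r t : ℝ) : |wave η r t| ≤ 1 := abs_smoothSign_le _ _

theorem wave_neg (η r t : ℝ) : wave η r (-t) = -wave η r t := by
  rw [wave, mul_neg, mul_neg, Real.sin_neg, smoothSign_neg, wave]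

theorem wave_periodic (η : ℝ) {r : ℝ} (hr : r ≠ 0) : Function.Periodic (wave η r) (2 * r) := by
  intro t
  have : Real.pi * (r⁻¹ * (t + 2 * r)) = Real.pi * (r⁻¹ * t) + 2 * Real.pi := by
    field_simp
  rw [wave, this, Real.sin_add_two_pi, wave]

/-- The set where the square wave is smoothed. -/
def kink (η r : ℝ) : Set ℝ := {t | |Real.sin (Real.pi * (r⁻¹ * t))| ≤ η}

theorem isClosed_kink (η r : ℝ) : IsClosed (kink η r) :=
  isClosed_le (by fun_prop) continuous_const

theorem wave_eventually_const {η r t : ℝ} (hη : 0 < η) (ht : t ∉ kink η r) :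
    ∃ c : ℝ, (c = 1 ∨ c = -1) ∧ wave η r =ᶠ[𝓝 t] fun _ => c := by
  have hc : Continuous fun t => Real.sin (Real.pi * (r⁻¹ * t)) := by fun_prop
  have ht' : η < |Real.sin (Real.pi * (r⁻¹ * t))| := not_le.1 ht
  rcases lt_abs.1 ht' with h | h
  · refine ⟨1, Or.inl rfl, ?_⟩
    filter_upwards [hc.continuousAt.eventually (lt_mem_nhds h)] with s hs
    exact smoothSign_of_ge hη hs.le
  · refine ⟨-1, Or.inr rfl, ?_⟩
    filter_upwards [hc.continuousAt.eventually (gt_mem_nhds (lt_neg_of_lt_neg h))] with s hs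
    exact smoothSign_of_le hη hs.le

theorem wave_of_notMem_kink {η r t : ℝ} (hη : 0 < η) (ht : t ∉ kink η r) :
    (wave η r t = 1 ∨ wave η r t = -1) ∧ deriv (wave η r) t = 0 := by
  obtain ⟨c, hc, h⟩ := wave_eventually_const hη ht
  rw [h.eq_of_nhds, h.deriv_eq]
  simpa using hc

theorem exists_bound_of_periodic {f : ℝ → ℝ} (hf : Continuous f) {c : ℝ} (hc : 0 < c)
    (hp : Function.Periodic f c) : ∃ K : ℝ, 0 ≤ K ∧ ∀ t, |f t| ≤ K := by
  obtain ⟨K, hK⟩ := (isCompact_Icc (a := (0 : ℝ)) (b := c)).exists_bound_of_continuousOn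
    hf.continuousOn
  refine ⟨max K 0, le_max_right _ _, fun t => ?_⟩
  obtain ⟨s, hs, hst⟩ := hp.exists_mem_Ico₀ hc t
  rw [hst]
  exact (hK s ⟨hs.1, hs.2.le⟩).trans (le_max_left _ _)

theorem periodic_deriv {f : ℝ → ℝ} {c : ℝ} (hp : Function.Periodic f c) :
    Function.Periodic (deriv f) c := by
  intro t
  rw [← deriv_comp_add_const]
  congr 1
  funext s
  exact hp s

theorem exists_bound_deriv_wave (η : ℝ) :
    ∃ K : ℝ, 0 ≤ K ∧ ∀ r > 0, ∀ t, |deriv (wave η r) t| ≤ K / r ∧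
      |deriv (deriv (wave η r)) t| ≤ K / r ^ 2 := by
  have hp := wave_periodic η one_ne_zero
  obtain ⟨K1, hK1, h1⟩ := exists_bound_of_periodic (contDiff_deriv (contDiff_wave η 1)).continuous
    (by norm_num) (periodic_deriv hp)
  obtain ⟨K2, hK2, h2⟩ := exists_bound_of_periodic
    (contDiff_deriv (contDiff_deriv (contDiff_wave η 1))).continuous
    (by norm_num) (periodic_deriv (periodic_deriv hp))
  refine ⟨K1 + K2, by positivity, fun r hr t => ?_⟩
  have e0 : wave η r = fun t => wave η 1 (r⁻¹ * t) := by
    funext t; simp [wave]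
  have e1 : deriv (wave η r) = fun t => r⁻¹ * deriv (wave η 1) (r⁻¹ * t) := by
    funext t; rw [e0, deriv_comp_mul_left, smul_eq_mul]
  have e2 : deriv (deriv (wave η r)) t = r⁻¹ * (r⁻¹ * deriv (deriv (wave η 1)) (r⁻¹ * t)) := by
    rw [e1, deriv_const_mul_field, deriv_comp_mul_left, smul_eq_mul]
  have hr' : 0 < r⁻¹ := inv_pos.2 hr
  constructor
  · rw [e1, abs_mul, abs_of_pos hr', div_eq_inv_mul]
    gcongr
    exact (h1 _).trans (by linarith)
  · rw [e2, abs_mul, abs_mul, abs_of_pos hr', ← mul_assoc, ← sq, div_eq_inv_mul, inv_pow]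
    gcongr
    exact (h2 _).trans (by linarith)

/-- A rounded triangle wave of period `2 r`, with slope `±1` outside `kink η r`. -/
def tent (η r t : ℝ) : ℝ := ∫ s in (0 : ℝ)..t, wave η r s

theorem hasDerivAt_tent (η r t : ℝ) : HasDerivAt (tent η r) (wave η r t) t :=
  intervalIntegral.integral_hasDerivAt_right ((contDiff_wave η r).continuous.intervalIntegrable _ _)
    ((contDiff_wave η r).continuous.stronglyMeasurableAtFilter _ _)
    (contDiff_wave η r).continuous.continuousAt

theorem deriv_tent (η r : ℝ) : deriv (tent η r) = wave η r :=
  funext fun t => (hasDerivAt_tent η r t).deriv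

theorem contDiff_tent (η r : ℝ) : ContDiff ℝ ∞ (tent η r) := by
  rw [contDiff_infty_iff_deriv, deriv_tent]
  exact ⟨fun t => (hasDerivAt_tent η r t).differentiableAt, contDiff_wave η r⟩

theorem tent_periodic (η : ℝ) {r : ℝ} (hr : r ≠ 0) : Function.Periodic (tent η r) (2 * r) := by
  intro t
  have hi : ∀ x y, IntervalIntegrable (wave η r) volume x y := fun x y =>
    (contDiff_wave η r).continuous.intervalIntegrable _ _
  have h1 := intervalIntegral.integral_add_adjacent_intervals (hi 0 t) (hi t (t + 2 * r))
  have h2 := (wave_periodic η hr).intervalIntegral_add_eq t (-r)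
  have h3 : ∫ s in (-r)..r, wave η r s = -∫ s in (-r)..r, wave η r s := by
    conv_lhs => rw [← neg_neg r, ← intervalIntegral.integral_comp_neg, neg_neg]
    rw [← intervalIntegral.integral_neg]
    simp [wave_neg]
  have h4 : -r + 2 * r = r := by ring
  rw [h4] at h2
  rw [tent, ← h1, h2, tent]
  linarith

theorem abs_tent_le (η : ℝ) {r : ℝ} (hr : 0 < r) (t : ℝ) : |tent η r t| ≤ r := by
  obtain ⟨s, hs, hst⟩ := (tent_periodic η hr.ne').exists_mem_Ico (by linarith : 0 < 2 * r) t (-r)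
  rw [hst]
  have h := intervalIntegral.norm_integral_le_of_norm_le_const (a := 0) (b := s) (C := 1)
    (f := wave η r) fun x _ => abs_wave_le η r x
  rw [Real.norm_eq_abs] at h
  refine h.trans ?_
  rw [sub_zero, one_mul, abs_le]
  constructor <;> linarith [hs.1, hs.2]

/-- The kinks occupy an arbitrarily small fraction of a period, uniformly in the period. -/
theorem exists_kink_small {δ : ℝ} (hδ : 0 < δ) :
    ∃ η : ℝ, 0 < η ∧ ∀ r > 0, volume (kink η r ∩ Set.Ioc 0 (2 * r)) ≤ ENNReal.ofReal (δ * r) := by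
  have hm : ∀ k : ℕ, NullMeasurableSet (kink (1 / ((k : ℝ) + 1)) 1 ∩ Set.Ioc 0 2) volume :=
    fun k => ((isClosed_kink _ _).measurableSet.inter measurableSet_Ioc).nullMeasurableSet
  have hanti : Antitone fun k : ℕ => kink (1 / ((k : ℝ) + 1)) 1 ∩ Set.Ioc 0 2 := by
    intro k l hkl t ht
    refine ⟨?_, ht.2⟩
    have h1 : |Real.sin (Real.pi * ((1 : ℝ)⁻¹ * t))| ≤ 1 / ((l : ℝ) + 1) := ht.1
    refine h1.trans ?_
    exact one_div_le_one_div_of_le (by positivity) (by gcongr)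
  have hlim := tendsto_measure_iInter_atTop hm hanti
    ⟨0, ne_top_of_le_ne_top (by simp) (measure_mono Set.inter_subset_right)⟩
  have hnull : volume (⋂ k : ℕ, kink (1 / ((k : ℝ) + 1)) 1 ∩ Set.Ioc 0 2) = 0 := by
    refine measure_mono_null (t := {1, 2}) ?_ (by
      exact (Set.toFinite ({1, 2} : Set ℝ)).measure_zero volume)
    intro t ht
    rw [Set.mem_iInter] at ht
    have h0 : Real.sin (Real.pi * t) = 0 := by
      have h1 : ∀ k : ℕ, |Real.sin (Real.pi * t)| ≤ 1 / ((k : ℝ) + 1) := fun k => by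
        have : |Real.sin (Real.pi * ((1 : ℝ)⁻¹ * t))| ≤ 1 / ((k : ℝ) + 1) := (ht k).1
        simpa using this
      exact abs_nonpos_iff.1
        (ge_of_tendsto' (tendsto_one_div_add_atTop_nhds_zero_nat (𝕜 := ℝ)) h1)
    obtain ⟨z, hz⟩ := Real.sin_eq_zero_iff.1 h0
    have hzt : (z : ℝ) = t := by
      have := Real.pi_ne_zero
      rw [mul_comm] at hz
      exact mul_left_cancel₀ this hz
    have h2 := (ht 0).2
    rw [← hzt] at h2 ⊢
    have h3 : 0 < z := by exact_mod_cast h2.1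
    have h4 : z ≤ 2 := by exact_mod_cast h2.2
    have h5 : z = 1 ∨ z = 2 := by omega
    rcases h5 with rfl | rfl <;> simp
  rw [hnull] at hlim
  obtain ⟨k, hk⟩ := (hlim.eventually
    (gt_mem_nhds (show (0 : ℝ≥0∞) < ENNReal.ofReal δ by simpa using hδ))).exists
  refine ⟨1 / ((k : ℝ) + 1), by positivity, fun r hr => ?_⟩
  -- the general period follows from `r = 1` by scaling
  have hpre : kink (1 / ((k : ℝ) + 1)) r ∩ Set.Ioc 0 (2 * r) =
      (r⁻¹ * ·) ⁻¹' (kink (1 / ((k : ℝ) + 1)) 1 ∩ Set.Ioc 0 2) := by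
    ext t
    have e1 : 0 < t ↔ 0 < r⁻¹ * t := by
      rw [mul_pos_iff_of_pos_left (inv_pos.2 hr)]
    have e2 : t ≤ 2 * r ↔ r⁻¹ * t ≤ 2 := by
      rw [inv_mul_le_iff₀ hr, mul_comm]
    simp only [kink, Set.mem_inter_iff, Set.mem_preimage, Set.mem_ofPred_eq, Set.mem_Ioc, e1, e2,
      inv_one, one_mul]
  rw [hpre, Real.volume_preimage_mul_left (inv_pos.2 hr).ne', inv_inv, abs_of_pos hr, mul_comm δ,
    ENNReal.ofReal_mul hr.le]
  gcongr
  exact hk.le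

/-- The primitive, vanishing for `t ≤ 0`, of a smooth transition from `0` to `1` on `(0, 2 ε)`. -/
def drop (ε t : ℝ) : ℝ := ∫ s in (0 : ℝ)..t, Real.smoothTransition ((2 * ε)⁻¹ * s)

theorem hasDerivAt_drop (ε t : ℝ) :
    HasDerivAt (drop ε) (Real.smoothTransition ((2 * ε)⁻¹ * t)) t := by
  have hc : Continuous fun s => Real.smoothTransition ((2 * ε)⁻¹ * s) :=
    Real.smoothTransition.continuous.comp (by fun_prop)
  exact intervalIntegral.integral_hasDerivAt_right (hc.intervalIntegrable _ _)
    (hc.stronglyMeasurableAtFilter _ _) hc.continuousAt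

theorem deriv_drop (ε : ℝ) : deriv (drop ε) = fun t => Real.smoothTransition ((2 * ε)⁻¹ * t) :=
  funext fun t => (hasDerivAt_drop ε t).deriv

theorem contDiff_drop (ε : ℝ) : ContDiff ℝ ∞ (drop ε) := by
  rw [contDiff_infty_iff_deriv, deriv_drop]
  exact ⟨fun t => (hasDerivAt_drop ε t).differentiableAt,
    Real.smoothTransition.contDiff.comp (by fun_prop)⟩

theorem drop_of_nonpos {ε t : ℝ} (hε : 0 < ε) (ht : t ≤ 0) : drop ε t = 0 := by
  rw [drop, intervalIntegral.integral_symm, neg_eq_zero]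
  refine (intervalIntegral.integral_congr fun s hs => ?_).trans intervalIntegral.integral_zero
  rw [Set.uIcc_of_le ht] at hs
  exact Real.smoothTransition.zero_of_nonpos (mul_nonpos_of_nonneg_of_nonpos (by positivity) hs.2)

theorem sub_drop_of_ge {ε t : ℝ} (hε : 0 < ε) (ht : 2 * ε ≤ t) :
    t - drop ε t = 2 * ε - drop ε (2 * ε) := by
  have hd : ∀ t, HasDerivAt (fun t => t - drop ε t)
      (1 - Real.smoothTransition ((2 * ε)⁻¹ * t)) t := fun t =>
    (hasDerivAt_id t).sub (hasDerivAt_drop ε t)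
  have hge : ∀ s ∈ Set.Icc (2 * ε) t, s - drop ε s = 2 * ε - drop ε (2 * ε) := by
    refine constant_of_derivWithin_zero
      (fun s _ => (hd s).differentiableAt.differentiableWithinAt) fun s hs => ?_
    rw [(hd s).hasDerivWithinAt.derivWithin
        ((uniqueDiffOn_Icc (hs.1.trans_lt hs.2)) s ⟨hs.1, hs.2.le⟩),
      Real.smoothTransition.one_of_one_le, sub_self]
    rw [inv_mul_eq_div, le_div_iff₀ (by positivity), one_mul]
    exact hs.1
  exact hge t ⟨ht, le_rfl⟩

theorem sub_drop_mem {ε t : ℝ} (hε : 0 < ε) (ht : 0 ≤ t) :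
    t - drop ε t ∈ Set.Icc 0 (2 * ε) := by
  have hd : ∀ t, HasDerivAt (fun t => t - drop ε t)
      (1 - Real.smoothTransition ((2 * ε)⁻¹ * t)) t := fun t =>
    (hasDerivAt_id t).sub (hasDerivAt_drop ε t)
  have hmono : Monotone fun t => t - drop ε t :=
    monotone_of_deriv_nonneg (fun t => (hd t).differentiableAt) fun t => by
      rw [(hd t).deriv]
      linarith [Real.smoothTransition.le_one ((2 * ε)⁻¹ * t)]
  have hmono' : Monotone (drop ε) :=
    monotone_of_deriv_nonneg (fun t => (hasDerivAt_drop ε t).differentiableAt) fun t => by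
      rw [deriv_drop]
      exact Real.smoothTransition.nonneg _
  have h0 : drop ε 0 = 0 := drop_of_nonpos hε le_rfl
  constructor
  · have := hmono ht
    simpa [h0] using this
  · rcases le_total t (2 * ε) with h | h
    · have := hmono' ht
      rw [h0] at this
      linarith
    · rw [sub_drop_of_ge hε h]
      have := hmono' (show (0 : ℝ) ≤ 2 * ε by positivity)
      rw [h0] at this
      linarith

theorem exists_bound_deriv_drop :
    ∃ K : ℝ, 0 ≤ K ∧ ∀ ε > 0, ∀ t, |deriv (deriv (drop ε)) t| ≤ K / ε := by
  obtain ⟨K, hK1, hK⟩ := exists_bound_deriv_smoothTransition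
  refine ⟨K, by linarith, fun ε hε t => ?_⟩
  rw [deriv_drop, deriv_comp_mul_left, smul_eq_mul, abs_mul, abs_of_pos (by positivity),
    div_eq_inv_mul]
  refine mul_le_mul ?_ (hK _).1 (abs_nonneg _) (by positivity)
  exact inv_anti₀ hε (by linarith)

end Cutoffs

/-! ### Attainable pairs of energy and constraint form a convex set -/

section Mixing

variable {d n : ℕ}

theorem volume_box (B : Fin n → Set ℝ) (T : Set ℝ) :
    volume {x : Fin (n + 1) → ℝ | (∀ j : Fin n, x j.castSucc ∈ B j) ∧ x (Fin.last n) ∈ T} =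
      (∏ j, volume (B j)) * volume T := by
  have : {x : Fin (n + 1) → ℝ | (∀ j : Fin n, x j.castSucc ∈ B j) ∧ x (Fin.last n) ∈ T} =
      Set.pi Set.univ (Fin.lastCases (motive := fun _ => Set ℝ) T B) := by
    ext x
    simp [Set.mem_pi, Fin.forall_fin_succ', Fin.lastCases_castSucc, Fin.lastCases_last]
  rw [this, volume_pi_pi, Fin.prod_univ_castSucc]
  simp

theorem volume_slab_inter {P : ℝ} (T : Set ℝ) :
    volume (slab n P ∩ {x | x (Fin.last n) ∈ T}) = ENNReal.ofReal P ^ n * volume T := by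
  have h := volume_box (fun _ : Fin n => Set.Ioc 0 P) T
  rw [Finset.prod_const, Real.volume_Ioc, sub_zero, Finset.card_univ, Fintype.card_fin] at h
  rw [← h]
  rfl

/-- Points of a period cell with one coordinate in a set of relative length at most `δ`. -/
theorem volume_slab_inter_kink_le {P δ : ℝ} (hδ : 0 ≤ δ) (j₀ : Fin n) {B T : Set ℝ}
    (hB : volume (B ∩ Set.Ioc 0 P) ≤ ENNReal.ofReal (δ * P)) :
    volume (slab n P ∩ {x | x j₀.castSucc ∈ B ∧ x (Fin.last n) ∈ T}) ≤
      ENNReal.ofReal δ * ENNReal.ofReal P ^ n * volume T := by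
  classical
  have h := volume_box (fun j : Fin n => if j = j₀ then B ∩ Set.Ioc 0 P else Set.Ioc 0 P) T
  have hsub : slab n P ∩ {x | x j₀.castSucc ∈ B ∧ x (Fin.last n) ∈ T} ⊆
      {x : Fin (n + 1) → ℝ | (∀ j : Fin n, x j.castSucc ∈
        (if j = j₀ then B ∩ Set.Ioc 0 P else Set.Ioc 0 P)) ∧ x (Fin.last n) ∈ T} := by
    rintro x ⟨h1, h2, h3⟩
    refine ⟨fun j => ?_, h3⟩
    split_ifs with hj
    · subst hj; exact ⟨h2, h1 j⟩
    · exact h1 j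
  refine (measure_mono hsub).trans ?_
  rw [h]
  gcongr
  calc ∏ j, volume (if j = j₀ then B ∩ Set.Ioc 0 P else Set.Ioc 0 P)
      ≤ ∏ j : Fin n, (if j = j₀ then ENNReal.ofReal δ else 1) * ENNReal.ofReal P := by
        refine Finset.prod_le_prod' fun j _ => ?_
        split_ifs
        · rwa [← ENNReal.ofReal_mul hδ]
        · simp
    _ = _ := by rw [Finset.prod_mul_distrib]; simp

theorem Comparable.le_of_left {W : Matrix (Fin d) (Fin (n + 1)) ℝ → ℝ≥0} {a : Fin d → ℝ}
    {p C : ℝ} (hp : 2 ≤ p) (hW : Comparable W a p C) {s : ℝ} (hs : s = 1 ∨ s = -1)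
    (ξ : Matrix (Fin d) (Fin (n + 1)) ℝ) :
    (W ξ : ℝ) ≤ C * matNorm (ξ - s • well n a) ^ p := by
  have hC := hW.one_le
  refine (hW.upper ξ).trans ?_
  gcongr
  · exact wellDist_nonneg a ξ
  · rcases hs with rfl | rfl
    · rw [one_smul]; exact min_le_left _ _
    · rw [neg_one_smul]; exact min_le_right _ _

theorem hessNorm_last (s : ℝ) (c : Fin d → ℝ) :
    hessNorm (fun i (j k : Fin (n + 1)) => if j = Fin.last n ∧ k = Fin.last n then s * c i else 0) =
      |s| * matNorm (well n c) := by
  have h1 : ∀ i, ∑ j : Fin (n + 1), ∑ k : Fin (n + 1),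
      (if j = Fin.last n ∧ k = Fin.last n then s * c i else 0) ^ 2 = s ^ 2 * c i ^ 2 := by
    intro i
    rw [Finset.sum_eq_single (Fin.last n), Finset.sum_eq_single (Fin.last n)]
    · simp [mul_pow]
    · intro k _ hk; simp [hk]
    · simp
    · intro j _ hj; simp [hj]
    · simp
  have h2 : ∀ i, ∑ j, well n c i j ^ 2 = c i ^ 2 := by
    intro i
    rw [Finset.sum_eq_single (Fin.last n)]
    · simp [well, Matrix.vecMulVec_apply]
    · intro k _ hk; simp [well, Matrix.vecMulVec_apply, hk]
    · simp
  rw [hessNorm, matNorm, Finset.sum_congr rfl fun i _ => h1 i, Finset.sum_congr rfl fun i _ => h2 i,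
    ← Finset.mul_sum, Real.sqrt_mul (sq_nonneg s), Real.sqrt_sq_eq_abs]

theorem matNorm_smul_well (s : ℝ) (c : Fin d → ℝ) :
    matNorm (s • well n c) = |s| * matNorm (well n c) := by
  have h1 : ∀ i, ∑ j, (s • well n c) i j ^ 2 = s ^ 2 * ∑ j, well n c i j ^ 2 := by
    intro i
    rw [Finset.mul_sum]
    refine Finset.sum_congr rfl fun j _ => ?_
    rw [Matrix.smul_apply, smul_eq_mul, mul_pow]
  rw [matNorm, matNorm, Finset.sum_congr rfl fun i _ => h1 i,
    ← Finset.mul_sum, Real.sqrt_mul (sq_nonneg s), Real.sqrt_sq_eq_abs]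

/-- Derivatives of a map that depends on `x_N` only near a point. -/
theorem grad_hess_of_eventually {v : (Fin (n + 1) → ℝ) → Fin d → ℝ} {x : Fin (n + 1) → ℝ}
    {a c : Fin d → ℝ} {s : ℝ} {g : ℝ → ℝ} (hg : ContDiff ℝ ∞ g)
    (h : v =ᶠ[𝓝 x] fun y => (s * y (Fin.last n)) • a + g (y (Fin.last n)) • c) :
    grad v x = s • well n a + deriv g (x (Fin.last n)) • well n c ∧
      hess v x = fun i j k => if j = Fin.last n ∧ k = Fin.last n then
        deriv (deriv g) (x (Fin.last n)) * c i else 0 := by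
  have hs : ContDiff ℝ ∞ fun t : ℝ => s * t := by fun_prop
  have h1 : v =ᶠ[𝓝 x] fun y => coordMap (Fin.last n) (fun t => s * t) a y +
    coordMap (Fin.last n) g c y := h
  have hd : deriv (fun t : ℝ => s * t) = fun _ => s := by
    funext t; simp
  have hsm := smooth_coordMap (n := n) hs (Fin.last n) a
  have hsm' := smooth_coordMap (n := n) hg (Fin.last n) c
  constructor
  · rw [grad_congr h1, grad_add hsm hsm', grad_coordMap hs, grad_coordMap hg, hd]
    funext i j
    change (if j = Fin.last n then s * a i else 0) +
      (if j = Fin.last n then deriv g (x (Fin.last n)) * c i else 0) =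
      s * well n a i j + deriv g (x (Fin.last n)) * well n c i j
    simp [well, Matrix.vecMulVec_apply, Pi.single_apply]
  · rw [hess_congr h1, hess_add hsm hsm', hess_coordMap hs, hess_coordMap hg, hd]
    funext i j k
    simp

/-- The energy density is bounded by powers of the distance of the gradient from one well and of
the second gradient. -/
theorem Comparable.eden_le {W : Matrix (Fin d) (Fin (n + 1)) ℝ → ℝ≥0} {a : Fin d → ℝ}
    {p C : ℝ} (hp : 2 ≤ p) (hW : Comparable W a p C) {s : ℝ} (hs : s = 1 ∨ s = -1) {ε : ℝ}
    (hε : 0 < ε) (lam : ℝ) {v : (Fin (n + 1) → ℝ) → Fin d → ℝ} {x : Fin (n + 1) → ℝ} {M N : ℝ}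
    (hM : matNorm (grad v x - s • well n a) ≤ M) (hN : hessNorm (hess v x) ≤ N) :
    eden W ε lam v x ≤ ENNReal.ofReal (C / ε * M ^ p + 2 * ε * N ^ 2) := by
  refine ENNReal.ofReal_le_ofReal ?_
  have hC := hW.one_le
  have h1 : (W (grad v x) : ℝ) ≤ C * M ^ p := by
    refine (hW.le_of_left hp hs _).trans ?_
    gcongr
    exact matNorm_nonneg _
  have h2 : hessNorm (hess v x) ^ 2 ≤ N ^ 2 := by
    gcongr
    exact hessNorm_nonneg _
  have h3 : min (lam ^ 2) (hessNorm (hess v x) ^ 2) ≤ N ^ 2 := (min_le_right _ _).trans h2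
  calc _ ≤ 1 / ε * (C * M ^ p) + ε * N ^ 2 + ε * N ^ 2 := by gcongr
    _ = _ := by ring

theorem gden_le {lam : ℝ} (hlam : lam ≤ 0) {v : (Fin (n + 1) → ℝ) → Fin d → ℝ}
    {x : Fin (n + 1) → ℝ} {N : ℝ} (hN : hessNorm (hess v x) ≤ N) :
    gden lam v x ≤ ENNReal.ofReal N :=
  ENNReal.ofReal_le_ofReal (max_le (by linarith) ((hessNorm_nonneg _).trans hN))

theorem eden_gden_congr (W : Matrix (Fin d) (Fin (n + 1)) ℝ → ℝ≥0) (ε lam : ℝ)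
    {v w : (Fin (n + 1) → ℝ) → Fin d → ℝ} {x : Fin (n + 1) → ℝ} (h : v =ᶠ[𝓝 x] w) :
    eden W ε lam v x = eden W ε lam w x ∧ gden lam v x = gden lam w x := by
  rw [eden, eden, gden, gden, grad_congr h, hess_congr h]
  exact ⟨rfl, rfl⟩

/-- An affine map with gradient in one of the wells carries no energy. -/
theorem Comparable.density_eq_zero {W : Matrix (Fin d) (Fin (n + 1)) ℝ → ℝ≥0} {a : Fin d → ℝ}
    {p C : ℝ} (hp : 2 ≤ p) (hW : Comparable W a p C) {s : ℝ} (hs : s = 1 ∨ s = -1) {ε lam : ℝ}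
    (hε : 0 < ε) (hlam : lam ≤ 0) {v : (Fin (n + 1) → ℝ) → Fin d → ℝ} {x : Fin (n + 1) → ℝ}
    {c : Fin d → ℝ} (h : v =ᶠ[𝓝 x] fun y => (s * y (Fin.last n)) • a + c) :
    eden W ε lam v x = 0 ∧ gden lam v x = 0 := by
  obtain ⟨h1, h2⟩ := grad_of_eventually_affine h
  have hN : hessNorm (hess v x) ≤ 0 := by rw [h2, hessNorm_zero]
  have hM : matNorm (grad v x - s • well n a) ≤ 0 := by rw [h1, sub_self, matNorm_zero]
  constructor
  · have := hW.eden_le hp hs hε lam hM hN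
    rw [Real.zero_rpow (by linarith)] at this
    simpa using this
  · simpa using gden_le hlam hN

/-- Integrals over a slab are perturbed little by a bounded density on a set of small volume. -/
theorem setLIntegral_le_add_const {S T : Set (Fin (n + 1) → ℝ)}
    (hT : MeasurableSet T) {f g : (Fin (n + 1) → ℝ) → ℝ≥0∞} {c : ℝ≥0∞}
    (h : ∀ x ∈ S, f x ≤ g x + T.indicator (fun _ => c) x) (hS : MeasurableSet S) :
    ∫⁻ x in S, f x ≤ (∫⁻ x in S, g x) + c * volume (S ∩ T) := by
  calc ∫⁻ x in S, f x ≤ ∫⁻ x in S, (g x + T.indicator (fun _ => c) x) := setLIntegral_mono' hS h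
    _ = (∫⁻ x in S, g x) + ∫⁻ x in S, T.indicator (fun _ => c) x :=
        lintegral_add_right _ (measurable_const.indicator hT)
    _ = _ := by
        rw [lintegral_indicator hT, lintegral_const, Measure.restrict_apply MeasurableSet.univ,
          Set.univ_inter, Measure.restrict_apply hT, Set.inter_comm]


/-- The additive constants of a profile can be removed by a cutoff on a tall layer, at arbitrarily
small cost since `p > 1`. -/
theorem Profile.exists_normalized {W : Matrix (Fin d) (Fin (n + 1)) ℝ → ℝ≥0}
    {a : Fin d → ℝ} {p C : ℝ} (hp : 2 ≤ p) (hW : Comparable W a p C) {ε lam P : ℝ}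
    (hε : 0 < ε) (hlam : lam ≤ 0) (hP : 0 < P) {E Γ : ℝ≥0∞}
    {v : (Fin (n + 1) → ℝ) → Fin d → ℝ} (hv : Profile W a ε lam P E Γ v) {δ : ℝ} (hδ : 0 < δ) :
    ∃ w, Profile W a ε lam P (E + ENNReal.ofReal δ) (Γ + ENNReal.ofReal δ) w ∧
      ∃ h, 0 < h ∧ ∀ x : Fin (n + 1) → ℝ, h ≤ |x (Fin.last n)| →
        w x = |x (Fin.last n)| • a := by
  obtain ⟨h, cp, cm, hh, hfar⟩ := hv.far
  obtain ⟨K, hK1, hK⟩ := exists_bound_deriv_smoothTransition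
  have hC := hW.one_le
  set M := max (matNorm (well n cp)) (matNorm (well n cm)) with hM
  have hM0 : 0 ≤ M := (matNorm_nonneg _).trans (le_max_left _ _)
  set B := C / ε * (K * M) ^ p + 2 * ε * (K * M) ^ 2 + K * M with hB
  have hB0 : 0 ≤ B := by positivity
  -- the cutoffs have slope of order `1 / H` over a height `H`, which costs densities of order
  -- `1 / H ^ 2` on a volume of order `H`
  obtain ⟨H, hHh⟩ := exists_gt (max (max h 1) (4 * B / δ))
  have hH1 : 1 < H := (le_max_right h 1).trans_lt ((le_max_left _ _).trans_lt hHh)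
  have hHh' : h < H := (le_max_left h 1).trans_lt ((le_max_left _ _).trans_lt hHh)
  have hHδ : 4 * B / δ < H := (le_max_right _ _).trans_lt hHh
  have hH0 : 0 < H := by linarith
  -- the cutoffs at the top and at the bottom
  let g : ℝ → ℝ → ℝ := fun s t => Real.smoothTransition (H⁻¹ * (s * t) - 1)
  have hg : ∀ s, ContDiff ℝ ∞ (g s) := fun s => Real.smoothTransition.contDiff.comp (by fun_prop)
  have hg0 : ∀ s t, s * t ≤ H → g s t = 0 := fun s t hst =>
    Real.smoothTransition.zero_of_nonpos (by
      rw [sub_nonpos, inv_mul_le_iff₀ hH0]; linarith)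
  have hg1 : ∀ s t, 2 * H ≤ s * t → g s t = 1 := fun s t hst =>
    Real.smoothTransition.one_of_one_le (by
      have : 2 ≤ H⁻¹ * (s * t) := by rw [le_inv_mul_iff₀ hH0]; linarith
      linarith)
  have hgd : ∀ s, s = 1 ∨ s = -1 → ∀ t, |deriv (g s) t| ≤ K / H ∧
      |deriv (deriv (g s)) t| ≤ K / H ^ 2 := by
    intro s hs t
    have e0 : g s = fun t => (fun r => Real.smoothTransition (r - 1)) ((H⁻¹ * s) * t) := by
      funext t; simp only [g]; rw [mul_assoc]
    have e1 : deriv (g s) = fun t => (H⁻¹ * s) * deriv Real.smoothTransition ((H⁻¹ * s) * t - 1) := by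
      funext t
      rw [e0, deriv_comp_mul_left (H⁻¹ * s) (fun r => Real.smoothTransition (r - 1)),
        deriv_comp_sub_const, smul_eq_mul]
    have e2 : deriv (deriv (g s)) t =
        (H⁻¹ * s) * ((H⁻¹ * s) * deriv (deriv Real.smoothTransition) ((H⁻¹ * s) * t - 1)) := by
      rw [e1, deriv_const_mul_field,
        deriv_comp_mul_left (H⁻¹ * s) (fun r => deriv Real.smoothTransition (r - 1)),
        deriv_comp_sub_const, smul_eq_mul]
    have hs1 : |H⁻¹ * s| = H⁻¹ := by
      rw [abs_mul, abs_of_pos (inv_pos.2 hH0)]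
      rcases hs with rfl | rfl <;> simp
    constructor
    · rw [e1, abs_mul, hs1, div_eq_inv_mul]
      gcongr
      exact (hK _).1
    · rw [e2, abs_mul _ (_ * _), abs_mul _ (deriv _ _), hs1, ← mul_assoc, ← sq, div_eq_inv_mul,
        inv_pow]
      gcongr
      exact (hK _).2
  let w : (Fin (n + 1) → ℝ) → Fin d → ℝ := fun x =>
    v x + (coordMap (Fin.last n) (g 1) (-cp) x + coordMap (Fin.last n) (g (-1)) (-cm) x)
  have hws : Smooth w := hv.smooth.add ((smooth_coordMap (hg _) _ _).add (smooth_coordMap (hg _) _ _))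
  have hwp : Per P w := by
    intro k x
    simp [w, coordMap, hv.per k x]
  have hmid : ∀ x : Fin (n + 1) → ℝ, |x (Fin.last n)| < H → w =ᶠ[𝓝 x] v := by
    intro x hx
    have h1 : ∀ᶠ y : Fin (n + 1) → ℝ in 𝓝 x, |y (Fin.last n)| < H :=
      (continuous_abs.comp (continuous_apply (Fin.last n))).continuousAt.eventually (gt_mem_nhds hx)
    filter_upwards [h1] with y hy
    rw [abs_lt] at hy
    simp [w, coordMap, hg0 1 (y (Fin.last n)) (by linarith), hg0 (-1) (y (Fin.last n)) (by linarith)]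
  have htop : ∀ x : Fin (n + 1) → ℝ, H ≤ |x (Fin.last n)| → ∃ (s : ℝ) (c : Fin d → ℝ),
      (s = 1 ∨ s = -1) ∧ s * x (Fin.last n) = |x (Fin.last n)| ∧ matNorm (well n c) ≤ M ∧
      w =ᶠ[𝓝 x] fun y => (s * y (Fin.last n)) • a + (1 - g s (y (Fin.last n))) • c := by
    intro x hx
    rcases le_abs.1 hx with hx' | hx'
    · refine ⟨1, cp, Or.inl rfl, by rw [one_mul, abs_of_pos (by linarith)], le_max_left _ _, ?_⟩
      filter_upwards [eventually_lt_last (hHh'.trans_le hx')] with y hy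
      simp only [w, coordMap, (hfar y).1 hy.le, hg0 (-1) (y (Fin.last n)) (by linarith)]
      module
    · refine ⟨-1, cm, Or.inr rfl, by rw [abs_of_neg (by linarith)]; ring, le_max_right _ _, ?_⟩
      filter_upwards [eventually_last_lt (show x (Fin.last n) < -h by linarith)] with y hy
      simp only [w, coordMap, (hfar y).2 hy.le, hg0 1 (y (Fin.last n)) (by linarith)]
      module
  have hend : ∀ x : Fin (n + 1) → ℝ, 2 * H ≤ |x (Fin.last n)| → w x = |x (Fin.last n)| • a := by
    intro x hx
    obtain ⟨s, c, -, hsx, -, hw⟩ := htop x (by linarith)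
    rw [hw.eq_of_nhds, hg1 s _ (by rw [hsx]; exact hx), hsx]
    simp
  let T : Set (Fin (n + 1) → ℝ) := {x | x (Fin.last n) ∈ Set.Icc (-(2 * H)) (2 * H)}
  have hT : MeasurableSet T := measurable_pi_apply (Fin.last n) measurableSet_Icc
  have hpt : ∀ x, eden W ε lam w x ≤ eden W ε lam v x +
        T.indicator (fun _ => ENNReal.ofReal (B / H ^ 2)) x ∧
      gden lam w x ≤ gden lam v x + T.indicator (fun _ => ENNReal.ofReal (B / H ^ 2)) x := by
    intro x
    rcases lt_or_ge |x (Fin.last n)| H with hx | hx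
    · rw [(eden_gden_congr W ε lam (hmid x hx)).1, (eden_gden_congr W ε lam (hmid x hx)).2]
      exact ⟨le_self_add, le_self_add⟩
    obtain ⟨s, c, hs, hsx, hc, hw⟩ := htop x hx
    rcases le_or_gt |x (Fin.last n)| (2 * H) with hx2 | hx2
    · have hxT : x ∈ T := abs_le.1 hx2
      rw [Set.indicator_of_mem hxT]
      obtain ⟨e1, e2⟩ := grad_hess_of_eventually (contDiff_const.sub (hg s)) hw
      have d1 : deriv (fun t => 1 - g s t) = fun t => -deriv (g s) t := by
        funext t; rw [deriv_const_sub]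
      rw [d1] at e1 e2
      have d2 : deriv (fun t => -deriv (g s) t) (x (Fin.last n)) =
          -deriv (deriv (g s)) (x (Fin.last n)) := deriv.fun_neg
      rw [d2] at e2
      have m1 : matNorm (grad w x - s • well n a) ≤ K * M / H := by
        rw [e1, add_sub_cancel_left, matNorm_smul_well, abs_neg, mul_div_right_comm]
        exact mul_le_mul (hgd s hs _).1 hc (matNorm_nonneg _) (by positivity)
      have m2 : hessNorm (hess w x) ≤ K * M / H ^ 2 := by
        rw [e2, hessNorm_last, abs_neg, mul_div_right_comm]
        exact mul_le_mul (hgd s hs _).2 hc (matNorm_nonneg _) (by positivity)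
      have q1 : H ^ 2 ≤ H ^ p := by
        rw [← Real.rpow_natCast]
        exact Real.rpow_le_rpow_of_exponent_le hH1.le (by simpa using hp)
      have q2 : H ^ 2 ≤ (H ^ 2) ^ 2 := by
        have : 1 ≤ H ^ 2 := one_le_pow₀ hH1.le
        nlinarith
      constructor
      · refine (hW.eden_le hp hs hε lam m1 m2).trans ((ENNReal.ofReal_le_ofReal ?_).trans
          le_add_self)
        rw [Real.div_rpow (by positivity) hH0.le, div_pow, hB, add_div, add_div]
        have r1 : C / ε * ((K * M) ^ p / H ^ p) ≤ C / ε * (K * M) ^ p / H ^ 2 := by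
          rw [mul_div_assoc]; gcongr
        have r2 : 2 * ε * ((K * M) ^ 2 / (H ^ 2) ^ 2) ≤ 2 * ε * (K * M) ^ 2 / H ^ 2 := by
          rw [mul_div_assoc]; gcongr
        have r3 : 0 ≤ K * M / H ^ 2 := by positivity
        linarith
      · refine (gden_le hlam m2).trans ((ENNReal.ofReal_le_ofReal ?_).trans le_add_self)
        gcongr
        rw [hB]
        exact le_add_of_nonneg_left (by positivity)
    · have hev : w =ᶠ[𝓝 x] fun y => (s * y (Fin.last n)) • a + (0 : Fin d → ℝ) := by
        have h1 : ∀ᶠ y : Fin (n + 1) → ℝ in 𝓝 x, 2 * H < s * y (Fin.last n) := by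
          refine (Continuous.continuousAt (f := fun y : Fin (n + 1) → ℝ => s * y (Fin.last n))
            (by fun_prop)).eventually (lt_mem_nhds ?_)
          simpa only [hsx] using hx2
        filter_upwards [h1, hw] with y hy hwy
        rw [hwy, hg1 s _ hy.le]
        simp
      obtain ⟨z1, z2⟩ := hW.density_eq_zero hp hs hε hlam hev
      rw [z1, z2]
      exact ⟨zero_le, zero_le⟩
  have hvol : ENNReal.ofReal (B / H ^ 2) * volume (slab n P ∩ T) ≤
      ENNReal.ofReal (P ^ n) * ENNReal.ofReal δ := by
    rw [volume_slab_inter, Real.volume_Icc, ← ENNReal.ofReal_pow hP.le, mul_left_comm,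
      ← ENNReal.ofReal_mul (by positivity)]
    gcongr
    have : B < δ * H / 4 := by
      rw [div_lt_iff₀ hδ] at hHδ; linarith
    have h4 : 2 * H - -(2 * H) = 4 * H := by ring
    rw [h4, div_mul_eq_mul_div, div_le_iff₀ (by positivity)]
    nlinarith
  refine ⟨w, ⟨hws, hwp, ⟨2 * H, 0, 0, by positivity, fun x => ⟨fun hx => ?_, fun hx => ?_⟩⟩, ?_, ?_⟩,
    2 * H, by positivity, hend⟩
  · rw [hend x (hx.trans (le_abs_self _)), abs_of_pos (by linarith), add_zero]
  · rw [hend x (by rw [abs_of_neg (by linarith)]; linarith), abs_of_neg (by linarith), add_zero]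
  · refine (setLIntegral_le_add_const hT (fun x _ => (hpt x).1) (measurableSet_slab P)).trans ?_
    rw [mul_add]
    exact add_le_add hv.energy_le hvol
  · refine (setLIntegral_le_add_const hT (fun x _ => (hpt x).2) (measurableSet_slab P)).trans ?_
    rw [mul_add]
    exact add_le_add hv.constraint_le hvol

end Mixing

section Convexity

variable {d n : ℕ}

theorem matNorm_le_of_entry_le {ξ : Matrix (Fin d) (Fin (n + 1)) ℝ} {K : ℝ}
    (h : ∀ i j, |ξ i j| ≤ K) : matNorm ξ ≤ d * (n + 1) * K := by
  refine (matNorm_le_sum ξ).trans ?_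
  refine (Finset.sum_le_sum fun i _ => Finset.sum_le_sum fun j _ => h i j).trans_eq ?_
  simp
  ring

theorem hessNorm_le_of_entry_le {H : Fin d → Fin (n + 1) → Fin (n + 1) → ℝ} {K : ℝ}
    (h : ∀ i j k, |H i j k| ≤ K) : hessNorm H ≤ d * (n + 1) ^ 2 * K := by
  refine (hessNorm_le_sum H).trans ?_
  refine (Finset.sum_le_sum fun i _ => Finset.sum_le_sum fun j _ =>
    Finset.sum_le_sum fun k _ => h i j k).trans_eq ?_
  simp
  ring

/-- Bounds for the derivatives of a partition-of-unity combination `g + φ (f - g)`. -/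
theorem abs_pd_mix_le {f g φ : (Fin (n + 1) → ℝ) → ℝ} (hf : ContDiff ℝ ∞ f) (hg : ContDiff ℝ ∞ g)
    (hφ : ContDiff ℝ ∞ φ) {x : Fin (n + 1) → ℝ} {K : ℝ}
    (hf0 : |f x| ≤ K) (hg0 : |g x| ≤ K) (hf1 : ∀ j, |pd j f x| ≤ K) (hg1 : ∀ j, |pd j g x| ≤ K)
    (hf2 : ∀ j k, |pd k (pd j f) x| ≤ K) (hg2 : ∀ j k, |pd k (pd j g) x| ≤ K)
    (hφ0 : |φ x| ≤ 1) (hφ1 : ∀ j, |pd j φ x| ≤ 1) (hφ2 : ∀ j k, |pd k (pd j φ) x| ≤ 1) :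
    (∀ j, |pd j (fun y => g y + φ y * (f y - g y)) x| ≤ 5 * K) ∧
      ∀ j k, |pd k (pd j fun y => g y + φ y * (f y - g y)) x| ≤ 9 * K := by
  have hK : 0 ≤ K := (abs_nonneg _).trans hf0
  have hfg := hf.sub hg
  have e1 : ∀ j y, pd j (fun y => g y + φ y * (f y - g y)) y =
      pd j g y + (φ y * (pd j f y - pd j g y) + pd j φ y * (f y - g y)) := by
    intro j y
    rw [pd_add (diffAt_of_contDiff hg y) (diffAt_of_contDiff (hφ.mul hfg) y),
      pd_mul (diffAt_of_contDiff hφ y) (diffAt_of_contDiff hfg y),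
      pd_sub (diffAt_of_contDiff hf y) (diffAt_of_contDiff hg y)]
  have hd : ∀ {u w : ℝ}, |u| ≤ K → |w| ≤ K → |u - w| ≤ 2 * K := fun {u w} hu hw => by
    have := abs_sub u w; linarith
  have hm : ∀ {u w : ℝ}, |u| ≤ 1 → |w| ≤ 2 * K → |u * w| ≤ 2 * K := fun {u w} hu hw => by
    rw [abs_mul]
    calc |u| * |w| ≤ 1 * (2 * K) := by gcongr
      _ = 2 * K := one_mul _
  constructor
  · intro j
    rw [e1]
    have t1 := hm hφ0 (hd (hf1 j) (hg1 j))
    have t2 := hm (hφ1 j) (hd hf0 hg0)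
    have t3 := abs_add_le (pd j g x) (φ x * (pd j f x - pd j g x) + pd j φ x * (f x - g x))
    have t4 := abs_add_le (φ x * (pd j f x - pd j g x)) (pd j φ x * (f x - g x))
    have := hg1 j
    linarith
  · intro j k
    have e2 : (pd j fun y => g y + φ y * (f y - g y)) = fun y =>
      pd j g y + (φ y * (pd j f y - pd j g y) + pd j φ y * (f y - g y)) := funext (e1 j)
    have c1 := contDiff_pd hf j
    have c2 := contDiff_pd hg j
    have c3 := contDiff_pd hφ j
    rw [e2, pd_add (diffAt_of_contDiff c2 x)
        (diffAt_of_contDiff ((hφ.mul (c1.sub c2)).add (c3.mul hfg)) x),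
      pd_add (diffAt_of_contDiff (hφ.mul (c1.sub c2)) x) (diffAt_of_contDiff (c3.mul hfg) x),
      pd_mul (diffAt_of_contDiff hφ x) (diffAt_of_contDiff (c1.sub c2) x),
      pd_mul (diffAt_of_contDiff c3 x) (diffAt_of_contDiff hfg x),
      pd_sub (diffAt_of_contDiff c1 x) (diffAt_of_contDiff c2 x),
      pd_sub (diffAt_of_contDiff hf x) (diffAt_of_contDiff hg x)]
    have t1 := hm hφ0 (hd (hf2 j k) (hg2 j k))
    have t2 := hm (hφ1 k) (hd (hf1 j) (hg1 j))
    have t3 := hm (hφ1 j) (hd (hf1 k) (hg1 k))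
    have t4 := hm (hφ2 j k) (hd hf0 hg0)
    have t5 := hg2 j k
    refine (abs_add_le _ _).trans ?_
    refine (add_le_add t5 ((abs_add_le _ _).trans (add_le_add ((abs_add_le _ _).trans
      (add_le_add t1 t2)) ((abs_add_le _ _).trans (add_le_add t3 t4))))).trans ?_
    linarith

theorem half_mul_le {x b c E : ℝ≥0∞} (h : 2 * x = b * c) (hc : c ≤ E) : x ≤ b * (E / 2) := by
  rw [← mul_div_assoc, ENNReal.le_div_iff_mul_le (by simp) (by simp), mul_comm, h]
  gcongr

/-- A profile and its derivatives up to order two are bounded on horizontal layers. -/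
theorem Profile.exists_bound {W : Matrix (Fin d) (Fin (n + 1)) ℝ → ℝ≥0} {a : Fin d → ℝ}
    {ε lam P : ℝ} {E Γ : ℝ≥0∞} {v : (Fin (n + 1) → ℝ) → Fin d → ℝ}
    (hv : Profile W a ε lam P E Γ v) (hP : 0 < P) (h : ℝ) :
    ∃ K, 0 ≤ K ∧ ∀ x : Fin (n + 1) → ℝ, |x (Fin.last n)| ≤ h → ∀ i, |v x i| ≤ K ∧
      (∀ j, |pd j (fun y => v y i) x| ≤ K) ∧ ∀ j k, |pd k (pd j fun y => v y i) x| ≤ K := by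
  obtain ⟨K0, hK0, h0⟩ := hv.per.exists_bound hP hv.smooth.continuous h
  obtain ⟨K1, hK1, h1⟩ := (Per.grad hv.per).comp matNorm |>.exists_bound hP
    (continuous_matNorm.comp hv.smooth.continuous_grad) h
  obtain ⟨K2, hK2, h2⟩ := (Per.hess hv.per).comp hessNorm |>.exists_bound hP
    (continuous_hessNorm.comp hv.smooth.continuous_hess) h
  refine ⟨K0 + K1 + K2, by positivity, fun x hx i => ⟨?_, fun j => ?_, fun j k => ?_⟩⟩
  · have := (norm_le_pi_norm (v x) i).trans (h0 x hx)
    rw [Real.norm_eq_abs] at this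
    linarith
  · have := (abs_entry_le_matNorm (grad v x) i j).trans ((le_abs_self _).trans (h1 x hx))
    change |pd j (fun y => v y i) x| ≤ _ at this
    linarith
  · have := (abs_entry_le_hessNorm (hess v x) i j k).trans ((le_abs_self _).trans (h2 x hx))
    change |pd k (pd j fun y => v y i) x| ≤ _ at this
    linarith

/-- Off its kinks, the wave equals `1` on the first half of a period and `-1` on the second. -/
theorem wave_eventually_sign {η r t : ℝ} (hη : 0 < η) (hr0 : 0 < r) (ht : t ∈ Set.Ioc 0 (2 * r))
    (hk : t ∉ kink η r) :
    (t ≤ r ∧ wave η r =ᶠ[𝓝 t] fun _ => 1) ∨ (r < t ∧ wave η r =ᶠ[𝓝 t] fun _ => -1) := by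
  obtain ⟨c, hc, hev⟩ := wave_eventually_const hη hk
  have hcw : wave η r t = c := hev.eq_of_nhds
  have hsk : η < |Real.sin (Real.pi * (r⁻¹ * t))| := not_le.1 hk
  have hpi := Real.pi_pos
  have ht2 : r⁻¹ * t ≤ 2 := by
    rw [inv_mul_le_iff₀ hr0]; linarith [ht.2]
  have ht0 : 0 < r⁻¹ * t := mul_pos (inv_pos.2 hr0) ht.1
  rcases le_or_gt t r with htr | htr
  · left
    refine ⟨htr, ?_⟩
    have h1 : r⁻¹ * t ≤ 1 := by rw [inv_mul_le_iff₀ hr0]; linarith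
    have h2 : 0 ≤ Real.sin (Real.pi * (r⁻¹ * t)) :=
      Real.sin_nonneg_of_nonneg_of_le_pi (by positivity) (by nlinarith)
    rw [abs_of_nonneg h2] at hsk
    have h3 : wave η r t = 1 := smoothSign_of_ge hη hsk.le
    rwa [← hcw, h3] at hev
  · right
    refine ⟨htr, ?_⟩
    have h1 : 1 < r⁻¹ * t := by rw [lt_inv_mul_iff₀ hr0]; linarith
    have h2 : 0 ≤ Real.sin (Real.pi * (r⁻¹ * t) - Real.pi) :=
      Real.sin_nonneg_of_nonneg_of_le_pi (by nlinarith) (by nlinarith)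
    rw [Real.sin_sub_pi] at h2
    rw [abs_of_nonpos (by linarith)] at hsk
    have h3 : wave η r t = -1 := smoothSign_of_le hη (by linarith)
    rwa [← hcw, h3] at hev

/-- The cutoff `(1 + wave) / 2` has derivatives bounded by one when its period is large. -/
theorem wave_cutoff {η r Kw : ℝ}
    (hKw : ∀ t, |deriv (wave η r) t| ≤ Kw / r ∧ |deriv (deriv (wave η r)) t| ≤ Kw / r ^ 2)
    (hr : Kw + 1 < r) (hKw0 : 0 ≤ Kw) (l : Fin (n + 1)) :
    ContDiff ℝ ∞ (fun x : Fin (n + 1) → ℝ => 1 / 2 * (1 + wave η r (x l))) ∧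
      (∀ x : Fin (n + 1) → ℝ, |1 / 2 * (1 + wave η r (x l))| ≤ 1) ∧
      (∀ j x, |pd j (fun x : Fin (n + 1) → ℝ => 1 / 2 * (1 + wave η r (x l))) x| ≤ 1) ∧
      ∀ j k x, |pd k (pd j fun x : Fin (n + 1) → ℝ => 1 / 2 * (1 + wave η r (x l))) x| ≤ 1 := by
  have hr0 : 0 < r := by linarith
  let φ₀ : ℝ → ℝ := fun t => 1 / 2 * (1 + wave η r t)
  have hφ₀ : ContDiff ℝ ∞ φ₀ := contDiff_const.mul (contDiff_const.add (contDiff_wave η r))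
  have hdφ : deriv φ₀ = fun t => 1 / 2 * deriv (wave η r) t := by
    funext t
    simp only [φ₀]
    rw [deriv_const_mul_field, deriv_const_add]
  have hφb : ∀ t, |φ₀ t| ≤ 1 ∧ |deriv φ₀ t| ≤ 1 ∧ |deriv (deriv φ₀) t| ≤ 1 := by
    intro t
    have h1 := abs_le.1 (abs_wave_le η r t)
    obtain ⟨h2, h3⟩ := hKw t
    have h4 : Kw / r ≤ 1 := by rw [div_le_one hr0]; linarith
    have h5 : Kw / r ^ 2 ≤ 1 := by
      rw [div_le_one (by positivity)]; nlinarith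
    refine ⟨?_, ?_, ?_⟩
    · simp only [φ₀]
      rw [abs_le]
      constructor <;> linarith [h1.1, h1.2]
    · rw [hdφ, abs_mul]
      norm_num
      linarith
    · rw [hdφ, deriv_const_mul_field, abs_mul]
      norm_num
      linarith
  have hφ1 : ∀ j, (pd j fun x : Fin (n + 1) → ℝ => φ₀ (x l)) =
      fun x => if j = l then deriv φ₀ (x l) else 0 :=
    fun j => funext fun x => pd_coord ((hφ₀.differentiable (by simp)) _) j
  refine ⟨contDiff_coord hφ₀ _, fun x => (hφb _).1, fun j x => ?_, fun j k x => ?_⟩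
  · change |pd j (fun x : Fin (n + 1) → ℝ => φ₀ (x l)) x| ≤ 1
    rw [hφ1]
    dsimp only
    split_ifs
    · exact (hφb _).2.1
    · simp
  · change |pd k (pd j fun x : Fin (n + 1) → ℝ => φ₀ (x l)) x| ≤ 1
    rw [hφ1]
    by_cases hj : j = l
    · simp only [hj, if_true]
      rw [pd_coord (((contDiff_deriv hφ₀).differentiable (by simp)) _)]
      split_ifs
      · exact (hφb _).2.2
      · simp
    · simp [hj]

/-- The averaging of two periodic densities, each used on half of a large period. -/
theorem setLIntegral_mix_le {P δ B : ℝ} (hP : 0 < P) (m : ℕ) (j₀ : Fin n)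
    {T : Set (Fin (n + 1) → ℝ)} (hT : MeasurableSet T)
    (hvol : ENNReal.ofReal B * volume (slab n (2 * m * P) ∩ T) ≤
      ENNReal.ofReal ((2 * m * P) ^ n) * ENNReal.ofReal δ)
    {f g₁ g₂ : (Fin (n + 1) → ℝ) → ℝ≥0∞} {F₁ F₂ : ℝ≥0∞} (p1 : Per P g₁) (p2 : Per P g₂)
    (m1 : Measurable g₁)
    (hf : ∀ x ∈ slab n (2 * m * P), f x ≤
      ({x : Fin (n + 1) → ℝ | x j₀.castSucc ≤ m * P}.indicator g₁ x +
        {x : Fin (n + 1) → ℝ | x j₀.castSucc ≤ m * P}ᶜ.indicator g₂ x) +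
        T.indicator (fun _ => ENNReal.ofReal B) x)
    (e1 : ∫⁻ x in slab n P, g₁ x ≤ ENNReal.ofReal (P ^ n) * F₁)
    (e2 : ∫⁻ x in slab n P, g₂ x ≤ ENNReal.ofReal (P ^ n) * F₂) :
    ∫⁻ x in slab n (2 * m * P), f x ≤ ENNReal.ofReal ((2 * m * P) ^ n) *
      (F₁ / 2 + F₂ / 2 + ENNReal.ofReal δ) := by
  set L : Set (Fin (n + 1) → ℝ) := {x | x j₀.castSucc ≤ m * P} with hLdef
  have hL : MeasurableSet L := measurableSet_le (measurable_pi_apply _) measurable_const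
  refine (setLIntegral_le_add_const hT hf (measurableSet_slab _)).trans ?_
  rw [mul_add]
  refine add_le_add ?_ hvol
  rw [lintegral_add_left (m1.indicator hL), lintegral_indicator hL, lintegral_indicator hL.compl,
    Measure.restrict_restrict hL, Measure.restrict_restrict hL.compl, mul_add,
    Set.inter_comm L, Set.inter_comm Lᶜ]
  have hc : slab n (2 * m * P) ∩ Lᶜ = slab n (2 * m * P) ∩ {x | m * P < x j₀.castSucc} := by
    ext x; simp [L]
  rw [hc]
  have hpow : (2 * m : ℝ≥0∞) ^ n * ENNReal.ofReal (P ^ n) =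
      ENNReal.ofReal ((2 * m * P) ^ n) := by
    rw [mul_pow (2 * (m : ℝ)) P, ENNReal.ofReal_mul (by positivity),
      ENNReal.ofReal_pow (p := 2 * (m : ℝ)) (by positivity), ENNReal.ofReal_mul (by norm_num)]
    simp
  have q : ∀ F : ℝ≥0∞, (2 * m : ℝ≥0∞) ^ n * (ENNReal.ofReal (P ^ n) * F / 2) =
      ENNReal.ofReal ((2 * m * P) ^ n) * (F / 2) := by
    intro F
    rw [mul_div_assoc, ← mul_assoc, hpow]
  refine add_le_add ?_ ?_
  · rw [← q]
    exact half_mul_le (Per.setLIntegral_half hP p1 m j₀).1 e1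
  · rw [← q]
    exact half_mul_le (Per.setLIntegral_half hP p2 m j₀).2 e2

/-- Two profiles with the same period can be combined, on a large common period, into one whose
energy and constraint are nearly the averages of the given ones. -/
theorem Profile.exists_mix {W : Matrix (Fin d) (Fin (n + 1)) ℝ → ℝ≥0}
    {a : Fin d → ℝ} {p C : ℝ} (hp : 2 ≤ p) (hWc : Continuous W) (hW : Comparable W a p C)
    {ε lam P : ℝ} (hε : 0 < ε) (hlam : lam ≤ 0) (hP : 0 < P) (j₀ : Fin n) {E₁ E₂ Γ₁ Γ₂ : ℝ≥0∞}
    {v₁ v₂ : (Fin (n + 1) → ℝ) → Fin d → ℝ} (hv₁ : Profile W a ε lam P E₁ Γ₁ v₁)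
    (hv₂ : Profile W a ε lam P E₂ Γ₂ v₂) {h : ℝ} (hh : 0 < h)
    (hf₁ : ∀ x : Fin (n + 1) → ℝ, h ≤ |x (Fin.last n)| → v₁ x = |x (Fin.last n)| • a)
    (hf₂ : ∀ x : Fin (n + 1) → ℝ, h ≤ |x (Fin.last n)| → v₂ x = |x (Fin.last n)| • a)
    {δ : ℝ} (hδ : 0 < δ) :
    ∃ m : ℕ, 0 < m ∧ ∃ v, Profile W a ε lam (m * P) (E₁ / 2 + E₂ / 2 + ENNReal.ofReal δ)
      (Γ₁ / 2 + Γ₂ / 2 + ENNReal.ofReal δ) v := by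
  have hC := hW.one_le
  obtain ⟨Ka, hKa0, hKa⟩ := hv₁.exists_bound hP h
  obtain ⟨Kb, hKb0, hKb⟩ := hv₂.exists_bound hP h
  set K := Ka + Kb with hK
  set N := matNorm (well n a) with hN
  have hN0 : 0 ≤ N := matNorm_nonneg _
  set M₁ := d * (n + 1) * (5 * K) + N with hM₁
  set M₂ := d * (n + 1) ^ 2 * (9 * K) with hM₂
  set B := C / ε * M₁ ^ p + 2 * ε * M₂ ^ 2 + M₂ with hB
  have hK0 : 0 ≤ K := by positivity
  have hM₁0 : 0 ≤ M₁ := by positivity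
  have hM₂0 : 0 ≤ M₂ := by positivity
  have hB0 : 0 ≤ B := by positivity
  obtain ⟨η, hη, hkink⟩ := exists_kink_small (δ := δ / (h * (B + 1))) (by positivity)
  obtain ⟨Kw, hKw0, hKw⟩ := exists_bound_deriv_wave η
  obtain ⟨m, hm⟩ := exists_nat_gt ((Kw + 1) / P)
  rw [div_lt_iff₀ hP] at hm
  set r : ℝ := m * P with hr
  have hr1 : Kw + 1 < r := hm
  have hr0 : 0 < r := by linarith
  have hm0 : 0 < m := by
    rcases Nat.eq_zero_or_pos m with h0 | h0
    · rw [hr, h0] at hr0; simp at hr0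
    · exact h0
  obtain ⟨hφ, hφb, hφ1b, hφ2b⟩ := wave_cutoff (hKw r hr0) hr1 hKw0 j₀.castSucc
  set φ : (Fin (n + 1) → ℝ) → ℝ := fun x => 1 / 2 * (1 + wave η r (x j₀.castSucc)) with hφdef
  -- `v₁` and `v₂` alternate on strips of width `m P` in the direction `j₀`
  let v : (Fin (n + 1) → ℝ) → Fin d → ℝ := fun x i => v₂ x i + φ x * (v₁ x i - v₂ x i)
  have hvs : Smooth v := fun i => (hv₂.smooth i).add (hφ.mul ((hv₁.smooth i).sub (hv₂.smooth i)))
  have hvp : Per (2 * m * P) v := by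
    intro k x
    have p1 := hv₁.per.mul_nat (2 * m) k x
    have p2 := hv₂.per.mul_nat (2 * m) k x
    push_cast at p1 p2
    have p3 : φ (x + hvec fun j => k j * (2 * m * P)) = φ x := by
      have := (wave_periodic η hr0.ne').int_mul (k j₀) (x j₀.castSucc)
      simp only [hφdef, Pi.add_apply, hvec_castSucc]
      rw [mul_assoc 2 (m : ℝ) P, ← hr, this]
    funext i
    simp only [v, p1, p2, p3]
  have hvfar : ∀ x : Fin (n + 1) → ℝ, h ≤ |x (Fin.last n)| → v x = |x (Fin.last n)| • a := by
    intro x hx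
    funext i
    simp [v, hf₁ x hx, hf₂ x hx]
  have hsin : ∀ t ∈ Set.Ioc 0 (2 * m * P), t ∉ kink η r →
      (t ≤ r ∧ wave η r =ᶠ[𝓝 t] fun _ => 1) ∨ (r < t ∧ wave η r =ᶠ[𝓝 t] fun _ => -1) :=
    fun t ht hk => wave_eventually_sign hη hr0 ⟨ht.1, ht.2.trans_eq (by rw [hr]; ring)⟩ hk
  have hcont : ∀ (x : Fin (n + 1) → ℝ) (q : ℝ → Prop), (∀ᶠ t in 𝓝 (x j₀.castSucc), q t) →
      ∀ᶠ y : Fin (n + 1) → ℝ in 𝓝 x, q (y j₀.castSucc) := fun x q hq =>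
    (continuous_apply j₀.castSucc).continuousAt.eventually hq
  -- the transition zone, on which only crude bounds hold; its volume is a small fraction of
  -- the period
  let T : Set (Fin (n + 1) → ℝ) :=
    {x | x j₀.castSucc ∈ kink η r ∧ x (Fin.last n) ∈ Set.Icc (-h) h}
  have hkm : MeasurableSet (kink η r) := (isClosed_kink η r).measurableSet
  have hT1 : MeasurableSet {x : Fin (n + 1) → ℝ | x j₀.castSucc ∈ kink η r} :=
    hkm.preimage (measurable_pi_apply j₀.castSucc)
  have hT2 : MeasurableSet {x : Fin (n + 1) → ℝ | x (Fin.last n) ∈ Set.Icc (-h) h} :=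
    measurableSet_Icc.preimage (measurable_pi_apply (Fin.last n))
  have hT : MeasurableSet T := hT1.inter hT2
  let L : Set (Fin (n + 1) → ℝ) := {x | x j₀.castSucc ≤ m * P}
  have hpt : ∀ x ∈ slab n (2 * m * P),
      eden W ε lam v x ≤ (L.indicator (eden W ε lam v₁) x + Lᶜ.indicator (eden W ε lam v₂) x) +
        T.indicator (fun _ => ENNReal.ofReal B) x ∧
      gden lam v x ≤ (L.indicator (gden lam v₁) x + Lᶜ.indicator (gden lam v₂) x) +
        T.indicator (fun _ => ENNReal.ofReal B) x := by
    intro x hx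
    by_cases hxk : x j₀.castSucc ∈ kink η r
    · rcases le_or_gt |x (Fin.last n)| h with hxh | hxh
      · have hxT : x ∈ T := ⟨hxk, abs_le.1 hxh⟩
        rw [Set.indicator_of_mem hxT]
        have hent := fun i => abs_pd_mix_le (K := K) (hv₁.smooth i) (hv₂.smooth i) hφ
          ((hKa x hxh i).1.trans (by linarith)) ((hKb x hxh i).1.trans (by linarith))
          (fun j => ((hKa x hxh i).2.1 j).trans (by linarith))
          (fun j => ((hKb x hxh i).2.1 j).trans (by linarith))
          (fun j k => ((hKa x hxh i).2.2 j k).trans (by linarith))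
          (fun j k => ((hKb x hxh i).2.2 j k).trans (by linarith))
          (hφb x) (fun j => hφ1b j x) (fun j k => hφ2b j k x)
        have m1 : matNorm (grad v x - (1 : ℝ) • well n a) ≤ M₁ := by
          rw [one_smul]
          exact (matNorm_sub_le _ _).trans
            (add_le_add (matNorm_le_of_entry_le fun i j => (hent i).1 j) le_rfl)
        have m2 : hessNorm (hess v x) ≤ M₂ :=
          hessNorm_le_of_entry_le fun i j k => (hent i).2 j k
        constructor
        · refine (hW.eden_le hp (Or.inl rfl) hε lam m1 m2).trans
            ((ENNReal.ofReal_le_ofReal ?_).trans le_add_self)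
          linarith
        · refine (gden_le hlam m2).trans ((ENNReal.ofReal_le_ofReal ?_).trans le_add_self)
          rw [hB]
          exact le_add_of_nonneg_left (by positivity)
      · obtain ⟨s, hs, hsx⟩ : ∃ s : ℝ, (s = 1 ∨ s = -1) ∧
            ∀ᶠ y : Fin (n + 1) → ℝ in 𝓝 x, |y (Fin.last n)| = s * y (Fin.last n) := by
          rcases lt_abs.1 hxh with h' | h'
          · refine ⟨1, Or.inl rfl, ?_⟩
            filter_upwards [eventually_lt_last h'] with y hy
            rw [abs_of_pos (by linarith), one_mul]
          · refine ⟨-1, Or.inr rfl, ?_⟩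
            filter_upwards [eventually_last_lt (lt_neg_of_lt_neg h')] with y hy
            rw [abs_of_neg (by linarith)]; ring
        have hev : v =ᶠ[𝓝 x] fun y => (s * y (Fin.last n)) • a + (0 : Fin d → ℝ) := by
          have h1 : ∀ᶠ y : Fin (n + 1) → ℝ in 𝓝 x, h < |y (Fin.last n)| :=
            (continuous_abs.comp (continuous_apply (Fin.last n))).continuousAt.eventually
              (lt_mem_nhds hxh)
          filter_upwards [h1, hsx] with y hy hys
          rw [hvfar y hy.le, hys, add_zero]
        obtain ⟨z1, z2⟩ := hW.density_eq_zero hp hs hε hlam hev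
        rw [z1, z2]
        exact ⟨zero_le, zero_le⟩
    · rcases hsin _ (hx j₀) hxk with ⟨ht, hev⟩ | ⟨ht, hev⟩
      · have hxL : x ∈ L := ht
        have hvv : v =ᶠ[𝓝 x] v₁ := by
          filter_upwards [hcont x _ hev] with y hy
          funext i
          simp only [v, hφdef, hy]
          ring
        rw [(eden_gden_congr W ε lam hvv).1, (eden_gden_congr W ε lam hvv).2,
          Set.indicator_of_mem hxL, Set.indicator_of_mem hxL, add_assoc, add_assoc]
        exact ⟨le_self_add, le_self_add⟩
      · have hxL : x ∈ Lᶜ := not_le.2 ht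
        have hvv : v =ᶠ[𝓝 x] v₂ := by
          filter_upwards [hcont x _ hev] with y hy
          funext i
          simp only [v, hφdef, hy]
          ring
        rw [(eden_gden_congr W ε lam hvv).1, (eden_gden_congr W ε lam hvv).2,
          Set.indicator_of_mem hxL, Set.indicator_of_mem hxL]
        exact ⟨le_add_self.trans le_self_add, le_add_self.trans le_self_add⟩
  have hvol : ENNReal.ofReal B * volume (slab n (2 * m * P) ∩ T) ≤
      ENNReal.ofReal ((2 * m * P) ^ n) * ENNReal.ofReal δ := by
    have hk := hkink r hr0
    have h2r : 2 * r = 2 * m * P := by rw [hr]; ring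
    have h3 : δ / (h * (B + 1)) * r = δ / (2 * h * (B + 1)) * (2 * m * P) := by
      rw [← h2r]; field_simp
    rw [h2r, h3] at hk
    have hk2 := volume_slab_inter_kink_le (by positivity) j₀ (T := Set.Icc (-h) h) hk
    refine (mul_le_mul_right hk2 _).trans ?_
    rw [Real.volume_Icc, ← ENNReal.ofReal_pow (by positivity), ← ENNReal.ofReal_mul (by positivity),
      ← ENNReal.ofReal_mul (by positivity), ← ENNReal.ofReal_mul (by positivity),
      ← ENNReal.ofReal_mul (by positivity)]
    refine ENNReal.ofReal_le_ofReal ?_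
    have h4 : B * (δ / (2 * h * (B + 1)) * (2 * m * P) ^ n * (h - -h)) =
      (2 * m * P) ^ n * δ * (B / (B + 1)) := by field_simp; ring
    rw [h4]
    refine mul_le_of_le_one_right (by positivity) ?_
    rw [div_le_one (by positivity)]
    linarith
  have hcast : ((2 * m : ℕ) : ℝ) * P = 2 * m * P := by push_cast; ring
  refine ⟨2 * m, by omega, v, ?_⟩
  rw [hcast]
  refine ⟨hvs, hvp, ⟨h, 0, 0, hh, fun x => ⟨fun hx => ?_, fun hx => ?_⟩⟩, ?_, ?_⟩
  · rw [hvfar x (hx.trans (le_abs_self _)), abs_of_pos (by linarith), add_zero]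
  · rw [hvfar x (by rw [abs_of_neg (by linarith)]; linarith), abs_of_neg (by linarith), add_zero]
  · exact setLIntegral_mix_le hP m j₀ hT hvol (hv₁.per.eden W ε lam) (hv₂.per.eden W ε lam)
      (measurable_eden hWc ε lam hv₁.smooth) (fun x hx => (hpt x hx).1) hv₁.energy_le hv₂.energy_le
  · exact setLIntegral_mix_le hP m j₀ hT hvol (hv₁.per.gden lam) (hv₂.per.gden lam) (measurable_gden lam hv₁.smooth)
      (fun x hx => (hpt x hx).2) hv₁.constraint_le hv₂.constraint_le

end Convexity

section Attain

variable {d n : ℕ} {W : Matrix (Fin d) (Fin (n + 1)) ℝ → ℝ≥0} {a : Fin d → ℝ} {ε lam P : ℝ}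

theorem Profile.mono {E E' Γ Γ' : ℝ≥0∞} {v : (Fin (n + 1) → ℝ) → Fin d → ℝ}
    (hv : Profile W a ε lam P E Γ v) (hE : E ≤ E') (hΓ : Γ ≤ Γ') :
    Profile W a ε lam P E' Γ' v :=
  ⟨hv.smooth, hv.per, hv.far, hv.energy_le.trans (by gcongr), hv.constraint_le.trans (by gcongr)⟩

theorem Profile.mul_nat (hP : 0 < P) {E Γ : ℝ≥0∞} {v : (Fin (n + 1) → ℝ) → Fin d → ℝ}
    (hv : Profile W a ε lam P E Γ v) (m : ℕ) : Profile W a ε lam (m * P) E Γ v := by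
  have h : ENNReal.ofReal ((m * P) ^ n) = (m : ℝ≥0∞) ^ n * ENNReal.ofReal (P ^ n) := by
    rw [mul_pow, ENNReal.ofReal_mul (by positivity), ENNReal.ofReal_pow (by positivity),
      ENNReal.ofReal_natCast]
  refine ⟨hv.smooth, hv.per.mul_nat m, hv.far, ?_, ?_⟩
  · rw [Per.setLIntegral_slab hP (hv.per.eden W ε lam), h, mul_assoc]
    gcongr
    exact hv.energy_le
  · rw [Per.setLIntegral_slab hP (hv.per.gden lam), h, mul_assoc]
    gcongr
    exact hv.constraint_le

/-- The pairs of energy and constraint densities per unit area which profiles, with a period that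
is a multiple of `P`, realise up to an arbitrarily small excess. -/
def attain (W : Matrix (Fin d) (Fin (n + 1)) ℝ → ℝ≥0) (a : Fin d → ℝ) (ε lam P : ℝ) :
    Set (ℝ × ℝ) :=
  {q | 0 ≤ q.1 ∧ 0 ≤ q.2 ∧ ∀ δ > 0, ∃ m : ℕ, 0 < m ∧ ∃ v,
    Profile W a ε lam (m * P) (ENNReal.ofReal (q.1 + δ)) (ENNReal.ofReal (q.2 + δ)) v}

theorem Profile.mem_attain {E Γ : ℝ} (hE : 0 ≤ E) (hΓ : 0 ≤ Γ)
    {v : (Fin (n + 1) → ℝ) → Fin d → ℝ}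
    (hv : Profile W a ε lam P (ENNReal.ofReal E) (ENNReal.ofReal Γ) v) :
    (E, Γ) ∈ attain W a ε lam P := by
  refine ⟨hE, hΓ, fun δ hδ => ⟨1, one_pos, v, ?_⟩⟩
  rw [Nat.cast_one, one_mul]
  exact hv.mono (ENNReal.ofReal_le_ofReal (by simpa using hδ.le))
    (ENNReal.ofReal_le_ofReal (by simpa using hδ.le))

theorem attain_mono {q q' : ℝ × ℝ} (hq : q ∈ attain W a ε lam P) (h : q ≤ q') :
    q' ∈ attain W a ε lam P := by
  refine ⟨hq.1.trans h.1, hq.2.1.trans h.2, fun δ hδ => ?_⟩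
  obtain ⟨m, hm, v, hv⟩ := hq.2.2 δ hδ
  exact ⟨m, hm, v, hv.mono (ENNReal.ofReal_le_ofReal (by linarith [h.1]))
    (ENNReal.ofReal_le_ofReal (by linarith [h.2]))⟩

/-- The arbitrarily small excess allowed in the definition makes the set closed. -/
theorem isClosed_attain : IsClosed (attain W a ε lam P) := by
  refine isClosed_of_closure_subset fun q hq => ?_
  rw [Metric.mem_closure_iff] at hq
  have key : ∀ δ > 0, ∃ q' ∈ attain W a ε lam P, q'.1 ≤ q.1 + δ ∧ q'.2 ≤ q.2 + δ := by
    intro δ hδ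
    obtain ⟨q', hq', hd⟩ := hq δ hδ
    rw [Prod.dist_eq, max_lt_iff, Real.dist_eq, Real.dist_eq] at hd
    exact ⟨q', hq', by linarith [(abs_lt.1 hd.1).1], by linarith [(abs_lt.1 hd.2).1]⟩
  refine ⟨le_of_forall_pos_le_add fun δ hδ => ?_, le_of_forall_pos_le_add fun δ hδ => ?_,
    fun δ hδ => ?_⟩
  · obtain ⟨q', hq', h1, -⟩ := key δ hδ
    exact hq'.1.trans h1
  · obtain ⟨q', hq', -, h2⟩ := key δ hδ
    exact hq'.2.1.trans h2
  · obtain ⟨q', hq', h1, h2⟩ := key (δ / 2) (by positivity)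
    obtain ⟨m, hm, v, hv⟩ := hq'.2.2 (δ / 2) (by positivity)
    exact ⟨m, hm, v, hv.mono (ENNReal.ofReal_le_ofReal (by linarith))
      (ENNReal.ofReal_le_ofReal (by linarith))⟩

/-- A closed set containing the midpoints of its points is convex. -/
theorem convex_of_isClosed_of_midpoint {S : Set (ℝ × ℝ)} (hS : IsClosed S)
    (hm : ∀ x ∈ S, ∀ y ∈ S, (1 / 2 : ℝ) • (x + y) ∈ S) : Convex ℝ S := by
  rw [convex_iff_segment_subset]
  intro x hx y hy z hz
  rw [segment_eq_image] at hz
  obtain ⟨t, ht, rfl⟩ := hz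
  let f : ℝ → ℝ × ℝ := fun t => (1 - t) • x + t • y
  have hf : Continuous f := by fun_prop
  have hT : IsClosed (f ⁻¹' S) := hS.preimage hf
  have h0 : f 0 ∈ S := by simpa [f] using hx
  have h1 : f 1 ∈ S := by simpa [f] using hy
  -- a gap of `{t | f t ∈ S}` would contain the midpoint of its end points
  obtain ⟨l, ⟨hl, hlS⟩, hlmax⟩ := (isCompact_Icc.inter_right hT).exists_isGreatest
    (⟨0, ⟨le_rfl, ht.1⟩, h0⟩ : (Set.Icc 0 t ∩ f ⁻¹' S).Nonempty)
  obtain ⟨u, ⟨hu, huS⟩, humin⟩ := (isCompact_Icc.inter_right hT).exists_isLeast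
    (⟨1, ⟨ht.2, le_rfl⟩, h1⟩ : (Set.Icc t 1 ∩ f ⁻¹' S).Nonempty)
  have hmid : f ((l + u) / 2) ∈ S := by
    have h := hm _ hlS _ huS
    have e : (1 / 2 : ℝ) • (f l + f u) = f ((l + u) / 2) := by simp only [f]; module
    rwa [e] at h
  rcases le_total ((l + u) / 2) t with h | h
  · have h2 := hlmax ⟨⟨by linarith [hl.1, hu.1, ht.1], h⟩, hmid⟩
    have h3 : l = t := le_antisymm hl.2 (by linarith [hu.1])
    exact h3 ▸ hlS
  · have h2 := humin ⟨⟨h, by linarith [hl.2, hu.2, ht.2]⟩, hmid⟩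
    have h3 : u = t := le_antisymm (by linarith [hl.2]) hu.1
    exact h3 ▸ huS

/-- Midpoints are attained by letting two profiles alternate on wide vertical strips, after their
additive constants have been removed. This needs a horizontal direction `j₀`. -/
theorem convex_attain {p C : ℝ} (hp : 2 ≤ p) (hWc : Continuous W) (hW : Comparable W a p C)
    (hε : 0 < ε) (hlam : lam ≤ 0) (hP : 0 < P) (j₀ : Fin n) :
    Convex ℝ (attain W a ε lam P) := by
  refine convex_of_isClosed_of_midpoint isClosed_attain fun q hq q' hq' => ?_
  refine ⟨?_, ?_, fun δ hδ => ?_⟩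
  · have := hq.1; have := hq'.1; simp only [Prod.smul_fst, Prod.fst_add, smul_eq_mul]; positivity
  · have := hq.2.1; have := hq'.2.1
    simp only [Prod.smul_snd, Prod.snd_add, smul_eq_mul]; positivity
  have hδ3 : 0 < δ / 3 := by positivity
  obtain ⟨m, hm, v, hv⟩ := hq.2.2 _ hδ3
  obtain ⟨m', hm', v', hv'⟩ := hq'.2.2 _ hδ3
  have hmP : 0 < m * P := by positivity
  have hmP' : 0 < m' * P := by positivity
  have e : (m : ℝ) * (m' * P) = m' * (m * P) := by ring
  obtain ⟨w, hw, h, hh, hf⟩ := (hv.mul_nat hmP m').exists_normalized hp hW hε hlam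
    (by positivity) hδ3
  have hv2 := hv'.mul_nat hmP' m
  rw [e] at hv2
  obtain ⟨w', hw', h', hh', hf'⟩ := hv2.exists_normalized hp hW hε hlam (by positivity) hδ3
  obtain ⟨k, hk, z, hz⟩ := Profile.exists_mix hp hWc hW hε hlam (by positivity) j₀ hw hw'
    (h := max h h') (lt_max_of_lt_left hh) (fun x hx => hf x ((le_max_left _ _).trans hx))
    (fun x hx => hf' x ((le_max_right _ _).trans hx)) hδ3
  have half : ∀ s t : ℝ, 0 ≤ s → 0 ≤ t →
      (ENNReal.ofReal (s + δ / 3) + ENNReal.ofReal (δ / 3)) / 2 +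
        (ENNReal.ofReal (t + δ / 3) + ENNReal.ofReal (δ / 3)) / 2 + ENNReal.ofReal (δ / 3) =
      ENNReal.ofReal (1 / 2 * (s + t) + δ) := by
    intro s t hs ht
    have h2 : (2 : ℝ≥0∞) = ENNReal.ofReal 2 := by simp
    rw [h2, ← ENNReal.ofReal_add (by positivity) hδ3.le,
      ← ENNReal.ofReal_add (by positivity) hδ3.le, ← ENNReal.ofReal_div_of_pos two_pos,
      ← ENNReal.ofReal_div_of_pos two_pos, ← ENNReal.ofReal_add (by positivity) (by positivity),
      ← ENNReal.ofReal_add (by positivity) hδ3.le]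
    congr 1
    ring
  rw [half _ _ hq.1 hq'.1, half _ _ hq.2.1 hq'.2.1] at hz
  refine ⟨k * (m' * m), by positivity, z, ?_⟩
  have e2 : ((k * (m' * m) : ℕ) : ℝ) * P = k * (m' * (m * P)) := by push_cast; ring
  rw [e2]
  exact hz

/-- The average of attainable pairs is attainable. For `n = 0` there is nothing to average. -/
theorem average_mem_attain {p C : ℝ} (hp : 2 ≤ p) (hWc : Continuous W) (hW : Comparable W a p C)
    (hε : 0 < ε) (hlam : lam ≤ 0) (hP : 0 < P) {Y : Set (Fin n → ℝ)} (hY0 : volume Y ≠ 0)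
    (hY : volume Y ≠ ⊤) {f : (Fin n → ℝ) → ℝ × ℝ}
    (hf : ∀ᵐ y ∂(volume.restrict Y), f y ∈ attain W a ε lam P) (hfi : IntegrableOn f Y) :
    ⨍ y in Y, f y ∈ attain W a ε lam P := by
  rcases Nat.eq_zero_or_pos n with rfl | hn
  · have := ae_restrict_neBot.2 hY0
    obtain ⟨y, hy⟩ := hf.exists
    have : f = fun _ => f y := funext fun z => congrArg f (Subsingleton.elim z y)
    rw [this, setAverage_const hY0 hY]
    exact hy
  · exact (convex_attain hp hWc hW hε hlam hP ⟨0, hn⟩).set_average_mem isClosed_attain hY0 hY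
      hf hfi

end Attain

/-! ### Folding the domain -/

section Fold

variable {d n : ℕ}

/-- The map `x ↦ (y + ρ(x_N) ψ(x'), θ(x_N))`, where `ψ` acts on each horizontal coordinate. -/
def foldMap (ρ θ ψ : ℝ → ℝ) (y : Fin n → ℝ) (x : Fin (n + 1) → ℝ) : Fin (n + 1) → ℝ :=
  Fin.snoc (α := fun _ => ℝ) (fun j => y j + ρ (x (Fin.last n)) * ψ (x j.castSucc))
    (θ (x (Fin.last n)))

@[simp] theorem foldMap_castSucc (ρ θ ψ : ℝ → ℝ) (y : Fin n → ℝ) (x : Fin (n + 1) → ℝ)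
    (i : Fin n) : foldMap ρ θ ψ y x i.castSucc = y i + ρ (x (Fin.last n)) * ψ (x i.castSucc) := by
  simp [foldMap]

@[simp] theorem foldMap_last (ρ θ ψ : ℝ → ℝ) (y : Fin n → ℝ) (x : Fin (n + 1) → ℝ) :
    foldMap ρ θ ψ y x (Fin.last n) = θ (x (Fin.last n)) := by
  simp [foldMap]

variable {ρ θ ψ : ℝ → ℝ} (y : Fin n → ℝ)

theorem smooth_foldMap (hρ : ContDiff ℝ ∞ ρ) (hθ : ContDiff ℝ ∞ θ) (hψ : ContDiff ℝ ∞ ψ) :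
    Smooth (foldMap ρ θ ψ y) := by
  intro l
  cases l using Fin.lastCases with
  | last =>
    simp only [foldMap_last]
    exact contDiff_coord hθ _
  | cast i =>
    simp only [foldMap_castSucc]
    exact contDiff_const.add ((contDiff_coord hρ _).mul (contDiff_coord hψ _))

theorem pd_coord_mul {f g : ℝ → ℝ} (hf : ContDiff ℝ ∞ f) (hg : ContDiff ℝ ∞ g)
    (j l m : Fin (n + 1)) :
    (pd j fun x => f (x l) * g (x m)) = fun x =>
      (if j = m then f (x l) * deriv g (x m) else 0) +
        (if j = l then deriv f (x l) * g (x m) else 0) := by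
  funext x
  rw [pd_mul (diffAt_of_contDiff (contDiff_coord hf l) x)
    (diffAt_of_contDiff (contDiff_coord hg m) x), pd_coord ((hf.differentiable (by simp)) _),
    pd_coord ((hg.differentiable (by simp)) _)]
  split_ifs <;> simp

theorem pd_foldMap_castSucc (hρ : ContDiff ℝ ∞ ρ) (hψ : ContDiff ℝ ∞ ψ) (i : Fin n)
    (j : Fin (n + 1)) : (pd j fun x => foldMap ρ θ ψ y x i.castSucc) = fun x =>
      (if j = i.castSucc then ρ (x (Fin.last n)) * deriv ψ (x i.castSucc) else 0) +
        (if j = Fin.last n then deriv ρ (x (Fin.last n)) * ψ (x i.castSucc) else 0) := by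
  rw [← pd_coord_mul hρ hψ]
  funext x
  simp only [foldMap_castSucc]
  rw [pd_add (differentiableAt_const _)
    (diffAt_of_contDiff ((contDiff_coord hρ _).mul (contDiff_coord hψ _)) x), pd_const, zero_add]

theorem pd_foldMap_last (hθ : ContDiff ℝ ∞ θ) (j : Fin (n + 1)) :
    (pd j fun x => foldMap ρ θ ψ y x (Fin.last n)) = fun x =>
      if j = Fin.last n then deriv θ (x (Fin.last n)) else 0 := by
  funext x
  simp only [foldMap_last]
  exact pd_coord ((hθ.differentiable (by simp)) _) j

/-- The differential of the fold map is a contraction if the horizontal fold is only faded out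
where the vertical variable is frozen. -/
theorem contr_grad_foldMap (hρ : ContDiff ℝ ∞ ρ) (hθ : ContDiff ℝ ∞ θ) (hψ : ContDiff ℝ ∞ ψ)
    {r : ℝ} (hψ0 : ∀ t, |ψ t| ≤ r) (hψ1 : ∀ t, |deriv ψ t| ≤ 1) {x : Fin (n + 1) → ℝ}
    (h0 : deriv ρ (x (Fin.last n)) = 0 ∨ deriv θ (x (Fin.last n)) = 0)
    (h1 : ρ (x (Fin.last n)) ^ 2 + deriv ρ (x (Fin.last n)) ^ 2 * (n * r ^ 2) ≤ 1)
    (h2 : deriv θ (x (Fin.last n)) ^ 2 ≤ 1) : Contr (grad (foldMap ρ θ ψ y) x) := by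
  intro h
  set R := ρ (x (Fin.last n))
  set R' := deriv ρ (x (Fin.last n))
  set T' := deriv θ (x (Fin.last n))
  have e1 : ∀ (i : Fin n) (k : Fin (n + 1)), grad (foldMap ρ θ ψ y) x i.castSucc k =
      (if k = i.castSucc then R * deriv ψ (x i.castSucc) else 0) +
        (if k = Fin.last n then R' * ψ (x i.castSucc) else 0) := fun i k =>
    congrFun (pd_foldMap_castSucc y hρ hψ i k) x
  have e2 : ∀ k : Fin (n + 1), grad (foldMap ρ θ ψ y) x (Fin.last n) k =
      if k = Fin.last n then T' else 0 := fun k => congrFun (pd_foldMap_last y hθ k) x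
  simp only [Fin.sum_univ_castSucc, e1, e2]
  simp only [Fin.castSucc_inj, Fin.castSucc_ne_last, if_true, if_false, add_zero, mul_zero,
    mul_ite, Finset.sum_ite_eq, Finset.mem_univ, (Fin.castSucc_ne_last _).symm, zero_add]
  set S := ∑ i : Fin n, h i.castSucc ^ 2
  have b1 : ∑ i : Fin n, (h i.castSucc * (R * deriv ψ (x i.castSucc))) ^ 2 ≤ R ^ 2 * S := by
    rw [Finset.mul_sum]
    refine Finset.sum_le_sum fun i _ => ?_
    have hd : deriv ψ (x i.castSucc) ^ 2 ≤ 1 := by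
      rw [← sq_abs]; exact pow_le_one₀ (abs_nonneg _) (hψ1 _)
    calc _ = R ^ 2 * h i.castSucc ^ 2 * deriv ψ (x i.castSucc) ^ 2 := by ring
      _ ≤ R ^ 2 * h i.castSucc ^ 2 * 1 := by gcongr
      _ = _ := mul_one _
  have b2 : (∑ i : Fin n, h i.castSucc * (R' * ψ (x i.castSucc))) ^ 2 ≤
      R' ^ 2 * (n * r ^ 2) * S := by
    refine (Finset.sum_mul_sq_le_sq_mul_sq _ _ _).trans ?_
    rw [mul_comm]
    refine mul_le_mul_of_nonneg_right ?_ (by positivity)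
    calc ∑ i : Fin n, (R' * ψ (x i.castSucc)) ^ 2 ≤ ∑ _i : Fin n, R' ^ 2 * r ^ 2 := by
          refine Finset.sum_le_sum fun i _ => ?_
          rw [mul_pow]
          gcongr R' ^ 2 * ?_
          rw [← sq_abs]
          gcongr
          exact hψ0 _
      _ = _ := by simp; ring
  have b3 : (h (Fin.last n) * T') ^ 2 ≤ h (Fin.last n) ^ 2 := by
    rw [mul_pow]
    exact mul_le_of_le_one_right (sq_nonneg _) h2
  -- since one of the two derivatives vanishes, the last column has no mixed term
  have hcross : (∑ i : Fin n, h i.castSucc * (R' * ψ (x i.castSucc))) *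
      (h (Fin.last n) * T') = 0 := by
    rcases h0 with h0 | h0 <;> simp [h0]
  have hS : 0 ≤ S := by positivity
  nlinarith [mul_le_mul_of_nonneg_right h1 hS]

theorem abs_hess_foldMap_le (hρ : ContDiff ℝ ∞ ρ) (hθ : ContDiff ℝ ∞ θ) (hψ : ContDiff ℝ ∞ ψ)
    {b : ℝ} {x : Fin (n + 1) → ℝ} (hb : 0 ≤ b)
    (h1 : ∀ i : Fin n, |ρ (x (Fin.last n)) * deriv (deriv ψ) (x i.castSucc)| ≤ b)
    (h2 : ∀ i : Fin n, |deriv ρ (x (Fin.last n)) * deriv ψ (x i.castSucc)| ≤ b)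
    (h3 : ∀ i : Fin n, |deriv (deriv ρ) (x (Fin.last n)) * ψ (x i.castSucc)| ≤ b)
    (h4 : |deriv (deriv θ) (x (Fin.last n))| ≤ b) (l j k : Fin (n + 1)) :
    |hess (foldMap ρ θ ψ y) x l j k| ≤ b := by
  have hρ' := contDiff_deriv hρ
  have hψ' := contDiff_deriv hψ
  cases l using Fin.lastCases with
  | last =>
    change |pd k (pd j fun x => foldMap ρ θ ψ y x (Fin.last n)) x| ≤ b
    rw [pd_foldMap_last y hθ]
    by_cases hj : j = Fin.last n
    · simp only [hj, if_true]
      rw [pd_coord (((contDiff_deriv hθ).differentiable (by simp)) _)]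
      split_ifs
      · exact h4
      · simpa using hb
    · simpa [hj] using hb
  | cast i =>
    change |pd k (pd j fun x => foldMap ρ θ ψ y x i.castSucc) x| ≤ b
    rw [pd_foldMap_castSucc y hρ hψ]
    have hne : i.castSucc ≠ Fin.last n := Fin.castSucc_ne_last i
    by_cases hj : j = i.castSucc
    · simp only [hj, hne, if_true, if_false, add_zero]
      rw [pd_coord_mul hρ hψ']
      by_cases hk : k = i.castSucc
      · simpa [hk, hne] using h1 i
      · by_cases hk' : k = Fin.last n
        · simpa [hk', hne.symm] using h2 i
        · simpa [hk, hk'] using hb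
    · by_cases hj' : j = Fin.last n
      · simp only [hj', hne.symm, if_true, if_false, zero_add]
        rw [pd_coord_mul hρ' hψ]
        by_cases hk : k = i.castSucc
        · simpa [hk, hne] using h2 i
        · by_cases hk' : k = Fin.last n
          · simpa [hk', hne.symm] using h3 i
          · simpa [hk, hk'] using hb
      · simpa [hj, hj'] using hb

/-- Chain rule for `u ∘ Φ + s (x_N - Φ_N) a`: subtracting the well `s a ⊗ e_N` from the gradients
removes the affine correction. -/
theorem grad_hess_comp_add {u v : (Fin (n + 1) → ℝ) → Fin d → ℝ}
    {Φ : (Fin (n + 1) → ℝ) → Fin (n + 1) → ℝ} (hu : Smooth u) (hΦ : Smooth Φ)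
    {x : Fin (n + 1) → ℝ} {s : ℝ} {a : Fin d → ℝ}
    (hv : v =ᶠ[𝓝 x] fun z => u (Φ z) + (s * (z (Fin.last n) - Φ z (Fin.last n))) • a) :
    grad v x - s • well n a =
        (fun i j => ∑ l, (grad u (Φ x) - s • well n a) i l * grad Φ x l j) ∧
      hess v x = fun i j k =>
        (∑ l, (∑ m, hess u (Φ x) i l m * grad Φ x m k) * grad Φ x l j) +
          ∑ l, (grad u (Φ x) - s • well n a) i l * hess Φ x l j k := by
  have hlin : ∀ c : ℝ, ContDiff ℝ ∞ fun t : ℝ => c * t := fun c => by fun_prop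
  have hcm : ∀ c : ℝ, Smooth (n := n) (coordMap (Fin.last n) (fun t => c * t) a) := fun c =>
    smooth_coordMap (hlin c) _ a
  have hder : ∀ c : ℝ, deriv (fun t : ℝ => c * t) = fun _ => c := fun c => by funext t; simp
  have hgc : ∀ (c : ℝ) (z : Fin (n + 1) → ℝ),
      grad (coordMap (Fin.last n) (fun t => c * t) a) z = c • well n a := by
    intro c z
    rw [grad_coordMap (hlin c), hder]
    funext i j
    change _ = c * well n a i j
    simp [well, Matrix.vecMulVec_apply, Pi.single_apply]
  have hhc : ∀ (c : ℝ) (z : Fin (n + 1) → ℝ),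
      hess (coordMap (Fin.last n) (fun t => c * t) a) z = fun _ _ _ => 0 := by
    intro c z
    rw [hess_coordMap (hlin c), hder]
    funext i j k
    simp
  let w : (Fin (n + 1) → ℝ) → Fin d → ℝ := fun z =>
    u z + coordMap (Fin.last n) (fun t => -s * t) a z
  have hw : Smooth w := hu.add (hcm _)
  have hgw : ∀ z, grad w z = grad u z - s • well n a := fun z => by
    rw [grad_add hu (hcm _), hgc, neg_smul, sub_eq_add_neg]
  have hhw : ∀ z, hess w z = hess u z := fun z => by
    rw [hess_add hu (hcm _), hhc]; simp
  have hv' : v =ᶠ[𝓝 x] fun z => w (Φ z) + coordMap (Fin.last n) (fun t => s * t) a z := by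
    filter_upwards [hv] with z hz
    rw [hz]
    simp only [w, coordMap]
    module
  constructor
  · rw [grad_congr hv', grad_add (hw.comp hΦ) (hcm _), hgc, add_sub_cancel_right,
      grad_comp hw hΦ, hgw]
  · rw [hess_congr hv', hess_add (hw.comp hΦ) (hcm _), hhc, hess_comp hw hΦ, hgw, hhw]
    simp

end Fold

/-! ### The fold in the vertical variable -/

section Bend

/-- A smooth odd truncation of the identity at height about `s`: the identity on `[-s, s]` and
constant for `t ≥ s + 2 ε` and for `t ≤ -(s + 2 ε)`. -/
def bend (ε s t : ℝ) : ℝ := t - drop ε (t - s) + drop ε (-t - s)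

theorem bend_neg (ε s t : ℝ) : bend ε s (-t) = -bend ε s t := by
  simp only [bend, neg_neg]
  ring

theorem contDiff_bend (ε s : ℝ) : ContDiff ℝ ∞ (bend ε s) :=
  (contDiff_id.sub ((contDiff_drop ε).comp (contDiff_id.sub contDiff_const))).add
    ((contDiff_drop ε).comp (contDiff_neg.sub contDiff_const))

variable {ε s t : ℝ}

theorem sub_bend_of_gt (hε : 0 < ε) (ht : -s ≤ t) : t - bend ε s t = drop ε (t - s) := by
  rw [bend, drop_of_nonpos hε (show -t - s ≤ 0 by linarith)]
  ring

theorem bend_of_mem (hε : 0 < ε) (ht : |t| ≤ s) : bend ε s t = t := by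
  rw [abs_le] at ht
  have h := sub_bend_of_gt hε ht.1
  rw [drop_of_nonpos hε (by linarith)] at h
  linarith

theorem hasDerivAt_bend (ε s t : ℝ) : HasDerivAt (bend ε s)
    (1 - Real.smoothTransition ((2 * ε)⁻¹ * (t - s)) -
      Real.smoothTransition ((2 * ε)⁻¹ * (-t - s))) t := by
  have h1 := (hasDerivAt_drop ε (t - s)).comp t ((hasDerivAt_id t).sub_const s)
  have h2 := (hasDerivAt_drop ε (-t - s)).comp t ((hasDerivAt_neg t).sub_const s)
  refine (((hasDerivAt_id t).sub h1).add h2).congr_deriv ?_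
  ring

theorem deriv_bend_sq_le (ε s t : ℝ) : deriv (bend ε s) t ^ 2 ≤ 1 := by
  rw [(hasDerivAt_bend ε s t).deriv]
  have h1 := Real.smoothTransition.nonneg ((2 * ε)⁻¹ * (t - s))
  have h2 := Real.smoothTransition.le_one ((2 * ε)⁻¹ * (t - s))
  have h3 := Real.smoothTransition.nonneg ((2 * ε)⁻¹ * (-t - s))
  have h4 := Real.smoothTransition.le_one ((2 * ε)⁻¹ * (-t - s))
  rw [sq_le_one_iff_abs_le_one, abs_le]
  constructor <;> linarith

theorem bend_of_ge (hε : 0 < ε) (hs : 0 < s) (ht : s + 2 * ε ≤ t) :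
    bend ε s t = s + (2 * ε - drop ε (2 * ε)) := by
  have h1 := sub_bend_of_gt hε (show -s ≤ t by linarith)
  have h2 := sub_drop_of_ge hε (show 2 * ε ≤ t - s by linarith)
  linarith

theorem bend_mem (hε : 0 < ε) (hs : 0 < s) (ht : s ≤ t) :
    bend ε s t ∈ Set.Icc s (s + 2 * ε) := by
  have h1 := sub_bend_of_gt hε (show -s ≤ t by linarith)
  have h2 := sub_drop_mem hε (show 0 ≤ t - s by linarith)
  constructor <;> linarith [h2.1, h2.2]

/-- Beyond `s + 2 ε` the truncation is locally constant. -/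
theorem bend_eventually_const (hε : 0 < ε) (hs : 0 < s) (ht : s + 2 * ε < |t|) :
    ∃ c, bend ε s =ᶠ[𝓝 t] fun _ => c := by
  rcases lt_abs.1 ht with h | h
  · refine ⟨s + (2 * ε - drop ε (2 * ε)), ?_⟩
    filter_upwards [lt_mem_nhds h] with τ hτ using bend_of_ge hε hs hτ.le
  · refine ⟨-(s + (2 * ε - drop ε (2 * ε))), ?_⟩
    filter_upwards [gt_mem_nhds (show t < -(s + 2 * ε) by linarith)] with τ hτ
    rw [← bend_of_ge hε hs (show s + 2 * ε ≤ -τ by linarith), bend_neg, neg_neg]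

theorem deriv_of_eventually_const {f : ℝ → ℝ} {c : ℝ} (h : f =ᶠ[𝓝 t] fun _ => c) :
    deriv f t = 0 ∧ deriv (deriv f) t = 0 := by
  have h1 : deriv f =ᶠ[𝓝 t] fun _ => 0 := by
    refine h.deriv.trans ?_
    simp
  exact ⟨h1.eq_of_nhds, by rw [h1.deriv_eq]; simp⟩

theorem exists_bound_deriv_bend :
    ∃ K : ℝ, 0 ≤ K ∧ ∀ ε > 0, ∀ s t, |deriv (deriv (bend ε s)) t| ≤ K / ε := by
  obtain ⟨K, hK0, hK⟩ := exists_bound_deriv_drop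
  refine ⟨2 * K, by positivity, fun ε hε s t => ?_⟩
  have hd := contDiff_deriv (contDiff_drop ε)
  have e1 : deriv (bend ε s) = fun t => 1 - deriv (drop ε) (t - s) - deriv (drop ε) (-t - s) := by
    funext t
    rw [(hasDerivAt_bend ε s t).deriv, deriv_drop]
  have hd' : ∀ t, HasDerivAt (deriv (drop ε)) (deriv (deriv (drop ε)) t) t := fun t =>
    ((hd.differentiable (by simp)) t).hasDerivAt
  have h1 := (hd' (t - s)).comp t ((hasDerivAt_id t).sub_const s)
  have h2 := (hd' (-t - s)).comp t ((hasDerivAt_neg t).sub_const s)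
  have h3 : HasDerivAt (deriv (bend ε s))
      (deriv (deriv (drop ε)) (-t - s) - deriv (deriv (drop ε)) (t - s)) t := by
    rw [e1]
    exact (((hasDerivAt_const t (1 : ℝ)).sub h1).sub h2).congr_deriv (by ring)
  rw [h3.deriv]
  refine (abs_sub _ _).trans ?_
  have h4 := hK ε hε (t - s)
  have h5 := hK ε hε (-t - s)
  rw [mul_div_assoc]
  linarith

/-- The square of the smooth transition; its derivative is dominated by its square root. -/
def ramp (t : ℝ) : ℝ := Real.smoothTransition t ^ 2

theorem contDiff_ramp : ContDiff ℝ ∞ ramp := Real.smoothTransition.contDiff.pow 2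

theorem contDiff_smoothTransition : ContDiff ℝ ∞ Real.smoothTransition :=
  Real.smoothTransition.contDiff

theorem deriv_ramp :
    deriv ramp = fun t => 2 * Real.smoothTransition t * deriv Real.smoothTransition t := by
  funext t
  have h : HasDerivAt Real.smoothTransition (deriv Real.smoothTransition t) t :=
    (contDiff_smoothTransition.differentiable (by simp) t).hasDerivAt
  have h2 : HasDerivAt ramp _ t := h.pow 2
  rw [h2.deriv]
  norm_num

theorem exists_bound_deriv_ramp :
    ∃ K : ℝ, 1 ≤ K ∧ (∀ t, |deriv ramp t| ≤ K * Real.smoothTransition t) ∧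
      (∀ t, |deriv ramp t| ≤ K) ∧ ∀ t, |deriv (deriv ramp) t| ≤ K := by
  obtain ⟨K, hK1, hK⟩ := exists_bound_deriv_smoothTransition
  have hs0 := Real.smoothTransition.nonneg
  have hs1 := Real.smoothTransition.le_one
  have hc := contDiff_deriv (contDiff_smoothTransition)
  have h1 : ∀ t, |deriv ramp t| ≤ 2 * K * Real.smoothTransition t := fun t => by
    rw [deriv_ramp, abs_mul, abs_mul, abs_of_nonneg (hs0 t), abs_two]
    nlinarith [(hK t).1, hs0 t]
  refine ⟨2 * (K ^ 2 + K), by nlinarith, fun t => (h1 t).trans ?_, fun t => (h1 t).trans ?_,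
    fun t => ?_⟩
  · have := hs0 t
    gcongr
    nlinarith
  · nlinarith [hs0 t, hs1 t]
  · have e1 : HasDerivAt Real.smoothTransition (deriv Real.smoothTransition t) t :=
      (contDiff_smoothTransition.differentiable (by simp) t).hasDerivAt
    have e2 : HasDerivAt (deriv Real.smoothTransition) (deriv (deriv Real.smoothTransition) t) t :=
      (hc.differentiable (by simp) t).hasDerivAt
    have e3 : HasDerivAt (deriv ramp)
        (2 * deriv Real.smoothTransition t * deriv Real.smoothTransition t +
          2 * Real.smoothTransition t * deriv (deriv Real.smoothTransition) t) t := by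
      rw [deriv_ramp]
      exact (e1.const_mul 2).mul e2
    rw [e3.deriv]
    have hd := (hK t).1
    have hdd := (hK t).2
    have := hs0 t
    have := hs1 t
    calc _ ≤ |2 * deriv Real.smoothTransition t * deriv Real.smoothTransition t| +
          |2 * Real.smoothTransition t * deriv (deriv Real.smoothTransition) t| := abs_add_le _ _
      _ = 2 * (|deriv Real.smoothTransition t| * |deriv Real.smoothTransition t|) +
          2 * (Real.smoothTransition t * |deriv (deriv Real.smoothTransition) t|) := by
          rw [abs_mul, abs_mul, abs_mul, abs_mul, abs_two, abs_of_nonneg (hs0 t)]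
          ring
      _ ≤ 2 * (K * K) + 2 * (1 * K) := by gcongr
      _ = _ := by ring

/-- A smooth even cutoff, equal to one on `[-c, c]` and to zero off `(-(c + l), c + l)`. -/
def fade (c l t : ℝ) : ℝ := 1 - ramp (l⁻¹ * (t - c)) - ramp (l⁻¹ * (-t - c))

variable {c l : ℝ}

theorem contDiff_fade (c l : ℝ) : ContDiff ℝ ∞ (fade c l) :=
  (contDiff_const.sub (contDiff_ramp.comp (by fun_prop))).sub (contDiff_ramp.comp (by fun_prop))

theorem ramp_of_nonpos (ht : t ≤ 0) : ramp t = 0 := by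
  rw [ramp, Real.smoothTransition.zero_of_nonpos ht]
  norm_num

theorem ramp_of_one_le (ht : 1 ≤ t) : ramp t = 1 := by
  rw [ramp, Real.smoothTransition.one_of_one_le ht]
  norm_num

theorem deriv_ramp_of_nonpos (ht : t ≤ 0) : deriv ramp t = 0 := by
  rw [deriv_ramp]
  simp [Real.smoothTransition.zero_of_nonpos ht]

theorem hasDerivAt_fade (c l t : ℝ) : HasDerivAt (fade c l)
    (l⁻¹ * (deriv ramp (l⁻¹ * (-t - c)) - deriv ramp (l⁻¹ * (t - c)))) t := by
  have hd : ∀ t, HasDerivAt ramp (deriv ramp t) t := fun t =>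
    (contDiff_ramp.differentiable (by simp) t).hasDerivAt
  have h1 := (hd (l⁻¹ * (t - c))).comp t (((hasDerivAt_id t).sub_const c).const_mul l⁻¹)
  have h2 := (hd (l⁻¹ * (-t - c))).comp t (((hasDerivAt_neg t).sub_const c).const_mul l⁻¹)
  refine (((hasDerivAt_const t (1 : ℝ)).sub h1).sub h2).congr_deriv ?_
  ring

theorem fade_of_mem (hl : 0 < l) (ht : |t| ≤ c) : fade c l t = 1 ∧ deriv (fade c l) t = 0 := by
  rw [abs_le] at ht
  have h1 : l⁻¹ * (t - c) ≤ 0 := mul_nonpos_of_nonneg_of_nonpos (by positivity) (by linarith)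
  have h2 : l⁻¹ * (-t - c) ≤ 0 := mul_nonpos_of_nonneg_of_nonpos (by positivity) (by linarith)
  rw [(hasDerivAt_fade c l t).deriv, fade, ramp_of_nonpos h1, ramp_of_nonpos h2,
    deriv_ramp_of_nonpos h1, deriv_ramp_of_nonpos h2]
  norm_num

theorem fade_of_ge (hc : 0 < c) (hl : 0 < l) (ht : c + l ≤ |t|) : fade c l t = 0 := by
  rcases le_abs.1 ht with h | h
  · have h1 : 1 ≤ l⁻¹ * (t - c) := by rw [le_inv_mul_iff₀ hl]; linarith
    have h2 : l⁻¹ * (-t - c) ≤ 0 := mul_nonpos_of_nonneg_of_nonpos (by positivity) (by linarith)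
    rw [fade, ramp_of_one_le h1, ramp_of_nonpos h2]
    norm_num
  · have h1 : 1 ≤ l⁻¹ * (-t - c) := by rw [le_inv_mul_iff₀ hl]; linarith
    have h2 : l⁻¹ * (t - c) ≤ 0 := mul_nonpos_of_nonneg_of_nonpos (by positivity) (by linarith)
    rw [fade, ramp_of_one_le h1, ramp_of_nonpos h2]
    norm_num

/-- The trade-off between the cutoff and its slope that keeps the faded fold a contraction. -/
theorem fade_sq_add_le {K M : ℝ}
    (hK : ∀ t, |deriv ramp t| ≤ K * Real.smoothTransition t) (hc : 0 < c) (hl : 0 < l)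
    (hM : 0 ≤ M) (h : K ^ 2 * M ≤ l ^ 2) (t : ℝ) :
    fade c l t ^ 2 + deriv (fade c l) t ^ 2 * M ≤ 1 := by
  -- with `σ = smoothTransition`, the estimate reduces to `(1 - σ ^ 2) ^ 2 + σ ^ 2 ≤ 1`
  have key : ∀ τ : ℝ, (1 - ramp τ) ^ 2 + (l⁻¹ * deriv ramp τ) ^ 2 * M ≤ 1 := by
    intro τ
    have h0 := Real.smoothTransition.nonneg τ
    have h1 := Real.smoothTransition.le_one τ
    have h2 : deriv ramp τ ^ 2 ≤ (K * Real.smoothTransition τ) ^ 2 := by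
      rw [← sq_abs]
      exact pow_le_pow_left₀ (abs_nonneg _) (hK τ) 2
    have h3 : l⁻¹ ^ 2 * (K ^ 2 * M) ≤ 1 := by
      rw [inv_pow, inv_mul_le_iff₀ (by positivity)]
      linarith
    have h4 : (l⁻¹ * deriv ramp τ) ^ 2 * M ≤ Real.smoothTransition τ ^ 2 := by
      calc (l⁻¹ * deriv ramp τ) ^ 2 * M = l⁻¹ ^ 2 * M * deriv ramp τ ^ 2 := by ring
        _ ≤ l⁻¹ ^ 2 * M * (K * Real.smoothTransition τ) ^ 2 := by gcongr
        _ = l⁻¹ ^ 2 * (K ^ 2 * M) * Real.smoothTransition τ ^ 2 := by ring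
        _ ≤ 1 * Real.smoothTransition τ ^ 2 := by gcongr
        _ = _ := one_mul _
    have h5 : Real.smoothTransition τ ^ 2 ≤ 1 := pow_le_one₀ h0 h1
    rw [ramp]
    nlinarith [sq_nonneg (Real.smoothTransition τ)]
  rw [(hasDerivAt_fade c l t).deriv, fade]
  rcases le_total 0 t with ht | ht
  · have h2 : l⁻¹ * (-t - c) ≤ 0 := mul_nonpos_of_nonneg_of_nonpos (by positivity) (by linarith)
    rw [ramp_of_nonpos h2, deriv_ramp_of_nonpos h2]
    have := key (l⁻¹ * (t - c))
    linarith
  · have h2 : l⁻¹ * (t - c) ≤ 0 := mul_nonpos_of_nonneg_of_nonpos (by positivity) (by linarith)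
    rw [ramp_of_nonpos h2, deriv_ramp_of_nonpos h2]
    have := key (l⁻¹ * (-t - c))
    linarith

theorem abs_deriv_fade_le {K : ℝ} (hK : ∀ t, |deriv ramp t| ≤ K)
    (hK2 : ∀ t, |deriv (deriv ramp) t| ≤ K) (hl : 0 < l) (c t : ℝ) :
    |deriv (fade c l) t| ≤ 2 * K / l ∧ |deriv (deriv (fade c l)) t| ≤ 2 * K / l ^ 2 := by
  have e1 : deriv (fade c l) = fun t =>
      l⁻¹ * (deriv ramp (l⁻¹ * (-t - c)) - deriv ramp (l⁻¹ * (t - c))) :=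
    funext fun t => (hasDerivAt_fade c l t).deriv
  constructor
  · rw [e1, abs_mul, abs_of_pos (inv_pos.2 hl), div_eq_inv_mul]
    gcongr
    refine (abs_sub _ _).trans ?_
    linarith [hK (l⁻¹ * (-t - c)), hK (l⁻¹ * (t - c))]
  · have hd : ∀ t, HasDerivAt (deriv ramp) (deriv (deriv ramp) t) t := fun t =>
      ((contDiff_deriv contDiff_ramp).differentiable (by simp) t).hasDerivAt
    have h1 := (hd (l⁻¹ * (t - c))).comp t (((hasDerivAt_id t).sub_const c).const_mul l⁻¹)
    have h2 := (hd (l⁻¹ * (-t - c))).comp t (((hasDerivAt_neg t).sub_const c).const_mul l⁻¹)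
    have h3 : HasDerivAt (deriv (fade c l))
        (-(l ^ 2)⁻¹ * (deriv (deriv ramp) (l⁻¹ * (-t - c)) +
          deriv (deriv ramp) (l⁻¹ * (t - c)))) t := by
      rw [e1]
      refine ((h2.sub h1).const_mul l⁻¹).congr_deriv ?_
      field_simp
      ring
    rw [h3.deriv, abs_mul, abs_neg, abs_of_pos (by positivity), div_eq_inv_mul]
    gcongr
    refine (abs_add_le _ _).trans ?_
    linarith [hK2 (l⁻¹ * (-t - c)), hK2 (l⁻¹ * (t - c))]

end Bend

section Folded

variable {d n : ℕ}

/-- The fold map used in the construction: reflections in a grid of width `r` for `|x_N| ≤ s`, a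
freezing of `x_N` on layers of width `2 ε`, and then a fading of the horizontal variables. -/
def foldOf (ε s r l η : ℝ) (y : Fin n → ℝ) : (Fin (n + 1) → ℝ) → Fin (n + 1) → ℝ :=
  foldMap (fade (s + 2 * ε) l) (bend ε s) (tent η r) y

theorem smooth_foldOf (ε s r l η : ℝ) (y : Fin n → ℝ) : Smooth (foldOf ε s r l η y) :=
  smooth_foldMap y (contDiff_fade _ _) (contDiff_bend _ _) (contDiff_tent _ _)

/-- The fold map is a contraction, with second derivatives of order `1 / ε` on the freezing layers
and of order `1 / r` elsewhere. The fading layers have width `L r`; the constant `L` depends on the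
dimension only, while `β` may depend on the smoothing parameter `η`. -/
def FoldBounds (n : ℕ) (L η β : ℝ) : Prop :=
  ∀ (r ε s : ℝ) (y : Fin n → ℝ) (x : Fin (n + 1) → ℝ), 0 < r → 0 < ε → ε ≤ r → 0 < s →
    Contr (grad (foldOf ε s r (L * r) η y) x) ∧
    (∀ l j k, |hess (foldOf ε s r (L * r) η y) x l j k| ≤ β / ε) ∧
    (|x (Fin.last n)| < s ∨ s + 2 * ε < |x (Fin.last n)| →
      ∀ l j k, |hess (foldOf ε s r (L * r) η y) x l j k| ≤ β / r)

/-- Fading the horizontal variables, which are of size `r`, over a height `L r` with `L` large keeps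
the fold map a contraction. -/
theorem exists_foldBounds (n : ℕ) :
    ∃ L : ℝ, 1 ≤ L ∧ ∀ η : ℝ, ∃ β : ℝ, 0 ≤ β ∧ FoldBounds n L η β := by
  obtain ⟨K, hK1, hKa, hKb, hKc⟩ := exists_bound_deriv_ramp
  obtain ⟨Kb, hKb0, hbend⟩ := exists_bound_deriv_bend
  refine ⟨K * (n + 1), by nlinarith [(Nat.cast_nonneg n : (0 : ℝ) ≤ n)], fun η => ?_⟩
  obtain ⟨Kw, hKw0, hw⟩ := exists_bound_deriv_wave η
  refine ⟨Kw + 2 * K + Kb, by positivity, fun r ε s y x hr hε hεr hs => ?_⟩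
  have hn : (0 : ℝ) ≤ n := Nat.cast_nonneg n
  have hL1 : 1 ≤ K * (n + 1) := by nlinarith
  set l := K * (n + 1) * r with hl
  have hrl : r ≤ l := by rw [hl]; nlinarith
  have hl0 : 0 < l := by linarith
  have hc0 : 0 < s + 2 * ε := by linarith
  set t := x (Fin.last n) with ht
  have hfade := fade_sq_add_le hKa hc0 hl0 (M := n * r ^ 2) (by positivity) (by
    have h1 : (n : ℝ) ≤ (n + 1) ^ 2 := by nlinarith
    calc K ^ 2 * (n * r ^ 2) ≤ K ^ 2 * ((n + 1) ^ 2 * r ^ 2) := by gcongr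
      _ = l ^ 2 := by rw [hl]; ring) t
  have hf1 : |fade (s + 2 * ε) l t| ≤ 1 := by
    rw [← sq_le_one_iff_abs_le_one]
    nlinarith [mul_nonneg (sq_nonneg (deriv (fade (s + 2 * ε) l) t)) (by positivity :
      (0 : ℝ) ≤ n * r ^ 2)]
  obtain ⟨hf2, hf3⟩ := abs_deriv_fade_le hKb hKc hl0 (s + 2 * ε) t
  have q1 : ∀ i : Fin n, |fade (s + 2 * ε) l t * deriv (deriv (tent η r)) (x i.castSucc)| ≤
      (Kw + 2 * K) / r := fun i => by
    rw [deriv_tent, abs_mul]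
    calc _ ≤ 1 * (Kw / r) := mul_le_mul hf1 (hw r hr _).1 (abs_nonneg _) zero_le_one
      _ ≤ _ := by rw [one_mul]; gcongr; linarith
  have q2 : ∀ i : Fin n, |deriv (fade (s + 2 * ε) l) t * deriv (tent η r) (x i.castSucc)| ≤
      (Kw + 2 * K) / r := fun i => by
    rw [deriv_tent, abs_mul]
    calc _ ≤ 2 * K / l * 1 := mul_le_mul hf2 (abs_wave_le _ _ _) (abs_nonneg _) (by positivity)
      _ ≤ (Kw + 2 * K) / r := by rw [mul_one]; gcongr; linarith
  have q3 : ∀ i : Fin n, |deriv (deriv (fade (s + 2 * ε) l)) t * tent η r (x i.castSucc)| ≤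
      (Kw + 2 * K) / r := fun i => by
    rw [abs_mul]
    calc _ ≤ 2 * K / l ^ 2 * r := mul_le_mul hf3 (abs_tent_le _ hr _) (abs_nonneg _) (by positivity)
      _ ≤ 2 * K / r ^ 2 * r := by gcongr
      _ = 2 * K / r := by field_simp
      _ ≤ (Kw + 2 * K) / r := by gcongr; linarith
  have hle : (Kw + 2 * K) / r ≤ (Kw + 2 * K + Kb) / ε :=
    div_le_div₀ (by positivity) (by linarith) hε hεr
  have hle' : (Kw + 2 * K) / r ≤ (Kw + 2 * K + Kb) / r :=
    div_le_div₀ (by positivity) (by linarith) hr le_rfl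
  have hc1 := contDiff_fade (s + 2 * ε) l
  have hc2 := contDiff_bend ε s
  have hc3 := contDiff_tent η r
  refine ⟨?_, ?_, fun h => ?_⟩
  · refine contr_grad_foldMap y hc1 hc2 hc3 (abs_tent_le η hr) (fun t => ?_) ?_ hfade
      (deriv_bend_sq_le ε s t)
    · rw [deriv_tent]; exact abs_wave_le _ _ _
    · rcases le_or_gt |t| (s + 2 * ε) with h | h
      · exact Or.inl (fade_of_mem hl0 h).2
      · obtain ⟨c, hc⟩ := bend_eventually_const hε hs h
        exact Or.inr (deriv_of_eventually_const hc).1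
  · refine abs_hess_foldMap_le y hc1 hc2 hc3 (by positivity) (fun i => (q1 i).trans hle)
      (fun i => (q2 i).trans hle) (fun i => (q3 i).trans hle) ((hbend ε hε s t).trans ?_)
    gcongr; linarith
  · refine abs_hess_foldMap_le y hc1 hc2 hc3 (by positivity) (fun i => (q1 i).trans hle')
      (fun i => (q2 i).trans hle') (fun i => (q3 i).trans hle') ?_
    have h0 : deriv (deriv (bend ε s)) t = 0 := by
      rcases h with h | h
      · have hev : bend ε s =ᶠ[𝓝 t] id := by
          filter_upwards [continuous_abs.continuousAt.eventually (gt_mem_nhds h)] with τ hτ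
          exact bend_of_mem hε (le_of_lt hτ)
        rw [hev.deriv.deriv_eq]
        simp
      · obtain ⟨c, hc⟩ := bend_eventually_const hε hs h
        exact (deriv_of_eventually_const hc).2
    rw [← ht, h0, abs_zero]
    positivity

/-- The error density at a point of the transition zones of the construction, in terms of the
distance `t` of the gradient from a well and of the modulus `h` of the second gradient. -/
def excess (C p ε b t h : ℝ) : ℝ := C / ε * t ^ p + 2 * ε * (h + b * t) ^ 2 + b * t

/-- Upper bound for both densities at the kinks and on the fading layers. -/
def kinkDen (C p : ℝ) (a : Fin d → ℝ) (ε lam b : ℝ) (u : (Fin (n + 1) → ℝ) → Fin d → ℝ)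
    (z : Fin (n + 1) → ℝ) : ℝ≥0∞ :=
  ENNReal.ofReal (excess C p ε b (wellDist a (grad u z)) (hessNorm (hess u z))) + gden lam u z

/-- The distance of the gradient from the well of the half space in which the point lies. -/
def sideDist (a : Fin d → ℝ) (u : (Fin (n + 1) → ℝ) → Fin d → ℝ) (z : Fin (n + 1) → ℝ) : ℝ :=
  matNorm (grad u z - (if 0 ≤ z (Fin.last n) then (1 : ℝ) else -1) • well n a)

/-- Upper bound for both densities on the freezing layers. -/
def layerDen (C p : ℝ) (a : Fin d → ℝ) (ε lam b : ℝ) (u : (Fin (n + 1) → ℝ) → Fin d → ℝ)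
    (z : Fin (n + 1) → ℝ) : ℝ≥0∞ :=
  ENNReal.ofReal (excess C p ε b (sideDist a u z) (hessNorm (hess u z))) + gden lam u z

variable {W : Matrix (Fin d) (Fin (n + 1)) ℝ → ℝ≥0} {a : Fin d → ℝ} {p C ε lam : ℝ}

/-- Densities of `u ∘ Φ + s (x_N - Φ_N) a` for a contraction `Φ`. The distance from the other well,
`t = -s`, may be used where `Φ_N` is constant to second order. -/
theorem densities_comp_le (hp : 2 ≤ p) (hW : Comparable W a p C) (hε : 0 < ε)
    {u v : (Fin (n + 1) → ℝ) → Fin d → ℝ}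
    {Φ : (Fin (n + 1) → ℝ) → Fin (n + 1) → ℝ} (hu : Smooth u) (hΦ : Smooth Φ)
    {x : Fin (n + 1) → ℝ} {s t : ℝ} (hs : s = 1 ∨ s = -1)
    (hv : v =ᶠ[𝓝 x] fun z => u (Φ z) + (s * (z (Fin.last n) - Φ z (Fin.last n))) • a)
    (hst : s = t ∨ (∀ j, grad Φ x (Fin.last n) j = 0) ∧ ∀ j k, hess Φ x (Fin.last n) j k = 0)
    (hA : Contr (grad Φ x)) {b : ℝ} (hb : 0 ≤ b) (hB : ∀ l j k, |hess Φ x l j k| ≤ b) :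
    eden W ε lam v x ≤ ENNReal.ofReal (excess C p ε ((n + 1) ^ 2 * b)
        (matNorm (grad u (Φ x) - t • well n a)) (hessNorm (hess u (Φ x)))) + gden lam u (Φ x) ∧
      gden lam v x ≤ ENNReal.ofReal (excess C p ε ((n + 1) ^ 2 * b)
        (matNorm (grad u (Φ x) - t • well n a)) (hessNorm (hess u (Φ x)))) + gden lam u (Φ x) := by
  have hC := hW.one_le
  obtain ⟨e1, e2⟩ := grad_hess_comp_add hu hΦ hv
  have hchange : ∀ B : Fin (n + 1) → ℝ, (s = t ∨ B (Fin.last n) = 0) → ∀ i,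
      ∑ l, (grad u (Φ x) - s • well n a) i l * B l =
        ∑ l, (grad u (Φ x) - t • well n a) i l * B l := by
    rintro B (rfl | h0) i
    · rfl
    · refine Finset.sum_congr rfl fun l _ => ?_
      cases l using Fin.lastCases with
      | last => rw [h0, mul_zero, mul_zero]
      | cast j =>
        congr 1
        change grad u (Φ x) i j.castSucc - s * well n a i j.castSucc =
          grad u (Φ x) i j.castSucc - t * well n a i j.castSucc
        simp [well, Matrix.vecMulVec_apply]
  set D := matNorm (grad u (Φ x) - t • well n a) with hD
  set h := hessNorm (hess u (Φ x)) with hh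
  have hD0 : 0 ≤ D := matNorm_nonneg _
  have hh0 : 0 ≤ h := hessNorm_nonneg _
  have m1 : matNorm (grad v x - s • well n a) ≤ D := by
    rw [e1]
    have : (fun i j => ∑ l, (grad u (Φ x) - s • well n a) i l * grad Φ x l j) =
        fun i j => ∑ l, (grad u (Φ x) - t • well n a) i l * grad Φ x l j := by
      funext i j
      exact hchange (fun l => grad Φ x l j) (hst.imp_right fun h => h.1 j) i
    rw [this]
    exact hA.matNorm_le _
  have m2 : hessNorm (hess v x) ≤ h + (n + 1) ^ 2 * b * D := by
    rw [e2]
    refine (hessNorm_add_le _ _).trans (add_le_add (hA.hessNorm_le _) ?_)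
    have : (fun i j k => ∑ l, (grad u (Φ x) - s • well n a) i l * hess Φ x l j k) =
        fun i j k => ∑ l, (grad u (Φ x) - t • well n a) i l * hess Φ x l j k := by
      funext i j k
      exact hchange (fun l => hess Φ x l j k) (hst.imp_right fun h => h.2 j k) i
    rw [this]
    exact hessNorm_contract_le hb hB _
  constructor
  · refine (hW.eden_le hp hs hε lam m1 m2).trans
      ((ENNReal.ofReal_le_ofReal ?_).trans le_self_add)
    rw [excess]
    linarith [show 0 ≤ (n + 1) ^ 2 * b * D by positivity]
  · rw [gden, gden, ← ENNReal.ofReal_add (by rw [excess]; positivity) (le_max_right _ _)]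
    refine ENNReal.ofReal_le_ofReal ?_
    have h3 : (n + 1) ^ 2 * b * D ≤ excess C p ε ((n + 1) ^ 2 * b) D h := by
      rw [excess]
      exact le_add_of_nonneg_left (by positivity)
    have h4 : 0 ≤ (n + 1) ^ 2 * b * D := by positivity
    refine max_le ?_ (add_nonneg (h4.trans h3) (le_max_right _ _))
    linarith [le_max_left (lam + h) 0]

/-- Reflections in the horizontal variables preserve both densities. -/
theorem densities_comp_eq (h4 : H4 W)
    {u v : (Fin (n + 1) → ℝ) → Fin d → ℝ}
    {Φ : (Fin (n + 1) → ℝ) → Fin (n + 1) → ℝ} (hu : Smooth u) (hΦ : Smooth Φ)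
    {x : Fin (n + 1) → ℝ} (hv : v =ᶠ[𝓝 x] fun z => u (Φ z)) {σ : Fin (n + 1) → ℝ}
    (hσ : ∀ j, σ j = 1 ∨ σ j = -1) (hA : ∀ l j, grad Φ x l j = if j = l then σ l else 0)
    (hB : ∀ l j k, hess Φ x l j k = 0) :
    eden W ε lam v x = eden W ε lam u (Φ x) ∧ gden lam v x = gden lam u (Φ x) := by
  have e1 : grad v x = fun i j => grad u (Φ x) i j * σ j := by
    rw [grad_congr hv, grad_comp hu hΦ]
    funext i j
    simp [hA]
  have e2 : hess v x = fun i j k => hess u (Φ x) i j k * σ k * σ j := by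
    rw [hess_congr hv, hess_comp hu hΦ]
    funext i j k
    simp [hA, hB]
  have e3 : hessNorm (hess v x) = hessNorm (hess u (Φ x)) := by
    rw [e2, hessNorm, hessNorm]
    congr 1
    refine Finset.sum_congr rfl fun i _ => Finset.sum_congr rfl fun j _ =>
      Finset.sum_congr rfl fun k _ => ?_
    rcases hσ j with h | h <;> rcases hσ k with h' | h' <;> rw [h, h'] <;> ring
  constructor
  · rw [eden, eden, e3, e1, h4.mul_sign σ hσ]
  · rw [gden, gden, e3]

end Folded

/-! ### Composition with the fold map -/

section FoldedMap

variable {d n : ℕ}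

/-- The map `u ∘ Φ` for the fold map `Φ`, continued affinely in `x_N` with slope `± a`. Near points
with `|x_N| < s` it is `u ∘ Φ`; elsewhere it is `u ∘ Φ + σ (x_N - Φ_N) a` with `σ` the sign of
`x_N`. -/
def folded (u : (Fin (n + 1) → ℝ) → Fin d → ℝ) (a : Fin d → ℝ) (ε s r l η : ℝ) (y : Fin n → ℝ)
    (x : Fin (n + 1) → ℝ) : Fin d → ℝ :=
  u (foldOf ε s r l η y x) + (drop ε (x (Fin.last n) - s) + drop ε (-x (Fin.last n) - s)) • a

variable {u : (Fin (n + 1) → ℝ) → Fin d → ℝ} {a : Fin d → ℝ} {ε s r l η : ℝ} {y : Fin n → ℝ}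
  {x : Fin (n + 1) → ℝ}

theorem smooth_folded (hu : Smooth u) (a : Fin d → ℝ) (ε s r l η : ℝ) (y : Fin n → ℝ) :
    Smooth (folded u a ε s r l η y) := by
  have h : ContDiff ℝ ∞ fun t => drop ε (t - s) + drop ε (-t - s) :=
    ((contDiff_drop ε).comp (contDiff_id.sub contDiff_const)).add
      ((contDiff_drop ε).comp (contDiff_neg.sub contDiff_const))
  exact (hu.comp (smooth_foldOf ε s r l η y)).add (smooth_coordMap h (Fin.last n) a)

theorem per_folded (hr : 0 < r) : Per (2 * r) (folded u a ε s r l η y) := by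
  intro k x
  have h : foldOf ε s r l η y (x + hvec fun j => k j * (2 * r)) = foldOf ε s r l η y x := by
    funext i
    cases i using Fin.lastCases with
    | last => simp [foldOf]
    | cast i => simp [foldOf, (tent_periodic η hr.ne').int_mul (k i) (x i.castSucc)]
  simp [folded, h]

/-- The amount by which `bend` falls short of the identity, up to sign; on the other side of the
interface both sides of the equation vanish. -/
theorem drop_add_drop (hε : 0 < ε) {σ t : ℝ} (hσ : σ = 1 ∨ σ = -1)
    (ht : -s ≤ σ * t) : drop ε (t - s) + drop ε (-t - s) = σ * (t - bend ε s t) := by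
  rcases hσ with rfl | rfl
  · rw [one_mul] at ht ⊢
    rw [sub_bend_of_gt hε ht, drop_of_nonpos hε (show -t - s ≤ 0 by linarith), add_zero]
  · have h := sub_bend_of_gt hε (show -s ≤ -t by linarith)
    rw [bend_neg] at h
    rw [← h, drop_of_nonpos hε (show t - s ≤ 0 by linarith)]
    ring

theorem folded_eventuallyEq (hε : 0 < ε) {σ : ℝ} (hσ : σ = 1 ∨ σ = -1)
    (hx : -s < σ * x (Fin.last n)) : folded u a ε s r l η y =ᶠ[𝓝 x] fun z =>
      u (foldOf ε s r l η y z) +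
        (σ * (z (Fin.last n) - foldOf ε s r l η y z (Fin.last n))) • a := by
  have h : ∀ᶠ z : Fin (n + 1) → ℝ in 𝓝 x, -s < σ * z (Fin.last n) :=
    (Continuous.continuousAt (f := fun z : Fin (n + 1) → ℝ => σ * z (Fin.last n))
      (by fun_prop)).eventually (lt_mem_nhds hx)
  filter_upwards [h] with z hz
  rw [folded, drop_add_drop hε hσ hz.le]
  simp [foldOf]

theorem foldOf_of_ge (hε : 0 < ε) (hs : 0 < s) (hl : 0 < l) {σ : ℝ} (hσ : σ = 1 ∨ σ = -1)
    (hx : s + 2 * ε + l ≤ σ * x (Fin.last n)) : foldOf ε s r l η y x =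
      Fin.snoc (α := fun _ => ℝ) y (σ * (s + (2 * ε - drop ε (2 * ε)))) := by
  have h1 : s + 2 * ε + l ≤ |x (Fin.last n)| := by
    rcases hσ with rfl | rfl
    · exact (by linarith : _ ≤ x (Fin.last n)).trans (le_abs_self _)
    · exact (by linarith : _ ≤ -x (Fin.last n)).trans (neg_le_abs _)
  funext i
  cases i using Fin.lastCases with
  | last =>
    simp only [foldOf, foldMap_last, Fin.snoc_last]
    rcases hσ with rfl | rfl
    · rw [bend_of_ge hε hs (by linarith), one_mul]
    · rw [← neg_neg (x (Fin.last n)), bend_neg, bend_of_ge hε hs (by linarith), neg_one_mul]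
  | cast i =>
    simp [foldOf, fade_of_ge (by linarith : 0 < s + 2 * ε) hl h1]

/-- Beyond the fading layer the fold map is constant, so that the folded map is affine. -/
theorem folded_of_ge (hε : 0 < ε) (hs : 0 < s) (hl : 0 < l) {σ : ℝ} (hσ : σ = 1 ∨ σ = -1) :
    ∃ c : Fin d → ℝ, ∀ x : Fin (n + 1) → ℝ, s + 2 * ε + l ≤ σ * x (Fin.last n) →
      folded u a ε s r l η y x = (σ * x (Fin.last n)) • a + c := by
  set z : Fin (n + 1) → ℝ :=
    Fin.snoc (α := fun _ => ℝ) y (σ * (s + (2 * ε - drop ε (2 * ε)))) with hz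
  refine ⟨u z + -(σ * z (Fin.last n)) • a, fun x hx => ?_⟩
  have h1 := foldOf_of_ge (r := r) (η := η) (y := y) hε hs hl hσ hx
  have h2 : bend ε s (x (Fin.last n)) = z (Fin.last n) := by
    rw [hz, ← h1]; simp [foldOf]
  rw [folded, drop_add_drop hε hσ (by linarith), h1, ← hz, h2]
  module

theorem exists_far_folded (hε : 0 < ε) (hs : 0 < s) (hl : 0 < l) :
    ∃ (h : ℝ) (cp cm : Fin d → ℝ), 0 < h ∧ ∀ x : Fin (n + 1) → ℝ,
      (h ≤ x (Fin.last n) → folded u a ε s r l η y x = x (Fin.last n) • a + cp) ∧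
      (x (Fin.last n) ≤ -h → folded u a ε s r l η y x = -x (Fin.last n) • a + cm) := by
  obtain ⟨cp, hp⟩ := folded_of_ge (u := u) (a := a) (r := r) (η := η) (y := y) hε hs hl
    (Or.inl rfl)
  obtain ⟨cm, hm⟩ := folded_of_ge (u := u) (a := a) (r := r) (η := η) (y := y) hε hs hl
    (Or.inr rfl)
  refine ⟨s + 2 * ε + l, cp, cm, by linarith, fun x => ⟨fun hx => ?_, fun hx => ?_⟩⟩
  · rw [hp x (by linarith), one_mul]
  · rw [hm x (by linarith), neg_one_mul]

theorem exists_wellDist_eq (a : Fin d → ℝ) (ξ : Matrix (Fin d) (Fin (n + 1)) ℝ) :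
    ∃ σ : ℝ, (σ = 1 ∨ σ = -1) ∧ wellDist a ξ = matNorm (ξ - σ • well n a) := by
  rcases min_choice (matNorm (ξ - well n a)) (matNorm (ξ - -well n a)) with h | h
  · exact ⟨1, Or.inl rfl, by rw [one_smul]; exact h⟩
  · exact ⟨-1, Or.inr rfl, by rw [neg_one_smul]; exact h⟩

/-- The bound for the densities of the folded map: the density `f` of `u` inside, `k` at the kinks
and on the fading layers, `t` on the freezing layers. -/
def foldedBound (ε s r l η : ℝ) (f k t : (Fin (n + 1) → ℝ) → ℝ≥0∞) (y : Fin n → ℝ)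
    (x : Fin (n + 1) → ℝ) : ℝ≥0∞ :=
  {x : Fin (n + 1) → ℝ | |x (Fin.last n)| < s}.indicator (fun x => f (foldOf ε s r l η y x)) x +
    (∑ j : Fin n, {x : Fin (n + 1) → ℝ | x j.castSucc ∈ kink η r ∧ |x (Fin.last n)| < s}.indicator
      (fun x => k (foldOf ε s r l η y x)) x) +
    {x : Fin (n + 1) → ℝ | s + 2 * ε < |x (Fin.last n)| ∧
      |x (Fin.last n)| ≤ s + 2 * ε + l}.indicator (fun x => k (foldOf ε s r l η y x)) x +
    {x : Fin (n + 1) → ℝ | s ≤ |x (Fin.last n)| ∧ |x (Fin.last n)| ≤ s + 2 * ε}.indicator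
      (fun x => t (foldOf ε s r l η y x)) x

variable {W : Matrix (Fin d) (Fin (n + 1)) ℝ → ℝ≥0} {p C lam : ℝ}

/-- Between the kinks the fold map is a reflection composed with a translation, which by (H4)
changes neither density. -/
theorem folded_densities_of_notMem (h4 : H4 W) (hu : Smooth u) (hη : 0 < η) (hε : 0 < ε)
    (hl : 0 < l) (hx : |x (Fin.last n)| < s)
    (hk : ∀ j : Fin n, x j.castSucc ∉ kink η r) :
    eden W ε lam (folded u a ε s r l η y) x = eden W ε lam u (foldOf ε s r l η y x) ∧
      gden lam (folded u a ε s r l η y) x = gden lam u (foldOf ε s r l η y x) := by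
  have hc1 := contDiff_fade (s + 2 * ε) l
  have hc2 := contDiff_bend ε s
  have hc3 := contDiff_tent η r
  have hfe : fade (s + 2 * ε) l =ᶠ[𝓝 (x (Fin.last n))] fun _ => 1 := by
    filter_upwards [continuous_abs.continuousAt.eventually
      (gt_mem_nhds (show |x (Fin.last n)| < s + 2 * ε by linarith))] with τ hτ
    exact (fade_of_mem hl (le_of_lt hτ)).1
  have hbe : bend ε s =ᶠ[𝓝 (x (Fin.last n))] id := by
    filter_upwards [continuous_abs.continuousAt.eventually (gt_mem_nhds hx)] with τ hτ
    exact bend_of_mem hε (le_of_lt hτ)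
  have hw := fun j => wave_of_notMem_kink hη (hk j)
  refine densities_comp_eq h4 hu (smooth_foldOf ε s r l η y)
    (σ := Fin.snoc (α := fun _ => ℝ) (fun j => wave η r (x j.castSucc)) 1) ?_ (fun j => ?_)
    (fun i j => ?_) fun i j k => ?_
  · have h1 := folded_eventuallyEq (u := u) (a := a) (r := r) (l := l) (η := η) (y := y) hε
      (x := x) (Or.inl rfl) (by rw [one_mul]; exact (abs_lt.1 hx).1)
    filter_upwards [h1, (continuous_apply (Fin.last n)).continuousAt.eventually hbe] with z hz hz'
    rw [hz]
    simp [foldOf, hz']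
  · cases j using Fin.lastCases with
    | last => simp
    | cast j => simpa using (hw j).1
  · cases i using Fin.lastCases with
    | last =>
      refine (congrFun (pd_foldMap_last y hc2 j) x).trans ?_
      rw [hbe.deriv_eq]
      simp
    | cast i =>
      refine (congrFun (pd_foldMap_castSucc y hc1 hc3 i j) x).trans ?_
      rw [hfe.deriv_eq, hfe.eq_of_nhds, deriv_tent]
      simp
  · have h0 := deriv_of_eventually_const hfe
    have := abs_hess_foldMap_le y hc1 hc2 hc3 le_rfl (x := x)
      (fun j => by rw [deriv_tent, (hw j).2]; simp) (fun j => by rw [h0.1]; simp)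
      (fun j => by rw [h0.2]; simp) (by rw [hbe.deriv.deriv_eq]; simp) i j k
    exact abs_nonpos_iff.1 this

/-- Pointwise bound of the densities of the folded map in each of the regions of the fold. At the
kinks and on the fading layers the distance to the nearest well enters, on the freezing layers the
distance to the well belonging to the side. -/
theorem folded_densities_le (hp : 2 ≤ p) (hW : Comparable W a p C) (h4 : H4 W) (hu : Smooth u)
    (hlam : lam ≤ 0) {L β : ℝ} (hL : 1 ≤ L) (hβ : 0 ≤ β) (hb : FoldBounds n L η β) (hη : 0 < η)
    (hr : 0 < r) (hε : 0 < ε) (hεr : ε ≤ r) (hs : 0 < s) (y : Fin n → ℝ)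
    (x : Fin (n + 1) → ℝ) :
    eden W ε lam (folded u a ε s r (L * r) η y) x ≤
        foldedBound ε s r (L * r) η (eden W ε lam u)
          (kinkDen C p a ε lam ((n + 1) ^ 2 * (β / r)) u)
          (layerDen C p a ε lam ((n + 1) ^ 2 * (β / ε)) u) y x ∧
      gden lam (folded u a ε s r (L * r) η y) x ≤
        foldedBound ε s r (L * r) η (gden lam u)
          (kinkDen C p a ε lam ((n + 1) ^ 2 * (β / r)) u)
          (layerDen C p a ε lam ((n + 1) ^ 2 * (β / ε)) u) y x := by
  have hl : 0 < L * r := by positivity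
  obtain ⟨hA, hB3, hB1⟩ := hb r ε s y x hr hε hεr hs
  have hΦ := smooth_foldOf ε s r (L * r) η y
  rcases lt_or_ge |x (Fin.last n)| s with hx | hx
  · by_cases hk : ∃ j : Fin n, x j.castSucc ∈ kink η r
    · obtain ⟨j, hj⟩ := hk
      obtain ⟨σ, hσ, hd⟩ := exists_wellDist_eq a (grad u (foldOf ε s r (L * r) η y x))
      have hσx : -s < σ * x (Fin.last n) := by
        rw [abs_lt] at hx
        rcases hσ with rfl | rfl <;> linarith [hx.1, hx.2]
      have h := densities_comp_le (lam := lam) hp hW hε hu hΦ hσ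
        (folded_eventuallyEq hε hσ hσx) (Or.inl rfl) hA (by positivity) (hB1 (Or.inl hx))
      rw [← hd] at h
      have hle : ∀ f : (Fin (n + 1) → ℝ) → ℝ≥0∞,
          kinkDen C p a ε lam ((n + 1) ^ 2 * (β / r)) u (foldOf ε s r (L * r) η y x) ≤
          foldedBound ε s r (L * r) η f (kinkDen C p a ε lam ((n + 1) ^ 2 * (β / r)) u)
            (layerDen C p a ε lam ((n + 1) ^ 2 * (β / ε)) u) y x := by
        intro f
        rw [foldedBound]
        refine le_trans ?_ le_self_add
        refine le_trans ?_ le_self_add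
        refine le_trans ?_ le_add_self
        refine le_trans (le_of_eq ?_) (Finset.single_le_sum (f := fun j : Fin n =>
          {x : Fin (n + 1) → ℝ | x j.castSucc ∈ kink η r ∧ |x (Fin.last n)| < s}.indicator
            (fun x => kinkDen C p a ε lam ((n + 1) ^ 2 * (β / r)) u (foldOf ε s r (L * r) η y x)) x)
          (fun _ _ => zero_le) (Finset.mem_univ j))
        rw [Set.indicator_of_mem (s := {x : Fin (n + 1) → ℝ |
          x j.castSucc ∈ kink η r ∧ |x (Fin.last n)| < s}) ⟨hj, hx⟩]
      exact ⟨h.1.trans (hle _), h.2.trans (hle _)⟩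
    · push Not at hk
      obtain ⟨e1, e2⟩ := folded_densities_of_notMem (a := a) (y := y) (lam := lam) h4 hu hη hε hl
        hx hk
      have hle : ∀ f : (Fin (n + 1) → ℝ) → ℝ≥0∞, f (foldOf ε s r (L * r) η y x) ≤
          foldedBound ε s r (L * r) η f (kinkDen C p a ε lam ((n + 1) ^ 2 * (β / r)) u)
            (layerDen C p a ε lam ((n + 1) ^ 2 * (β / ε)) u) y x := by
        intro f
        rw [foldedBound, Set.indicator_of_mem (s := {x : Fin (n + 1) → ℝ | |x (Fin.last n)| < s}) hx,
          add_assoc, add_assoc]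
        exact le_self_add
      rw [e1, e2]
      exact ⟨hle _, hle _⟩
  obtain ⟨σ, hσ, hσx⟩ : ∃ σ : ℝ, (σ = 1 ∨ σ = -1) ∧ |x (Fin.last n)| = σ * x (Fin.last n) := by
    rcases abs_choice (x (Fin.last n)) with h | h
    · exact ⟨1, Or.inl rfl, by rw [h, one_mul]⟩
    · exact ⟨-1, Or.inr rfl, by rw [h, neg_one_mul]⟩
  have hev := folded_eventuallyEq (u := u) (a := a) (r := r) (l := L * r) (η := η) (y := y)
    (s := s) hε hσ (x := x) (by linarith)
  rcases le_or_gt |x (Fin.last n)| (s + 2 * ε) with hx2 | hx2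
  · have h := densities_comp_le (lam := lam) hp hW hε hu hΦ hσ hev (Or.inl rfl) hA
      (by positivity) hB3
    have hsd : matNorm (grad u (foldOf ε s r (L * r) η y x) - σ • well n a) =
        sideDist a u (foldOf ε s r (L * r) η y x) := by
      have hz : foldOf ε s r (L * r) η y x (Fin.last n) = bend ε s (x (Fin.last n)) := by
        simp [foldOf]
      rw [sideDist, hz]
      rcases hσ with rfl | rfl
      · have := (bend_mem hε hs (show s ≤ x (Fin.last n) by linarith)).1
        rw [if_pos (by linarith)]
      · have := (bend_mem hε hs (show s ≤ -x (Fin.last n) by linarith)).1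
        rw [bend_neg] at this
        rw [if_neg (by linarith)]
    rw [hsd] at h
    have hle : ∀ f : (Fin (n + 1) → ℝ) → ℝ≥0∞,
        layerDen C p a ε lam ((n + 1) ^ 2 * (β / ε)) u (foldOf ε s r (L * r) η y x) ≤
        foldedBound ε s r (L * r) η f (kinkDen C p a ε lam ((n + 1) ^ 2 * (β / r)) u)
          (layerDen C p a ε lam ((n + 1) ^ 2 * (β / ε)) u) y x := by
      intro f
      rw [foldedBound, Set.indicator_of_mem (s := {x : Fin (n + 1) → ℝ | s ≤ |x (Fin.last n)| ∧
        |x (Fin.last n)| ≤ s + 2 * ε}) ⟨hx, hx2⟩]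
      exact le_add_self
    exact ⟨h.1.trans (hle _), h.2.trans (hle _)⟩
  rcases le_or_gt |x (Fin.last n)| (s + 2 * ε + L * r) with hx3 | hx3
  · obtain ⟨τ, -, hd⟩ := exists_wellDist_eq a (grad u (foldOf ε s r (L * r) η y x))
    -- on the fading layer `Φ_N` is constant, so the nearest of the two wells may be used
    -- even if it belongs to the other side
    have hfl : (∀ j, grad (foldOf ε s r (L * r) η y) x (Fin.last n) j = 0) ∧
        ∀ j k, hess (foldOf ε s r (L * r) η y) x (Fin.last n) j k = 0 := by
      obtain ⟨c, hc⟩ := bend_eventually_const hε hs hx2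
      have hc2 := contDiff_bend ε s
      obtain ⟨z1, z2⟩ := deriv_of_eventually_const hc
      constructor
      · intro j
        refine (congrFun (pd_foldMap_last y hc2 j) x).trans ?_
        simp [z1]
      · intro j k
        change pd k (pd j fun x => foldMap _ _ _ y x (Fin.last n)) x = 0
        rw [pd_foldMap_last y hc2]
        by_cases hj : j = Fin.last n
        · simp only [hj, if_true]
          rw [pd_coord (((contDiff_deriv hc2).differentiable (by simp)) _), z2, ite_self]
        · simp [hj]
    have h := densities_comp_le (lam := lam) hp hW hε hu hΦ (t := τ) hσ hev (Or.inr hfl) hA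
      (by positivity) (hB1 (Or.inr hx2))
    rw [← hd] at h
    have hle : ∀ f : (Fin (n + 1) → ℝ) → ℝ≥0∞,
        kinkDen C p a ε lam ((n + 1) ^ 2 * (β / r)) u (foldOf ε s r (L * r) η y x) ≤
        foldedBound ε s r (L * r) η f (kinkDen C p a ε lam ((n + 1) ^ 2 * (β / r)) u)
          (layerDen C p a ε lam ((n + 1) ^ 2 * (β / ε)) u) y x := by
      intro f
      rw [foldedBound]
      refine le_trans ?_ le_self_add
      refine le_trans (le_of_eq ?_) le_add_self
      rw [Set.indicator_of_mem (s := {x : Fin (n + 1) → ℝ | s + 2 * ε < |x (Fin.last n)| ∧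
        |x (Fin.last n)| ≤ s + 2 * ε + L * r}) ⟨hx2, hx3⟩]
    exact ⟨h.1.trans (hle _), h.2.trans (hle _)⟩
  · obtain ⟨c, hc⟩ := folded_of_ge (u := u) (a := a) (r := r) (η := η) (y := y) hε hs hl hσ
    have hev : folded u a ε s r (L * r) η y =ᶠ[𝓝 x] fun z => (σ * z (Fin.last n)) • a + c := by
      have h : ∀ᶠ z : Fin (n + 1) → ℝ in 𝓝 x, s + 2 * ε + L * r < σ * z (Fin.last n) :=
        (Continuous.continuousAt (f := fun z : Fin (n + 1) → ℝ => σ * z (Fin.last n))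
          (by fun_prop)).eventually (lt_mem_nhds (by rwa [hσx] at hx3))
      filter_upwards [h] with z hz using hc z hz.le
    obtain ⟨z1, z2⟩ := hW.density_eq_zero hp hσ hε hlam hev
    rw [z1, z2]
    exact ⟨zero_le, zero_le⟩

end FoldedMap

/-! ### Integration over horizontal sections -/

section Sections

variable {n : ℕ}

/-- The point `(z, t)`. -/
def join (z : Fin n → ℝ) (t : ℝ) : Fin (n + 1) → ℝ := Fin.snoc (α := fun _ => ℝ) z t

@[simp] theorem join_castSucc (z : Fin n → ℝ) (t : ℝ) (j : Fin n) : join z t j.castSucc = z j := by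
  simp [join]

@[simp] theorem join_last (z : Fin n → ℝ) (t : ℝ) : join z t (Fin.last n) = t := by
  simp [join]

theorem continuous_join : Continuous fun q : (Fin n → ℝ) × ℝ => join q.1 q.2 := by
  refine continuous_pi fun i => ?_
  cases i using Fin.lastCases with
  | last => simpa using continuous_snd
  | cast i =>
    simp only [join_castSucc]
    fun_prop

theorem lintegral_eq_join {f : (Fin (n + 1) → ℝ) → ℝ≥0∞} (hf : Measurable f) :
    ∫⁻ x, f x = ∫⁻ t, ∫⁻ z : Fin n → ℝ, f (join z t) := by
  have hmp := (volume_preserving_piFinSuccAbove (fun _ : Fin (n + 1) => ℝ) (Fin.last n)).symm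
  rw [← hmp.lintegral_comp_emb (MeasurableEquiv.measurableEmbedding _), Measure.volume_eq_prod,
    lintegral_prod _ (by
      refine Measurable.aemeasurable ?_
      exact hf.comp (MeasurableEquiv.measurable _))]
  have : ∀ (t : ℝ) (z : Fin n → ℝ), (MeasurableEquiv.piFinSuccAbove (fun _ => ℝ)
      (Fin.last n)).symm (t, z) = join z t := fun t z => Fin.insertNth_last' t z
  simp only [this]

/-- The integral of `f` over the horizontal section at height `t` of the cylinder over `B`. -/
def sect (B : Set (Fin n → ℝ)) (f : (Fin (n + 1) → ℝ) → ℝ≥0∞) (t : ℝ) : ℝ≥0∞ :=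
  ∫⁻ z in B, f (join z t)

theorem measurable_sect (B : Set (Fin n → ℝ)) {f : (Fin (n + 1) → ℝ) → ℝ≥0∞} (hf : Measurable f) :
    Measurable (sect B f) :=
  Measurable.lintegral_prod_left' (f := fun q : (Fin n → ℝ) × ℝ => f (join q.1 q.2))
    (hf.comp continuous_join.measurable)

theorem measurable_horizontal :
    Measurable fun (x : Fin (n + 1) → ℝ) (j : Fin n) => x j.castSucc :=
  measurable_pi_lambda _ fun j => measurable_pi_apply j.castSucc

theorem setLIntegral_sect {B : Set (Fin n → ℝ)} (hB : MeasurableSet B) {T : Set ℝ}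
    (hT : MeasurableSet T) {f : (Fin (n + 1) → ℝ) → ℝ≥0∞} (hf : Measurable f) :
    ∫⁻ t in T, sect B f t =
      ∫⁻ x in {x | (fun j : Fin n => x j.castSucc) ∈ B ∧ x (Fin.last n) ∈ T}, f x := by
  have hS : MeasurableSet {x : Fin (n + 1) → ℝ | (fun j : Fin n => x j.castSucc) ∈ B ∧
      x (Fin.last n) ∈ T} :=
    (hB.preimage measurable_horizontal).inter (hT.preimage (measurable_pi_apply (Fin.last n)))
  rw [← lintegral_indicator hS, lintegral_eq_join (hf.indicator hS), ← lintegral_indicator hT]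
  refine lintegral_congr fun t => ?_
  by_cases ht : t ∈ T
  · rw [Set.indicator_of_mem ht, sect, ← lintegral_indicator hB]
    refine lintegral_congr fun z => ?_
    by_cases hz : z ∈ B <;> simp [Set.indicator, hz, ht]
  · rw [Set.indicator_of_notMem ht]
    refine (lintegral_eq_zero_of_ae_eq_zero (ae_of_all _ fun z => ?_)).symm
    refine Set.indicator_of_notMem ?_ _
    simp [ht]

/-- Functions of `x_N` integrate over cylinders by multiplication with the area of the base. -/
theorem lintegral_cylinder (B : Fin n → Set ℝ) {h : ℝ → ℝ≥0∞} (hh : Measurable h) :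
    ∫⁻ x in {x : Fin (n + 1) → ℝ | ∀ j : Fin n, x j.castSucc ∈ B j}, h (x (Fin.last n)) =
      (∏ j, volume (B j)) * ∫⁻ t, h t := by
  have hm : Measurable fun x : Fin (n + 1) → ℝ => x (Fin.last n) := measurable_pi_apply _
  have : Measure.map (fun x : Fin (n + 1) → ℝ => x (Fin.last n))
      (volume.restrict {x : Fin (n + 1) → ℝ | ∀ j : Fin n, x j.castSucc ∈ B j}) =
      (∏ j, volume (B j)) • volume := by
    ext T hT
    rw [Measure.map_apply hm hT, Measure.restrict_apply (hT.preimage hm), Measure.smul_apply,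
      smul_eq_mul, ← volume_box, Set.inter_comm]
    rfl
  rw [← lintegral_map hh hm, this, lintegral_smul_measure, smul_eq_mul]

theorem setLIntegral_slab_last {P : ℝ} (hP : 0 ≤ P) {h : ℝ → ℝ≥0∞} (hh : Measurable h) :
    ∫⁻ x in slab n P, h (x (Fin.last n)) = ENNReal.ofReal (P ^ n) * ∫⁻ t, h t := by
  have := lintegral_cylinder (fun _ : Fin n => Set.Ioc 0 P) hh
  rw [Finset.prod_const, Real.volume_Ioc, sub_zero, Finset.card_univ, Fintype.card_fin,
    ← ENNReal.ofReal_pow hP] at this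
  exact this

theorem setLIntegral_slab_kink_le {P δ : ℝ} (hP : 0 ≤ P) (hδ : 0 ≤ δ) (j₀ : Fin n) {B : Set ℝ}
    (hBm : MeasurableSet B) (hB : volume (B ∩ Set.Ioc 0 P) ≤ ENNReal.ofReal (δ * P))
    {h : ℝ → ℝ≥0∞} (hh : Measurable h) :
    ∫⁻ x in slab n P, {x : Fin (n + 1) → ℝ | x j₀.castSucc ∈ B}.indicator
      (fun x => h (x (Fin.last n))) x ≤
      ENNReal.ofReal (P ^ n) * (ENNReal.ofReal δ * ∫⁻ t, h t) := by
  classical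
  have hBm' : MeasurableSet {x : Fin (n + 1) → ℝ | x j₀.castSucc ∈ B} :=
    hBm.preimage (measurable_pi_apply j₀.castSucc)
  rw [setLIntegral_indicator hBm']
  have hsub : {x : Fin (n + 1) → ℝ | x j₀.castSucc ∈ B} ∩ slab n P ⊆
      {x : Fin (n + 1) → ℝ | ∀ j : Fin n, x j.castSucc ∈
        (fun j => if j = j₀ then B ∩ Set.Ioc 0 P else Set.Ioc 0 P) j} := by
    rintro x ⟨h2, h1⟩ j
    dsimp only
    split_ifs with hj
    · subst hj; exact ⟨h2, h1 j⟩
    · exact h1 j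
  refine (lintegral_mono_set hsub).trans ?_
  rw [lintegral_cylinder _ hh, ← mul_assoc]
  gcongr
  calc ∏ j, volume (if j = j₀ then B ∩ Set.Ioc 0 P else Set.Ioc 0 P)
      ≤ ∏ j : Fin n, (if j = j₀ then ENNReal.ofReal δ else 1) * ENNReal.ofReal P := by
        refine Finset.prod_le_prod' fun j _ => ?_
        split_ifs
        · rwa [← ENNReal.ofReal_mul hδ]
        · simp
    _ = _ := by
        rw [Finset.prod_mul_distrib, mul_comm, ENNReal.ofReal_pow hP]
        simp

theorem lintegral_indicator_abs_le {T : Set ℝ} (hT : MeasurableSet T) {h : ℝ → ℝ≥0∞}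
    (hh : Measurable h) :
    ∫⁻ t, {t | |t| ∈ T}.indicator h t ≤ ∫⁻ t in T, (h t + h (-t)) := by
  have hT' : MeasurableSet (-T) := hT.neg
  have h1 : ∀ t, {t | |t| ∈ T}.indicator h t ≤ T.indicator h t + (-T).indicator h t := by
    intro t
    by_cases ht : |t| ∈ T
    · rw [Set.indicator_of_mem (s := {t : ℝ | |t| ∈ T}) ht]
      rcases abs_choice t with h0 | h0 <;> rw [h0] at ht
      · rw [Set.indicator_of_mem ht]; exact le_self_add
      · rw [Set.indicator_of_mem (s := -T) ht]; exact le_add_self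
    · rw [Set.indicator_of_notMem (s := {t : ℝ | |t| ∈ T}) ht]
      exact zero_le
  refine (lintegral_mono h1).trans_eq ?_
  rw [lintegral_add_left (hh.indicator hT), lintegral_add_left hh, lintegral_indicator hT]
  congr 1
  have h2 : ∫⁻ t, (-T).indicator h t = ∫⁻ t, (-T).indicator h (-t) :=
    ((Measure.measurePreserving_neg volume).lintegral_comp (hh.indicator hT')).symm
  rw [h2, ← lintegral_indicator hT]
  refine lintegral_congr fun t => ?_
  by_cases ht : t ∈ T <;> simp [Set.indicator, ht]

end Sections

/-! ### Averaging the construction -/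

section Averaging

variable {d n : ℕ}

/-- The open cube of side `1 - 2 r`. -/
def innerCube (n : ℕ) (r : ℝ) : Set (Fin (n + 1) → ℝ) :=
  {x | ∀ i, x i ∈ Set.Ioo (-(1 / 2 - r)) (1 / 2 - r)}

/-- The horizontal section of `innerCube n r`. -/
def box (n : ℕ) (r : ℝ) : Set (Fin n → ℝ) :=
  {z | ∀ j, z j ∈ Set.Ioo (-(1 / 2 - r)) (1 / 2 - r)}

theorem box_eq_pi (n : ℕ) (r : ℝ) :
    box n r = Set.pi Set.univ fun _ => Set.Ioo (-(1 / 2 - r)) (1 / 2 - r) := by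
  ext z; simp [box]

theorem measurableSet_box (n : ℕ) (r : ℝ) : MeasurableSet (box n r) := by
  rw [box_eq_pi]
  exact MeasurableSet.univ_pi fun _ => measurableSet_Ioo

theorem innerCube_eq (n : ℕ) (r : ℝ) : innerCube n r =
    {x | (fun j : Fin n => x j.castSucc) ∈ box n r ∧
      x (Fin.last n) ∈ Set.Ioo (-(1 / 2 - r)) (1 / 2 - r)} := by
  ext x
  simp [innerCube, box, Fin.forall_fin_succ']

theorem measurableSet_innerCube (n : ℕ) (r : ℝ) : MeasurableSet (innerCube n r) := by
  have : innerCube n r = Set.pi Set.univ fun _ => Set.Ioo (-(1 / 2 - r)) (1 / 2 - r) := by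
    ext z; simp [innerCube]
  rw [this]
  exact MeasurableSet.univ_pi fun _ => measurableSet_Ioo

theorem volume_box_eq (n : ℕ) (r : ℝ) : volume (box n r) = ENNReal.ofReal (1 - 2 * r) ^ n := by
  rw [box_eq_pi, volume_pi_pi]
  simp only [Real.volume_Ioo, Finset.prod_const, Finset.card_univ, Fintype.card_fin]
  congr 2
  ring

variable {ε s r l η : ℝ}

theorem continuous_foldOf (ε s r l η : ℝ) : Continuous
    fun q : (Fin n → ℝ) × (Fin (n + 1) → ℝ) => foldOf ε s r l η q.1 q.2 := by
  have h1 := (contDiff_fade (s + 2 * ε) l).continuous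
  have h2 := (contDiff_bend ε s).continuous
  have h3 := (contDiff_tent η r).continuous
  refine continuous_pi fun i => ?_
  cases i using Fin.lastCases with
  | last =>
    simp only [foldOf, foldMap_last]
    fun_prop
  | cast i =>
    simp only [foldOf, foldMap_castSucc]
    fun_prop

theorem abs_fade_le {c l : ℝ} (hc : 0 < c) (hl : 0 < l) (t : ℝ) : |fade c l t| ≤ 1 := by
  obtain ⟨K, -, hK, -⟩ := exists_bound_deriv_ramp
  have := fade_sq_add_le hK hc hl le_rfl (by rw [mul_zero]; positivity) t
  rw [← sq_le_one_iff_abs_le_one]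
  linarith

/-- As `y` varies, the horizontal part of the fold map is a translate of `y` by at most `r`. -/
theorem lintegral_foldOf_le (hr : 0 < r) (hc : 0 < s + 2 * ε) (hl : 0 < l)
    (f : (Fin (n + 1) → ℝ) → ℝ≥0∞) (x : Fin (n + 1) → ℝ) :
    ∫⁻ y in box n (2 * r), f (foldOf ε s r l η y x) ≤
      sect (box n r) f (bend ε s (x (Fin.last n))) := by
  let w : Fin n → ℝ := fun j => fade (s + 2 * ε) l (x (Fin.last n)) * tent η r (x j.castSucc)
  have hw : ∀ j, |w j| ≤ r := fun j => by
    rw [abs_mul]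
    calc _ ≤ 1 * r := mul_le_mul (abs_fade_le hc hl _) (abs_tent_le η hr _) (abs_nonneg _)
          zero_le_one
      _ = r := one_mul r
  let g : (Fin n → ℝ) → ℝ≥0∞ := fun z => f (join z (bend ε s (x (Fin.last n))))
  have h1 : ∀ y, f (foldOf ε s r l η y x) = g (y + w) := fun y => rfl
  simp only [h1]
  rw [sect, ← lintegral_indicator (measurableSet_box n _),
    ← lintegral_indicator (measurableSet_box n _),
    ← lintegral_add_right_eq_self (fun z => (box n r).indicator
      (fun z => f (join z (bend ε s (x (Fin.last n))))) z) w]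
  refine lintegral_mono fun y => ?_
  by_cases hy : y ∈ box n (2 * r)
  · have hy' : y + w ∈ box n r := fun j => by
      have h2 := hy j
      have h3 := abs_le.1 (hw j)
      rw [Pi.add_apply]
      constructor <;> linarith [h2.1, h2.2, h3.1, h3.2]
    rw [Set.indicator_of_mem hy, Set.indicator_of_mem hy']
  · rw [Set.indicator_of_notMem hy]
    exact zero_le

/-- The sum of the values of `F` at `t` and `-t`. -/
def evenSum (F : ℝ → ℝ≥0∞) (t : ℝ) : ℝ≥0∞ := F t + F (-t)

theorem measurable_evenSum {F : ℝ → ℝ≥0∞} (hF : Measurable F) : Measurable (evenSum F) :=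
  hF.add (hF.comp measurable_neg)

/-- The contribution of the freezing and fading layers at height `s`, in terms of the sectional
integrals `K`, `T` of the corresponding densities. -/
def layerErr (ε l : ℝ) (K T : ℝ → ℝ≥0∞) (s : ℝ) : ℝ≥0∞ :=
  ENNReal.ofReal l * evenSum K (s + (2 * ε - drop ε (2 * ε))) +
    ∫⁻ τ in Set.Icc 0 (2 * ε), evenSum T (s + (τ - drop ε τ))

theorem measurable_foldedBound {f k t : (Fin (n + 1) → ℝ) → ℝ≥0∞} (hf : Measurable f)
    (hk : Measurable k) (ht : Measurable t) :
    Measurable fun q : (Fin n → ℝ) × (Fin (n + 1) → ℝ) =>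
      foldedBound ε s r l η f k t q.1 q.2 := by
  have hc := (continuous_foldOf (n := n) ε s r l η).measurable
  have hlast : Measurable fun x : Fin (n + 1) → ℝ => |x (Fin.last n)| :=
    (continuous_abs.comp (continuous_apply (Fin.last n))).measurable
  have key : ∀ {S : Set (Fin (n + 1) → ℝ)} {g : (Fin (n + 1) → ℝ) → ℝ≥0∞}, MeasurableSet S →
      Measurable g → Measurable fun q : (Fin n → ℝ) × (Fin (n + 1) → ℝ) =>
        S.indicator (fun x => g (foldOf ε s r l η q.1 x)) q.2 := by
    intro S g hS hg
    exact (hg.comp hc).indicator (hS.preimage measurable_snd)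
  have hk1 : MeasurableSet (kink η r) := (isClosed_kink η r).measurableSet
  have m1 : MeasurableSet {x : Fin (n + 1) → ℝ | |x (Fin.last n)| < s} :=
    measurableSet_Iio.preimage hlast
  have m2 : ∀ j : Fin n, MeasurableSet {x : Fin (n + 1) → ℝ | x j.castSucc ∈ kink η r} := fun j =>
    hk1.preimage (measurable_pi_apply j.castSucc)
  have m3 : MeasurableSet {x : Fin (n + 1) → ℝ | s + 2 * ε < |x (Fin.last n)| ∧
      |x (Fin.last n)| ≤ s + 2 * ε + l} := measurableSet_Ioc.preimage hlast
  have m4 : MeasurableSet {x : Fin (n + 1) → ℝ | s ≤ |x (Fin.last n)| ∧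
      |x (Fin.last n)| ≤ s + 2 * ε} := measurableSet_Icc.preimage hlast
  exact (((key m1 hf).add (Finset.measurable_sum _ fun j _ => key ((m2 j).inter m1) hk)).add
    (key m3 hk)).add (key m4 ht)

/-- Averaging over `y` turns the densities along the fold map into their integrals: up to the
layers, the total is the integral of `f` over the inner cube, plus `k` weighted with the small
fraction of the kinks. -/
theorem lintegral_foldedBound_le {f k t : (Fin (n + 1) → ℝ) → ℝ≥0∞} (hf : Measurable f)
    (hk : Measurable k) (ht : Measurable t) {δ : ℝ} (hδ : 0 ≤ δ)
    (hkink : volume (kink η r ∩ Set.Ioc 0 (2 * r)) ≤ ENNReal.ofReal (δ * (2 * r)))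
    (hr : 0 < r) (hl : 0 < l) (hε : 0 < ε) (hs : 0 < s) (hsr : s ≤ 1 / 2 - r) :
    ∫⁻ y in box n (2 * r), ∫⁻ x in slab n (2 * r), foldedBound ε s r l η f k t y x ≤
      ENNReal.ofReal ((2 * r) ^ n) * ((∫⁻ x in innerCube n r, f x) +
        (n * ENNReal.ofReal δ * (∫⁻ x in innerCube n r, k x) +
          layerErr ε l (sect (box n r) k) (sect (box n r) t) s)) := by
  have hc : 0 < s + 2 * ε := by linarith
  set F := sect (box n r) f with hF
  set K := sect (box n r) k with hK
  set T := sect (box n r) t with hT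
  have mF : Measurable F := measurable_sect _ hf
  have mK : Measurable K := measurable_sect _ hk
  have mT : Measurable T := measurable_sect _ ht
  have mb : Measurable (bend ε s) := (contDiff_bend ε s).continuous.measurable
  have hQ : ∀ {g : (Fin (n + 1) → ℝ) → ℝ≥0∞}, Measurable g →
      ∫⁻ t, {t : ℝ | |t| < s}.indicator (fun t => sect (box n r) g (bend ε s t)) t ≤
        ∫⁻ x in innerCube n r, g x := by
    intro g hg
    have hset : {t : ℝ | |t| < s} = Set.Ioo (-s) s := by ext t; simp [abs_lt]
    rw [hset, lintegral_indicator measurableSet_Ioo]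
    calc _ = ∫⁻ t in Set.Ioo (-s) s, sect (box n r) g t := by
          refine setLIntegral_congr_fun measurableSet_Ioo fun t ht => ?_
          have h : |t| ≤ s := (abs_lt.2 ⟨ht.1, ht.2⟩).le
          simp only [bend_of_mem hε h]
      _ ≤ ∫⁻ t in Set.Ioo (-(1 / 2 - r)) (1 / 2 - r), sect (box n r) g t :=
          lintegral_mono_set (Set.Ioo_subset_Ioo (neg_le_neg hsr) hsr)
      _ = _ := by rw [setLIntegral_sect (measurableSet_box n r) measurableSet_Ioo hg, innerCube_eq]
  rw [lintegral_lintegral_swap (measurable_foldedBound hf hk ht).aemeasurable]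
  -- integration in `y` replaces the densities by their sectional integrals
  have hin : ∀ x : Fin (n + 1) → ℝ,
      ∫⁻ y in box n (2 * r), foldedBound ε s r l η f k t y x ≤
      {t : ℝ | |t| < s}.indicator (fun t => F (bend ε s t)) (x (Fin.last n)) +
      (∑ j : Fin n, {x : Fin (n + 1) → ℝ | x j.castSucc ∈ kink η r}.indicator
        (fun x => {t : ℝ | |t| < s}.indicator (fun t => K (bend ε s t)) (x (Fin.last n))) x) +
      {t : ℝ | |t| ∈ Set.Ioc (s + 2 * ε) (s + 2 * ε + l)}.indicator
        (fun t => K (bend ε s t)) (x (Fin.last n)) +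
      {t : ℝ | |t| ∈ Set.Icc s (s + 2 * ε)}.indicator
        (fun t => T (bend ε s t)) (x (Fin.last n)) := by
    intro x
    have mfold : Measurable fun y : Fin n → ℝ => foldOf ε s r l η y x :=
      ((continuous_foldOf (n := n) ε s r l η).comp (by fun_prop : Continuous
        fun y : Fin n → ℝ => (y, x))).measurable
    have mi : ∀ (S : Set (Fin (n + 1) → ℝ)) {g : (Fin (n + 1) → ℝ) → ℝ≥0∞}, Measurable g →
        Measurable fun y : Fin n → ℝ => S.indicator (fun x => g (foldOf ε s r l η y x)) x := by
      intro S g hg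
      by_cases hx : x ∈ S
      · simp only [Set.indicator_of_mem hx]
        exact hg.comp mfold
      · simp only [Set.indicator_of_notMem hx]
        exact measurable_const
    have key : ∀ (S : Set (Fin (n + 1) → ℝ)) (g : (Fin (n + 1) → ℝ) → ℝ≥0∞),
        ∫⁻ y in box n (2 * r), S.indicator (fun x => g (foldOf ε s r l η y x)) x ≤
          S.indicator (fun x => sect (box n r) g (bend ε s (x (Fin.last n)))) x := by
      intro S g
      by_cases hx : x ∈ S
      · simp only [Set.indicator_of_mem hx]
        exact lintegral_foldOf_le hr hc hl g x
      · simp [Set.indicator_of_notMem hx]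
    simp only [foldedBound]
    rw [lintegral_add_right _ (mi _ ht), lintegral_add_right _ (mi _ hk),
      lintegral_add_left (mi _ hf), lintegral_finsetSum _ fun j _ => mi _ hk]
    refine add_le_add (add_le_add (add_le_add (key _ _) (Finset.sum_le_sum fun j _ => ?_))
      (key _ _)) (key _ _)
    refine (key _ _).trans_eq ?_
    by_cases h1 : x j.castSucc ∈ kink η r <;> by_cases h2 : |x (Fin.last n)| < s <;>
      simp [Set.indicator, h1, h2, hK]
  refine (lintegral_mono hin).trans ?_
  have hlast : Measurable fun x : Fin (n + 1) → ℝ => x (Fin.last n) := measurable_pi_apply _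
  have n1 : MeasurableSet {t : ℝ | |t| < s} := measurableSet_Iio.preimage measurable_abs
  have n2 : MeasurableSet {t : ℝ | |t| ∈ Set.Ioc (s + 2 * ε) (s + 2 * ε + l)} :=
    measurableSet_Ioc.preimage measurable_abs
  have n3 : MeasurableSet {t : ℝ | |t| ∈ Set.Icc s (s + 2 * ε)} :=
    measurableSet_Icc.preimage measurable_abs
  have n4 : ∀ j : Fin n, MeasurableSet {x : Fin (n + 1) → ℝ | x j.castSucc ∈ kink η r} := fun j =>
    (isClosed_kink η r).measurableSet.preimage (measurable_pi_apply j.castSucc)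
  have i1 : Measurable ({t : ℝ | |t| < s}.indicator fun t => F (bend ε s t)) :=
    (mF.comp mb).indicator n1
  have i2 : Measurable ({t : ℝ | |t| < s}.indicator fun t => K (bend ε s t)) :=
    (mK.comp mb).indicator n1
  have i3 : Measurable ({t : ℝ | |t| ∈ Set.Ioc (s + 2 * ε) (s + 2 * ε + l)}.indicator
      fun t => K (bend ε s t)) := (mK.comp mb).indicator n2
  have i4 : Measurable ({t : ℝ | |t| ∈ Set.Icc s (s + 2 * ε)}.indicator
      fun t => T (bend ε s t)) := (mT.comp mb).indicator n3
  have j1 : Measurable fun x : Fin (n + 1) → ℝ => {t : ℝ | |t| < s}.indicator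
    (fun t => F (bend ε s t)) (x (Fin.last n)) := i1.comp hlast
  have j2 : ∀ j : Fin n, Measurable ({x : Fin (n + 1) → ℝ | x j.castSucc ∈ kink η r}.indicator
    fun x => {t : ℝ | |t| < s}.indicator (fun t => K (bend ε s t)) (x (Fin.last n))) := fun j =>
    (i2.comp hlast).indicator (n4 j)
  have j3 : Measurable fun x : Fin (n + 1) → ℝ =>
    {t : ℝ | |t| ∈ Set.Ioc (s + 2 * ε) (s + 2 * ε + l)}.indicator
      (fun t => K (bend ε s t)) (x (Fin.last n)) := i3.comp hlast
  have j4 : Measurable fun x : Fin (n + 1) → ℝ => {t : ℝ | |t| ∈ Set.Icc s (s + 2 * ε)}.indicator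
      (fun t => T (bend ε s t)) (x (Fin.last n)) := i4.comp hlast
  rw [lintegral_add_right _ j4, lintegral_add_right _ j3, lintegral_add_left j1,
    lintegral_finsetSum _ fun j _ => j2 j]
  have e1 : ∫⁻ x in slab n (2 * r),
      {t : ℝ | |t| < s}.indicator (fun t => F (bend ε s t)) (x (Fin.last n)) ≤
      ENNReal.ofReal ((2 * r) ^ n) * ∫⁻ x in innerCube n r, f x := by
    rw [setLIntegral_slab_last (by positivity) i1]
    gcongr
    exact hQ hf
  have e2 : ∑ j : Fin n, ∫⁻ x in slab n (2 * r),
      {x : Fin (n + 1) → ℝ | x j.castSucc ∈ kink η r}.indicator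
        (fun x => {t : ℝ | |t| < s}.indicator (fun t => K (bend ε s t)) (x (Fin.last n))) x ≤
      ENNReal.ofReal ((2 * r) ^ n) *
        (n * ENNReal.ofReal δ * ∫⁻ x in innerCube n r, k x) := by
    refine (Finset.sum_le_sum fun j _ => (setLIntegral_slab_kink_le (by positivity) hδ j
      (isClosed_kink η r).measurableSet hkink i2).trans
      (mul_le_mul_right (mul_le_mul_right (hQ hk) _) _)).trans_eq ?_
    rw [Finset.sum_const, Finset.card_univ, Fintype.card_fin, nsmul_eq_mul]
    ring
  have e3 : ∫⁻ x in slab n (2 * r), {t : ℝ | |t| ∈ Set.Ioc (s + 2 * ε) (s + 2 * ε + l)}.indicator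
        (fun t => K (bend ε s t)) (x (Fin.last n)) ≤
      ENNReal.ofReal ((2 * r) ^ n) *
        (ENNReal.ofReal l * evenSum K (s + (2 * ε - drop ε (2 * ε)))) := by
    rw [setLIntegral_slab_last (by positivity) i3]
    gcongr
    refine (lintegral_indicator_abs_le measurableSet_Ioc (mK.comp mb)).trans_eq ?_
    have : ∀ t ∈ Set.Ioc (s + 2 * ε) (s + 2 * ε + l), (K ∘ bend ε s) t + (K ∘ bend ε s) (-t) =
        evenSum K (s + (2 * ε - drop ε (2 * ε))) := fun t ht => by
      rw [Function.comp_apply, Function.comp_apply, bend_neg, bend_of_ge hε hs ht.1.le]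
      rfl
    rw [setLIntegral_congr_fun measurableSet_Ioc this, setLIntegral_const, Real.volume_Ioc,
      add_sub_cancel_left, mul_comm]
  have e4 : ∫⁻ x in slab n (2 * r), {t : ℝ | |t| ∈ Set.Icc s (s + 2 * ε)}.indicator
        (fun t => T (bend ε s t)) (x (Fin.last n)) ≤
      ENNReal.ofReal ((2 * r) ^ n) *
        ∫⁻ τ in Set.Icc 0 (2 * ε), evenSum T (s + (τ - drop ε τ)) := by
    rw [setLIntegral_slab_last (by positivity) i4]
    refine mul_le_mul_right ?_ _
    refine (lintegral_indicator_abs_le measurableSet_Icc (mT.comp mb)).trans_eq ?_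
    have : ∀ t ∈ Set.Icc s (s + 2 * ε), (T ∘ bend ε s) t + (T ∘ bend ε s) (-t) =
        evenSum T (s + ((t - s) - drop ε (t - s))) := fun t ht => by
      have h1 := sub_bend_of_gt hε (show -s ≤ t by linarith [ht.1])
      have h2 : bend ε s t = s + ((t - s) - drop ε (t - s)) := by linarith
      rw [Function.comp_apply, Function.comp_apply, bend_neg, h2]
      rfl
    rw [setLIntegral_congr_fun measurableSet_Icc this, ← lintegral_indicator measurableSet_Icc,
      ← lintegral_indicator measurableSet_Icc, ← lintegral_add_right_eq_self _ s]
    refine lintegral_congr fun τ => ?_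
    have hm : τ + s ∈ Set.Icc s (s + 2 * ε) ↔ τ ∈ Set.Icc 0 (2 * ε) := by
      simp only [Set.mem_Icc]
      constructor <;> rintro ⟨h1, h2⟩ <;> constructor <;> linarith
    by_cases hτ : τ ∈ Set.Icc 0 (2 * ε)
    · rw [Set.indicator_of_mem hτ, Set.indicator_of_mem (hm.2 hτ), add_sub_cancel_right]
    · rw [Set.indicator_of_notMem hτ, Set.indicator_of_notMem (fun h => hτ (hm.1 h))]
  refine (add_le_add (add_le_add (add_le_add e1 e2) e3) e4).trans_eq ?_
  rw [layerErr]
  ring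

end Averaging

/-! ### Choice of the height and of the offset -/

section Selection

variable {d n : ℕ} {ε r l η : ℝ}

theorem setLIntegral_shift_le {F : ℝ → ℝ≥0∞} {c : ℝ} (hc0 : 0 ≤ c) (hc1 : c ≤ 1 / 8) :
    ∫⁻ s in Set.Ioo (1 / 8 : ℝ) (1 / 4), F (s + c) ≤ ∫⁻ s in Set.Ioo (1 / 8 : ℝ) (3 / 8), F s := by
  rw [← lintegral_indicator measurableSet_Ioo, ← lintegral_indicator measurableSet_Ioo,
    ← lintegral_add_right_eq_self ((Set.Ioo (1 / 8 : ℝ) (3 / 8)).indicator F) c]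
  refine lintegral_mono fun s => ?_
  by_cases hs : s ∈ Set.Ioo (1 / 8 : ℝ) (1 / 4)
  · rw [Set.indicator_of_mem hs, Set.indicator_of_mem
      (show s + c ∈ Set.Ioo (1 / 8 : ℝ) (3 / 8) from ⟨by linarith [hs.1], by linarith [hs.2]⟩)]
  · rw [Set.indicator_of_notMem hs]
    exact zero_le

/-- The part of `innerCube n r` at distance more than `1 / 8` from the interface. -/
def outerPart (n : ℕ) (r : ℝ) : Set (Fin (n + 1) → ℝ) :=
  innerCube n r ∩ {x | 1 / 8 < |x (Fin.last n)|}

theorem measurableSet_outerPart (n : ℕ) (r : ℝ) : MeasurableSet (outerPart n r) :=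
  (measurableSet_innerCube n r).inter (measurableSet_lt measurable_const
    (continuous_abs.comp (continuous_apply (Fin.last n))).measurable)

/-- The heights between `1 / 8` and `3 / 8`, on both sides of the interface, lie in the outer part.
-/
theorem setLIntegral_evenSum_le (hr : r ≤ 1 / 8) {f : (Fin (n + 1) → ℝ) → ℝ≥0∞}
    (hf : Measurable f) : ∫⁻ t in Set.Ioo (1 / 8 : ℝ) (3 / 8), evenSum (sect (box n r) f) t ≤
      2 * ∫⁻ x in outerPart n r, f x := by
  have h1 : ∫⁻ t in Set.Ioo (1 / 8 : ℝ) (3 / 8), sect (box n r) f t ≤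
      ∫⁻ x in outerPart n r, f x := by
    rw [setLIntegral_sect (measurableSet_box n r) measurableSet_Ioo hf]
    refine lintegral_mono_set ?_
    rintro x ⟨hx, hx1, hx2⟩
    rw [outerPart, innerCube_eq]
    exact ⟨⟨hx, by linarith, by linarith⟩, hx1.trans_le (le_abs_self _)⟩
  have h2 : ∫⁻ t in Set.Ioo (1 / 8 : ℝ) (3 / 8), sect (box n r) f (-t) ≤
      ∫⁻ x in outerPart n r, f x := by
    have e : ∫⁻ t in Set.Ioo (1 / 8 : ℝ) (3 / 8), sect (box n r) f (-t) =
        ∫⁻ t in Set.Ioo (-(3 / 8) : ℝ) (-(1 / 8)), sect (box n r) f t := by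
      rw [← lintegral_indicator measurableSet_Ioo, ← lintegral_indicator measurableSet_Ioo,
        ← (Measure.measurePreserving_neg volume).lintegral_comp
          ((measurable_sect _ hf).indicator measurableSet_Ioo)]
      refine lintegral_congr fun t => ?_
      have hm : -t ∈ Set.Ioo (-(3 / 8) : ℝ) (-(1 / 8)) ↔ t ∈ Set.Ioo (1 / 8 : ℝ) (3 / 8) := by
        simp only [Set.mem_Ioo]
        constructor <;> rintro ⟨h1, h2⟩ <;> constructor <;> linarith
      by_cases ht : t ∈ Set.Ioo (1 / 8 : ℝ) (3 / 8)
      · rw [Set.indicator_of_mem ht, Set.indicator_of_mem (hm.2 ht)]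
      · rw [Set.indicator_of_notMem ht, Set.indicator_of_notMem fun h => ht (hm.1 h)]
    rw [e, setLIntegral_sect (measurableSet_box n r) measurableSet_Ioo hf]
    refine lintegral_mono_set ?_
    rintro x ⟨hx, hx1, hx2⟩
    rw [outerPart, innerCube_eq]
    exact ⟨⟨hx, by linarith, by linarith⟩, (lt_neg_of_lt_neg hx2).trans_le (neg_le_abs _)⟩
  simp only [evenSum]
  rw [lintegral_add_left (measurable_sect _ hf), two_mul]
  exact add_le_add h1 h2

/-- A height for which the layers contribute at most a multiple of the average contribution. -/
theorem exists_layerErr_le (hε : 0 < ε) (hε16 : ε ≤ 1 / 16) (hr : r ≤ 1 / 8)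
    {k t : (Fin (n + 1) → ℝ) → ℝ≥0∞} (hk : Measurable k) (ht : Measurable t) :
    ∃ s ∈ Set.Ioo (1 / 8 : ℝ) (1 / 4), layerErr ε l (sect (box n r) k) (sect (box n r) t) s ≤
      16 * (ENNReal.ofReal l * (∫⁻ x in innerCube n r, k x) +
        ENNReal.ofReal (2 * ε) * ∫⁻ x in outerPart n r, t x) := by
  have mK := measurable_evenSum (measurable_sect (box n r) hk)
  have mT := measurable_evenSum (measurable_sect (box n r) ht)
  have md : Measurable fun τ => τ - drop ε τ :=
    (continuous_id.sub (contDiff_drop ε).continuous).measurable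
  have m1 : Measurable fun s => ENNReal.ofReal l *
      evenSum (sect (box n r) k) (s + (2 * ε - drop ε (2 * ε))) :=
    (mK.comp (measurable_id.add_const _)).const_mul _
  have m2 : Measurable fun q : ℝ × ℝ =>
      evenSum (sect (box n r) t) (q.1 + (q.2 - drop ε q.2)) :=
    mT.comp (measurable_fst.add (md.comp measurable_snd))
  have m3 : Measurable fun s => ∫⁻ τ in Set.Icc 0 (2 * ε),
      evenSum (sect (box n r) t) (s + (τ - drop ε τ)) :=
    Measurable.lintegral_prod_right' (f := fun q : ℝ × ℝ =>
      evenSum (sect (box n r) t) (q.1 + (q.2 - drop ε q.2))) m2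
  have hvol : volume (Set.Ioo (1 / 8 : ℝ) (1 / 4)) = ENNReal.ofReal (1 / 8) := by
    rw [Real.volume_Ioo]; norm_num
  -- some height does not exceed the average over `(1 / 8, 1 / 4)`; the layers then stay below
  -- `3 / 8`
  obtain ⟨s, hs, hle⟩ := exists_le_setLAverage (μ := volume) (s := Set.Ioo (1 / 8 : ℝ) (1 / 4))
    (f := layerErr ε l (sect (box n r) k) (sect (box n r) t)) (by rw [hvol]; simp)
    (by rw [hvol]; simp) (m1.add m3).aemeasurable
  refine ⟨s, hs, hle.trans ?_⟩
  rw [setLAverage_eq, hvol, ENNReal.div_le_iff (by simp) (by simp)]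
  have hsub : outerPart n r ⊆ innerCube n r := Set.inter_subset_left
  have a1 : ∫⁻ s in Set.Ioo (1 / 8 : ℝ) (1 / 4), ENNReal.ofReal l *
      evenSum (sect (box n r) k) (s + (2 * ε - drop ε (2 * ε))) ≤
      ENNReal.ofReal l * (2 * ∫⁻ x in innerCube n r, k x) := by
    rw [lintegral_const_mul' _ _ ENNReal.ofReal_ne_top]
    have hd := sub_drop_mem hε (show 0 ≤ 2 * ε by positivity)
    refine mul_le_mul_right ((setLIntegral_shift_le hd.1 (by linarith [hd.2])).trans
      ((setLIntegral_evenSum_le hr hk).trans ?_)) _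
    exact mul_le_mul_right (lintegral_mono_set hsub) _
  have a2 : ∫⁻ s in Set.Ioo (1 / 8 : ℝ) (1 / 4), ∫⁻ τ in Set.Icc 0 (2 * ε),
      evenSum (sect (box n r) t) (s + (τ - drop ε τ)) ≤
      ENNReal.ofReal (2 * ε) * (2 * ∫⁻ x in outerPart n r, t x) := by
    rw [lintegral_lintegral_swap m2.aemeasurable]
    calc _ ≤ ∫⁻ _τ in Set.Icc 0 (2 * ε), 2 * ∫⁻ x in outerPart n r, t x := by
          refine setLIntegral_mono' measurableSet_Icc fun τ hτ => ?_
          have hd := sub_drop_mem hε hτ.1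
          exact (setLIntegral_shift_le hd.1 (by linarith [hd.2])).trans
            (setLIntegral_evenSum_le hr ht)
      _ = _ := by rw [setLIntegral_const, Real.volume_Icc, sub_zero, mul_comm]
  have a3 : ∫⁻ s in Set.Ioo (1 / 8 : ℝ) (1 / 4),
      layerErr ε l (sect (box n r) k) (sect (box n r) t) s ≤
      ENNReal.ofReal l * (2 * ∫⁻ x in innerCube n r, k x) +
        ENNReal.ofReal (2 * ε) * (2 * ∫⁻ x in outerPart n r, t x) := by
    simp only [layerErr]
    rw [lintegral_add_left m1]
    exact add_le_add a1 a2
  refine a3.trans_eq ?_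
  have h8 : (16 : ℝ≥0∞) * ENNReal.ofReal (1 / 8) = 2 := by
    rw [show (16 : ℝ≥0∞) = ENNReal.ofReal 16 by simp, ← ENNReal.ofReal_mul (by norm_num)]
    norm_num
  rw [mul_right_comm, h8]
  ring

theorem measurable_kinkDen {u : (Fin (n + 1) → ℝ) → Fin d → ℝ} (hu : Smooth u) (C : ℝ) {p : ℝ}
    (hp : 0 ≤ p) (a : Fin d → ℝ) (ε lam b : ℝ) : Measurable (kinkDen C p a ε lam b u) := by
  have h1 : Continuous fun z => wellDist a (grad u z) :=
    (continuous_wellDist a).comp hu.continuous_grad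
  have h2 : Continuous fun z => hessNorm (hess u z) := continuous_hessNorm.comp hu.continuous_hess
  have h3 : Continuous fun z => wellDist a (grad u z) ^ p := h1.rpow_const fun _ => Or.inr hp
  refine Measurable.add ?_ (measurable_gden lam hu)
  refine ENNReal.measurable_ofReal.comp (Continuous.measurable ?_)
  simp only [excess]
  fun_prop

theorem measurable_sideDist {u : (Fin (n + 1) → ℝ) → Fin d → ℝ} (hu : Smooth u) (a : Fin d → ℝ) :
    Measurable (sideDist a u) := by
  have h1 : ∀ c : ℝ, Measurable fun z => matNorm (grad u z - c • well n a) := fun c =>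
    (continuous_matNorm.comp (hu.continuous_grad.sub continuous_const)).measurable
  have h2 : sideDist a u = fun z => if 0 ≤ z (Fin.last n) then
      matNorm (grad u z - (1 : ℝ) • well n a) else matNorm (grad u z - (-1 : ℝ) • well n a) := by
    funext z
    rw [sideDist]
    split_ifs <;> rfl
  rw [h2]
  exact Measurable.ite (measurableSet_le measurable_const (measurable_pi_apply _)) (h1 1) (h1 (-1))

theorem measurable_layerDen {u : (Fin (n + 1) → ℝ) → Fin d → ℝ} (hu : Smooth u) (C p : ℝ)
    (a : Fin d → ℝ) (ε lam b : ℝ) : Measurable (layerDen C p a ε lam b u) := by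
  have h1 := measurable_sideDist hu a
  have h2 : Measurable fun z => hessNorm (hess u z) :=
    (continuous_hessNorm.comp hu.continuous_hess).measurable
  refine Measurable.add ?_ (measurable_gden lam hu)
  refine ENNReal.measurable_ofReal.comp ?_
  simp only [excess]
  exact (((h1.pow_const p).const_mul _).add (((h2.add (h1.const_mul b)).pow_const 2).const_mul _)).add
    (h1.const_mul b)

variable {W : Matrix (Fin d) (Fin (n + 1)) ℝ → ℝ≥0} {a : Fin d → ℝ} {p C lam : ℝ}
  {u : (Fin (n + 1) → ℝ) → Fin d → ℝ}

/-- Averaging the folded maps over the positions of the grid: the densities of `u` on the inner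
cube are attainable, up to the error `R` from the kinks and layers. -/
theorem attain_of_smooth (hp : 2 ≤ p) (hWc : Continuous W) (hW : Comparable W a p C) (h4 : H4 W)
    (hu : Smooth u) (hlam : lam ≤ 0) {L β δ : ℝ} (hL : 1 ≤ L) (hβ : 0 ≤ β)
    (hb : FoldBounds n L η β) (hη : 0 < η) (hr : 0 < r) (hr8 : r ≤ 1 / 8) (hε : 0 < ε)
    (hεr : ε ≤ r) (hε16 : ε ≤ 1 / 16) (hδ : 0 ≤ δ)
    (hkink : volume (kink η r ∩ Set.Ioc 0 (2 * r)) ≤ ENNReal.ofReal (δ * (2 * r)))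
    {k t : (Fin (n + 1) → ℝ) → ℝ≥0∞} (hk : k = kinkDen C p a ε lam ((n + 1) ^ 2 * (β / r)) u)
    (ht : t = layerDen C p a ε lam ((n + 1) ^ 2 * (β / ε)) u) {E Γ R : ℝ} (hE0 : 0 ≤ E)
    (hΓ0 : 0 ≤ Γ) (hR0 : 0 ≤ R)
    (hE : ∫⁻ x in innerCube n r, eden W ε lam u x ≤ ENNReal.ofReal E)
    (hΓ : ∫⁻ x in innerCube n r, gden lam u x ≤ ENNReal.ofReal Γ)
    (hR : n * ENNReal.ofReal δ * (∫⁻ x in innerCube n r, k x) +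
      16 * (ENNReal.ofReal (L * r) * (∫⁻ x in innerCube n r, k x) +
        ENNReal.ofReal (2 * ε) * ∫⁻ x in outerPart n r, t x) ≤ ENNReal.ofReal R) :
    ((E + R) / (1 - 4 * r) ^ n, (Γ + R) / (1 - 4 * r) ^ n) ∈ attain W a ε lam (2 * r) := by
  have hl : 0 < L * r := by positivity
  have mk : Measurable k := by
    rw [hk]; exact measurable_kinkDen hu C (by linarith) a ε lam _
  have mt : Measurable t := by rw [ht]; exact measurable_layerDen hu C p a ε lam _
  obtain ⟨s, hs, hlay⟩ := exists_layerErr_le (l := L * r) hε hε16 hr8 mk mt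
  have hs0 : 0 < s := by linarith [hs.1]
  set q : ℝ := (2 * r) ^ n with hq
  have hq0 : 0 < q := by positivity
  set Q : ℝ := (1 - 4 * r) ^ n with hQ
  have hQ0 : 0 < Q := pow_pos (by linarith) n
  have hvol : volume (box n (2 * r)) = ENNReal.ofReal Q := by
    rw [volume_box_eq, hQ, ENNReal.ofReal_pow (by linarith)]
    congr 2
    ring
  -- the integrals of the bounds for the densities of the folded maps
  let J : ((Fin (n + 1) → ℝ) → ℝ≥0∞) → (Fin n → ℝ) → ℝ≥0∞ := fun f y =>
    ∫⁻ x in slab n (2 * r), foldedBound ε s r (L * r) η f k t y x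
  have mJ : ∀ {f}, Measurable f → Measurable (J f) := fun {f} hf =>
    Measurable.lintegral_prod_right' (f := fun q : (Fin n → ℝ) × (Fin (n + 1) → ℝ) =>
      foldedBound ε s r (L * r) η f k t q.1 q.2) (measurable_foldedBound hf mk mt)
  have hJ : ∀ {f F}, Measurable f → 0 ≤ F → ∫⁻ x in innerCube n r, f x ≤ ENNReal.ofReal F →
      ∫⁻ y in box n (2 * r), J f y ≤ ENNReal.ofReal (q * (F + R)) := by
    intro f F hf hF0 hF
    refine (lintegral_foldedBound_le hf mk mt hδ hkink hr hl hε hs0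
      (by linarith [hs.2])).trans ?_
    rw [ENNReal.ofReal_mul hq0.le, ENNReal.ofReal_add hF0 hR0]
    gcongr
    exact (add_le_add le_rfl hlay).trans hR
  have mE := measurable_eden hWc ε lam hu
  have mG := measurable_gden lam hu
  have finE := ne_top_of_le_ne_top ENNReal.ofReal_ne_top (hJ mE hE0 hE)
  have finG := ne_top_of_le_ne_top ENNReal.ofReal_ne_top (hJ mG hΓ0 hΓ)
  have intg : ∀ {f F}, Measurable f → 0 ≤ F → ∫⁻ x in innerCube n r, f x ≤ ENNReal.ofReal F →
      IntegrableOn (fun y => (J f y).toReal / q) (box n (2 * r)) ∧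
        ⨍ y in box n (2 * r), (J f y).toReal / q ≤ (F + R) / Q := by
    intro f F hf hF0 hF
    have hfin := ne_top_of_le_ne_top ENNReal.ofReal_ne_top (hJ hf hF0 hF)
    refine ⟨(integrable_toReal_of_lintegral_ne_top (mJ hf).aemeasurable hfin).div_const q, ?_⟩
    rw [setAverage_eq, integral_div,
      integral_toReal (mJ hf).aemeasurable (ae_lt_top (mJ hf) hfin), measureReal_def, hvol,
      ENNReal.toReal_ofReal hQ0.le, smul_eq_mul, div_eq_inv_mul _ Q]
    gcongr
    rw [div_le_iff₀ hq0, mul_comm (F + R)]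
    exact ENNReal.toReal_le_of_le_ofReal (by positivity) (hJ hf hF0 hF)
  obtain ⟨iE, bE⟩ := intg mE hE0 hE
  obtain ⟨iG, bG⟩ := intg mG hΓ0 hΓ
  -- the pair belonging to a single `y` is attained by its folded map; both averages are
  -- controlled simultaneously because the attainable set is convex
  have hmem := average_mem_attain (f := fun y => ((J (eden W ε lam u) y).toReal / q,
    (J (gden lam u) y).toReal / q)) hp hWc hW hε hlam (show 0 < 2 * r by positivity)
    (Y := box n (2 * r)) (by rw [hvol]; simpa using hQ0) (by rw [hvol]; simp)
    (by
      filter_upwards [ae_lt_top (mJ mE) finE, ae_lt_top (mJ mG) finG] with y h1 h2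
      have hpt := folded_densities_le (lam := lam) hp hW h4 hu hlam hL hβ hb hη hr hε hεr hs0 y
      rw [← hk, ← ht] at hpt
      have back : ∀ {z : ℝ≥0∞}, z < ⊤ →
          ENNReal.ofReal ((2 * r) ^ n) * ENNReal.ofReal (z.toReal / q) = z := by
        intro z hz
        rw [← ENNReal.ofReal_mul hq0.le, mul_div_cancel₀ _ hq0.ne', ENNReal.ofReal_toReal hz.ne]
      refine Profile.mem_attain (by positivity) (by positivity)
        (v := folded u a ε s r (L * r) η y)
        ⟨smooth_folded hu a ε s r _ η y, per_folded hr, exists_far_folded hε hs0 hl, ?_, ?_⟩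
      · rw [back h1]
        exact lintegral_mono fun x => (hpt x).1
      · rw [back h2]
        exact lintegral_mono fun x => (hpt x).2)
    (iE.prodMk iG)
  refine attain_mono hmem ⟨le_of_eq_of_le ?_ bE, le_of_eq_of_le ?_ bG⟩
  · rw [setAverage_eq, setAverage_eq, Prod.smul_fst, fst_integral (iE.prodMk iG)]
  · rw [setAverage_eq, setAverage_eq, Prod.smul_snd, snd_integral (iE.prodMk iG)]

end Selection

/-! ### Smallness of the errors -/

section Smallness

variable {d n : ℕ}

/-- Lower powers are controlled by the `p`-th power up to a small constant. -/
theorem exists_sq_add_le {p : ℝ} (hp : 2 ≤ p) {α : ℝ} (hα : 0 < α) :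
    ∃ K : ℝ, 0 ≤ K ∧ ∀ x : ℝ, 0 ≤ x → x ^ 2 + x ≤ α + K * x ^ p := by
  set τ := min 1 (α / 2) with hτ
  have hτ0 : 0 < τ := lt_min one_pos (by positivity)
  have hτ1 : τ ≤ 1 := min_le_left _ _
  have hτ2 : τ ≤ α / 2 := min_le_right _ _
  refine ⟨(1 + 1 / τ) * τ ^ (2 - p), by positivity, fun x hx => ?_⟩
  rcases le_or_gt x τ with h | h
  · have h1 : x ^ 2 ≤ x := by nlinarith
    have h2 : 0 ≤ (1 + 1 / τ) * τ ^ (2 - p) * x ^ p := by positivity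
    linarith
  · have hx0 : 0 < x := hτ0.trans h
    have h1 : x ≤ x ^ 2 * (1 / τ) := by
      rw [mul_one_div, le_div_iff₀ hτ0, sq]
      gcongr
    have h2 : x ^ 2 ≤ τ ^ (2 - p) * x ^ p := by
      have h3 : x ^ (2 - p) ≤ τ ^ (2 - p) :=
        Real.rpow_le_rpow_of_nonpos hτ0 h.le (by linarith)
      calc x ^ 2 = x ^ (2 - p) * x ^ p := by
            rw [← Real.rpow_add hx0, sub_add_cancel, Real.rpow_two]
        _ ≤ _ := by gcongr
    calc x ^ 2 + x ≤ (1 + 1 / τ) * x ^ 2 := by linarith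
      _ ≤ (1 + 1 / τ) * (τ ^ (2 - p) * x ^ p) := by gcongr
      _ ≤ _ := by rw [← mul_assoc]; linarith

variable {W : Matrix (Fin d) (Fin (n + 1)) ℝ → ℝ≥0} {a : Fin d → ℝ} {p C ε lam b r : ℝ}
  {u : (Fin (n + 1) → ℝ) → Fin d → ℝ}

theorem ofReal_mul_eden (hε : 0 < ε) {c : ℝ} (hc : 0 ≤ c) {z : Fin (n + 1) → ℝ} :
    ENNReal.ofReal (c * (W (grad u z) / ε + ε * hessNorm (hess u z) ^ 2)) ≤
      ENNReal.ofReal c * eden W ε lam u z := by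
  rw [eden, ← ENNReal.ofReal_mul hc]
  refine ENNReal.ofReal_le_ofReal ?_
  have : 0 ≤ ε * min (lam ^ 2) (hessNorm (hess u z) ^ 2) :=
    mul_nonneg hε.le (le_min (sq_nonneg _) (sq_nonneg _))
  refine mul_le_mul_of_nonneg_left ?_ hc
  rw [one_div, inv_mul_eq_div]
  linarith

/-- The density at the kinks is bounded by a multiple of the density of `u`. The constants depending
on the bound `b` for the second derivatives of the fold come with a factor `ε` or `α`. -/
theorem kinkDen_le (hW : Comparable W a p C) (hε : 0 < ε) (hε1 : ε ≤ 1)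
    (hb : 0 ≤ b) {α K : ℝ} (hα : 0 ≤ α) (hK : 0 ≤ K)
    (hY : ∀ x : ℝ, 0 ≤ x → x ^ 2 + x ≤ α + K * x ^ p) (z : Fin (n + 1) → ℝ) :
    kinkDen C p a ε lam b u z ≤ ENNReal.ofReal (C ^ 2 + 4 + (4 * b ^ 2 + b) * (K * C) * ε) *
      eden W ε lam u z + ENNReal.ofReal ((4 * b ^ 2 + b) * α) + gden lam u z := by
  have hC := hW.one_le
  rw [kinkDen]
  gcongr
  set D := wellDist a (grad u z)
  set h := hessNorm (hess u z)
  have hD : 0 ≤ D := wellDist_nonneg _ _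
  have hh : 0 ≤ h := hessNorm_nonneg _
  have hlow := hW.lower (grad u z)
  set w : ℝ := ((W (grad u z) : ℝ≥0) : ℝ)
  have hw : 0 ≤ w := NNReal.coe_nonneg _
  have key : excess C p ε b D h ≤
      (C ^ 2 + 4 + (4 * b ^ 2 + b) * (K * C) * ε) * (w / ε + ε * h ^ 2) +
        (4 * b ^ 2 + b) * α := by
    have h1 : C / ε * D ^ p ≤ C ^ 2 * (w / ε) := by
      calc C / ε * D ^ p ≤ C / ε * (C * w) := by gcongr
        _ = _ := by ring
    have h2 : 2 * ε * (h + b * D) ^ 2 ≤ 4 * (ε * h ^ 2) + 4 * b ^ 2 * D ^ 2 := by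
      have : (h + b * D) ^ 2 ≤ 2 * (h ^ 2 + b ^ 2 * D ^ 2) := by nlinarith [sq_nonneg (h - b * D)]
      calc 2 * ε * (h + b * D) ^ 2 ≤ 2 * ε * (2 * (h ^ 2 + b ^ 2 * D ^ 2)) := by gcongr
        _ = 4 * (ε * h ^ 2) + 4 * b ^ 2 * D ^ 2 * ε := by ring
        _ ≤ 4 * (ε * h ^ 2) + 4 * b ^ 2 * D ^ 2 * 1 := by gcongr
        _ = _ := by ring
    have h3 : 4 * b ^ 2 * D ^ 2 + b * D ≤ (4 * b ^ 2 + b) * (D ^ 2 + D) := by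
      have e1 : 0 ≤ b * D ^ 2 := by positivity
      have e2 : 0 ≤ b ^ 2 * D := by positivity
      nlinarith
    have h4 : D ^ 2 + D ≤ α + K * (C * w) := (hY D hD).trans (by gcongr)
    have h5 : (4 * b ^ 2 + b) * (D ^ 2 + D) ≤ (4 * b ^ 2 + b) * (α + K * (C * w)) := by gcongr
    have h6 : (4 * b ^ 2 + b) * (K * C) * ε * (w / ε) = (4 * b ^ 2 + b) * (K * (C * w)) := by
      field_simp
    have h7 : 0 ≤ (4 * b ^ 2 + b) * (K * C) * ε * (ε * h ^ 2) := by positivity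
    have h8 : 0 ≤ C ^ 2 * (ε * h ^ 2) := by positivity
    have h9 : 0 ≤ w / ε := by positivity
    rw [excess]
    nlinarith
  refine (ENNReal.ofReal_le_ofReal key).trans ?_
  rw [ENNReal.ofReal_add (by positivity) (by positivity)]
  gcongr
  exact ofReal_mul_eden hε (by positivity)

/-- The freezing layers have width `2 ε`; multiplied by it, the density there is bounded by the
distance to the well of the side and by small terms, since second derivatives of order `B / ε`
contribute `B` only. -/
theorem ofReal_mul_layerDen_le (hC : 1 ≤ C) (hε : 0 < ε) {B : ℝ} (hB : 0 ≤ B)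
    {α K : ℝ} (hα : 0 ≤ α) (hK : 0 ≤ K)
    (hY : ∀ x : ℝ, 0 ≤ x → x ^ 2 + x ≤ α + K * x ^ p) (z : Fin (n + 1) → ℝ) :
    ENNReal.ofReal (2 * ε) * layerDen C p a ε lam (B / ε) u z ≤
      ENNReal.ofReal (2 * C + (8 * B ^ 2 + 2 * B) * K) * ENNReal.ofReal (sideDist a u z ^ p) +
      ENNReal.ofReal (8 * ε) * eden W ε lam u z + ENNReal.ofReal ((8 * B ^ 2 + 2 * B) * α) +
      ENNReal.ofReal (2 * ε) * gden lam u z := by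
  rw [layerDen, mul_add]
  gcongr
  set D := sideDist a u z
  set h := hessNorm (hess u z)
  have hD : 0 ≤ D := matNorm_nonneg _
  have hh : 0 ≤ h := hessNorm_nonneg _
  set w : ℝ := ((W (grad u z) : ℝ≥0) : ℝ)
  have hw : 0 ≤ w := NNReal.coe_nonneg _
  have key : 2 * ε * excess C p ε (B / ε) D h ≤
      ((2 * C + (8 * B ^ 2 + 2 * B) * K) * D ^ p + 8 * ε * (w / ε + ε * h ^ 2)) +
        (8 * B ^ 2 + 2 * B) * α := by
    have h2 : 4 * ε ^ 2 * (h + B / ε * D) ^ 2 ≤ 8 * ε ^ 2 * h ^ 2 + 8 * B ^ 2 * D ^ 2 := by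
      have : (h + B / ε * D) ^ 2 ≤ 2 * (h ^ 2 + (B / ε) ^ 2 * D ^ 2) := by
        nlinarith [sq_nonneg (h - B / ε * D)]
      calc 4 * ε ^ 2 * (h + B / ε * D) ^ 2 ≤ 4 * ε ^ 2 * (2 * (h ^ 2 + (B / ε) ^ 2 * D ^ 2)) := by
            gcongr
        _ = _ := by field_simp; ring
    have h3 : 8 * B ^ 2 * D ^ 2 + 2 * B * D ≤ (8 * B ^ 2 + 2 * B) * (D ^ 2 + D) := by
      have e1 : 0 ≤ B * D ^ 2 := by positivity
      have e2 : 0 ≤ B ^ 2 * D := by positivity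
      nlinarith
    have h5 : (8 * B ^ 2 + 2 * B) * (D ^ 2 + D) ≤ (8 * B ^ 2 + 2 * B) * (α + K * D ^ p) := by
      exact mul_le_mul_of_nonneg_left (hY D hD) (by positivity)
    have e : 2 * ε * excess C p ε (B / ε) D h =
        2 * C * D ^ p + 4 * ε ^ 2 * (h + B / ε * D) ^ 2 + 2 * B * D := by
      rw [excess]; field_simp; ring
    have h6 : 8 * ε * (w / ε + ε * h ^ 2) = 8 * w + 8 * ε ^ 2 * h ^ 2 := by
      field_simp
    rw [e, h6]
    nlinarith
  rw [← ENNReal.ofReal_mul (by positivity)]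
  refine (ENNReal.ofReal_le_ofReal key).trans ?_
  rw [ENNReal.ofReal_add (by positivity) (by positivity),
    ENNReal.ofReal_add (by positivity) (by positivity), ENNReal.ofReal_mul (by positivity)]
  gcongr
  exact ofReal_mul_eden hε (by positivity)

theorem volume_innerCube_le (n : ℕ) (hr : 0 ≤ r) : volume (innerCube n r) ≤ 1 := by
  rw [← volume_cube (n := n)]
  exact measure_mono fun x hx i => ⟨by linarith [(hx i).1], by linarith [(hx i).2]⟩

theorem setLIntegral_kinkDen_le (hWc : Continuous W) (hW : Comparable W a p C) (hu : Smooth u)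
    (hr : 0 ≤ r) (hε : 0 < ε) (hε1 : ε ≤ 1)
    (hb : 0 ≤ b) {α K : ℝ} (hα : 0 ≤ α) (hK : 0 ≤ K)
    (hY : ∀ x : ℝ, 0 ≤ x → x ^ 2 + x ≤ α + K * x ^ p) {M Γ : ℝ} (hM : 0 ≤ M) (hΓ : 0 ≤ Γ)
    (hE : ∫⁻ x in innerCube n r, eden W ε lam u x ≤ ENNReal.ofReal M)
    (hG : ∫⁻ x in innerCube n r, gden lam u x ≤ ENNReal.ofReal Γ) :
    ∫⁻ x in innerCube n r, kinkDen C p a ε lam b u x ≤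
      ENNReal.ofReal ((C ^ 2 + 4 + (4 * b ^ 2 + b) * (K * C) * ε) * M + (4 * b ^ 2 + b) * α + Γ) := by
  have hC := hW.one_le
  refine (lintegral_mono fun x => kinkDen_le hW hε hε1 hb hα hK hY x).trans ?_
  have hc₁ : 0 ≤ C ^ 2 + 4 + (4 * b ^ 2 + b) * (K * C) * ε := by positivity
  have hc₂ : 0 ≤ (4 * b ^ 2 + b) * α := by positivity
  generalize C ^ 2 + 4 + (4 * b ^ 2 + b) * (K * C) * ε = c₁ at hc₁ ⊢
  generalize (4 * b ^ 2 + b) * α = c₂ at hc₂ ⊢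
  rw [lintegral_add_right _ (measurable_gden lam hu), lintegral_add_right _ measurable_const,
    lintegral_const_mul _ (measurable_eden hWc ε lam hu), setLIntegral_const,
    ENNReal.ofReal_add (by positivity) hΓ, ENNReal.ofReal_add (by positivity) (by positivity),
    ENNReal.ofReal_mul (by positivity)]
  refine add_le_add (add_le_add (mul_le_mul_right hE _) ?_) hG
  exact (mul_le_mul_right (volume_innerCube_le n hr) _).trans_eq (mul_one _)

theorem setLIntegral_layerDen_le (hWc : Continuous W) (hC : 1 ≤ C) (hu : Smooth u)
    (hr : 0 ≤ r) (hε : 0 < ε) {B : ℝ} (hB : 0 ≤ B) {α K : ℝ} (hα : 0 ≤ α) (hK : 0 ≤ K)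
    (hY : ∀ x : ℝ, 0 ≤ x → x ^ 2 + x ≤ α + K * x ^ p) {M Γ μ : ℝ} (hM : 0 ≤ M) (hΓ : 0 ≤ Γ)
    (hμ : 0 ≤ μ) (hE : ∫⁻ x in innerCube n r, eden W ε lam u x ≤ ENNReal.ofReal M)
    (hG : ∫⁻ x in innerCube n r, gden lam u x ≤ ENNReal.ofReal Γ)
    (hD : ∫⁻ x in outerPart n r, ENNReal.ofReal (sideDist a u x ^ p) ≤ ENNReal.ofReal μ) :
    ENNReal.ofReal (2 * ε) * ∫⁻ x in outerPart n r, layerDen C p a ε lam (B / ε) u x ≤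
      ENNReal.ofReal ((2 * C + (8 * B ^ 2 + 2 * B) * K) * μ + 8 * ε * M +
        (8 * B ^ 2 + 2 * B) * α + 2 * ε * Γ) := by
  have hsub : outerPart n r ⊆ innerCube n r := Set.inter_subset_left
  have hE' := (lintegral_mono_set hsub).trans hE
  have hG' := (lintegral_mono_set hsub).trans hG
  have hv' := (measure_mono hsub).trans (volume_innerCube_le n hr)
  have mD : Measurable fun x => ENNReal.ofReal (sideDist a u x ^ p) :=
    ENNReal.measurable_ofReal.comp ((measurable_sideDist hu a).pow_const p)
  rw [← lintegral_const_mul' _ _ ENNReal.ofReal_ne_top]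
  refine (lintegral_mono fun x => ofReal_mul_layerDen_le (W := W) hC hε hB hα hK hY x).trans ?_
  have hc₁ : 0 ≤ 2 * C + (8 * B ^ 2 + 2 * B) * K := by positivity
  have hc₂ : 0 ≤ (8 * B ^ 2 + 2 * B) * α := by positivity
  generalize 2 * C + (8 * B ^ 2 + 2 * B) * K = c₁ at hc₁ ⊢
  generalize (8 * B ^ 2 + 2 * B) * α = c₂ at hc₂ ⊢
  rw [lintegral_add_right _ ((measurable_gden lam hu).const_mul _),
    lintegral_add_right _ measurable_const,
    lintegral_add_right _ ((measurable_eden hWc ε lam hu).const_mul _),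
    lintegral_const_mul _ mD,
    lintegral_const_mul _ (measurable_eden hWc ε lam hu),
    lintegral_const_mul _ (measurable_gden lam hu), setLIntegral_const,
    ENNReal.ofReal_add (by positivity) (by positivity),
    ENNReal.ofReal_add (by positivity) (by positivity),
    ENNReal.ofReal_add (by positivity) (by positivity),
    ENNReal.ofReal_mul (q := μ) (by positivity), ENNReal.ofReal_mul (q := M) (by positivity),
    ENNReal.ofReal_mul (q := Γ) (by positivity)]
  refine add_le_add (add_le_add (add_le_add (mul_le_mul_right hD _) (mul_le_mul_right hE' _)) ?_)
    (mul_le_mul_right hG' _)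
  exact (mul_le_mul_right hv' _).trans_eq (mul_one _)

/-- The choice of the grid size. -/
theorem exists_grid_size (n : ℕ) {L K₀ M Γ δ : ℝ} (hδ : 0 < δ) :
    ∃ r : ℝ, 0 < r ∧ r ≤ 1 / 8 ∧ 16 * (L * r) * K₀ ≤ δ / 12 ∧
      (M + δ / 4) / (1 - 4 * r) ^ n ≤ M + δ / 2 ∧ (Γ + δ / 4) / (1 - 4 * r) ^ n ≤ Γ + δ / 2 := by
  have hc : ∀ c : ℝ, Tendsto (fun r : ℝ => c / (1 - 4 * r) ^ n) (𝓝[>] 0) (𝓝 c) := by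
    intro c
    have h : ContinuousAt (fun r : ℝ => c / (1 - 4 * r) ^ n) 0 :=
      ContinuousAt.div (by fun_prop) (by fun_prop) (by simp)
    have h2 := h.tendsto
    simp only [mul_zero, sub_zero, one_pow, div_one] at h2
    exact h2.mono_left nhdsWithin_le_nhds
  have hl : Tendsto (fun r : ℝ => 16 * (L * r) * K₀) (𝓝[>] 0) (𝓝 0) := by
    have h : Continuous fun r : ℝ => 16 * (L * r) * K₀ := by fun_prop
    have h2 := h.tendsto 0
    simp only [mul_zero, zero_mul] at h2
    exact h2.mono_left nhdsWithin_le_nhds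
  have h8 : Tendsto (fun r : ℝ => r) (𝓝[>] 0) (𝓝 0) := nhdsWithin_le_nhds
  have e := ((hl.eventually_le_const (show 0 < δ / 12 by positivity)).and
    (((hc (M + δ / 4)).eventually_le_const (show M + δ / 4 < M + δ / 2 by linarith)).and
    ((hc (Γ + δ / 4)).eventually_le_const (show Γ + δ / 4 < Γ + δ / 2 by linarith)))).and
    ((h8.eventually_le_const (show (0 : ℝ) < 1 / 8 by norm_num)).and self_mem_nhdsWithin)
  obtain ⟨r, ⟨h1, h2, h3⟩, h4, h5⟩ := e.exists
  exact ⟨r, h5, h4, h1, h2, h3⟩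

/-- The choice of the small parameter bounding `ε` and the distance to the wells. -/
theorem exists_small_parameters (hp : 2 ≤ p) (hC : 1 ≤ C) {B M Γ δ : ℝ} (hM : 0 ≤ M)
    (hΓ : 0 ≤ Γ) (hδ : 0 < δ) (hr : 0 < r) (hb : 0 ≤ b) (hB : 0 ≤ B) :
    ∃ α K τ : ℝ, 0 ≤ α ∧ 0 ≤ K ∧ (∀ x : ℝ, 0 ≤ x → x ^ 2 + x ≤ α + K * x ^ p) ∧
      0 < τ ∧ τ ≤ 1 / 16 ∧ τ ≤ r ∧ ∀ ε, 0 < ε → ε ≤ τ →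
        (C ^ 2 + 4 + (4 * b ^ 2 + b) * (K * C) * ε) * M + (4 * b ^ 2 + b) * α + Γ ≤
          (C ^ 2 + 5) * M + 1 + Γ ∧
        (2 * C + (8 * B ^ 2 + 2 * B) * K) * τ + 8 * ε * M + (8 * B ^ 2 + 2 * B) * α + 2 * ε * Γ ≤
          δ / 192 := by
  set q₁ : ℝ := 4 * b ^ 2 + b
  set q₂ : ℝ := 8 * B ^ 2 + 2 * B
  have hq₁ : 0 ≤ q₁ := by positivity
  have hq₂ : 0 ≤ q₂ := by positivity
  have hm : 0 < min 1 (δ / 768) := lt_min one_pos (by positivity)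
  set α : ℝ := min 1 (δ / 768) / (q₁ + q₂ + 1)
  have hα : 0 < α := by positivity
  have hqα : (q₁ + q₂ + 1) * α = min 1 (δ / 768) := by
    simp only [α]; field_simp
  obtain ⟨K, hK, hY⟩ := exists_sq_add_le hp hα
  set S : ℝ := 8 * M + 2 * Γ + (2 * C + q₂ * K) + q₁ * (K * C)
  have hS : 0 < S := by positivity
  have hm' : 0 < min 1 (δ / 768) / S := by positivity
  refine ⟨α, K, min (min (1 / 16) r) (min 1 (δ / 768) / S), hα.le, hK, hY,
    lt_min (lt_min (by norm_num) hr) hm', (min_le_left _ _).trans (min_le_left _ _),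
    (min_le_left _ _).trans (min_le_right _ _), fun ε hε hετ => ?_⟩
  set τ := min (min (1 / 16) r) (min 1 (δ / 768) / S)
  have hτ : 0 ≤ τ := hε.le.trans hετ
  have t : S * τ ≤ min 1 (δ / 768) := by
    have : τ ≤ min 1 (δ / 768) / S := min_le_right _ _
    rwa [le_div_iff₀ hS, mul_comm] at this
  have e₁ : 0 ≤ q₁ * α := by positivity
  have e₂ : 0 ≤ q₂ * α := by positivity
  have l₁ := min_le_left 1 (δ / 768)
  have l₂ := min_le_right 1 (δ / 768)
  have f₁ : 0 ≤ (8 * M + 2 * Γ + (2 * C + q₂ * K)) * τ := by positivity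
  have f₂ : 0 ≤ q₁ * (K * C) * τ := by positivity
  have hSτ : S * τ = (8 * M + 2 * Γ + (2 * C + q₂ * K)) * τ + q₁ * (K * C) * τ := by
    simp only [S]; ring
  constructor
  · have h2 : q₁ * (K * C) * ε ≤ q₁ * (K * C) * τ := by gcongr
    have h3 : (C ^ 2 + 4 + q₁ * (K * C) * ε) * M ≤ (C ^ 2 + 5) * M := by
      refine mul_le_mul_of_nonneg_right ?_ hM
      linarith
    linarith
  · have h3 : ε * M ≤ τ * M := by gcongr
    have h4 : ε * Γ ≤ τ * Γ := by gcongr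
    linarith

theorem ofReal_combination {m : ℕ} {x y z w : ℝ} (hx : 0 ≤ x) (hy : 0 ≤ y) (hz : 0 ≤ z)
    (hw : 0 ≤ w) :
    m * ENNReal.ofReal x * ENNReal.ofReal y +
        16 * (ENNReal.ofReal z * ENNReal.ofReal y + ENNReal.ofReal w) =
      ENNReal.ofReal (m * x * y + (16 * (z * y + w))) := by
  rw [ENNReal.ofReal_add (by positivity) (by positivity), ENNReal.ofReal_mul (q := y)
    (by positivity), ENNReal.ofReal_mul (q := x) (by positivity), ENNReal.ofReal_natCast,
    ENNReal.ofReal_mul (p := 16) (by positivity), ENNReal.ofReal_add (by positivity) hw,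
    ENNReal.ofReal_mul (q := y) (by positivity)]
  simp

/-- The main construction: a smooth map with gradient close to the wells away from the interface
yields a periodic competitor, with arbitrarily small loss in energy and constraint. -/
theorem exists_phiPTilde_le_of_smooth (hp : 2 ≤ p) (hWc : Continuous W) (hW : Comparable W a p C)
    (h4 : H4 W) {M Γ δ : ℝ} (hM : 0 ≤ M) (hΓ : 0 ≤ Γ) (hδ : 0 < δ) :
    ∃ r : ℝ, 0 < r ∧ r ≤ 1 / 8 ∧ ∃ τ : ℝ, 0 < τ ∧
      ∀ (u : (Fin (n + 1) → ℝ) → Fin d → ℝ) (ε lam : ℝ), Smooth u → 0 < ε → ε ≤ τ → lam ≤ 0 →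
        ∫⁻ x in innerCube n r, eden W ε lam u x ≤ ENNReal.ofReal M →
        ∫⁻ x in innerCube n r, gden lam u x ≤ ENNReal.ofReal Γ →
        ∫⁻ x in outerPart n r, ENNReal.ofReal (sideDist a u x ^ p) ≤ ENNReal.ofReal τ →
        PhiPTilde W a (Γ + δ) ≤ ENNReal.ofReal (M + δ) := by
  have hC := hW.one_le
  obtain ⟨L, hL, hfold⟩ := exists_foldBounds n
  set K₀ : ℝ := (C ^ 2 + 5) * M + 1 + Γ with hK₀
  have hK₀0 : 0 < K₀ := by positivity
  -- the order of the choices: `L` depends on the dimension only, then `r`, the smoothing `η`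
  -- of the kinks, the bound `β` for the fold, and finally the bound `τ` for `ε`
  obtain ⟨r, hr0, hr8, hrL, hrM, hrΓ⟩ := exists_grid_size n (L := L) (K₀ := K₀) (M := M) (Γ := Γ) hδ
  -- the relative size of the kinks
  set ν : ℝ := δ / (12 * (n + 1) * K₀) with hν
  have hν0 : 0 < ν := by positivity
  have hνn : n * ν * K₀ ≤ δ / 12 := by
    rw [hν]
    have h1 : (n : ℝ) * (δ / (12 * (n + 1) * K₀)) * K₀ = δ / 12 * (n / (n + 1)) := by
      field_simp
    rw [h1]
    refine mul_le_of_le_one_right (by positivity) ?_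
    rw [div_le_one (by positivity)]
    linarith
  obtain ⟨η, hη, hkink⟩ := exists_kink_small (δ := 2 * ν) (by positivity)
  obtain ⟨β, hβ, hb⟩ := hfold η
  set b : ℝ := (n + 1) ^ 2 * (β / r) with hbdef
  have hb0 : 0 ≤ b := by positivity
  set B : ℝ := (n + 1) ^ 2 * β with hBdef
  have hB0 : 0 ≤ B := by positivity
  obtain ⟨α, K, τ, hα0, hK0, hY, hτ0, t1, t2, hτ⟩ :=
    exists_small_parameters hp hC hM hΓ hδ hr0 hb0 hB0
  refine ⟨r, hr0, hr8, τ, hτ0, fun u ε lam hu hε hετ hlam hE hG hD => ?_⟩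
  have hε1 : ε ≤ 1 := by linarith
  have hkd : ∫⁻ x in innerCube n r, kinkDen C p a ε lam b u x ≤ ENNReal.ofReal K₀ :=
    (setLIntegral_kinkDen_le hWc hW hu hr0.le hε hε1 hb0 hα0 hK0 hY hM hΓ hE hG).trans
      (ENNReal.ofReal_le_ofReal (hτ ε hε hετ).1)
  have hld : ENNReal.ofReal (2 * ε) * ∫⁻ x in outerPart n r, layerDen C p a ε lam (B / ε) u x ≤
      ENNReal.ofReal (δ / 192) :=
    (setLIntegral_layerDen_le hWc hC hu hr0.le hε hB0 hα0 hK0 hY hM hΓ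
      hτ0.le hE hG hD).trans (ENNReal.ofReal_le_ofReal (hτ ε hε hετ).2)
  have hbB : (n + 1 : ℝ) ^ 2 * (β / ε) = B / ε := by rw [hBdef]; ring
  have hmem := attain_of_smooth (R := δ / 4) hp hWc hW h4 hu hlam hL hβ hb hη hr0 hr8 hε
    (hετ.trans t2) (hετ.trans t1) hν0.le
    ((hkink r hr0).trans_eq (by congr 1; ring)) rfl rfl hM hΓ (by positivity) hE hG (by
      rw [hbB, ← hbdef]
      calc _ ≤ n * ENNReal.ofReal ν * ENNReal.ofReal K₀ +
            16 * (ENNReal.ofReal (L * r) * ENNReal.ofReal K₀ + ENNReal.ofReal (δ / 192)) := by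
            gcongr
        _ = ENNReal.ofReal (n * ν * K₀ + (16 * (L * r * K₀ + δ / 192))) :=
            ofReal_combination hν0.le hK₀0.le (by positivity) (by positivity)
        _ ≤ _ := by
            refine ENNReal.ofReal_le_ofReal ?_
            linarith)
  have hmem2 := attain_mono hmem (q' := (M + δ / 2, Γ + δ / 2)) ⟨hrM, hrΓ⟩
  obtain ⟨m, hm, v, hv⟩ := hmem2.2.2 (δ / 2) (by positivity)
  have e1 : M + δ / 2 + δ / 2 = M + δ := by ring
  have e2 : Γ + δ / 2 + δ / 2 = Γ + δ := by ring
  simp only [e1, e2] at hv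
  exact hv.phiPTilde_le hWc hε hlam (by positivity)

end Smallness

/-! ### Mollification -/

section Mollification

open Metric
open scoped Convolution

variable {n : ℕ}

/-- A sequence of bump functions shrinking to the origin. -/
def bumpSeq (n m : ℕ) : ContDiffBump (0 : Fin (n + 1) → ℝ) where
  rIn := 1 / (2 * (m + 1))
  rOut := 1 / (m + 1)
  rIn_pos := by positivity
  rIn_lt_rOut := by
    rw [div_lt_div_iff₀ (by positivity) (by positivity)]
    linarith [(m.cast_nonneg : (0 : ℝ) ≤ m)]

/-- The mollifier of radius `1 / (m + 1)`. -/
def kern (n m : ℕ) : (Fin (n + 1) → ℝ) → ℝ := (bumpSeq n m).normed volume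

/-- The mollification of `f` at scale `1 / (m + 1)`. -/
def moll (m : ℕ) (f : (Fin (n + 1) → ℝ) → ℝ) (x : Fin (n + 1) → ℝ) : ℝ :=
  (kern n m ⋆[ContinuousLinearMap.lsmul ℝ ℝ, volume] f) x

variable {f g : (Fin (n + 1) → ℝ) → ℝ} {m : ℕ} {x : Fin (n + 1) → ℝ}

theorem contDiff_kern : ContDiff ℝ ∞ (kern n m) := (bumpSeq n m).contDiff_normed

theorem hasCompactSupport_kern : HasCompactSupport (kern n m) :=
  (bumpSeq n m).hasCompactSupport_normed

theorem kern_nonneg (x : Fin (n + 1) → ℝ) : 0 ≤ kern n m x := (bumpSeq n m).nonneg_normed x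

theorem integral_kern : ∫ x, kern n m x = 1 := (bumpSeq n m).integral_normed

theorem kern_eq_zero (hx : 1 / (m + 1 : ℝ) ≤ ‖x‖) : kern n m x = 0 := by
  by_contra h
  have h2 : x ∈ Function.support ((bumpSeq n m).normed volume) := h
  rw [(bumpSeq n m).support_normed_eq, mem_ball_zero_iff] at h2
  exact absurd hx (not_le.2 h2)

theorem moll_apply : moll m f x = ∫ t, kern n m (x - t) * f t := by
  rw [moll, convolution_eq_swap]
  rfl

theorem moll_apply' : moll m f x = ∫ t, kern n m t * f (x - t) := rfl

theorem integrable_kern_mul (hf : LocallyIntegrable f) (x : Fin (n + 1) → ℝ) :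
    Integrable fun t => kern n m t * f (x - t) :=
  (hasCompactSupport_kern.convolutionExists_left (ContinuousLinearMap.lsmul ℝ ℝ)
    contDiff_kern.continuous hf x).integrable

theorem integrable_kern : Integrable (kern n m) :=
  contDiff_kern.continuous.integrable_of_hasCompactSupport hasCompactSupport_kern

theorem contDiff_moll (hf : LocallyIntegrable f) : ContDiff ℝ ∞ (moll m f) :=
  hasCompactSupport_kern.contDiff_convolution_left _ contDiff_kern hf

theorem pd_moll_eq_integral (hf : LocallyIntegrable f) (j : Fin (n + 1)) :
    pd j (moll m f) x = ∫ t, pd j (kern n m) (x - t) * f t := by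
  have h := hasCompactSupport_kern.hasFDerivAt_convolution_left (ContinuousLinearMap.lsmul ℝ ℝ)
    (contDiff_kern (n := n) (m := m) |>.of_le (by simp)) hf x
  have h2 : fderiv ℝ (moll m f) x = (fderiv ℝ (kern n m)
      ⋆[(ContinuousLinearMap.lsmul ℝ ℝ).precompL (Fin (n + 1) → ℝ), volume] f) x := h.fderiv
  have hi : Integrable fun t => ((ContinuousLinearMap.lsmul ℝ ℝ : ℝ →L[ℝ] ℝ →L[ℝ] ℝ).precompL
      (Fin (n + 1) → ℝ)) (fderiv ℝ (kern n m) (x - t)) (f t) := by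
    have := (hasCompactSupport_kern (n := n) (m := m)).fderiv ℝ |>.convolutionExists_left
      ((ContinuousLinearMap.lsmul ℝ ℝ : ℝ →L[ℝ] ℝ →L[ℝ] ℝ).precompL (Fin (n + 1) → ℝ))
      (contDiff_kern.continuous_fderiv (by simp)) hf x
    exact this.integrable_swap
  rw [pd, h2, convolution_eq_swap, ContinuousLinearMap.integral_apply hi]
  rfl

/-- Derivatives of a mollified function are mollified weak derivatives, away from the boundary. -/
theorem pd_moll {U : Set (Fin (n + 1) → ℝ)} (hU : MeasurableSet U) {j : Fin (n + 1)}
    (hf : LocallyIntegrable (U.indicator f))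
    (hw : ∀ φ, IsTest U φ → ∫ x in U, f x * fderiv ℝ φ x (Pi.single j 1) = -∫ x in U, g x * φ x)
    (hx : closedBall x (1 / (m + 1 : ℝ)) ⊆ U) :
    pd j (moll m (U.indicator f)) x = moll m (U.indicator g) x := by
  have ht : IsTest U fun t => kern n m (x - t) := by
    have hc : HasCompactSupport fun t => kern n m (x - t) :=
      hasCompactSupport_kern.comp_homeomorph (Homeomorph.subLeft x)
    refine ⟨contDiff_kern.comp (by fun_prop), hc, ?_⟩
    have h : tsupport (fun t => kern n m (x - t)) ⊆ closedBall x (1 / (m + 1 : ℝ)) := by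
      refine closure_minimal (fun t ht => ?_) isClosed_closedBall
      by_contra h
      refine ht (kern_eq_zero ?_)
      rw [mem_closedBall, dist_comm, dist_eq_norm, not_le] at h
      exact h.le
    exact h.trans hx
  have h := hw _ ht
  have hd : ∀ t, fderiv ℝ (fun t => kern n m (x - t)) t (Pi.single j 1) =
      -pd j (kern n m) (x - t) := by
    intro t
    have h1 := (diffAt_of_contDiff (contDiff_kern (n := n) (m := m)) (x - t)).hasFDerivAt.comp t
      ((hasFDerivAt_id (𝕜 := ℝ) t).const_sub x)
    have h2 : fderiv ℝ (fun t => kern n m (x - t)) t = _ := h1.fderiv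
    rw [h2]
    simp [pd]
  simp only [hd, mul_neg, integral_neg, neg_inj] at h
  rw [pd_moll_eq_integral hf, moll_apply]
  have e : ∀ (k : (Fin (n + 1) → ℝ) → ℝ) (q : (Fin (n + 1) → ℝ) → ℝ),
      ∫ t, k t * U.indicator q t = ∫ t in U, q t * k t := by
    intro k q
    rw [← integral_indicator hU]
    congr 1
    funext t
    by_cases ht : t ∈ U <;> simp [ht, mul_comm]
  rw [e, e, h]

theorem ae_tendsto_moll (hf : LocallyIntegrable f) :
    ∀ᵐ x, Tendsto (fun m => moll m f x) atTop (𝓝 (f x)) := by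
  refine ContDiffBump.ae_convolution_tendsto_right_of_locallyIntegrable (K := 2)
    (φ := fun m => bumpSeq n m) ?_ (Eventually.of_forall fun m => ?_) hf
  · exact tendsto_one_div_add_atTop_nhds_zero_nat
  · change 1 / (m + 1 : ℝ) ≤ 2 * (1 / (2 * (m + 1)))
    field_simp
    rfl

/-- The mollification depends only on the values of `f` in a ball of radius `1 / (m + 1)`. -/
theorem moll_const_of_ae (c : ℝ) (h : ∀ᵐ t, t ∈ ball x (1 / (m + 1 : ℝ)) → f t = c) :
    moll m f x = c := by
  rw [moll_apply]
  have e : ∀ᵐ t, kern n m (x - t) * f t = kern n m (x - t) * c := by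
    filter_upwards [h] with t ht
    by_cases h2 : t ∈ ball x (1 / (m + 1 : ℝ))
    · rw [ht h2]
    · rw [kern_eq_zero, zero_mul, zero_mul]
      rwa [mem_ball, dist_comm, dist_eq_norm, not_lt] at h2
  rw [integral_congr_ae e, integral_mul_const, integral_sub_left_eq_self (kern n m) volume x,
    integral_kern, one_mul]

theorem abs_moll_le : |moll m f x| ≤ moll m (fun y => |f y|) x := by
  rw [moll_apply', moll_apply', ← Real.norm_eq_abs]
  refine (norm_integral_le_integral_norm _).trans_eq ?_
  congr 1
  funext t
  rw [norm_mul, Real.norm_of_nonneg (kern_nonneg t), Real.norm_eq_abs]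

theorem moll_mono (hf : LocallyIntegrable f) (hg : LocallyIntegrable g) (h : ∀ᵐ y, f y ≤ g y) :
    moll m f x ≤ moll m g x := by
  rw [moll_apply', moll_apply']
  refine integral_mono_ae (integrable_kern_mul hf x) (integrable_kern_mul hg x) ?_
  have h2 : ∀ᵐ t, f (x - t) ≤ g (x - t) :=
    (Measure.measurePreserving_sub_left volume x).quasiMeasurePreserving.ae h
  filter_upwards [h2] with t ht
  exact mul_le_mul_of_nonneg_left ht (kern_nonneg t)

/-- Jensen's inequality for mollification. -/
theorem abs_moll_rpow_le {p : ℝ} (hp : 1 ≤ p) (hf : LocallyIntegrable f)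
    (hfp : LocallyIntegrable fun y => |f y| ^ p) :
    |moll m f x| ^ p ≤ moll m (fun y => |f y| ^ p) x := by
  have hfa : LocallyIntegrable fun y => |f y| := fun y => by
    obtain ⟨s, hs, hi⟩ := hf y
    exact ⟨s, hs, hi.norm⟩
  refine (Real.rpow_le_rpow (abs_nonneg _) abs_moll_le (by linarith)).trans ?_
  set S := moll m (fun y => |f y|) x with hS
  have hS0 : 0 ≤ S := integral_nonneg fun t => mul_nonneg (kern_nonneg t) (abs_nonneg _)
  rcases hS0.eq_or_lt with h0 | h0
  · rw [← h0, Real.zero_rpow (by linarith)]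
    exact integral_nonneg fun t => mul_nonneg (kern_nonneg t) (by positivity)
  -- the tangent line of `t ↦ t ^ p` at the mean value `S`
  have hT : ∀ t : ℝ, 0 ≤ t → S ^ p * (1 - p) + p * S ^ (p - 1) * t ≤ t ^ p := by
    intro t ht
    have h1 := one_add_mul_self_le_rpow_one_add (s := t / S - 1)
      (by linarith [div_nonneg ht hS0]) hp
    rw [add_sub_cancel, Real.div_rpow ht hS0, le_div_iff₀ (by positivity)] at h1
    refine le_of_eq_of_le ?_ h1
    rw [Real.rpow_sub h0, Real.rpow_one]
    field_simp
    ring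
  have e : ∫ t, (S ^ p * (1 - p) * kern n m t + p * S ^ (p - 1) * (kern n m t * |f (x - t)|)) =
      S ^ p := by
    rw [integral_add (integrable_kern.const_mul _) ((integrable_kern_mul hfa x).const_mul _),
      integral_const_mul, integral_const_mul, integral_kern, ← moll_apply' (f := fun y => |f y|), ← hS,
      Real.rpow_sub h0, Real.rpow_one]
    field_simp
    ring
  rw [← e, moll_apply']
  refine integral_mono ((integrable_kern.const_mul _).add
    ((integrable_kern_mul hfa x).const_mul _)) (integrable_kern_mul hfp x) fun t => ?_
  refine le_of_eq_of_le ?_ (mul_le_mul_of_nonneg_left (hT |f (x - t)| (abs_nonneg _))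
    (kern_nonneg t))
  ring

theorem moll_nonneg (hf : ∀ y, 0 ≤ f y) : 0 ≤ moll m f x :=
  integral_nonneg fun t => mul_nonneg (kern_nonneg t) (hf _)

theorem lintegral_moll (hf : Integrable f) (h0 : ∀ y, 0 ≤ f y) :
    ∫⁻ x, ENNReal.ofReal (moll m f x) = ∫⁻ x, ENNReal.ofReal (f x) := by
  have hi : Integrable (moll m f) := integrable_kern.integrable_convolution _ hf
  rw [← ofReal_integral_eq_lintegral_ofReal hi (Eventually.of_forall fun x => moll_nonneg h0),
    ← ofReal_integral_eq_lintegral_ofReal hf (Eventually.of_forall h0)]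
  congr 1
  have := integral_convolution (μ := volume) (ν := volume) (ContinuousLinearMap.lsmul ℝ ℝ)
    (integrable_kern (n := n) (m := m)) hf
  refine this.trans ?_
  rw [integral_kern]
  simp

/-- Upper semicontinuity of integrals under domination by a convergent sequence with constant
integrals. -/
theorem eventually_lintegral_le_of_dominated {X : Type*} [MeasurableSpace X] {μ : Measure X}
    {F K : ℕ → X → ℝ≥0∞} {F' K' : X → ℝ≥0∞} (hF : ∀ m, Measurable (F m))
    (hK : ∀ m, Measurable (K m))
    (hFK : ∀ᶠ m in atTop, ∀ x, F m x ≤ K m x) (tF : ∀ᵐ x ∂μ, Tendsto (fun m => F m x) atTop (𝓝 (F' x)))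
    (tK : ∀ᵐ x ∂μ, Tendsto (fun m => K m x) atTop (𝓝 (K' x)))
    (hi : ∀ m, ∫⁻ x, K m x ∂μ = ∫⁻ x, K' x ∂μ) (hfin : ∫⁻ x, K' x ∂μ ≠ ⊤)
    {δ : ℝ≥0∞} (hδ : 0 < δ) :
    ∀ᶠ m in atTop, ∫⁻ x, F m x ∂μ ≤ ∫⁻ x, F' x ∂μ + δ := by
  have hF' : AEMeasurable F' μ :=
    aemeasurable_of_tendsto_metrizable_ae' (fun m => (hF m).aemeasurable) tF
  have hK' : AEMeasurable K' μ :=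
    aemeasurable_of_tendsto_metrizable_ae' (fun m => (hK m).aemeasurable) tK
  have hF'K : ∀ᵐ x ∂μ, F' x ≤ K' x := by
    filter_upwards [tF, tK] with x h1 h2
    exact le_of_tendsto_of_tendsto h1 h2 (hFK.mono fun m hm => hm x)
  have hfin' : ∀ᵐ x ∂μ, K' x < ⊤ := ae_lt_top' hK' hfin
  have hsub : ∀ m, (∀ x, F m x ≤ K m x) →
      ∫⁻ x, F m x ∂μ + ∫⁻ x, (K m x - F m x) ∂μ = ∫⁻ x, K' x ∂μ := by
    intro m hm
    rw [← hi m, ← lintegral_add_left (hF m)]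
    exact lintegral_congr fun x => add_tsub_cancel_of_le (hm x)
  have hsub' : ∫⁻ x, F' x ∂μ + ∫⁻ x, (K' x - F' x) ∂μ = ∫⁻ x, K' x ∂μ := by
    rw [← lintegral_add_left' hF']
    refine lintegral_congr_ae ?_
    filter_upwards [hF'K] with x hx using add_tsub_cancel_of_le hx
  have hfatou : ∫⁻ x, (K' x - F' x) ∂μ ≤ liminf (fun m => ∫⁻ x, (K m x - F m x) ∂μ) atTop := by
    refine le_trans (le_of_eq (lintegral_congr_ae ?_))
      (lintegral_liminf_le fun m => (hK m).sub (hF m))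
    filter_upwards [tF, tK, hfin'] with x h1 h2 h3
    exact (ENNReal.Tendsto.sub h2 h1 (Or.inl h3.ne)).liminf_eq.symm
  have hI : ∫⁻ x, (K' x - F' x) ∂μ ≠ ⊤ :=
    ((self_le_add_left _ _).trans_eq hsub').trans_lt hfin.lt_top |>.ne
  have hev : ∀ᶠ m in atTop, ∫⁻ x, (K' x - F' x) ∂μ ≤ ∫⁻ x, (K m x - F m x) ∂μ + δ := by
    by_cases h0 : ∫⁻ x, (K' x - F' x) ∂μ = 0
    · exact Eventually.of_forall fun m => by simp [h0]
    · have : ∫⁻ x, (K' x - F' x) ∂μ - δ <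
          liminf (fun m => ∫⁻ x, (K m x - F m x) ∂μ) atTop :=
        (ENNReal.sub_lt_self hI h0 hδ.ne').trans_le hfatou
      filter_upwards [eventually_lt_of_lt_liminf this] with m hm
      exact tsub_le_iff_right.1 hm.le
  filter_upwards [hev, hFK] with m hm hm'
  refine (ENNReal.add_le_add_iff_right (a := ∫⁻ x, (K' x - F' x) ∂μ) hI).1 ?_
  calc _ ≤ ∫⁻ x, F m x ∂μ + (∫⁻ x, (K m x - F m x) ∂μ + δ) := by gcongr
    _ = ∫⁻ x, K' x ∂μ + δ := by rw [← add_assoc, hsub m hm']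
    _ = _ := by rw [← hsub', add_right_comm]

end Mollification

section MollifiedMaps

open Metric

variable {d n : ℕ} {f g : (Fin (n + 1) → ℝ) → ℝ} {m : ℕ} {x : Fin (n + 1) → ℝ}

theorem moll_add (hf : LocallyIntegrable f) (hg : LocallyIntegrable g) :
    moll m (fun y => f y + g y) x = moll m f x + moll m g x := by
  simp only [moll_apply', mul_add]
  exact integral_add (integrable_kern_mul hf x) (integrable_kern_mul hg x)

theorem moll_const_mul (c : ℝ) : moll m (fun y => c * f y) x = c * moll m f x := by
  simp only [moll_apply', mul_left_comm _ c]
  exact integral_const_mul _ _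

theorem moll_sum {ι : Type*} {s : Finset ι} {k : ι → (Fin (n + 1) → ℝ) → ℝ}
    (hk : ∀ l ∈ s, LocallyIntegrable (k l)) :
    moll m (fun y => ∑ l ∈ s, k l y) x = ∑ l ∈ s, moll m (k l) x := by
  simp only [moll_apply', Finset.mul_sum]
  exact integral_finsetSum _ fun l hl => integrable_kern_mul (hk l hl) x

variable {q : ℝ≥0∞} {U V : Set (Fin (n + 1) → ℝ)} {u : (Fin (n + 1) → ℝ) → Fin d → ℝ}
  {G : (Fin (n + 1) → ℝ) → Matrix (Fin d) (Fin (n + 1)) ℝ}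
  {H : (Fin (n + 1) → ℝ) → Fin d → Fin (n + 1) → Fin (n + 1) → ℝ}

theorem locallyIntegrable_indicator (hq : 1 ≤ q) (hU : MeasurableSet U)
    (hf : MemLp f q (volume.restrict U)) : LocallyIntegrable (U.indicator f) :=
  ((memLp_indicator_iff_restrict hU).2 hf).locallyIntegrable hq

/-- The mollification of a map on `U`, extended by zero. -/
def mollMap (m : ℕ) (U : Set (Fin (n + 1) → ℝ)) (u : (Fin (n + 1) → ℝ) → Fin d → ℝ)
    (x : Fin (n + 1) → ℝ) : Fin d → ℝ :=
  fun i => moll m (U.indicator fun y => u y i) x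

theorem smooth_mollMap (hq : 1 ≤ q) (hU : MeasurableSet U) (hS : IsSobolevTwo q U u G H) (m : ℕ) :
    Smooth (mollMap m U u) :=
  fun i => contDiff_moll (locallyIntegrable_indicator hq hU (hS.memLp_fun i))

theorem grad_mollMap (hq : 1 ≤ q) (hU : MeasurableSet U) (hS : IsSobolevTwo q U u G H)
    (hx : closedBall x (1 / (m + 1 : ℝ)) ⊆ U) :
    grad (mollMap m U u) x = fun i j => moll m (U.indicator fun y => G y i j) x := by
  funext i j
  exact pd_moll hU (locallyIntegrable_indicator hq hU (hS.memLp_fun i)) (hS.weak_grad i j) hx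

/-- Weak derivatives commute with mollification at points whose distance from the boundary exceeds
the scale. -/
theorem hess_mollMap (hq : 1 ≤ q) (hU : MeasurableSet U) (hS : IsSobolevTwo q U u G H) {ρ : ℝ}
    (hρ : 1 / (m + 1 : ℝ) < ρ) (hx : closedBall x ρ ⊆ U) :
    hess (mollMap m U u) x = fun i j k => moll m (U.indicator fun y => H y i j k) x := by
  funext i j k
  have h : (pd j fun y => mollMap m U u y i) =ᶠ[𝓝 x] moll m (U.indicator fun y => G y i j) := by
    filter_upwards [ball_mem_nhds x (show 0 < ρ - 1 / (m + 1 : ℝ) by linarith)] with y hy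
    refine pd_moll hU (locallyIntegrable_indicator hq hU (hS.memLp_fun i)) (hS.weak_grad i j) ?_
    refine (closedBall_subset_closedBall' ?_).trans hx
    rw [mem_ball] at hy
    linarith
  rw [hess, pd_congr h k]
  exact pd_moll hU (locallyIntegrable_indicator hq hU (hS.memLp_grad i j)) (hS.weak_hess i j k)
    ((closedBall_subset_closedBall hρ.le).trans hx)

theorem eventually_one_div_lt {ρ : ℝ} (hρ : 0 < ρ) : ∀ᶠ m : ℕ in atTop, 1 / (m + 1 : ℝ) < ρ :=
  tendsto_one_div_add_atTop_nhds_zero_nat.eventually_lt_const hρ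

/-- Almost everywhere convergence of the first two derivatives of the mollified maps. -/
theorem ae_tendsto_mollMap (hq : 1 ≤ q) (hU : MeasurableSet U) (hS : IsSobolevTwo q U u G H)
    {ρ : ℝ} (hρ : 0 < ρ) : ∀ᵐ x : Fin (n + 1) → ℝ, closedBall x ρ ⊆ U →
      Tendsto (fun m => grad (mollMap m U u) x) atTop (𝓝 (G x)) ∧
        Tendsto (fun m => hess (mollMap m U u) x) atTop (𝓝 (H x)) := by
  have hG : ∀ᵐ x : Fin (n + 1) → ℝ, ∀ i j, Tendsto (fun m => moll m
      (U.indicator fun y => G y i j) x) atTop (𝓝 (U.indicator (fun y => G y i j) x)) := by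
    simp only [ae_all_iff]
    exact fun i j => ae_tendsto_moll (locallyIntegrable_indicator hq hU (hS.memLp_grad i j))
  have hH : ∀ᵐ x : Fin (n + 1) → ℝ, ∀ i j k, Tendsto (fun m => moll m
      (U.indicator fun y => H y i j k) x) atTop (𝓝 (U.indicator (fun y => H y i j k) x)) := by
    simp only [ae_all_iff]
    exact fun i j k => ae_tendsto_moll (locallyIntegrable_indicator hq hU (hS.memLp_hess i j k))
  filter_upwards [hG, hH] with x h1 h2 hx
  have hxU : x ∈ U := hx (mem_closedBall_self hρ.le)
  simp only [Set.indicator_of_mem hxU] at h1 h2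
  constructor
  · have h : Tendsto (fun m i j => moll m (U.indicator fun y => G y i j) x) atTop (𝓝 (G x)) :=
      tendsto_pi_nhds.2 fun i => tendsto_pi_nhds.2 fun j => h1 i j
    refine h.congr' ?_
    filter_upwards [eventually_one_div_lt hρ] with m hm
    exact (grad_mollMap hq hU hS ((closedBall_subset_closedBall hm.le).trans hx)).symm
  · have h : Tendsto (fun m i j k => moll m (U.indicator fun y => H y i j k) x) atTop (𝓝 (H x)) :=
      tendsto_pi_nhds.2 fun i => tendsto_pi_nhds.2 fun j => tendsto_pi_nhds.2 fun k => h2 i j k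
    refine h.congr' ?_
    filter_upwards [eventually_one_div_lt hρ] with m hm
    exact (hess_mollMap hq hU hS hm hx).symm

variable {Ψ : (Fin (n + 1) → ℝ) → Matrix (Fin d) (Fin (n + 1)) ℝ →
    (Fin d → Fin (n + 1) → Fin (n + 1) → ℝ) → ℝ}

/-- Integrals of a density along mollified maps are asymptotically bounded by the integral along
the original map, if the density is dominated by a convergent sequence. -/
theorem eventually_setLIntegral_mollMap_le (hq : 1 ≤ q) (hU : MeasurableSet U)
    (hS : IsSobolevTwo q U u G H) {ρ : ℝ} (hρ : 0 < ρ) (hV : MeasurableSet V)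
    (hVU : ∀ x ∈ V, closedBall x ρ ⊆ U)
    (hΨ : ∀ x, Continuous fun z : Matrix (Fin d) (Fin (n + 1)) ℝ ×
      (Fin d → Fin (n + 1) → Fin (n + 1) → ℝ) => Ψ x z.1 z.2)
    (hΨm : ∀ w : (Fin (n + 1) → ℝ) → Fin d → ℝ, Smooth w →
      Measurable fun x => Ψ x (grad w x) (hess w x))
    {K : ℕ → (Fin (n + 1) → ℝ) → ℝ≥0∞} {K' : (Fin (n + 1) → ℝ) → ℝ≥0∞}
    (hK : ∀ m, Measurable (K m)) (tK : ∀ᵐ x, Tendsto (fun m => K m x) atTop (𝓝 (K' x)))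
    (hi : ∀ m, ∫⁻ x, K m x = ∫⁻ x, K' x) (hfin : ∫⁻ x, K' x ≠ ⊤)
    (hΨK : ∀ᶠ m in atTop, ∀ x ∈ V, ENNReal.ofReal
      (Ψ x (fun i j => moll m (U.indicator fun y => G y i j) x)
        fun i j k => moll m (U.indicator fun y => H y i j k) x) ≤ K m x)
    {δ : ℝ≥0∞} (hδ : 0 < δ) :
    ∀ᶠ m in atTop, ∫⁻ x in V, ENNReal.ofReal
        (Ψ x (grad (mollMap m U u) x) (hess (mollMap m U u) x)) ≤
      (∫⁻ x in V, ENNReal.ofReal (Ψ x (G x) (H x))) + δ := by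
  simp only [← lintegral_indicator hV]
  refine eventually_lintegral_le_of_dominated (K := K) (K' := K') (fun m => ?_) hK ?_ ?_ tK hi
    hfin hδ
  · exact (ENNReal.measurable_ofReal.comp (hΨm _ (smooth_mollMap hq hU hS m))).indicator hV
  · filter_upwards [hΨK, eventually_one_div_lt hρ] with m hm hmρ x
    by_cases hx : x ∈ V
    · rw [Set.indicator_of_mem (s := V) hx, hess_mollMap hq hU hS hmρ (hVU x hx),
        grad_mollMap hq hU hS ((closedBall_subset_closedBall hmρ.le).trans (hVU x hx))]
      exact hm x hx
    · rw [Set.indicator_of_notMem (s := V) hx]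
      exact zero_le
  · filter_upwards [ae_tendsto_mollMap hq hU hS hρ] with x hx
    by_cases hxV : x ∈ V
    · simp only [Set.indicator_of_mem (s := V) hxV]
      obtain ⟨h1, h2⟩ := hx (hVU x hxV)
      exact (ENNReal.continuous_ofReal.tendsto _).comp
        (((hΨ x).tendsto (G x, H x)).comp (h1.prodMk_nhds h2))
    · simp only [Set.indicator_of_notMem (s := V) hxV]
      exact tendsto_const_nhds

/-- The case of densities with growth of order `p` in the gradient and quadratic growth in the
second gradient. -/
theorem eventually_setLIntegral_mollMap_le_of_growth {p : ℝ} (hp : 1 ≤ p) (hq : 1 ≤ q)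
    (hU : MeasurableSet U)
    (hS : IsSobolevTwo q U u G H) {ρ : ℝ} (hρ : 0 < ρ) (hV : MeasurableSet V)
    (hVfin : volume V ≠ ⊤) (hVU : ∀ x ∈ V, closedBall x ρ ⊆ U)
    (hG : ∀ i j, Integrable fun x => |U.indicator (fun y => G y i j) x| ^ p)
    (hH : ∀ i j k, Integrable fun x => |U.indicator (fun y => H y i j k) x| ^ (2 : ℝ))
    (hΨ : ∀ x, Continuous fun z : Matrix (Fin d) (Fin (n + 1)) ℝ ×
      (Fin d → Fin (n + 1) → Fin (n + 1) → ℝ) => Ψ x z.1 z.2)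
    (hΨm : ∀ w : (Fin (n + 1) → ℝ) → Fin d → ℝ, Smooth w →
      Measurable fun x => Ψ x (grad w x) (hess w x))
    {C : ℝ} (hC : 0 ≤ C) (hgrowth : ∀ x ξ η, Ψ x ξ η ≤
      C * (1 + ∑ i, ∑ j, |ξ i j| ^ p + ∑ i, ∑ j, ∑ k, |η i j k| ^ (2 : ℝ)))
    {δ : ℝ≥0∞} (hδ : 0 < δ) :
    ∀ᶠ m in atTop, ∫⁻ x in V, ENNReal.ofReal
        (Ψ x (grad (mollMap m U u) x) (hess (mollMap m U u) x)) ≤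
      (∫⁻ x in V, ENNReal.ofReal (Ψ x (G x) (H x))) + δ := by
  set k : (Fin (n + 1) → ℝ) → ℝ := fun x => C * (∑ i, ∑ j, |U.indicator (fun y => G y i j) x| ^ p +
    ∑ i, ∑ j, ∑ k, |U.indicator (fun y => H y i j k) x| ^ (2 : ℝ)) with hk
  have i1 : Integrable fun x => ∑ i, ∑ j, |U.indicator (fun y => G y i j) x| ^ p :=
    integrable_finsetSum _ fun i _ => integrable_finsetSum _ fun j _ => hG i j
  have i2 : Integrable fun x => ∑ i, ∑ j, ∑ k, |U.indicator (fun y => H y i j k) x| ^ (2 : ℝ) :=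
    integrable_finsetSum _ fun i _ => integrable_finsetSum _ fun j _ =>
      integrable_finsetSum _ fun k _ => hH i j k
  have hki : Integrable k := (i1.add i2).const_mul C
  have hk0 : ∀ x, 0 ≤ k x := fun x => by positivity
  have e : ∀ m x, moll m k x =
      C * (∑ i, ∑ j, moll m (fun x => |U.indicator (fun y => G y i j) x| ^ p) x +
        ∑ i, ∑ j, ∑ k, moll m (fun x => |U.indicator (fun y => H y i j k) x| ^ (2 : ℝ)) x) := by
    intro m x
    rw [hk, moll_const_mul, moll_add i1.locallyIntegrable i2.locallyIntegrable, moll_sum, moll_sum]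
    · congr 3
      · funext i
        exact moll_sum fun j _ => (hG i j).locallyIntegrable
      · funext i
        rw [moll_sum]
        · congr 1
          funext j
          exact moll_sum fun k _ => (hH i j k).locallyIntegrable
        · exact fun j _ => (integrable_finsetSum _ fun k _ => hH i j k).locallyIntegrable
    · exact fun i _ => (integrable_finsetSum _ fun j _ => integrable_finsetSum _ fun k _ =>
        hH i j k).locallyIntegrable
    · exact fun i _ => (integrable_finsetSum _ fun j _ => hG i j).locallyIntegrable
  have mm : ∀ m, Measurable fun x => ENNReal.ofReal (moll m k x) := fun m =>
    ENNReal.measurable_ofReal.comp (contDiff_moll hki.locallyIntegrable).continuous.measurable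
  have mc : Measurable (V.indicator fun _ => ENNReal.ofReal C) := measurable_const.indicator hV
  -- by Jensen the density is dominated by `C` plus the mollification of `k`, whose integral
  -- does not depend on `m`
  refine eventually_setLIntegral_mollMap_le hq hU hS hρ hV hVU hΨ hΨm
    (K := fun m x => V.indicator (fun _ => ENNReal.ofReal C) x + ENNReal.ofReal (moll m k x))
    (K' := fun x => V.indicator (fun _ => ENNReal.ofReal C) x + ENNReal.ofReal (k x))
    (fun m => mc.add (mm m)) ?_ ?_ ?_ (Eventually.of_forall fun m x hx => ?_) hδ
  · filter_upwards [ae_tendsto_moll hki.locallyIntegrable] with x hx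
    exact tendsto_const_nhds.add ((ENNReal.continuous_ofReal.tendsto _).comp hx)
  · intro m
    rw [lintegral_add_left mc, lintegral_add_left mc, lintegral_moll hki hk0]
  · rw [lintegral_add_left mc, lintegral_indicator hV, setLIntegral_const]
    exact ENNReal.add_ne_top.2 ⟨ENNReal.mul_ne_top ENNReal.ofReal_ne_top hVfin,
      (hki.lintegral_lt_top).ne⟩
  · rw [Set.indicator_of_mem (s := V) hx, ← ENNReal.ofReal_add hC (moll_nonneg hk0)]
    refine ENNReal.ofReal_le_ofReal ((hgrowth _ _ _).trans ?_)
    rw [e, add_assoc, mul_add, mul_one]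
    gcongr with i _ j _ i _ j _ k _
    · exact abs_moll_rpow_le hp (locallyIntegrable_indicator hq hU (hS.memLp_grad i j))
        (hG i j).locallyIntegrable
    · exact abs_moll_rpow_le one_le_two (locallyIntegrable_indicator hq hU (hS.memLp_hess i j k))
        (hH i j k).locallyIntegrable

end MollifiedMaps

/-! ### Smooth approximation of maps of finite energy -/

section SmoothApproximation

open Metric

variable {d n : ℕ} {W : Matrix (Fin d) (Fin (n + 1)) ℝ → ℝ≥0} {a : Fin d → ℝ} {p ε lam r γ : ℝ}
  {u : (Fin (n + 1) → ℝ) → Fin d → ℝ}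
  {G : (Fin (n + 1) → ℝ) → Matrix (Fin d) (Fin (n + 1)) ℝ}
  {H : (Fin (n + 1) → ℝ) → Fin d → Fin (n + 1) → Fin (n + 1) → ℝ}

theorem add_rpow_le_two_rpow_mul {x y : ℝ} (hp : 0 ≤ p) (hx : 0 ≤ x) (hy : 0 ≤ y) :
    (x + y) ^ p ≤ 2 ^ p * (x ^ p + y ^ p) := by
  have h : x + y ≤ 2 * max x y := by linarith [le_max_left x y, le_max_right x y]
  refine (Real.rpow_le_rpow (by positivity) h hp).trans ?_
  rw [Real.mul_rpow (by norm_num) (hx.trans (le_max_left _ _))]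
  refine mul_le_mul_of_nonneg_left ?_ (by positivity)
  rcases max_cases x y with ⟨h, -⟩ | ⟨h, -⟩ <;> rw [h]
  · exact le_add_of_nonneg_right (by positivity)
  · exact le_add_of_nonneg_left (by positivity)

theorem sum_rpow_le {ι : Type*} (s : Finset ι) (hp : 1 ≤ p) {f : ι → ℝ} (hf : ∀ i, 0 ≤ f i) :
    (∑ i ∈ s, f i) ^ p ≤ (s.card : ℝ) ^ (p - 1) * ∑ i ∈ s, f i ^ p :=
  Real.rpow_sum_le_const_mul_sum_rpow_of_nonneg s hp fun i _ => hf i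

theorem exists_matNorm_rpow_le (d n : ℕ) (hp : 1 ≤ p) : ∃ C : ℝ, 1 ≤ C ∧
    ∀ ξ : Matrix (Fin d) (Fin (n + 1)) ℝ, matNorm ξ ^ p ≤ C * ∑ i, ∑ j, |ξ i j| ^ p := by
  set N : ℝ := ((Finset.univ : Finset (Fin d × Fin (n + 1))).card : ℝ) ^ (p - 1)
  refine ⟨max 1 N, le_max_left _ _, fun ξ => ?_⟩
  have h := (Real.rpow_le_rpow (matNorm_nonneg ξ) (matNorm_le_sum ξ) (by linarith)).trans_eq
    (congrArg (· ^ p) (Fintype.sum_prod_type (fun q : Fin d × Fin (n + 1) => |ξ q.1 q.2|)).symm)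
  refine (h.trans (sum_rpow_le Finset.univ hp fun q => abs_nonneg _)).trans ?_
  rw [← Fintype.sum_prod_type (fun q : Fin d × Fin (n + 1) => |ξ q.1 q.2| ^ p)]
  gcongr
  exact le_max_right _ _

theorem hessNorm_sq_eq (η : Fin d → Fin (n + 1) → Fin (n + 1) → ℝ) :
    hessNorm η ^ 2 = ∑ i, ∑ j, ∑ k, |η i j k| ^ (2 : ℝ) := by
  simp only [hessNorm_sq, Real.rpow_two, sq_abs]

/-- The energy controls the integral of `W (∇u)` with a factor `ε`. -/
theorem setLIntegral_W_le (hε : 0 < ε) :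
    ∫⁻ x in cube n, ENNReal.ofReal (W (G x)) ≤ ENNReal.ofReal ε * energy W ε G H lam := by
  rw [energy, ← lintegral_const_mul' _ _ ENNReal.ofReal_ne_top]
  refine lintegral_mono fun x => ?_
  rw [← ENNReal.ofReal_mul hε.le]
  refine ENNReal.ofReal_le_ofReal ?_
  have h : 0 ≤ min (lam ^ 2) (hessNorm (H x) ^ 2) := le_min (sq_nonneg _) (sq_nonneg _)
  have e : ε * ((1 / ε) * (W (G x) : ℝ) + ε * hessNorm (H x) ^ 2 +
      ε * min (lam ^ 2) (hessNorm (H x) ^ 2)) = W (G x) +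
      ε ^ 2 * (hessNorm (H x) ^ 2 + min (lam ^ 2) (hessNorm (H x) ^ 2)) := by
    field_simp
    ring
  rw [e]
  exact le_add_of_nonneg_right (by positivity)

/-- The gradient of a map of finite energy is in `L ^ p` by the lower bound in (H2), although only
square integrability is part of the definition of admissibility. -/
theorem integrable_entry_rpow (hp : 1 ≤ p) (h2 : H2 W p) (hε : 0 < ε)
    (hS : IsSobolevTwo 2 (cube n) u G H) (hE : energy W ε G H lam ≠ ⊤) (i : Fin d)
    (j : Fin (n + 1)) :
    Integrable fun x => |(cube n).indicator (fun y => G y i j) x| ^ p := by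
  obtain ⟨C, hC, hW⟩ := h2
  have e : (fun x => |(cube n).indicator (fun y => G y i j) x| ^ p) =
      (cube n).indicator fun x => |G x i j| ^ p := by
    funext x
    by_cases hx : x ∈ cube n
    · simp [hx]
    · simp [hx, Real.zero_rpow (show p ≠ 0 by linarith)]
  rw [e, integrable_indicator_iff measurableSet_cube]
  refine ⟨((hS.memLp_grad i j).aestronglyMeasurable.norm.aemeasurable.pow_const
    p).aestronglyMeasurable, ?_⟩
  have h1 : ∀ x, ‖|G x i j| ^ p‖ₑ ≤
      ENNReal.ofReal C * ENNReal.ofReal (W (G x)) + ENNReal.ofReal (C * C) := by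
    intro x
    rw [← ENNReal.ofReal_mul (by linarith), ← ENNReal.ofReal_add (by positivity) (by positivity),
      Real.enorm_eq_ofReal (by positivity)]
    refine ENNReal.ofReal_le_ofReal ?_
    have h3 := (hW (G x)).1
    have h4 : matNorm (G x) ^ p ≤ C * W (G x) + C * C := by
      rw [one_div, inv_mul_eq_div, sub_le_iff_le_add, div_le_iff₀ (by linarith)] at h3
      linarith
    exact (Real.rpow_le_rpow (abs_nonneg _) (abs_entry_le_matNorm _ i j) (by linarith)).trans h4
  refine (lintegral_mono h1).trans_lt ?_
  rw [lintegral_add_right _ measurable_const, lintegral_const_mul' _ _ ENNReal.ofReal_ne_top,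
    setLIntegral_const, volume_cube, mul_one]
  exact ENNReal.add_lt_top.2 ⟨ENNReal.mul_lt_top ENNReal.ofReal_lt_top
    ((setLIntegral_W_le hε).trans_lt (ENNReal.mul_lt_top ENNReal.ofReal_lt_top hE.lt_top)),
    ENNReal.ofReal_lt_top⟩

theorem integrable_hess_entry_sq (hS : IsSobolevTwo 2 (cube n) u G H) (i : Fin d)
    (j k : Fin (n + 1)) :
    Integrable fun x => |(cube n).indicator (fun y => H y i j k) x| ^ (2 : ℝ) := by
  have h := ((memLp_indicator_iff_restrict measurableSet_cube).2
    (hS.memLp_hess i j k)).integrable_norm_rpow (by norm_num) (by norm_num)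
  simpa using h

theorem closedBall_subset_cube (hr : 0 < r) {x : Fin (n + 1) → ℝ} (hx : x ∈ innerCube n r) :
    closedBall x (r / 2) ⊆ cube n := by
  intro y hy j
  have h := (dist_le_pi_dist y x j).trans (mem_closedBall.1 hy)
  rw [Real.dist_eq, abs_le] at h
  have h2 := hx j
  constructor <;> linarith [h.1, h.2, h2.1, h2.2]

/-- The sign of the well `± a ⊗ e_N` on the side of the interface containing `x`. -/
def sideSign (x : Fin (n + 1) → ℝ) : ℝ := if 0 ≤ x (Fin.last n) then 1 else -1

theorem matNorm_sideSign_smul (ξ : Matrix (Fin d) (Fin (n + 1)) ℝ) (x : Fin (n + 1) → ℝ) :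
    matNorm (sideSign x • ξ) = matNorm ξ := by
  rw [sideSign]
  split_ifs <;> simp [matNorm_neg]

/-- Sobolev maps of finite energy are approximated by smooth maps in the interior of the cube. -/
theorem exists_smooth_approximation (hp : 2 ≤ p) (hWc : Continuous W) (h2 : H2 W p) (hε : 0 < ε)
    (hA : Admissible γ u G H lam) (hE : energy W ε G H lam ≠ ⊤) (hr : 0 < r) {δ : ℝ≥0∞}
    (hδ : 0 < δ) :
    ∃ w : (Fin (n + 1) → ℝ) → Fin d → ℝ, Smooth w ∧
      ∫⁻ x in innerCube n r, eden W ε lam w x ≤ energy W ε G H lam + δ ∧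
      ∫⁻ x in innerCube n r, gden lam w x ≤ ENNReal.ofReal γ + δ ∧
      ∫⁻ x in outerPart n r, ENNReal.ofReal (sideDist a w x ^ p) ≤
        (∫⁻ x in outerPart n r, ENNReal.ofReal (matNorm (G x - sideSign x • well n a) ^ p)) +
          δ := by
  obtain ⟨hS, hlam, hγ⟩ := hA
  have hp1 : 1 ≤ p := by linarith
  have hG := integrable_entry_rpow hp1 h2 hε hS hE
  have hH := integrable_hess_entry_sq hS
  have hsub : innerCube n r ⊆ cube n := fun x hx =>
    closedBall_subset_cube hr hx (mem_closedBall_self (by positivity))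
  have hfin : volume (innerCube n r) ≠ ⊤ :=
    ((measure_mono hsub).trans_lt (by rw [volume_cube]; exact ENNReal.one_lt_top)).ne
  have hfin' : volume (outerPart n r) ≠ ⊤ :=
    ((measure_mono Set.inter_subset_left).trans_lt hfin.lt_top).ne
  obtain ⟨C, hC, hW⟩ := h2
  obtain ⟨N, hN, hmat⟩ := exists_matNorm_rpow_le d n hp1
  have hs : ∀ ξ : Matrix (Fin d) (Fin (n + 1)) ℝ, 0 ≤ ∑ i, ∑ j, |ξ i j| ^ p := fun ξ => by
    positivity
  have ht : ∀ η : Fin d → Fin (n + 1) → Fin (n + 1) → ℝ,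
      0 ≤ ∑ i, ∑ j, ∑ k, |η i j k| ^ (2 : ℝ) := fun η => by positivity
  have c1 : Continuous fun z : Matrix (Fin d) (Fin (n + 1)) ℝ ×
      (Fin d → Fin (n + 1) → Fin (n + 1) → ℝ) => hessNorm z.2 :=
    continuous_hessNorm.comp continuous_snd
  have c2 : Continuous fun z : Matrix (Fin d) (Fin (n + 1)) ℝ ×
      (Fin d → Fin (n + 1) → Fin (n + 1) → ℝ) => (W z.1 : ℝ) :=
    NNReal.continuous_coe.comp (hWc.comp continuous_fst)
  have E1 := eventually_setLIntegral_mollMap_le_of_growth hp1 one_le_two measurableSet_cube hS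
    (ρ := r / 2) (by positivity) (measurableSet_innerCube n r) hfin
    (fun x hx => closedBall_subset_cube hr hx) hG hH
    (Ψ := fun _ ξ η => (1 / ε) * (W ξ : ℝ) + ε * hessNorm η ^ 2 +
      ε * min (lam ^ 2) (hessNorm η ^ 2))
    (fun _ => by fun_prop) (fun w hw => by
      have h1 : Continuous fun x => (W (grad w x) : ℝ) :=
        NNReal.continuous_coe.comp (hWc.comp hw.continuous_grad)
      have h2 : Continuous fun x => hessNorm (hess w x) :=
        continuous_hessNorm.comp hw.continuous_hess
      exact Continuous.measurable (by fun_prop)) (C := 1 / ε * (C * N) + 2 * ε) (by positivity)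
    (fun x ξ η => by
      rw [← hessNorm_sq_eq]
      have h1 : (W ξ : ℝ) ≤ C * N * (∑ i, ∑ j, |ξ i j| ^ p + 1) := by
        refine (hW ξ).2.trans ?_
        rw [mul_assoc]
        refine mul_le_mul_of_nonneg_left ?_ (by linarith)
        linarith [hmat ξ]
      have h3 : (1 / ε) * (W ξ : ℝ) ≤ 1 / ε * (C * N * (∑ i, ∑ j, |ξ i j| ^ p + 1)) := by gcongr
      have h4 : ε * min (lam ^ 2) (hessNorm η ^ 2) ≤ ε * hessNorm η ^ 2 := by
        gcongr; exact min_le_right _ _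
      have h5 : 0 ≤ 1 / ε * (C * N) * hessNorm η ^ 2 := by positivity
      have h6 : 0 ≤ 2 * ε * (1 + ∑ i, ∑ j, |ξ i j| ^ p) := by
        have := hs ξ
        positivity
      linarith) hδ
  have E2 := eventually_setLIntegral_mollMap_le_of_growth hp1 one_le_two measurableSet_cube hS
    (ρ := r / 2) (by positivity) (measurableSet_innerCube n r) hfin
    (fun x hx => closedBall_subset_cube hr hx) hG hH
    (Ψ := fun _ _ η => max (lam + hessNorm η) 0)
    (fun _ => by fun_prop) (fun w hw => by
      have h2 : Continuous fun x => hessNorm (hess w x) :=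
        continuous_hessNorm.comp hw.continuous_hess
      exact Continuous.measurable (by fun_prop)) (C := 1) zero_le_one
    (fun x ξ η => by
      rw [← hessNorm_sq_eq]
      have h1 := hs ξ
      have h3 := hessNorm_nonneg η
      refine max_le ?_ (by positivity)
      nlinarith [sq_nonneg (hessNorm η - 1)]) hδ
  have E3 := eventually_setLIntegral_mollMap_le_of_growth hp1 one_le_two measurableSet_cube hS
    (ρ := r / 2) (by positivity) (measurableSet_outerPart n r) hfin'
    (fun x hx => closedBall_subset_cube hr hx.1) hG hH
    (Ψ := fun x ξ _ => matNorm (ξ - sideSign x • well n a) ^ p)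
    (fun x => by
      refine Continuous.rpow_const (continuous_matNorm.comp (by fun_prop)) fun _ =>
        Or.inr (by linarith))
    (fun w hw => (measurable_sideDist hw a).pow_const p)
    (C := 2 ^ p * (N + matNorm (well n a) ^ p))
    (mul_nonneg (by positivity)
      (add_nonneg (by linarith) (Real.rpow_nonneg (matNorm_nonneg _) _)))
    (fun x ξ η => by
      have hw := matNorm_nonneg (well n a)
      have h1 : matNorm (ξ - sideSign x • well n a) ≤ matNorm ξ + matNorm (well n a) := by
        rw [← matNorm_sideSign_smul (well n a) x]
        exact matNorm_sub_le _ _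
      refine ((Real.rpow_le_rpow (matNorm_nonneg _) h1 (by linarith)).trans
        (add_rpow_le_two_rpow_mul (by linarith) (matNorm_nonneg _) hw)).trans ?_
      rw [mul_assoc]
      refine mul_le_mul_of_nonneg_left ?_ (by positivity)
      have h3 := hmat ξ
      have h4 := hs ξ
      have h5 := ht η
      have h6 : 0 ≤ matNorm (well n a) ^ p := by positivity
      nlinarith [mul_nonneg (show 0 ≤ N by linarith) h5, mul_nonneg h6 h4, mul_nonneg h6 h5]) hδ
  obtain ⟨m, ⟨e1, e2⟩, e3⟩ := ((E1.and E2).and E3).exists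
  refine ⟨mollMap m (cube n) u, smooth_mollMap one_le_two measurableSet_cube hS m, ?_, ?_, e3⟩
  · exact e1.trans (by gcongr; exact lintegral_mono_set hsub)
  · exact e2.trans (by gcongr; exact (lintegral_mono_set hsub).trans hγ)

end SmoothApproximation

/-! ### Convergence of the gradients on each side of the interface -/

section Sides

open scoped Manifold

variable {d n : ℕ} {W : Matrix (Fin d) (Fin (n + 1)) ℝ → ℝ≥0} {a : Fin d → ℝ}
  {p C ε lam r γ σ : ℝ}
  {u : (Fin (n + 1) → ℝ) → Fin d → ℝ}
  {G : (Fin (n + 1) → ℝ) → Matrix (Fin d) (Fin (n + 1)) ℝ}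
  {H : (Fin (n + 1) → ℝ) → Fin d → Fin (n + 1) → Fin (n + 1) → ℝ}

/-- The scalar product of `ξ` with `a ⊗ e_N`. -/
def normalPart (a : Fin d → ℝ) (ξ : Matrix (Fin d) (Fin (n + 1)) ℝ) : ℝ :=
  ∑ i, ξ i (Fin.last n) * a i

theorem normalPart_well (a : Fin d → ℝ) : normalPart a (well n a) = matNorm (well n a) ^ 2 := by
  rw [matNorm_sq, normalPart]
  refine Finset.sum_congr rfl fun i _ => ?_
  rw [Finset.sum_eq_single (Fin.last n)]
  · simp [well, Matrix.vecMulVec_apply, sq]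
  · intro j _ hj
    simp [well, Matrix.vecMulVec_apply, hj]
  · simp

theorem abs_normalPart_le (a : Fin d → ℝ) (ξ : Matrix (Fin d) (Fin (n + 1)) ℝ) :
    |normalPart a ξ| ≤ matNorm (well n a) * matNorm ξ := by
  have hw : matNorm (well n a) ^ 2 = ∑ i, a i ^ 2 := by
    rw [← normalPart_well, normalPart]
    simp [well, Matrix.vecMulVec_apply, sq]
  have h1 : normalPart a ξ ^ 2 ≤ (matNorm (well n a) * matNorm ξ) ^ 2 := by
    rw [mul_pow, hw, matNorm_sq, mul_comm]
    refine (Finset.sum_mul_sq_le_sq_mul_sq _ _ _).trans ?_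
    gcongr with i
    exact Finset.single_le_sum (f := fun j => ξ i j ^ 2) (fun j _ => sq_nonneg _)
      (Finset.mem_univ (Fin.last n))
  exact abs_le_of_sq_le_sq h1 (mul_nonneg (matNorm_nonneg _) (matNorm_nonneg _))

theorem normalPart_add (a : Fin d → ℝ) (ξ η : Matrix (Fin d) (Fin (n + 1)) ℝ) :
    normalPart a (ξ + η) = normalPart a ξ + normalPart a η := by
  simp [normalPart, add_mul, Finset.sum_add_distrib]

theorem normalPart_smul (a : Fin d → ℝ) (c : ℝ) (ξ : Matrix (Fin d) (Fin (n + 1)) ℝ) :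
    normalPart a (c • ξ) = c * normalPart a ξ := by
  simp [normalPart, Finset.mul_sum, mul_assoc]

/-- The nonnegative quantity controlling which of the two wells is close to `ξ`. -/
def sideGap (a : Fin d → ℝ) (σ : ℝ) (ξ : Matrix (Fin d) (Fin (n + 1)) ℝ) : ℝ :=
  matNorm (well n a) * wellDist a ξ + (matNorm (well n a) ^ 2 - σ * normalPart a ξ)

theorem wellDist_eq_min (hσ : σ = 1 ∨ σ = -1) (ξ : Matrix (Fin d) (Fin (n + 1)) ℝ) :
    wellDist a ξ = min (matNorm (ξ - σ • well n a)) (matNorm (ξ + σ • well n a)) := by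
  rcases hσ with rfl | rfl
  · rw [one_smul, wellDist, sub_neg_eq_add]
  · rw [neg_one_smul, sub_neg_eq_add, ← sub_eq_add_neg, min_comm, wellDist, sub_neg_eq_add]

/-- Near the wrong well `-σ a ⊗ e_N` the quantity `sideGap` is at least `2 |a| ^ 2`, and there it
controls the distance to the right one. -/
theorem exists_dist_le_sideGap (hp : 0 < p) (a : Fin d → ℝ) : ∃ K : ℝ, 1 ≤ K ∧
    ∀ (σ : ℝ), (σ = 1 ∨ σ = -1) → ∀ ξ : Matrix (Fin d) (Fin (n + 1)) ℝ, 0 ≤ sideGap a σ ξ ∧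
      matNorm (ξ - σ • well n a) ^ p ≤ K * (wellDist a ξ ^ p + sideGap a σ ξ) := by
  set α := matNorm (well n a) with hα
  have hα0 : 0 ≤ α := matNorm_nonneg _
  have hK : 1 ≤ 2 ^ p * (1 + (2 * α) ^ p / α ^ 2) := by
    have h1 : (1 : ℝ) ≤ 2 ^ p := Real.one_le_rpow one_le_two hp.le
    have h2 : 0 ≤ (2 * α) ^ p / α ^ 2 := by positivity
    nlinarith
  refine ⟨2 ^ p * (1 + (2 * α) ^ p / α ^ 2), hK, fun σ hσ ξ => ?_⟩
  have hσ2 : σ * σ = 1 := by rcases hσ with rfl | rfl <;> norm_num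
  have hσa : |σ| = 1 := by rcases hσ with rfl | rfl <;> norm_num
  have hD0 := wellDist_nonneg a ξ
  have hDp : 0 ≤ wellDist a ξ ^ p := by positivity
  -- near the well `s a ⊗ e_N` the scalar product with `a ⊗ e_N` is close to `s |a| ^ 2`
  have key : ∀ s : ℝ, s * s = 1 → matNorm (ξ - s • well n a) = wellDist a ξ →
      s * σ * α ^ 2 - α * wellDist a ξ ≤ σ * normalPart a ξ ∧
        σ * normalPart a ξ ≤ α * wellDist a ξ + s * σ * α ^ 2 := by
    intro s hs h
    have h1 := abs_normalPart_le a (ξ - s • well n a)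
    rw [h, sub_eq_add_neg, ← neg_smul, normalPart_add, normalPart_smul, normalPart_well] at h1
    have h2 : |σ * (normalPart a ξ + -s * matNorm (well n a) ^ 2)| ≤ α * wellDist a ξ := by
      rwa [abs_mul, hσa, one_mul]
    obtain ⟨h3, h4⟩ := abs_le.1 h2
    constructor <;> linarith
  rcases min_choice (matNorm (ξ - σ • well n a)) (matNorm (ξ + σ • well n a)) with h | h
  · rw [← wellDist_eq_min hσ] at h
    obtain ⟨-, k2⟩ := key σ hσ2 h.symm
    rw [hσ2] at k2
    have hT : 0 ≤ sideGap a σ ξ := by rw [sideGap]; linarith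
    refine ⟨hT, ?_⟩
    rw [← h]
    nlinarith
  · rw [← wellDist_eq_min hσ] at h
    have h' : matNorm (ξ - (-σ) • well n a) = wellDist a ξ := by
      rw [neg_smul, sub_neg_eq_add, h]
    obtain ⟨-, k2⟩ := key (-σ) (by linarith) h'
    rw [neg_mul, hσ2] at k2
    have hT : 2 * α ^ 2 ≤ sideGap a σ ξ := by rw [sideGap]; linarith
    refine ⟨by nlinarith [sq_nonneg α], ?_⟩
    have e : ξ - σ • well n a = (ξ + σ • well n a) - (σ • well n a + σ • well n a) := by abel
    have h1 : matNorm (σ • well n a) = α := by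
      rcases hσ with rfl | rfl <;> simp [hα, matNorm_neg]
    have h2 : matNorm (σ • well n a + σ • well n a) ≤ 2 * α := by
      rw [two_mul, ← h1]
      exact matNorm_add_le _ _
    have h3 : matNorm (ξ - σ • well n a) ≤ wellDist a ξ + 2 * α := by
      rw [e, h]
      exact (matNorm_sub_le _ _).trans (by rw [← h]; gcongr)
    refine ((Real.rpow_le_rpow (matNorm_nonneg _) h3 hp.le).trans
      (add_rpow_le_two_rpow_mul hp.le hD0 (by positivity))).trans ?_
    rw [mul_assoc]
    refine mul_le_mul_of_nonneg_left ?_ (by positivity)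
    -- for `a = 0` the quotient is zero, and so is the left hand side
    have h4 : (2 * α) ^ p ≤ (2 * α) ^ p / α ^ 2 * sideGap a σ ξ := by
      rcases hα0.eq_or_lt with h0 | h0
      · rw [← h0, mul_zero, Real.zero_rpow hp.ne']
        simp
      · calc (2 * α) ^ p = (2 * α) ^ p / α ^ 2 * α ^ 2 := by field_simp
          _ ≤ _ := by gcongr; nlinarith
    have h5 : 0 ≤ (2 * α) ^ p / α ^ 2 * wellDist a ξ ^ p := by positivity
    nlinarith [sq_nonneg α]

/-- A cutoff function which is one on one component of `outerPart n r`. -/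
theorem exists_side_cutoff (n : ℕ) (hr : 0 < r) (hσ : σ = 1 ∨ σ = -1) :
    ∃ ζ : (Fin (n + 1) → ℝ) → ℝ, IsTest (cube n) ζ ∧ (∀ x, 0 ≤ ζ x ∧ ζ x ≤ 1) ∧
      (∀ x ∈ outerPart n r, 0 < σ * x (Fin.last n) → ζ x = 1) ∧
      tsupport ζ ⊆ {x | 0 ≤ σ * x (Fin.last n)} := by
  set s : Set (Fin (n + 1) → ℝ) := innerCube n (r / 2) ∩ {x | 1 / 16 < σ * x (Fin.last n)}
  set t : Set (Fin (n + 1) → ℝ) :=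
    Set.Icc (fun _ => -(1 / 2 - r)) (fun _ => 1 / 2 - r) ∩ {x | 1 / 8 ≤ σ * x (Fin.last n)}
  have hso : IsOpen s := by
    refine IsOpen.inter ?_ (isOpen_lt (by fun_prop) (by fun_prop))
    rw [innerCube, Set.ofPred_forall]
    exact isOpen_iInter_of_finite fun i => isOpen_Ioo.preimage (continuous_apply i)
  have htc : IsClosed t := isClosed_Icc.inter (isClosed_le (by fun_prop) (by fun_prop))
  have hts : t ⊆ s := by
    rintro x ⟨⟨h1, h2⟩, h3⟩
    refine ⟨fun i => ⟨?_, ?_⟩, (by norm_num : (1 : ℝ) / 16 < 1 / 8).trans_le h3⟩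
    · linarith [h1 i]
    · linarith [h2 i]
  obtain ⟨ζ, h1, h2, h3, h4⟩ :=
    exists_contMDiff_support_eq_eq_one_iff (n := (⊤ : ℕ∞)) 𝓘(ℝ, Fin (n + 1) → ℝ) hso htc hts
  set k : Set (Fin (n + 1) → ℝ) := Set.Icc (fun _ => -(1 / 2 - r / 2)) (fun _ => 1 / 2 - r / 2)
  have hsk : s ⊆ k := fun x hx => ⟨fun i => (hx.1 i).1.le, fun i => (hx.1 i).2.le⟩
  refine ⟨ζ, ⟨h1.contDiff, HasCompactSupport.of_support_subset_isCompact isCompact_Icc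
    (h3.trans_subset hsk), ?_⟩, fun x => h2 ⟨x, rfl⟩, fun x hx h0 => ?_, ?_⟩
  · refine (closure_minimal (h3.trans_subset hsk) isClosed_Icc).trans fun x hx i => ⟨?_, ?_⟩
    · linarith [hx.1 i]
    · linarith [hx.2 i]
  · refine (h4 x).1 ⟨⟨fun i => (hx.1 i).1.le, fun i => (hx.1 i).2.le⟩, ?_⟩
    have h5 : 1 / 8 < |x (Fin.last n)| := hx.2
    have h6 : |x (Fin.last n)| = σ * x (Fin.last n) := by
      rw [← abs_of_pos h0, abs_mul]
      rcases hσ with rfl | rfl <;> simp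
    change 1 / 8 ≤ σ * x (Fin.last n)
    linarith
  · refine closure_minimal (h3.trans_subset fun x hx => ?_)
      (isClosed_le (by fun_prop) (by fun_prop))
    exact (show (0 : ℝ) ≤ 1 / 16 by norm_num).trans (le_of_lt hx.2)

end Sides

section SideConvergence

variable {d n : ℕ} {W : Matrix (Fin d) (Fin (n + 1)) ℝ → ℝ≥0} {a : Fin d → ℝ}
  {p C ε lam r γ σ : ℝ}
  {u : (Fin (n + 1) → ℝ) → Fin d → ℝ}
  {G : (Fin (n + 1) → ℝ) → Matrix (Fin d) (Fin (n + 1)) ℝ}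
  {H : (Fin (n + 1) → ℝ) → Fin d → Fin (n + 1) → Fin (n + 1) → ℝ}

theorem aemeasurable_matNorm_sub {μ : Measure (Fin (n + 1) → ℝ)}
    (hG : ∀ i j, AEMeasurable (fun x => G x i j) μ) (ξ : Matrix (Fin d) (Fin (n + 1)) ℝ) :
    AEMeasurable (fun x => matNorm (G x - ξ)) μ := by
  refine Real.continuous_sqrt.measurable.comp_aemeasurable ?_
  refine Finset.aemeasurable_fun_sum _ fun i _ => Finset.aemeasurable_fun_sum _ fun j _ => ?_
  exact ((hG i j).sub_const _).pow_const _

theorem aemeasurable_wellDist {μ : Measure (Fin (n + 1) → ℝ)}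
    (hG : ∀ i j, AEMeasurable (fun x => G x i j) μ) (a : Fin d → ℝ) :
    AEMeasurable (fun x => wellDist a (G x)) μ :=
  (aemeasurable_matNorm_sub hG _).min (aemeasurable_matNorm_sub hG _)

/-- Integration by parts against `|x_N| a` on one side of the interface. -/
theorem setIntegral_normalPart (hS : IsSobolevTwo 2 (cube n) u G H)
    {ζ : (Fin (n + 1) → ℝ) → ℝ} (hζ : IsTest (cube n) ζ)
    (hσ : σ = 1 ∨ σ = -1) (hs : tsupport ζ ⊆ {x | 0 ≤ σ * x (Fin.last n)}) :
    ∫ x in cube n, ζ x * (matNorm (well n a) ^ 2 - σ * normalPart a (G x)) =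
      σ * ∑ i, a i * ∫ x in cube n, (u x i - |x (Fin.last n)| * a i) *
        fderiv ℝ ζ x (Pi.single (Fin.last n) 1) := by
  have hσ2 : σ * σ = 1 := by rcases hσ with rfl | rfl <;> norm_num
  have hfin : IsFiniteMeasure (volume.restrict (cube n)) := ⟨by simp [volume_cube]⟩
  have hζi : Integrable ζ := hζ.1.continuous.integrable_of_hasCompactSupport hζ.2.1
  have cd : Continuous fun x => fderiv ℝ ζ x (Pi.single (Fin.last n) 1) :=
    (contDiff_pd hζ.1 (Fin.last n)).continuous
  have hds : ∀ x, x ∉ tsupport ζ → fderiv ℝ ζ x (Pi.single (Fin.last n) 1) = 0 := by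
    intro x hx
    rw [image_eq_zero_of_notMem_tsupport (f := fderiv ℝ ζ) fun h => hx (tsupport_fderiv_subset ℝ h)]
    rfl
  have hcd : HasCompactSupport fun x => fderiv ℝ ζ x (Pi.single (Fin.last n) 1) :=
    HasCompactSupport.intro hζ.2.1 hds
  obtain ⟨Z, hZ⟩ := hcd.exists_bound_of_continuous cd
  obtain ⟨Y, hY⟩ := hζ.2.1.exists_bound_of_continuous hζ.1.continuous
  have hdi : ∀ {f : (Fin (n + 1) → ℝ) → ℝ}, Integrable f (volume.restrict (cube n)) →
      Integrable (fun x => f x * fderiv ℝ ζ x (Pi.single (Fin.last n) 1))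
        (volume.restrict (cube n)) := fun hf =>
    hf.mul_bdd (c := Z) cd.aestronglyMeasurable (Eventually.of_forall hZ)
  have hGi : ∀ i j, Integrable (fun x => ζ x * G x i j) (volume.restrict (cube n)) := fun i j =>
    ((hS.memLp_grad i j).integrable one_le_two).bdd_mul (c := Y)
      hζ.1.continuous.aestronglyMeasurable (Eventually.of_forall hY)
  -- the profile `|x_N|` is linear on the support of `ζ`
  have habs : ∫ x in cube n, |x (Fin.last n)| * fderiv ℝ ζ x (Pi.single (Fin.last n) 1) =
      -σ * ∫ x in cube n, ζ x := by
    have e : ∀ x, |x (Fin.last n)| * fderiv ℝ ζ x (Pi.single (Fin.last n) 1) =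
        (σ * x (Fin.last n)) * fderiv ℝ ζ x (Pi.single (Fin.last n) 1) := by
      intro x
      by_cases hx : x ∈ tsupport ζ
      · have h0 : 0 ≤ σ * x (Fin.last n) := hs hx
        rw [← abs_of_nonneg h0, abs_mul]
        rcases hσ with rfl | rfl <;> simp
      · rw [hds x hx, mul_zero, mul_zero]
    have c : ContDiff ℝ ∞ fun x : Fin (n + 1) → ℝ => σ * x (Fin.last n) :=
      contDiff_const.mul (contDiff_apply ℝ ℝ _)
    rw [integral_congr_ae (Eventually.of_forall e), setIntegral_mul_fderiv_test c hζ]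
    have e2 : ∀ x, pd (Fin.last n) (fun x : Fin (n + 1) → ℝ => σ * x (Fin.last n)) x = σ := by
      intro x
      rw [pd_const_mul (f := fun x : Fin (n + 1) → ℝ => x (Fin.last n)) (by fun_prop)]
      have := pd_coord (g := fun t => t) (x := x) (i := Fin.last n) differentiableAt_id (Fin.last n)
      rw [this]
      simp
    simp only [e2]
    rw [integral_const_mul, neg_mul]
  have hui : ∀ i, Integrable (fun x => u x i) (volume.restrict (cube n)) := fun i =>
    (hS.memLp_fun i).integrable one_le_two
  have hxi : Integrable (fun x : Fin (n + 1) → ℝ => |x (Fin.last n)|)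
      (volume.restrict (cube n)) := by
    refine Integrable.of_bound (C := 1) (continuous_apply _).abs.aestronglyMeasurable ?_
    filter_upwards [ae_restrict_mem measurableSet_cube] with x hx
    rw [Real.norm_eq_abs, abs_abs, abs_le]
    constructor <;> linarith [(hx (Fin.last n)).1, (hx (Fin.last n)).2]
  have hu : ∀ i, ∫ x in cube n, (u x i - |x (Fin.last n)| * a i) *
      fderiv ℝ ζ x (Pi.single (Fin.last n) 1) =
      -(∫ x in cube n, ζ x * G x i (Fin.last n)) + σ * a i * ∫ x in cube n, ζ x := by
    intro i
    have e : ∀ x, (u x i - |x (Fin.last n)| * a i) * fderiv ℝ ζ x (Pi.single (Fin.last n) 1) =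
        u x i * fderiv ℝ ζ x (Pi.single (Fin.last n) 1) -
          a i * (|x (Fin.last n)| * fderiv ℝ ζ x (Pi.single (Fin.last n) 1)) := fun x => by ring
    rw [integral_congr_ae (Eventually.of_forall e), integral_sub (hdi (hui i))
      ((hdi hxi).const_mul _), integral_const_mul, habs, hS.weak_grad i _ ζ hζ]
    simp only [mul_comm (G _ _ _)]
    ring
  have e : ∀ x, ζ x * (matNorm (well n a) ^ 2 - σ * normalPart a (G x)) =
      matNorm (well n a) ^ 2 * ζ x - σ * ∑ i, a i * (ζ x * G x i (Fin.last n)) := by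
    intro x
    have : ∑ i, a i * (ζ x * G x i (Fin.last n)) = ζ x * normalPart a (G x) := by
      rw [normalPart, Finset.mul_sum]
      exact Finset.sum_congr rfl fun i _ => by ring
    rw [this]
    ring
  rw [integral_congr_ae (Eventually.of_forall e), integral_sub (hζi.integrableOn.const_mul _)
    ((integrable_finsetSum _ fun i _ => (hGi i _).const_mul _).const_mul _), integral_const_mul,
    integral_const_mul, integral_finsetSum _ fun i _ => (hGi i _).const_mul _]
  simp only [integral_const_mul, hu]
  have hw : matNorm (well n a) ^ 2 = ∑ i, a i * a i := by
    rw [← normalPart_well, normalPart]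
    simp [well, Matrix.vecMulVec_apply]
  rw [hw, Finset.sum_mul]
  simp only [mul_add, Finset.sum_add_distrib, Finset.mul_sum, mul_neg, Finset.sum_neg_distrib]
  rw [sub_eq_neg_add]
  congr 1
  refine Finset.sum_congr rfl fun i _ => ?_
  linear_combination -(a i * a i * ∫ x in cube n, ζ x) * hσ2

/-- Pairing of `u - |x_N| a`, which is small in `L ^ 1`, with a bounded function. -/
theorem abs_setIntegral_mul_le {κ Z : ℝ} (hZ0 : 0 ≤ Z) {g : (Fin (n + 1) → ℝ) → ℝ}
    (hZ : ∀ x, ‖g x‖ ≤ Z)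
    (hκ0 : 0 ≤ κ) (hu : eLpNorm (fun x => u x - |x (Fin.last n)| • a) 1
      (volume.restrict (cube n)) ≤ ENNReal.ofReal κ) (i : Fin d) :
    |∫ x in cube n, (u x i - |x (Fin.last n)| * a i) * g x| ≤ Z * κ := by
  rw [← Real.norm_eq_abs]
  refine (norm_integral_le_lintegral_norm _).trans ?_
  refine ENNReal.toReal_le_of_le_ofReal (by positivity) ?_
  rw [eLpNorm_one_eq_lintegral_enorm] at hu
  rw [ENNReal.ofReal_mul hZ0]
  refine le_trans ?_ (mul_le_mul_right hu _)
  rw [← lintegral_const_mul' _ _ ENNReal.ofReal_ne_top]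
  refine lintegral_mono fun x => ?_
  rw [← ofReal_norm, ← ENNReal.ofReal_mul hZ0, norm_mul, mul_comm]
  refine ENNReal.ofReal_le_ofReal (mul_le_mul (hZ x) ?_ (norm_nonneg _) hZ0)
  exact norm_le_pi_norm (u x - |x (Fin.last n)| • a) i

/-- On each side of the interface the gradient approaches the corresponding well, if the energy
and the distance to `|x_N| a` are small. -/
theorem exists_side_bound (hp : 2 ≤ p) (hW : Comparable W a p C) (hr : 0 < r)
    (hσ : σ = 1 ∨ σ = -1) {τ : ℝ} (hτ : 0 < τ) :
    ∃ κ : ℝ, 0 < κ ∧ ∀ (u : (Fin (n + 1) → ℝ) → Fin d → ℝ)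
      (G : (Fin (n + 1) → ℝ) → Matrix (Fin d) (Fin (n + 1)) ℝ)
      (H : (Fin (n + 1) → ℝ) → Fin d → Fin (n + 1) → Fin (n + 1) → ℝ) (ε lam M : ℝ),
      IsSobolevTwo 2 (cube n) u G H → 0 < ε → energy W ε G H lam ≤ ENNReal.ofReal M →
      ε * M ≤ κ → eLpNorm (fun x => u x - |x (Fin.last n)| • a) 1 (volume.restrict (cube n)) ≤
        ENNReal.ofReal κ →
      ∫⁻ x in outerPart n r ∩ {x | 0 < σ * x (Fin.last n)},
        ENNReal.ofReal (matNorm (G x - σ • well n a) ^ p) ≤ ENNReal.ofReal τ := by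
  have hC := hW.one_le
  obtain ⟨ζ, hζ, hζ01, hζ1, hζs⟩ := exists_side_cutoff n hr hσ
  have cd : Continuous fun x => fderiv ℝ ζ x (Pi.single (Fin.last n) 1) :=
    (contDiff_pd hζ.1 (Fin.last n)).continuous
  obtain ⟨Z, hZ⟩ := HasCompactSupport.exists_bound_of_continuous
    (f := fun x => fderiv ℝ ζ x (Pi.single (Fin.last n) 1)) (by
      refine HasCompactSupport.intro hζ.2.1 fun x hx => ?_
      rw [image_eq_zero_of_notMem_tsupport (f := fderiv ℝ ζ)
        fun h => hx (tsupport_fderiv_subset ℝ h)]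
      rfl) cd
  have hZ0 : 0 ≤ Z := (norm_nonneg _).trans (hZ 0)
  obtain ⟨K, hK, hside⟩ := exists_dist_le_sideGap (n := n) (show 0 < p by linarith) a
  set α := matNorm (well n a) with hα
  have hα0 : 0 ≤ α := matNorm_nonneg _
  set s := τ / (4 * K * (α + 1)) with hs
  have hs0 : 0 < s := by positivity
  obtain ⟨K₁, hK₁, hY⟩ := exists_sq_add_le hp hs0
  set A := ∑ i, |a i|
  have hA0 : 0 ≤ A := by positivity
  set S := K * (C + α * K₁ * C + A * Z) + 1 with hS
  have hS0 : 0 < S := by positivity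
  set κ := τ / (4 * S)
  have hκ0 : 0 < κ := by positivity
  have hSκ : S * κ = τ / 4 := by simp only [κ]; field_simp
  refine ⟨κ, hκ0, fun u G H ε lam M hSob hε hE hεM hu => ?_⟩
  have hfin : IsFiniteMeasure (volume.restrict (cube n)) := ⟨by simp [volume_cube]⟩
  have hGm : ∀ i j, AEMeasurable (fun x => G x i j) (volume.restrict (cube n)) := fun i j =>
    (hSob.memLp_grad i j).aestronglyMeasurable.aemeasurable
  have hDm := aemeasurable_wellDist hGm a
  have hD0 : ∀ x, 0 ≤ wellDist a (G x) := fun x => wellDist_nonneg _ _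
  have hDp : ∫⁻ x in cube n, ENNReal.ofReal (wellDist a (G x) ^ p) ≤ ENNReal.ofReal (C * κ) := by
    calc _ ≤ ∫⁻ x in cube n, ENNReal.ofReal C * ENNReal.ofReal (W (G x)) := by
          refine lintegral_mono fun x => ?_
          rw [← ENNReal.ofReal_mul (by linarith)]
          exact ENNReal.ofReal_le_ofReal (hW.lower _)
      _ = ENNReal.ofReal C * ∫⁻ x in cube n, ENNReal.ofReal (W (G x)) :=
          lintegral_const_mul' _ _ ENNReal.ofReal_ne_top
      _ ≤ ENNReal.ofReal C * (ENNReal.ofReal ε * ENNReal.ofReal M) :=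
          mul_le_mul_right ((setLIntegral_W_le (lam := lam) (H := H) hε).trans
            (mul_le_mul_right hE _)) _
      _ = ENNReal.ofReal (C * (ε * M)) := by
          rw [← ENNReal.ofReal_mul hε.le, ← ENNReal.ofReal_mul (by linarith)]
      _ ≤ _ := ENNReal.ofReal_le_ofReal (by gcongr)
  have hD : ∫⁻ x in cube n, ENNReal.ofReal (wellDist a (G x)) ≤
      ENNReal.ofReal (s + K₁ * (C * κ)) := by
    calc _ ≤ ∫⁻ x in cube n, (ENNReal.ofReal s +
          ENNReal.ofReal K₁ * ENNReal.ofReal (wellDist a (G x) ^ p)) := by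
          refine lintegral_mono fun x => ?_
          rw [← ENNReal.ofReal_mul hK₁, ← ENNReal.ofReal_add hs0.le
            (mul_nonneg hK₁ (Real.rpow_nonneg (hD0 x) _))]
          exact ENNReal.ofReal_le_ofReal (by linarith [hY _ (hD0 x), sq_nonneg (wellDist a (G x))])
      _ = ENNReal.ofReal s + ENNReal.ofReal K₁ *
          ∫⁻ x in cube n, ENNReal.ofReal (wellDist a (G x) ^ p) := by
          rw [lintegral_add_left measurable_const, lintegral_const_mul' _ _ ENNReal.ofReal_ne_top,
            setLIntegral_const, volume_cube, mul_one]
      _ ≤ ENNReal.ofReal s + ENNReal.ofReal K₁ * ENNReal.ofReal (C * κ) := by gcongr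
      _ = _ := by rw [← ENNReal.ofReal_mul hK₁, ← ENNReal.ofReal_add hs0.le (by positivity)]
  have hDi : Integrable (fun x => wellDist a (G x)) (volume.restrict (cube n)) := by
    refine ⟨hDm.aestronglyMeasurable, ?_⟩
    rw [hasFiniteIntegral_iff_ofReal (Eventually.of_forall hD0)]
    exact hD.trans_lt ENNReal.ofReal_lt_top
  have hDI : ∫ x in cube n, wellDist a (G x) ≤ s + K₁ * (C * κ) := by
    rw [integral_eq_lintegral_of_nonneg_ae (Eventually.of_forall hD0) hDm.aestronglyMeasurable]
    exact ENNReal.toReal_le_of_le_ofReal (by positivity) hD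
  have hζb : ∀ x, ‖ζ x‖ ≤ 1 := fun x => by
    rw [Real.norm_of_nonneg (hζ01 x).1]
    exact (hζ01 x).2
  have hζD : Integrable (fun x => ζ x * wellDist a (G x)) (volume.restrict (cube n)) :=
    hDi.bdd_mul (c := 1) hζ.1.continuous.aestronglyMeasurable (Eventually.of_forall hζb)
  have hζN : Integrable (fun x => ζ x * (α ^ 2 - σ * normalPart a (G x)))
      (volume.restrict (cube n)) := by
    refine Integrable.bdd_mul (c := 1) ?_ hζ.1.continuous.aestronglyMeasurable
      (Eventually.of_forall hζb)
    refine (integrable_const _).sub (Integrable.const_mul ?_ _)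
    exact integrable_finsetSum _ fun i _ =>
      ((hSob.memLp_grad i _).integrable one_le_two).mul_const _
  have hT0 : ∀ x, 0 ≤ ζ x * sideGap a σ (G x) := fun x =>
    mul_nonneg (hζ01 x).1 (hside σ hσ (G x)).1
  have hTeq : ∀ x, ζ x * sideGap a σ (G x) = α * (ζ x * wellDist a (G x)) +
      ζ x * (α ^ 2 - σ * normalPart a (G x)) := fun x => by rw [sideGap]; ring
  have hTi : Integrable (fun x => ζ x * sideGap a σ (G x)) (volume.restrict (cube n)) := by
    simp only [hTeq]
    exact (hζD.const_mul _).add hζN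
  -- the integral of `sideGap` is small: its first part by the energy, its second by
  -- integration by parts and the convergence of `u`
  have hTI : ∫ x in cube n, ζ x * sideGap a σ (G x) ≤ α * (s + K₁ * (C * κ)) + A * (Z * κ) := by
    simp only [hTeq]
    rw [integral_add (hζD.const_mul _) hζN, integral_const_mul,
      setIntegral_normalPart hSob hζ hσ hζs]
    refine add_le_add (mul_le_mul_of_nonneg_left ((integral_mono hζD hDi fun x => ?_).trans hDI)
      hα0) ?_
    · exact mul_le_of_le_one_left (hD0 x) (hζ01 x).2
    · refine (le_abs_self _).trans ?_
      rw [abs_mul, show |σ| = 1 by rcases hσ with rfl | rfl <;> norm_num, one_mul, Finset.sum_mul]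
      refine (Finset.abs_sum_le_sum_abs _ _).trans (Finset.sum_le_sum fun i _ => ?_)
      rw [abs_mul]
      exact mul_le_mul_of_nonneg_left (abs_setIntegral_mul_le hZ0 hZ hκ0.le hu i) (abs_nonneg _)
  have hsub : outerPart n r ∩ {x | 0 < σ * x (Fin.last n)} ⊆ cube n := fun x hx =>
    closedBall_subset_cube hr hx.1.1 (Metric.mem_closedBall_self (by positivity))
  have hms : MeasurableSet (outerPart n r ∩ {x | 0 < σ * x (Fin.last n)}) :=
    (measurableSet_outerPart n r).inter (measurableSet_lt (by fun_prop) (by fun_prop))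
  calc _ ≤ ∫⁻ x in outerPart n r ∩ {x | 0 < σ * x (Fin.last n)}, ENNReal.ofReal K *
        (ENNReal.ofReal (wellDist a (G x) ^ p) + ENNReal.ofReal (ζ x * sideGap a σ (G x))) := by
        refine setLIntegral_mono' hms fun x hx => ?_
        rw [← ENNReal.ofReal_add (Real.rpow_nonneg (hD0 x) _) (hT0 x),
          ← ENNReal.ofReal_mul (by linarith), hζ1 x hx.1 hx.2, one_mul]
        exact ENNReal.ofReal_le_ofReal (hside σ hσ (G x)).2
    _ ≤ ∫⁻ x in cube n, ENNReal.ofReal K *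
        (ENNReal.ofReal (wellDist a (G x) ^ p) + ENNReal.ofReal (ζ x * sideGap a σ (G x))) :=
        lintegral_mono_set hsub
    _ = ENNReal.ofReal K * ((∫⁻ x in cube n, ENNReal.ofReal (wellDist a (G x) ^ p)) +
        ENNReal.ofReal (∫ x in cube n, ζ x * sideGap a σ (G x))) := by
        rw [lintegral_const_mul' _ _ ENNReal.ofReal_ne_top,
          lintegral_add_left' (hDm.pow_const p).ennreal_ofReal,
          ofReal_integral_eq_lintegral_ofReal hTi (Eventually.of_forall hT0)]
    _ ≤ ENNReal.ofReal K * (ENNReal.ofReal (C * κ) +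
        ENNReal.ofReal (α * (s + K₁ * (C * κ)) + A * (Z * κ))) := by
        refine mul_le_mul_right (add_le_add hDp (ENNReal.ofReal_le_ofReal hTI)) _
    _ = ENNReal.ofReal (K * (C * κ + (α * (s + K₁ * (C * κ)) + A * (Z * κ)))) := by
        rw [← ENNReal.ofReal_add (by positivity) (by positivity), ← ENNReal.ofReal_mul
          (by linarith)]
    _ ≤ _ := by
        refine ENNReal.ofReal_le_ofReal ?_
        have h1 : K * (α * s) ≤ τ / 4 := by
          have : K * (α * s) = τ / 4 * (α / (α + 1)) := by rw [hs]; field_simp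
          rw [this]
          refine mul_le_of_le_one_right (by positivity) ?_
          rw [div_le_one (by positivity)]
          linarith
        have h2 : K * (C + α * K₁ * C + A * Z) * κ ≤ τ / 4 := by
          rw [← hSκ, hS]
          gcongr
          linarith
        linarith

end SideConvergence

/-! ### The lower bound -/

section LowerBound

variable {d n : ℕ} {W : Matrix (Fin d) (Fin (n + 1)) ℝ → ℝ≥0} {a : Fin d → ℝ} {p C : ℝ}

/-- The outer part consists of one component on each side of the interface. -/
theorem setLIntegral_outerPart_le {r : ℝ} {G : (Fin (n + 1) → ℝ) → Matrix (Fin d) (Fin (n + 1)) ℝ}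
    {t : ℝ≥0∞} (h : ∀ σ : ℝ, σ = 1 ∨ σ = -1 →
      ∫⁻ x in outerPart n r ∩ {x | 0 < σ * x (Fin.last n)},
        ENNReal.ofReal (matNorm (G x - σ • well n a) ^ p) ≤ t) :
    ∫⁻ x in outerPart n r, ENNReal.ofReal (matNorm (G x - sideSign x • well n a) ^ p) ≤
      t + t := by
  have hms : ∀ σ : ℝ, MeasurableSet (outerPart n r ∩ {x | 0 < σ * x (Fin.last n)}) := fun σ =>
    (measurableSet_outerPart n r).inter (measurableSet_lt (by fun_prop) (by fun_prop))
  have hsub : outerPart n r ⊆ (outerPart n r ∩ {x | 0 < 1 * x (Fin.last n)}) ∪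
      (outerPart n r ∩ {x | 0 < -1 * x (Fin.last n)}) := by
    intro x hx
    have h1 : 1 / 8 < |x (Fin.last n)| := hx.2
    rcases lt_or_ge 0 (x (Fin.last n)) with h2 | h2
    · exact Or.inl ⟨hx, by simpa using h2⟩
    · refine Or.inr ⟨hx, ?_⟩
      rw [abs_of_nonpos h2] at h1
      change 0 < -1 * x (Fin.last n)
      linarith
  refine (lintegral_mono_set hsub).trans ((lintegral_union_le _ _ _).trans (add_le_add ?_ ?_))
  · refine le_trans (le_of_eq (setLIntegral_congr_fun (hms 1) fun x hx => ?_)) (h 1 (Or.inl rfl))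
    have h2 : 0 < 1 * x (Fin.last n) := hx.2
    simp only [sideSign]
    rw [if_pos (by linarith)]
  · refine le_trans (le_of_eq (setLIntegral_congr_fun (hms (-1)) fun x hx => ?_))
      (h (-1) (Or.inr rfl))
    have h2 : 0 < -1 * x (Fin.last n) := hx.2
    simp only [sideSign]
    rw [if_neg (by linarith)]

/-- The lower bound: recovery sequences for `Φ̃` yield competitors for `Φ̃_p`. -/
theorem phiPTilde_le_of_phiTilde_lt (hp : 2 ≤ p) (h1 : H1 W a) (h2 : H2 W p) (h3 : H3 W a p)
    (h4 : H4 W) {γ M δ : ℝ} (hγ : 0 ≤ γ) (hM : 0 ≤ M) (hδ : 0 < δ)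
    (h : PhiTilde W a γ < ENNReal.ofReal M) :
    PhiPTilde W a (γ + δ) ≤ ENNReal.ofReal (M + δ) := by
  obtain ⟨C, hW⟩ := exists_comparable hp h1 h2 h3
  obtain ⟨r, hr, -, τ, hτ, key⟩ := exists_phiPTilde_le_of_smooth (δ := δ / 2) hp h1.1 hW h4 hM
    (show 0 ≤ γ + δ / 2 by positivity) (by positivity)
  have hτ4 : 0 < τ / 4 := by positivity
  obtain ⟨κ₁, hκ₁, b₁⟩ := exists_side_bound (σ := 1) hp hW hr (Or.inl rfl) hτ4
  obtain ⟨κ₂, hκ₂, b₂⟩ := exists_side_bound (σ := -1) hp hW hr (Or.inr rfl) hτ4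
  obtain ⟨E, ⟨ε, u, G, H, lam, hε, tε, hA, hu, rfl⟩, hE⟩ := sInf_lt_iff.1 h
  have f1 := frequently_lt_of_liminf_lt (by isBoundedDefault) hE
  have tεM : Tendsto (fun k => ε k * M) atTop (𝓝 0) := by simpa using tε.mul_const M
  have e := ((tε.eventually_le_const hτ).and ((tεM.eventually_le_const hκ₁).and
    (tεM.eventually_le_const hκ₂))).and
    ((hu.eventually_le_const (ENNReal.ofReal_pos.2 hκ₁)).and
      (hu.eventually_le_const (ENNReal.ofReal_pos.2 hκ₂)))
  obtain ⟨k, hk, ⟨k1, k2, k3⟩, k4, k5⟩ := (f1.and_eventually e).exists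
  -- the loss allowed in the smooth approximation of the chosen member of the sequence
  set s : ℝ≥0∞ := min (ENNReal.ofReal M - energy W (ε k) (G k) (H k) (lam k))
    (min (ENNReal.ofReal (δ / 2)) (ENNReal.ofReal (τ / 2))) with hs
  have hs0 : 0 < s := by
    refine lt_min (tsub_pos_of_lt hk) (lt_min (ENNReal.ofReal_pos.2 ?_) (ENNReal.ofReal_pos.2 ?_))
      <;> positivity
  obtain ⟨w, hw, w1, w2, w3⟩ := exists_smooth_approximation (a := a) hp h1.1 h2 (hε k) (hA k)
    hk.ne_top hr hs0
  have s1 : s ≤ _ := min_le_left _ _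
  have s2 : s ≤ ENNReal.ofReal (δ / 2) := (min_le_right _ _).trans (min_le_left _ _)
  have s3 : s ≤ ENNReal.ofReal (τ / 2) := (min_le_right _ _).trans (min_le_right _ _)
  have hside := setLIntegral_outerPart_le (a := a) (p := p) (r := r) (G := G k)
    (t := ENNReal.ofReal (τ / 4)) (by
      rintro σ (rfl | rfl)
      · exact b₁ _ _ _ _ _ M (hA k).1 (hε k) hk.le k2 k4
      · exact b₂ _ _ _ _ _ M (hA k).1 (hε k) hk.le k3 k5)
  have hfinal := key w (ε k) (lam k) hw (hε k) k1 (hA k).2.1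
    (w1.trans ((add_le_add_right s1 _).trans_eq (add_tsub_cancel_of_le hk.le)))
    (w2.trans (by rw [ENNReal.ofReal_add hγ (by positivity)]; gcongr))
    (w3.trans ((add_le_add hside s3).trans_eq (by
      rw [← ENNReal.ofReal_add hτ4.le hτ4.le, ← ENNReal.ofReal_add (by positivity) (by positivity)]
      congr 1
      ring)))
  rw [add_assoc, add_halves] at hfinal
  exact hfinal.trans (ENNReal.ofReal_le_ofReal (by linarith))

end LowerBound

/-! ### Periodic competitors as profiles -/

section Capping

variable {d n : ℕ} {W : Matrix (Fin d) (Fin (n + 1)) ℝ → ℝ≥0} {a : Fin d → ℝ} {p C : ℝ}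

theorem per_one_of_single {β : Type*} {f : (Fin (n + 1) → ℝ) → β}
    (hf : ∀ (j : Fin n) (x : Fin (n + 1) → ℝ), f (x + Pi.single j.castSucc 1) = f x) :
    Per 1 f := by
  intro k
  have e : hvec (fun j => (k j : ℝ) * 1) =
      ∑ j, k j • (Pi.single j.castSucc 1 : Fin (n + 1) → ℝ) := by
    funext i
    refine Fin.lastCases ?_ (fun i => ?_) i
    · simp [Finset.sum_apply, (Fin.castSucc_ne_last _).symm]
    · simp [Finset.sum_apply, Pi.single_apply]
  rw [e]
  refine Finset.sum_induction _ (fun z => ∀ x, f (x + z) = f x) (fun y z hy hz x => ?_)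
    (fun x => by rw [add_zero]) fun j _ => ?_
  · rw [← add_assoc, hz, hy]
  · exact (show Function.Periodic f (Pi.single j.castSucc 1) from hf j).zsmul (k j)

theorem volume_last_half (j : Fin (n + 1)) :
    volume {x : Fin (n + 1) → ℝ | x j = 1 / 2} = 0 := by
  rw [volume_pi]
  exact Measure.pi_hyperplane _ j _

/-- The map `w`, replaced by affine maps at heights above `h` and below `-h`. -/
def capped (a : Fin d → ℝ) (h : ℝ) (cp cm : Fin d → ℝ) (w : (Fin (n + 1) → ℝ) → Fin d → ℝ)
    (x : Fin (n + 1) → ℝ) : Fin d → ℝ :=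
  if h ≤ x (Fin.last n) then (1 * x (Fin.last n)) • a + cp
  else if x (Fin.last n) ≤ -h then (-1 * x (Fin.last n)) • a + cm
  else w x

variable {w : (Fin (n + 1) → ℝ) → Fin d → ℝ} {ε lam h h₁ h₂ : ℝ} {cp cm : Fin d → ℝ}

/-- The caps at height `± h` agree with `w` on neighbourhoods of these heights. -/
theorem capped_eventuallyEq (h0 : 0 < h₁) (hh₁ : h₁ < h) (hh₂ : h < h₂)
    (hcp : ∀ x : Fin (n + 1) → ℝ, h₁ < x (Fin.last n) → x (Fin.last n) < h₂ →
      w x = (1 * x (Fin.last n)) • a + cp)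
    (hcm : ∀ x : Fin (n + 1) → ℝ, -h₂ < x (Fin.last n) → x (Fin.last n) < -h₁ →
      w x = (-1 * x (Fin.last n)) • a + cm) (x : Fin (n + 1) → ℝ) :
    (h₁ < x (Fin.last n) → capped a h cp cm w =ᶠ[𝓝 x] fun y => (1 * y (Fin.last n)) • a + cp) ∧
    (x (Fin.last n) < -h₁ → capped a h cp cm w =ᶠ[𝓝 x] fun y => (-1 * y (Fin.last n)) • a + cm) ∧
    (-h < x (Fin.last n) → x (Fin.last n) < h → capped a h cp cm w =ᶠ[𝓝 x] w) := by
  refine ⟨fun hx => ?_, fun hx => ?_, fun hx hx' => ?_⟩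
  · filter_upwards [eventually_lt_last hx] with y hy
    rw [capped]
    split_ifs with h3 h4
    · rfl
    · linarith
    · exact hcp y hy (by linarith)
  · filter_upwards [eventually_last_lt hx] with y hy
    rw [capped]
    split_ifs with h3 h4
    · linarith
    · rfl
    · exact hcm y (by linarith) hy
  · filter_upwards [eventually_lt_last hx, eventually_last_lt hx'] with y hy hy'
    rw [capped, if_neg (by linarith), if_neg (by linarith)]

theorem smooth_affine (s : ℝ) (a c : Fin d → ℝ) :
    Smooth fun x : Fin (n + 1) → ℝ => (s * x (Fin.last n)) • a + c := fun i =>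
  (((contDiff_const.mul (contDiff_apply ℝ ℝ _)).mul contDiff_const).add contDiff_const :
    ContDiff ℝ ∞ fun x : Fin (n + 1) → ℝ => s * x (Fin.last n) * a i + c i)

/-- A periodic map which is affine with gradients in the wells near the top and the bottom of a
layer yields a profile. -/
theorem exists_profile_of_affine (hp : 2 ≤ p) (hW : Comparable W a p C) (hε : 0 < ε)
    (hlam : lam ≤ 0) (h0 : 0 < h₁) (hh₁ : h₁ < h) (hh₂ : h < h₂) (hh : h ≤ 1 / 2)
    (hw : Smooth w) (hper : Per 1 w)
    (hcp : ∀ x : Fin (n + 1) → ℝ, h₁ < x (Fin.last n) → x (Fin.last n) < h₂ →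
      w x = (1 * x (Fin.last n)) • a + cp)
    (hcm : ∀ x : Fin (n + 1) → ℝ, -h₂ < x (Fin.last n) → x (Fin.last n) < -h₁ →
      w x = (-1 * x (Fin.last n)) • a + cm) {E Γ : ℝ≥0∞}
    (hE : ∫⁻ x in cube n ∩ {x | x (Fin.last n) ∈ Set.Ioo (-h) h}, eden W ε lam w x ≤ E)
    (hΓ : ∫⁻ x in cube n ∩ {x | x (Fin.last n) ∈ Set.Ioo (-h) h}, gden lam w x ≤ Γ) :
    ∃ v, Profile W a ε lam 1 E Γ v := by
  have hev := capped_eventuallyEq h0 hh₁ hh₂ hcp hcm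
  have hs : Smooth (capped a h cp cm w) := by
    intro i
    refine contDiff_iff_contDiffAt.2 fun x => ?_
    obtain ⟨e1, e2, e3⟩ := hev x
    rcases lt_or_ge h₁ (x (Fin.last n)) with h3 | h3
    · exact ((smooth_affine 1 a cp i).contDiffAt).congr_of_eventuallyEq
        ((e1 h3).fun_comp fun y => y i)
    · rcases lt_or_ge (x (Fin.last n)) (-h₁) with h4 | h4
      · exact ((smooth_affine (-1) a cm i).contDiffAt).congr_of_eventuallyEq
          ((e2 h4).fun_comp fun y => y i)
      · exact ((hw i).contDiffAt).congr_of_eventuallyEq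
          ((e3 (by linarith) (by linarith)).fun_comp fun y => y i)
  -- slabs are built over `(0, 1]`, so the map is translated by `1 / 2` in the horizontal
  -- variables
  set b : Fin (n + 1) → ℝ := hvec fun _ => -(1 / 2) with hb
  have hbl : ∀ x : Fin (n + 1) → ℝ, (x + b) (Fin.last n) = x (Fin.last n) := fun x => by
    simp [hb]
  have hgrad : ∀ x, grad (fun y => capped a h cp cm w (y + b)) x =
      grad (capped a h cp cm w) (x + b) := fun x => by
    funext i j
    exact pd_comp_add_right (fun y => capped a h cp cm w y i) j b x
  have hhess : ∀ x, hess (fun y => capped a h cp cm w (y + b)) x =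
      hess (capped a h cp cm w) (x + b) := fun x => by
    funext i j k
    have e : (pd j fun y => capped a h cp cm w (y + b) i) =
        fun y => pd j (fun z => capped a h cp cm w z i) (y + b) := by
      funext y
      exact pd_comp_add_right (fun z => capped a h cp cm w z i) j b y
    rw [hess, e]
    exact pd_comp_add_right _ k b x
  have hint : ∀ {f g : (Fin (n + 1) → ℝ) → ℝ≥0∞} {t : ℝ≥0∞},
      (∀ x, x (Fin.last n) ∈ Set.Ioo (-h) h → f x = g x) →
      (∀ x, x (Fin.last n) ∉ Set.Ioo (-h) h → f x = 0) →
      ∫⁻ x in cube n ∩ {x | x (Fin.last n) ∈ Set.Ioo (-h) h}, g x ≤ t →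
      ∫⁻ x in slab n 1, f (x + b) ≤ t := by
    intro f g t h1 h2 h3
    rw [← setLIntegral_translate]
    have hm : MeasurableSet {x : Fin (n + 1) → ℝ | x (Fin.last n) ∈ Set.Ioo (-h) h} :=
      measurable_pi_apply (Fin.last n) measurableSet_Ioo
    have hT : {x : Fin (n + 1) → ℝ | x - b ∈ slab n 1} ⊆
        ({x | x (Fin.last n) ∈ Set.Ioo (-h) h}ᶜ ∪ ⋃ j, {x | x j = 1 / 2}) ∪
          (cube n ∩ {x | x (Fin.last n) ∈ Set.Ioo (-h) h}) := by
      intro x hx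
      by_cases hxN : x (Fin.last n) ∈ Set.Ioo (-h) h
      · by_cases hj : ∃ j, x j = 1 / 2
        · exact Or.inl (Or.inr (Set.mem_iUnion.2 hj))
        · refine Or.inr ⟨fun i => ?_, hxN⟩
          push Not at hj
          refine Fin.lastCases ⟨by linarith [hxN.1], by linarith [hxN.2]⟩ (fun i => ?_) i
          have h4 := hx i
          simp only [hb, Pi.sub_apply, hvec_castSucc, Set.mem_Ioc] at h4
          exact ⟨by linarith [h4.1], lt_of_le_of_ne (by linarith [h4.2]) (hj _)⟩
      · exact Or.inl (Or.inl hxN)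
    have hnull : ∫⁻ x in ⋃ j, {x : Fin (n + 1) → ℝ | x j = 1 / 2}, f x = 0 :=
      setLIntegral_measure_zero _ _ (measure_iUnion_null volume_last_half)
    have hzero : ∫⁻ x in {x : Fin (n + 1) → ℝ | x (Fin.last n) ∈ Set.Ioo (-h) h}ᶜ, f x = 0 := by
      rw [setLIntegral_congr_fun hm.compl fun x hx => h2 x hx, lintegral_zero]
    calc _ ≤ _ := lintegral_mono_set hT
      _ ≤ (∫⁻ x in {x : Fin (n + 1) → ℝ | x (Fin.last n) ∈ Set.Ioo (-h) h}ᶜ, f x) +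
          (∫⁻ x in ⋃ j, {x : Fin (n + 1) → ℝ | x j = 1 / 2}, f x) +
          ∫⁻ x in cube n ∩ {x | x (Fin.last n) ∈ Set.Ioo (-h) h}, f x :=
          (lintegral_union_le _ _ _).trans (by gcongr; exact lintegral_union_le _ _ _)
      _ ≤ t := by
          rw [hnull, hzero, add_zero, zero_add, setLIntegral_congr_fun
            (measurableSet_cube.inter hm) fun x hx => h1 x hx.2]
          exact h3
  have hin : ∀ x : Fin (n + 1) → ℝ, x (Fin.last n) ∈ Set.Ioo (-h) h →
      eden W ε lam (capped a h cp cm w) x = eden W ε lam w x ∧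
        gden lam (capped a h cp cm w) x = gden lam w x := fun x hx =>
    eden_gden_congr W ε lam ((hev x).2.2 hx.1 hx.2)
  have hout : ∀ x : Fin (n + 1) → ℝ, x (Fin.last n) ∉ Set.Ioo (-h) h →
      eden W ε lam (capped a h cp cm w) x = 0 ∧ gden lam (capped a h cp cm w) x = 0 := by
    intro x hx
    rcases lt_or_ge (-h) (x (Fin.last n)) with h3 | h3
    · have h4 : h ≤ x (Fin.last n) := not_lt.1 fun h4 => hx ⟨h3, h4⟩
      exact hW.density_eq_zero hp (Or.inl rfl) hε hlam ((hev x).1 (by linarith))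
    · exact hW.density_eq_zero hp (Or.inr rfl) hε hlam ((hev x).2.1 (by linarith))
  refine ⟨fun x => capped a h cp cm w (x + b), ⟨fun i => ?_, fun k x => ?_,
    ⟨h, cp, cm, h0.trans hh₁, fun x => ⟨fun hx => ?_, fun hx => ?_⟩⟩, ?_, ?_⟩⟩
  · exact (hs i).comp (contDiff_id.add contDiff_const)
  · have e : x + (hvec fun j => (k j : ℝ) * 1) + b = x + b + hvec fun j => (k j : ℝ) * 1 :=
      add_right_comm _ _ _
    have e2 : (x + b + hvec fun j => (k j : ℝ) * 1) (Fin.last n) = (x + b) (Fin.last n) := by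
      simp
    simp only [e]
    simp only [capped, e2, hper k]
  · simp only [capped, hbl, if_pos hx, one_mul]
  · simp only [capped, hbl]
    rw [if_neg (by linarith), if_pos hx, neg_one_mul]
  · rw [one_pow, ENNReal.ofReal_one, one_mul]
    simp only [eden, hgrad, hhess]
    exact hint (f := fun x => eden W ε lam (capped a h cp cm w) x) (fun x hx => (hin x hx).1)
      (fun x hx => (hout x hx).1) hE
  · rw [one_pow, ENNReal.ofReal_one, one_mul]
    simp only [gden, hhess]
    exact hint (f := fun x => gden lam (capped a h cp cm w) x) (fun x hx => (hin x hx).2)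
      (fun x hx => (hout x hx).2) hΓ

/-- A smooth map with gradient `s a ⊗ e_N` between two heights is affine there. -/
theorem exists_affine_of_grad_eq {s t₁ t₂ : ℝ} (hw : Smooth w)
    (h : ∀ x : Fin (n + 1) → ℝ, t₁ < x (Fin.last n) → x (Fin.last n) < t₂ →
      grad w x = s • well n a) :
    ∃ c : Fin d → ℝ, ∀ x : Fin (n + 1) → ℝ, t₁ < x (Fin.last n) → x (Fin.last n) < t₂ →
      w x = (s * x (Fin.last n)) • a + c := by
  have key : ∀ i, ∃ c : ℝ, ∀ x ∈ {x : Fin (n + 1) → ℝ | x (Fin.last n) ∈ Set.Ioo t₁ t₂},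
      w x i - ((s * x (Fin.last n)) • a + 0) i = c := by
    intro i
    have hg : ContDiff ℝ ∞ fun x : Fin (n + 1) → ℝ => w x i - ((s * x (Fin.last n)) • a + 0) i :=
      (hw i).sub (smooth_affine s a 0 i)
    refine IsOpen.exists_is_const_of_fderiv_eq_zero (𝕜 := ℝ)
      (isOpen_Ioo.preimage (continuous_apply (Fin.last n))) ?_
      (hg.differentiable (by simp)).differentiableOn fun x hx => ?_
    · exact ((convex_Ioo t₁ t₂).linear_preimage
        (LinearMap.proj (R := ℝ) (φ := fun _ : Fin (n + 1) => ℝ) (Fin.last n))).isPreconnected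
    · have hpd : ∀ j, pd j (fun x : Fin (n + 1) → ℝ => w x i - ((s * x (Fin.last n)) • a + 0) i) x =
          0 := by
        intro j
        rw [pd_sub (diffAt_of_contDiff (hw i) x) (diffAt_of_contDiff (smooth_affine s a 0 i) x)]
        have h1 := congrFun (congrFun (h x hx.1 hx.2) i) j
        have h2 := congrFun (congrFun (grad_of_eventually_affine (v := fun y : Fin (n + 1) → ℝ =>
          (s * y (Fin.last n)) • a + 0) (x := x) (EventuallyEq.refl _ _)).1 i) j
        exact (congrArg₂ (· - ·) h1 h2).trans (sub_self _)
      refine ContinuousLinearMap.coe_injective (LinearMap.pi_ext' fun j => ?_)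
      ext
      exact hpd j
  choose c hc using key
  refine ⟨c, fun x h1 h2 => ?_⟩
  funext i
  have := hc i x ⟨h1, h2⟩
  simp only [Pi.add_apply, Pi.zero_apply, add_zero] at this ⊢
  linarith

end Capping

/-! ### The upper bound -/

section UpperBound

open Metric

variable {d n : ℕ} {W : Matrix (Fin d) (Fin (n + 1)) ℝ → ℝ≥0} {a : Fin d → ℝ} {p C L lam γ : ℝ}
  {u : (Fin (n + 1) → ℝ) → Fin d → ℝ}
  {G : (Fin (n + 1) → ℝ) → Matrix (Fin d) (Fin (n + 1)) ℝ}
  {H : (Fin (n + 1) → ℝ) → Fin d → Fin (n + 1) → Fin (n + 1) → ℝ}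

/-- Mollifications of finitely many bounded functions are uniformly bounded. -/
theorem exists_abs_moll_le {ι : Type*} [Finite ι] {U : Set (Fin (n + 1) → ℝ)}
    (hU : MeasurableSet U) {f : ι → (Fin (n + 1) → ℝ) → ℝ}
    (hf : ∀ l, MemLp (f l) ⊤ (volume.restrict U)) :
    ∃ B : ℝ, 0 ≤ B ∧ ∀ l m x, |moll m (U.indicator (f l)) x| ≤ B := by
  have h : ∀ l, ∃ B : ℝ, ∀ m x, |moll m (U.indicator (f l)) x| ≤ B := by
    intro l
    have h1 := (memLp_indicator_iff_restrict hU).2 (hf l)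
    set B := (eLpNorm (U.indicator (f l)) ⊤ volume).toReal
    have h2 : ∀ᵐ x, |U.indicator (f l) x| ≤ B := by
      have h3 := ae_le_eLpNormEssSup (f := U.indicator (f l)) (μ := volume)
      rw [← eLpNorm_exponent_top] at h3
      filter_upwards [h3] with x hx
      have := ENNReal.toReal_mono h1.2.ne hx
      rwa [toReal_enorm] at this
    have hl := locallyIntegrable_indicator le_top hU (hf l)
    have hla : LocallyIntegrable fun y => |U.indicator (f l) y| := fun y => by
      obtain ⟨s, hs, hi⟩ := hl y
      exact ⟨s, hs, hi.norm⟩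
    refine ⟨B, fun m x => abs_moll_le.trans ((moll_mono hla (locallyIntegrable_const B) h2).trans_eq
      (moll_const_of_ae B (Eventually.of_forall fun _ _ => rfl)))⟩
  choose b hb using h
  obtain ⟨B, hB⟩ := Finite.exists_le b
  exact ⟨max B 0, le_max_right _ _, fun l m x =>
    (hb l m x).trans ((hB l).trans (le_max_left _ _))⟩

theorem per_mollMap {U : Set (Fin (n + 1) → ℝ)} (m : ℕ)
    (hU : ∀ (j : Fin n) (x : Fin (n + 1) → ℝ), x + Pi.single j.castSucc 1 ∈ U ↔ x ∈ U)
    (hu : ∀ (j : Fin n) (x : Fin (n + 1) → ℝ), u (x + Pi.single j.castSucc 1) = u x) :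
    Per 1 (mollMap m U u) := by
  refine per_one_of_single fun j x => ?_
  funext i
  simp only [mollMap, moll_apply']
  congr 1
  funext t
  congr 1
  have e : x + Pi.single j.castSucc 1 - t = (x - t) + Pi.single j.castSucc 1 := by abel
  rw [e]
  by_cases h : x - t ∈ U
  · rw [Set.indicator_of_mem (s := U) h, Set.indicator_of_mem (s := U) ((hU j _).2 h), hu]
  · rw [Set.indicator_of_notMem (s := U) h,
      Set.indicator_of_notMem (s := U) (fun h' => h ((hU j _).1 h'))]

theorem grad_mollMap_of_ae {q : ℝ≥0∞} {m : ℕ} {x : Fin (n + 1) → ℝ} (hq : 1 ≤ q)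
    {U : Set (Fin (n + 1) → ℝ)} (hU : MeasurableSet U) (hS : IsSobolevTwo q U u G H)
    (hx : closedBall x (1 / (m + 1 : ℝ)) ⊆ U) {ξ : Matrix (Fin d) (Fin (n + 1)) ℝ}
    (hG : ∀ᵐ y, y ∈ ball x (1 / (m + 1 : ℝ)) → G y = ξ) : grad (mollMap m U u) x = ξ := by
  rw [grad_mollMap hq hU hS hx]
  funext i j
  refine moll_const_of_ae _ ?_
  filter_upwards [hG] with y hy hyb
  rw [Set.indicator_of_mem (s := U) (hx (ball_subset_closedBall hyb)), hy hyb]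

theorem abs_last_sub_le {x y : Fin (n + 1) → ℝ} {ρ : ℝ} (h : y ∈ closedBall x ρ) :
    |y (Fin.last n) - x (Fin.last n)| ≤ ρ :=
  (dist_le_pi_dist y x (Fin.last n)).trans (mem_closedBall.1 h)

/-- Mollification and capping turn an admissible periodic competitor into a profile. -/
theorem exists_profile_of_competitor (hp : 2 ≤ p) (h2 : H2 W p) (hWc : Continuous W)
    (hW : Comparable W a p C) (hL : 0 < L) (hS : IsSobolevTwo ⊤ (strip n) u G H)
    (hper : ∀ (j : Fin n) (x : Fin (n + 1) → ℝ), u (x + Pi.single j.castSucc 1) = u x)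
    (hη : ∃ η : ℝ, 0 < η ∧ ∀ᵐ x ∂(volume.restrict (strip n)),
      (1 / 2 - η < x (Fin.last n) → G x = well n a) ∧
      (x (Fin.last n) < -(1 / 2) + η → G x = -well n a))
    (hA : Admissible γ u G H lam) {δ : ℝ≥0∞} (hδ : 0 < δ) :
    ∃ v, Profile W a (1 / L) lam 1 (energy W (1 / L) G H lam + δ) (ENNReal.ofReal γ + δ) v := by
  obtain ⟨η₀, hη₀, hG₀⟩ := hη
  obtain ⟨-, hlam, hγ⟩ := hA
  set η := min η₀ (1 / 4)
  have hη : 0 < η := lt_min hη₀ (by norm_num)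
  have hη₁ : η ≤ η₀ := min_le_left _ _
  have hη₂ : η ≤ 1 / 4 := min_le_right _ _
  rw [ae_restrict_iff' measurableSet_strip] at hG₀
  obtain ⟨C₂, hC₂, hW₂⟩ := h2
  obtain ⟨B, hB0, hB⟩ := exists_abs_moll_le measurableSet_strip
    (f := fun (l : Fin d × Fin (n + 1)) y => G y l.1 l.2) fun l => hS.memLp_grad l.1 l.2
  obtain ⟨D, hD0, hD⟩ := exists_abs_moll_le measurableSet_strip
    (f := fun (l : Fin d × Fin (n + 1) × Fin (n + 1)) y => H y l.1 l.2.1 l.2.2)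
    fun l => hS.memLp_hess l.1 l.2.1 l.2.2
  set V : Set (Fin (n + 1) → ℝ) :=
    cube n ∩ {x | x (Fin.last n) ∈ Set.Ioo (-(1 / 2 - η / 2)) (1 / 2 - η / 2)}
  have hVm : MeasurableSet V :=
    measurableSet_cube.inter (measurable_pi_apply (Fin.last n) measurableSet_Ioo)
  have hVc : V ⊆ cube n := Set.inter_subset_left
  have hVfin : volume V ≠ ⊤ :=
    ((measure_mono hVc).trans_lt (by rw [volume_cube]; exact ENNReal.one_lt_top)).ne
  have hVU : ∀ x ∈ V, closedBall x (η / 8) ⊆ strip n := by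
    rintro x ⟨-, hx⟩ y hy
    obtain ⟨h1, h2⟩ := abs_le.1 (abs_last_sub_le hy)
    exact ⟨by linarith [hx.1], by linarith [hx.2]⟩
  have hK : ∀ c : ℝ≥0∞, c ≠ ⊤ → ∫⁻ x, V.indicator (fun _ => c) x ≠ ⊤ := fun c hc => by
    rw [lintegral_indicator hVm, setLIntegral_const]
    exact ENNReal.mul_ne_top hc hVfin
  set N : ℝ := d * (n + 1) * B
  set N' : ℝ := d * (n + 1) ^ 2 * D
  have bG : ∀ m x, matNorm (fun i j => moll m ((strip n).indicator fun y => G y i j) x) ≤ N :=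
    fun m x => matNorm_le_of_entry_le fun i j => hB (i, j) m x
  have bH : ∀ m x,
      hessNorm (fun i j k => moll m ((strip n).indicator fun y => H y i j k) x) ≤ N' :=
    fun m x => hessNorm_le_of_entry_le fun i j k => hD (i, j, k) m x
  have E1 := eventually_setLIntegral_mollMap_le le_top measurableSet_strip hS
    (ρ := η / 8) (by positivity) hVm hVU
    (Ψ := fun _ ξ η => (1 / (1 / L)) * (W ξ : ℝ) + 1 / L * hessNorm η ^ 2 +
      1 / L * min (lam ^ 2) (hessNorm η ^ 2))
    (fun _ => by
      have c1 : Continuous fun z : Matrix (Fin d) (Fin (n + 1)) ℝ ×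
          (Fin d → Fin (n + 1) → Fin (n + 1) → ℝ) => hessNorm z.2 :=
        continuous_hessNorm.comp continuous_snd
      have c2 : Continuous fun z : Matrix (Fin d) (Fin (n + 1)) ℝ ×
          (Fin d → Fin (n + 1) → Fin (n + 1) → ℝ) => (W z.1 : ℝ) :=
        NNReal.continuous_coe.comp (hWc.comp continuous_fst)
      fun_prop)
    (fun w hw => by
      have h1 : Continuous fun x => (W (grad w x) : ℝ) :=
        NNReal.continuous_coe.comp (hWc.comp hw.continuous_grad)
      have h2 : Continuous fun x => hessNorm (hess w x) :=
        continuous_hessNorm.comp hw.continuous_hess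
      exact Continuous.measurable (by fun_prop))
    (K := fun _ => V.indicator fun _ => ENNReal.ofReal
      ((1 / (1 / L)) * (C₂ * (N ^ p + 1)) + 1 / L * N' ^ 2 + 1 / L * N' ^ 2))
    (fun _ => measurable_const.indicator hVm) (Eventually.of_forall fun _ => tendsto_const_nhds)
    (fun _ => rfl) (hK _ ENNReal.ofReal_ne_top)
    (Eventually.of_forall fun m x hx => by
      rw [Set.indicator_of_mem (s := V) hx]
      refine ENNReal.ofReal_le_ofReal ?_
      have h1 := matNorm_nonneg fun i j => moll m ((strip n).indicator fun y => G y i j) x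
      have h3 := hessNorm_nonneg fun i j k => moll m ((strip n).indicator fun y => H y i j k) x
      refine add_le_add (add_le_add (mul_le_mul_of_nonneg_left ((hW₂ _).2.trans ?_) (by positivity))
        ?_) (mul_le_mul_of_nonneg_left ((min_le_right _ _).trans ?_) (by positivity))
      · gcongr
        exact bG m x
      · gcongr
        exact bH m x
      · gcongr
        exact bH m x) hδ
  have E2 := eventually_setLIntegral_mollMap_le le_top measurableSet_strip hS
    (ρ := η / 8) (by positivity) hVm hVU
    (Ψ := fun _ _ η => max (lam + hessNorm η) 0)
    (fun _ => by
      have c1 : Continuous fun z : Matrix (Fin d) (Fin (n + 1)) ℝ ×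
          (Fin d → Fin (n + 1) → Fin (n + 1) → ℝ) => hessNorm z.2 :=
        continuous_hessNorm.comp continuous_snd
      fun_prop)
    (fun w hw => by
      have h2 : Continuous fun x => hessNorm (hess w x) :=
        continuous_hessNorm.comp hw.continuous_hess
      exact Continuous.measurable (by fun_prop))
    (K := fun _ => V.indicator fun _ => ENNReal.ofReal N')
    (fun _ => measurable_const.indicator hVm) (Eventually.of_forall fun _ => tendsto_const_nhds)
    (fun _ => rfl) (hK _ ENNReal.ofReal_ne_top)
    (Eventually.of_forall fun m x hx => by
      rw [Set.indicator_of_mem (s := V) hx]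
      exact ENNReal.ofReal_le_ofReal (max_le (by linarith [bH m x]) (by positivity))) hδ
  obtain ⟨m, ⟨e1, e2⟩, e3⟩ :=
    ((E1.and E2).and (eventually_one_div_lt (show 0 < η / 8 by positivity))).exists
  have hw := smooth_mollMap le_top measurableSet_strip hS m
  have hball : ∀ x : Fin (n + 1) → ℝ, -(1 / 2 - η / 8) < x (Fin.last n) →
      x (Fin.last n) < 1 / 2 - η / 8 → closedBall x (1 / (m + 1 : ℝ)) ⊆ strip n := by
    intro x h1 h2 y hy
    obtain ⟨h3, h4⟩ := abs_le.1 (abs_last_sub_le hy)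
    exact ⟨by linarith, by linarith⟩
  -- mollification keeps the gradient equal to the wells at distance `η / 8` from the
  -- transition and from the boundary of the strip
  obtain ⟨cp, hcp⟩ := exists_affine_of_grad_eq (a := a) (s := 1) (t₁ := 1 / 2 - η + η / 8)
    (t₂ := 1 / 2 - η / 8) hw fun x h1 h2 => by
      have hb := hball x (by linarith) h2
      rw [one_smul]
      refine grad_mollMap_of_ae le_top measurableSet_strip hS hb ?_
      filter_upwards [hG₀] with y hy hyb
      have h3 := abs_le.1 (abs_last_sub_le (ball_subset_closedBall hyb))
      exact (hy (hb (ball_subset_closedBall hyb))).1 (by linarith [h3.1])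
  obtain ⟨cm, hcm⟩ := exists_affine_of_grad_eq (a := a) (s := -1) (t₁ := -(1 / 2 - η / 8))
    (t₂ := -(1 / 2 - η + η / 8)) hw fun x h1 h2 => by
      have hb := hball x h1 (by linarith)
      rw [neg_one_smul]
      refine grad_mollMap_of_ae le_top measurableSet_strip hS hb ?_
      filter_upwards [hG₀] with y hy hyb
      have h3 := abs_le.1 (abs_last_sub_le (ball_subset_closedBall hyb))
      exact (hy (hb (ball_subset_closedBall hyb))).2 (by linarith [h3.2])
  refine exists_profile_of_affine (h := 1 / 2 - η / 2) hp hW (by positivity) hlam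
    (show 0 < 1 / 2 - η + η / 8 by linarith) (by linarith) (by linarith) (by linarith) hw
    (per_mollMap m (fun j x => ?_) hper) hcp hcm ?_ ?_
  · have : (x + Pi.single j.castSucc 1 : Fin (n + 1) → ℝ) (Fin.last n) = x (Fin.last n) := by
      simp [(Fin.castSucc_ne_last _).symm]
    change _ ∈ Set.Ioo _ _ ↔ _ ∈ Set.Ioo _ _
    rw [this]
  · exact e1.trans (by gcongr; exact lintegral_mono_set hVc)
  · exact e2.trans (by gcongr; exact (lintegral_mono_set hVc).trans hγ)

/-- The upper bound: periodic competitors yield recovery sequences. -/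
theorem phiTilde_le_phiPTilde (hp : 2 ≤ p) (h1 : H1 W a) (h2 : H2 W p) (h3 : H3 W a p)
    (hγ : 0 ≤ γ) {δ : ℝ} (hδ : 0 < δ) : PhiTilde W a (γ + δ) ≤ PhiPTilde W a γ := by
  obtain ⟨C, hW⟩ := exists_comparable hp h1 h2 h3
  refine le_sInf ?_
  rintro E ⟨L, u, G, H, lam, hL, hS, hper, hη, hA, rfl⟩
  refine ENNReal.le_of_forall_pos_le_add fun s hs _ => ?_
  have hs' : 0 < min (s : ℝ≥0∞) (ENNReal.ofReal δ) :=
    lt_min (by exact_mod_cast hs) (ENNReal.ofReal_pos.2 hδ)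
  obtain ⟨v, hv⟩ := exists_profile_of_competitor hp h2 h1.1 hW hL hS hper hη hA hs'
  have hv' : Profile W a (1 / L) lam 1 (energy W (1 / L) G H lam + s) (ENNReal.ofReal (γ + δ)) v :=
    hv.mono (by gcongr; exact min_le_left _ _)
      (by rw [ENNReal.ofReal_add hγ hδ.le]; gcongr; exact min_le_right _ _)
  exact hv'.phiTilde_le h1.1 (by positivity) hA.2.1 one_pos

/-- The lower bound without the auxiliary bound `M`; if `PhiTilde W a γ` is infinite, it is trivial.
-/
theorem phiPTilde_le_phiTilde (hp : 2 ≤ p) (h1 : H1 W a) (h2 : H2 W p) (h3 : H3 W a p)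
    (h4 : H4 W) (hγ : 0 ≤ γ) {δ : ℝ} (hδ : 0 < δ) : PhiPTilde W a (γ + δ) ≤ PhiTilde W a γ := by
  refine ENNReal.le_of_forall_pos_le_add fun s hs hfin => ?_
  set t : ℝ := min (s / 2) δ
  have hs2 : (0 : ℝ) < s / 2 := by positivity
  have ht : 0 < t := lt_min hs2 hδ
  have ht1 : t ≤ s / 2 := min_le_left _ _
  have ht2 : t ≤ δ := min_le_right _ _
  set M : ℝ := (PhiTilde W a γ).toReal
  have hM : 0 ≤ M := ENNReal.toReal_nonneg
  have hMe : ENNReal.ofReal M = PhiTilde W a γ := ENNReal.ofReal_toReal hfin.ne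
  have hlt : PhiTilde W a γ < ENNReal.ofReal (M + t) := by
    rw [← hMe]
    exact (ENNReal.ofReal_lt_ofReal_iff (by linarith)).2 (by linarith)
  have h := phiPTilde_le_of_phiTilde_lt hp h1 h2 h3 h4 hγ (by linarith) ht hlt
  calc PhiPTilde W a (γ + δ) ≤ PhiPTilde W a (γ + t) := PhiPTilde_antitone W a (by linarith)
    _ ≤ ENNReal.ofReal (M + t + t) := h
    _ ≤ ENNReal.ofReal (M + s) := ENNReal.ofReal_le_ofReal (by linarith)
    _ = _ := by rw [ENNReal.ofReal_add hM (NNReal.coe_nonneg s), hMe, ENNReal.ofReal_coe_nnreal]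

end UpperBound

end

end Surfactant

theorem mainTheorem6 (d n : ℕ) (a : Fin d → ℝ) (p : ℝ) (hp : 2 ≤ p)
    (W : Matrix (Fin d) (Fin (n + 1)) ℝ → NNReal)
    (h1 : Surfactant.H1 W a) (h2 : Surfactant.H2 W p)
    (h3 : Surfactant.H3 W a p) (h4 : Surfactant.H4 W)
    (γ : ℝ) (hγ : 0 ≤ γ) :
    Surfactant.PhiP W a γ = Surfactant.Phi W a γ := by
  have hdouble : Tendsto (fun δ : ℝ => δ + δ) (𝓝[>] 0) (𝓝[>] 0) := by
    refine tendsto_nhdsWithin_iff.2 ⟨?_, ?_⟩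
    · have h : Continuous fun δ : ℝ => δ + δ := by fun_prop
      have h0 := h.tendsto 0
      rw [add_zero] at h0
      exact h0.mono_left nhdsWithin_le_nhds
    · filter_upwards [self_mem_nhdsWithin] with δ hδ
      exact add_pos (Set.mem_Ioi.1 hδ) (Set.mem_Ioi.1 hδ)
  refine le_antisymm ?_ ?_
  · refine le_of_tendsto_of_tendsto ((Surfactant.tendsto_PhiP W a γ).comp hdouble)
      (Surfactant.tendsto_Phi W a γ) ?_
    filter_upwards [self_mem_nhdsWithin] with δ hδ
    have hδ' : 0 < δ := hδ
    have h := Surfactant.phiPTilde_le_phiTilde hp h1 h2 h3 h4 (show 0 ≤ γ + δ by linarith) hδ'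
    rwa [add_assoc] at h
  · refine le_of_tendsto_of_tendsto ((Surfactant.tendsto_Phi W a γ).comp hdouble)
      (Surfactant.tendsto_PhiP W a γ) ?_
    filter_upwards [self_mem_nhdsWithin] with δ hδ
    have hδ' : 0 < δ := hδ
    have h := Surfactant.phiTilde_le_phiPTilde hp h1 h2 h3 (show 0 ≤ γ + δ by linarith) hδ'
    rwa [add_assoc] at h
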